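/- **Setting.** Let $l>0$, $a\in\mathbb R$, $M>0$, and put $$\Delta(r)=(r^2+a^2)\Big(1-\frac{r^2}{l^2}\Big)-2Mr,\qquad \Xi=1+\frac{a^2}{l^2},\qquad \Delta_\theta=1+\frac{a^2}{l^2}\cos^2\theta .$$ Assume that $(a,M,l)$ is subextremal, i.e. $\Delta$ has four distinct real roots; let $r_+<\bar r_+$ be the two largest ones, and let $\omega_+=\frac{a\Xi}{r_+^2+a^2}$, $\bar\omega_+=\frac{a\Xi}{\bar r_+^2+a^2}$. Let $r^\star$ be a tortoise coordinate on $(r_+,\bar r_+)$, $\frac{dr^\star}{dr}=\frac{r^2+a^2}{\Delta}$, and $'=\frac{d}{dr^\star}$; thus $r^\star=-\infty$ is $r=r_+$ and $r^\star=+\infty$ is $r=\bar r_+$. Let $\mu^2\ge 0$. For $\xi\in\mathbb R$ let $$P_\mu(\xi)f=-\frac{1}{\sin\theta}\partial_\theta(\Delta_\theta\sin\theta\,\partial_\theta f)-\frac{\Xi^2}{\Delta_\theta\sin^2\theta}\partial_\varphi^2f-\Xi\frac{\xi^2}{\Delta_\theta}\cos^2\theta\, f-2i\xi\frac{\Xi}{\Delta_\theta}\frac{a^2}{l^2}\cos^2\theta\,\partial_\varphi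 f+\mu^2a^2\sin^2\theta\, f$$ on $\mathbb S^2$. For $m\in\mathbb Z$ let $\lambda^{(\xi)}_{m\ell}$, $\ell=|m|,|m|+1,\dots$, be its eigenvalues with eigenfunctions in $H^1(\mathbb S^2)$ of the form $S(\theta)e^{im\varphi}$, in increasing order. For $\omega\in\mathbb R$ write $\lambda=\lambda^{(a\omega)}_{m\ell}$, $\tilde\lambda=\lambda+a^2\omega^2$, and $$V=-\Delta^2\frac{3r^2}{(r^2+a^2)^4}+\Delta\frac{-5\frac{r^4}{l^2}+3r^2(1-\frac{a^2}{l^2})-4Mr+a^2}{(r^2+a^2)^3}+\frac{\Delta\tilde\lambda-\Xi^2a^2m^2-2m\omega a\Xi(\Delta-(r^2+a^2))}{(r^2+a^2)^2}+\mu^2\frac{\Delta}{r^2+a^2}.$$ An *outgoing solution* with right-hand side $H$ is a smooth $u:(r_+,\bar r_+)\to\mathbb C$ with $$u''+(\omega^2-V)u=H,\qquad \lim_{r^\star\to-\infty}\big(u'+i(\omega-\omega_+m)u\big)=0,\qquad \lim_{r^\star\to\infty}\big(u'-i(\omega-\bar\omega_+m)u\big)=0 .$$ Put $\Psi=u/\sqrt{r^2+a^2}$.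 Let $\mathcal{SF}$ be the set of $(\omega,m)$ with $am\omega\in\big(\frac{a^2m^2\Xi}{\bar r_+^2+a^2},\frac{a^2m^2\Xi}{r_+^2+a^2}\big)$ and, for $\mathcal C>0$, $$\mathcal F_{\mathcal{SF},\mathcal C}=\Big\{(\omega,m,\ell):\ |\omega|\in[\mathcal C^{-1},\mathcal C],\ \tilde\lambda\le\mathcal C,\ (\omega,m)\in\mathcal{SF},\ |\omega-\omega_+m|>\tfrac1{\mathcal C},\ |\omega-\bar\omega_+m|>\tfrac1{\mathcal C}\Big\}.$$ **Theorem.** For all $(a,M,l)$ and $\mu^2$ as above there are constants $E>0$ and $r_+<R^-<R^+<\bar r_+$, a function $r_{\rm trap}(\omega,m,\ell)\in(R^-,R^+)\cup\{0\}$, and $\delta,\mathcal C_0>0$ such that for all $r_{-\infty}\in(r_+,r_++\delta)$ and $r_{+\infty}\in(\bar r_+-\delta,\bar r_+)$ and all $\mathcal C\ge\mathcal C_0$ there is a constant $B=B(\mathcal C,r_{\pm\infty})>0$ with the following property. Let $\omega\in\mathbb R$, $m\in\mathbb Z$, $\ell\ge|m|$, and let $u$ be an outgoing solution with right-hand side $H$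 such that $\int_{\mathbb R}\Delta^{-1}|H|^2dr^\star<\infty$. Then the limit $|u|^2(-\infty)=\lim_{r^\star\to-\infty}|u|^2$ exists, the integrals below are absolutely convergent, and $$\begin{aligned} &\int_{r^\star_{-\infty}}^{r^\star_{\infty}}\Big(\Delta|\Psi'|^2+1_{\{|m|>0\}}\Delta|\Psi|^2+1_{\{|m|>0\}}\Delta|u'|^2+\Delta(\omega^2+\tilde\lambda)\Big(1-\frac{r_{\rm trap}}{r}\Big)^2|u|^2+\big(\mu^2+1_{\{|m|>0\}}\big)|u|^2\Big)dr^\star\\ &\quad\le B\,1_{\{|m|>0\}}\Big(\int_{-\infty}^{r^\star_{-\infty}}+\int_{r^\star_\infty}^{\infty}\Big)\big(|u'H|+|\omega uH|+|muH|\big)dr^\star+B\int_{\mathbb R}\frac{|H|^2}{\Delta}dr^\star\\ &\qquad+E\int_{\mathbb R}\Big((\omega-\omega_+m)\,\Im(\bar uH)+(\omega-\bar\omega_+m)\,\Im(\bar uH)\Big)dr^\star +B\,1_{\mathcal F_{\mathcal{SF},\mathcal C}}\,|\omega-\omega_+m|\,|\omega-\bar\omega_+m|\,|u|^2(-\infty).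 \end{aligned}$$ -/

import Mathlib

open Set Filter Topology MeasureTheory

namespace KerrDeSitter

noncomputable section

/-! ### Black hole parameters -/

/-- `Δ(r) = (r² + a²)(1 - r²/l²) - 2Mr`. -/
def Delta (a M l r : ℝ) : ℝ := (r ^ 2 + a ^ 2) * (1 - r ^ 2 / l ^ 2) - 2 * M * r

/-- `Ξ = 1 + a²/l²`. -/
def Xi (a l : ℝ) : ℝ := 1 + a ^ 2 / l ^ 2

/-- `Δ_θ = 1 + (a²/l²) cos² θ`. -/
def DeltaTheta (a l θ : ℝ) : ℝ := 1 + a ^ 2 / l ^ 2 * Real.cos θ ^ 2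

/-- Subextremality, `(a, M) ∈ 𝓑_l`: `M > 0` and the quartic `Δ` has four distinct real roots. -/
def IsSubextremal (a M l : ℝ) : Prop :=
  0 < M ∧ {r : ℝ | Delta a M l r = 0}.ncard = 4

/-- The radius `r̄₊` of the cosmological horizon: the largest root of `Δ`. -/
def rCosmo (a M l : ℝ) : ℝ := sSup {r : ℝ | Delta a M l r = 0}

/-- The radius `r₊` of the event horizon: the second largest root of `Δ`. -/
def rPlus (a M l : ℝ) : ℝ := sSup {r : ℝ | Delta a M l r = 0 ∧ r < rCosmo a M l}

/-- `ω₊ = aΞ / (r₊² + a²)`. -/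
def omegaPlus (a M l : ℝ) : ℝ := a * Xi a l / (rPlus a M l ^ 2 + a ^ 2)

/-- `ω̄₊ = aΞ / (r̄₊² + a²)`. -/
def omegaCosmo (a M l : ℝ) : ℝ := a * Xi a l / (rCosmo a M l ^ 2 + a ^ 2)

/-! ### The tortoise coordinate

The tortoise coordinate `r⋆ : (r₊, r̄₊) → ℝ` satisfies `dr⋆/dr = (r² + a²)/Δ`. All functions are
written as functions of `r`; then `′ = d/dr⋆` is `(Δ/(r² + a²)) d/dr`, the measure `dr⋆` is
`((r² + a²)/Δ) dr`, and `r⋆ → -∞`, `r⋆ → ∞` mean `r ↓ r₊`, `r ↑ r̄₊`. -/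

/-- The derivative `′ = d/dr⋆`. -/
def starDeriv (a M l : ℝ) (f : ℝ → ℂ) (r : ℝ) : ℂ :=
  ((Delta a M l r / (r ^ 2 + a ^ 2) : ℝ) : ℂ) * deriv f r

/-- The measure `dr⋆` on `(r₊, r̄₊)`. -/
def starMeasure (a M l : ℝ) : Measure ℝ :=
  (volume.restrict (Ioo (rPlus a M l) (rCosmo a M l))).withDensity
    fun r => ENNReal.ofReal ((r ^ 2 + a ^ 2) / Delta a M l r)

/-! ### The angular operator and its eigenvalues -/

/-- The angular operator `P_μ(ξ)` acting on a function `f(θ, φ)`; `musq` is `μ²`. -/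
def angularOp (a l musq ξ : ℝ) (f : ℝ → ℝ → ℂ) (θ φ : ℝ) : ℂ :=
  -((1 / Real.sin θ : ℝ) : ℂ) *
      deriv (fun t => ((DeltaTheta a l t * Real.sin t : ℝ) : ℂ) * deriv (fun s => f s φ) t) θ
    - ((Xi a l ^ 2 / DeltaTheta a l θ * (1 / Real.sin θ ^ 2) : ℝ) : ℂ) *
      deriv (deriv (fun p => f θ p)) φ
    - ((Xi a l * (ξ ^ 2 / DeltaTheta a l θ) * Real.cos θ ^ 2 : ℝ) : ℂ) * f θ φ
    - 2 * Complex.I *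
      ((ξ * (Xi a l / DeltaTheta a l θ) * (a ^ 2 / l ^ 2) * Real.cos θ ^ 2 : ℝ) : ℂ) *
      deriv (fun p => f θ p) φ
    + ((musq * a ^ 2 * Real.sin θ ^ 2 : ℝ) : ℂ) * f θ φ

/-- `Λ` is an eigenvalue of `P_μ(ξ)` with an eigenfunction of the form `S(θ) e^{imφ}`: `S` is
smooth on `(0, π)`, not identically zero, and the function `S(θ) e^{imφ}` lies in `H¹(𝕊²)`
(this is the regularity condition at the poles). -/
def IsAngularEigenvalue (a l musq ξ : ℝ) (m : ℤ) (Λ : ℝ) : Prop :=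
  ∃ S : ℝ → ℂ,
    ContDiffOn ℝ ((⊤ : ℕ∞) : WithTop ℕ∞) S (Ioo 0 Real.pi) ∧
    (∃ θ ∈ Ioo 0 Real.pi, S θ ≠ 0) ∧
    IntegrableOn
      (fun θ => (‖S θ‖ ^ 2 + ‖deriv S θ‖ ^ 2 + (m : ℝ) ^ 2 / Real.sin θ ^ 2 * ‖S θ‖ ^ 2)
        * Real.sin θ) (Ioo 0 Real.pi) ∧
    ∀ θ ∈ Ioo 0 Real.pi, ∀ φ : ℝ,
      angularOp a l musq ξ (fun t p => S t * Complex.exp (Complex.I * m * p)) θ φ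
        = (Λ : ℂ) * (S θ * Complex.exp (Complex.I * m * φ))

/-- `Λ = λ_{mℓ}^{(ξ)}`. For fixed `m` the eigenvalues are simple and are labelled
increasingly by `ℓ = |m|, |m| + 1, …`, so that exactly `ℓ - |m|` of them lie below
`λ_{mℓ}^{(ξ)}`. -/
def IsSpheroidalEigenvalue (a l musq ξ : ℝ) (m : ℤ) (ℓ : ℕ) (Λ : ℝ) : Prop :=
  m.natAbs ≤ ℓ ∧ IsAngularEigenvalue a l musq ξ m Λ ∧
    {Λ' : ℝ | IsAngularEigenvalue a l musq ξ m Λ' ∧ Λ' < Λ}.encard = ((ℓ - m.natAbs : ℕ) : ℕ∞)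

/-- `λ̃ = λ + a²ω²`. -/
def lamTilde (a ω Λ : ℝ) : ℝ := Λ + a ^ 2 * ω ^ 2

/-! ### Carter's radial equation -/

/-- `V_SL`. -/
def potentialSL (a M l r : ℝ) : ℝ :=
  -Delta a M l r ^ 2 * (3 * r ^ 2 / (r ^ 2 + a ^ 2) ^ 4)
    + Delta a M l r *
      ((-5 * (r ^ 4 / l ^ 2) + 3 * r ^ 2 * (1 - a ^ 2 / l ^ 2) - 4 * M * r + a ^ 2)
        / (r ^ 2 + a ^ 2) ^ 3)

/-- `V₀`. -/
def potentialZero (a M l ω : ℝ) (m : ℤ) (Λ r : ℝ) : ℝ :=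
  (Delta a M l r * (Λ + ω ^ 2 * a ^ 2) - Xi a l ^ 2 * a ^ 2 * (m : ℝ) ^ 2
      - 2 * m * ω * a * Xi a l * (Delta a M l r - (r ^ 2 + a ^ 2)))
    / (r ^ 2 + a ^ 2) ^ 2

/-- The potential `V = V_SL + V₀ + V_μ`, where `V_μ = μ² Δ / (r² + a²)`. -/
def potential (a M l musq ω : ℝ) (m : ℤ) (Λ r : ℝ) : ℝ :=
  potentialSL a M l r + potentialZero a M l ω m Λ r
    + musq * (Delta a M l r / (r ^ 2 + a ^ 2))

/-- `u` is a smooth solution on `(r₊, r̄₊)` of Carter's inhomogeneous radial equation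
`u'' + (ω² - V) u = H` that satisfies the outgoing boundary conditions
`u' + i(ω - ω₊m)u → 0` as `r⋆ → -∞` and `u' - i(ω - ω̄₊m)u → 0` as `r⋆ → ∞`. -/
structure IsOutgoingSolution (a M l musq ω : ℝ) (m : ℤ) (Λ : ℝ) (u H : ℝ → ℂ) : Prop where
  smooth : ContDiffOn ℝ ((⊤ : ℕ∞) : WithTop ℕ∞) u (Ioo (rPlus a M l) (rCosmo a M l))
  ode : ∀ r ∈ Ioo (rPlus a M l) (rCosmo a M l),
    starDeriv a M l (starDeriv a M l u) r
      + ((ω ^ 2 - potential a M l musq ω m Λ r : ℝ) : ℂ) * u r = H r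
  horizon : Tendsto
    (fun r => starDeriv a M l u r + Complex.I * ((ω - omegaPlus a M l * m : ℝ) : ℂ) * u r)
    (𝓝[>] (rPlus a M l)) (𝓝 0)
  cosmological : Tendsto
    (fun r => starDeriv a M l u r - Complex.I * ((ω - omegaCosmo a M l * m : ℝ) : ℂ) * u r)
    (𝓝[<] (rCosmo a M l)) (𝓝 0)

/-- `Ψ = u / √(r² + a²)`. -/
def psi (a : ℝ) (u : ℝ → ℂ) (r : ℝ) : ℂ := u r / ((Real.sqrt (r ^ 2 + a ^ 2) : ℝ) : ℂ)

/-! ### Frequency sets and the integrands of the estimate -/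

open Classical in
/-- The indicator `1_p` of a condition `p`. -/
def ind (p : Prop) : ℝ := if p then 1 else 0

/-- The superradiant frequencies `𝓢𝓕`. -/
def IsSuperradiant (a M l ω : ℝ) (m : ℤ) : Prop :=
  a * m * ω ∈ Ioo (a ^ 2 * (m : ℝ) ^ 2 * Xi a l / (rCosmo a M l ^ 2 + a ^ 2))
    (a ^ 2 * (m : ℝ) ^ 2 * Xi a l / (rPlus a M l ^ 2 + a ^ 2))

/-- The frequency set `𝓕_{𝓢𝓕,𝓒}`. -/
def InBoundedSuperradiant (a M l C ω : ℝ) (m : ℤ) (Λ : ℝ) : Prop :=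
  |ω| ∈ Icc C⁻¹ C ∧ lamTilde a ω Λ ≤ C ∧ IsSuperradiant a M l ω m ∧
    1 / C < |ω - omegaPlus a M l * m| ∧ 1 / C < |ω - omegaCosmo a M l * m|

/-- The integrand of the left-hand side; `rt` is the value of `r_trap`. -/
def bulkDensity (a M l musq ω : ℝ) (m : ℤ) (Λ rt : ℝ) (u : ℝ → ℂ) (r : ℝ) : ℝ :=
  Delta a M l r * ‖starDeriv a M l (psi a u) r‖ ^ 2
    + ind (0 < |m|) * Delta a M l r * ‖psi a u r‖ ^ 2
    + ind (0 < |m|) * Delta a M l r * ‖starDeriv a M l u r‖ ^ 2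
    + Delta a M l r * (ω ^ 2 + lamTilde a ω Λ) * (1 - rt / r) ^ 2 * ‖u r‖ ^ 2
    + (musq + ind (0 < |m|)) * ‖u r‖ ^ 2

/-- `|u'H| + |ω u H| + |m u H|`. -/
def sourceDensity (a M l ω : ℝ) (m : ℤ) (u H : ℝ → ℂ) (r : ℝ) : ℝ :=
  ‖starDeriv a M l u r * H r‖ + ‖(ω : ℂ) * u r * H r‖ + ‖(m : ℂ) * u r * H r‖

/-- `(ω - ω₊m) Im(ū H) + (ω - ω̄₊m) Im(ū H)`. -/
def fluxDensity (a M l ω : ℝ) (m : ℤ) (u H : ℝ → ℂ) (r : ℝ) : ℝ :=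
  (ω - omegaPlus a M l * m) * ((starRingEnd ℂ) (u r) * H r).im
    + (ω - omegaCosmo a M l * m) * ((starRingEnd ℂ) (u r) * H r).im

end

end KerrDeSitter

/-!
The theorem is proved for a first-order form of Carter's equation in the variable `r`. Write
`p = r₊`, `q = r̄₊`, `ρ² = r² + a²`, `K = ωρ² - aΞm` (`carterK`) and `L = λ̃ - 2maωΞ`
(`shiftedEigenvalue`). With `Ψ = u / ρ` and `w = ΔΨ_r` the equation becomes

  `Ψ_r = w / Δ`,  `w_r = F - (G / Δ) Ψ`,  `G = K² - Δ(L + μ²ρ²)`,  `F = ρ³ H / Δ`,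

so that `∫ |F|² dr` is comparable with `∫ |H|² / Δ dr⋆`, and the horizons are regular singular points.
The outgoing conditions say that `w + iKΨ → 0` at `p` and `w - iKΨ → 0` at `q`; they force `|Ψ|²` to
have limits `P` and `Q` there (`EndSystem.exists_limit`,
`IsOutgoingSolution.exists_radialSolution`). Integration of the flux `Im (Ψ̄ w)` gives

  `∫ Im (Ψ̄ F) dr = K(q) Q + K(p) P`  (`RadialSolution.flux_identity`),

hence the term with the constant `E` is `K(p)/ρ(p)² + K(q)/ρ(q)²` times the right-hand side, and it
controls `K(p)² P + K(q)² Q` unless `K(p) K(q) < 0`, which is exactly superradiance.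

About the angular equation only two facts are used: an inequality between `L` and `(ω, m)`
(`IsAngularEigenvalue.isAdmissible`), which holds because a Sturm–Liouville equation with a positive
potential has no solution of finite energy, and a gap above the lowest axisymmetric eigenvalue in the
massless case (`IsAngularEigenvalue.gap`).

For high frequencies `N² = ω² + m² + L` the estimates come from multiplier identities, and by
compactness of the normalised frequencies there are two cases
(`Horizons.exists_high_frequency_estimate`).

* If `|K| < ηN` somewhere, which includes all superradiant frequencies, then `K² - ΔL` is negative on an
  interval and has no critical point elsewhere (`Horizons.exists_separation`). Exponentially weighted
  multipliers exploit this, the boundary terms are absorbed by the interval where the equation is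
  elliptic, and the estimate has neither degeneration nor boundary terms
  (`Horizons.exists_barrier_estimate`).
* If `|K| ≥ ηN` throughout, then `K (Δ'K - 2ΔK')` has exactly one zero, the trapping radius `r_c`. A
  multiplier that changes sign there gives `∫ |w|² + (1 + N² (r - r_c)²) |Ψ|²`, and the boundary
  terms are controlled by the flux (`Horizons.exists_trapped_estimate`).

For bounded frequencies the solution is controlled, up to the source, by its value at any interior
point and by either of its horizon limits (`Horizons.exists_sup_bound`). Together with the flux identity
this bounds the solution by the source when a horizon limit enters the flux with a coefficient bounded
away from zero and no superradiance occurs (`Horizons.exists_rotating_bound`,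
`Horizons.exists_nonrotating_bound`). For axisymmetric or nonrotating frequencies near zero, either
the radial equation is coercive or the field is massless with small `L`, and then only `ωΨ` and `w` have
to be bounded (`Horizons.exists_coercive_bound`, `Horizons.exists_massless_bound`). A superradiant
frequency close to a threshold is still controlled by the flux; away from the thresholds it lies in
`𝓕_{𝒮𝓕,𝒞}`, and the horizon term of the estimate controls it (`Horizons.exists_superradiant_bound`).

The constant `E` must not depend on `r_{±∞}`, although the left-hand side contains coefficients of
size `1/Δ`. For trapped frequencies with `N` large in terms of `r_{±∞}` these coefficients are absorbed
by `N² (r - r_c)²` away from `r_c`, with a constant that depends only on the black hole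
(`Horizons.exists_bulkDensity_le_trapped`). All remaining frequencies have nondegenerate estimates in
which the flux term can be bounded by the energy, and their constants go into `B`
(`Horizons.exists_radial_estimate`).
-/

namespace KerrDeSitter
open Real
open Complex (I norm_real norm_I I_sq mul_conj)

/-! ### Monotonicity and Young's inequality -/

theorem monotoneOn_of_hasDerivAt {f f' : ℝ → ℝ} {S : Set ℝ} (hS : Convex ℝ S)
    (hf : ∀ t ∈ S, HasDerivAt f (f' t) t) (hf' : ∀ t ∈ S, 0 ≤ f' t) : MonotoneOn f S :=
  monotoneOn_of_deriv_nonneg hS (fun t ht => (hf t ht).continuousAt.continuousWithinAt)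
    (fun t ht => (hf t (interior_subset ht)).differentiableAt.differentiableWithinAt)
    fun t ht => by
      rw [(hf t (interior_subset ht)).deriv]
      exact hf' t (interior_subset ht)

theorem antitoneOn_of_hasDerivAt {f f' : ℝ → ℝ} {S : Set ℝ} (hS : Convex ℝ S)
    (hf : ∀ t ∈ S, HasDerivAt f (f' t) t) (hf' : ∀ t ∈ S, f' t ≤ 0) : AntitoneOn f S :=
  fun _ hx _ hy hxy => neg_le_neg_iff.1 (monotoneOn_of_hasDerivAt hS (fun t ht => (hf t ht).neg)
    (fun t ht => neg_nonneg.2 (hf' t ht)) hx hy hxy)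

theorem abs_inner_le_young (x y : ℂ) {ε : ℝ} (hε : 0 < ε) :
    |inner ℝ x y| ≤ ε * ‖x‖ ^ 2 + 1 / (4 * ε) * ‖y‖ ^ 2 := by
  refine (abs_real_inner_le_norm x y).trans ?_
  have e : ε * ‖x‖ ^ 2 + 1 / (4 * ε) * ‖y‖ ^ 2 - ‖x‖ * ‖y‖
      = (2 * ε * ‖x‖ - ‖y‖) ^ 2 / (4 * ε) := by field_simp; ring
  rw [← sub_nonneg, e]
  positivity

/-! ### The horizons and the radial function `Δ` -/

/-- The first derivative of `Δ`. -/
noncomputable def DeltaD (a M l r : ℝ) : ℝ := 2 * r - 4 * r ^ 3 / l ^ 2 - 2 * a ^ 2 * r / l ^ 2 - 2 * M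

/-- The second derivative of `Δ`. -/
noncomputable def DeltaDD (a l r : ℝ) : ℝ := 2 - 12 * r ^ 2 / l ^ 2 - 2 * a ^ 2 / l ^ 2

/-- The quartic `Δ` vanishes at `p` and `q`, is positive in between, and its two other roots are
`s ∈ [0, p)` and `-(s + p + q)`. -/
structure Horizons (a M l p q s : ℝ) : Prop where
  l_pos : 0 < l
  s_nonneg : 0 ≤ s
  s_lt : s < p
  p_lt : p < q
  factor : ∀ r, Delta a M l r = (r + (s + p + q)) * (r - s) * (r - p) * (q - r) / l ^ 2

theorem exists_horizons {a M l : ℝ} (hl : 0 < l) (h : IsSubextremal a M l) :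
    ∃ s, Horizons a M l (rPlus a M l) (rCosmo a M l) s := by
  obtain ⟨hM, hcard⟩ := h
  set Z := {r : ℝ | Delta a M l r = 0} with hZ
  have hfin : Z.Finite := Set.finite_of_ncard_ne_zero (by omega)
  have hc : hfin.toFinset.card = 4 := by rw [← Set.ncard_eq_toFinset_card Z hfin]; exact hcard
  set x := hfin.toFinset.orderEmbOfFin hc with hx
  have hmono : StrictMono x := x.strictMono
  have hrange : ∀ r, Delta a M l r = 0 ↔ r = x 0 ∨ r = x 1 ∨ r = x 2 ∨ r = x 3 := by
    intro r
    have : r ∈ Set.range x ↔ Delta a M l r = 0 := by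
      rw [hx, Finset.range_orderEmbOfFin]; simp [hZ]
    rw [← this]
    constructor
    · rintro ⟨i, rfl⟩; fin_cases i <;> simp
    · rintro (h | h | h | h) <;> exact ⟨_, h.symm⟩
  have h01 : x 0 < x 1 := hmono (by decide)
  have h12 : x 1 < x 2 := hmono (by decide)
  have h23 : x 2 < x 3 := hmono (by decide)
  have z0 := (hrange (x 0)).2 (by simp)
  have z1 := (hrange (x 1)).2 (by simp)
  have z2 := (hrange (x 2)).2 (by simp)
  have z3 := (hrange (x 3)).2 (by simp)
  have hq : rCosmo a M l = x 3 := by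
    refine IsGreatest.csSup_eq ⟨z3, fun r hr => ?_⟩
    rcases (hrange r).1 hr with h | h | h | h <;> rw [h] <;> linarith
  have hp : rPlus a M l = x 2 := by
    unfold rPlus
    rw [hq]
    refine IsGreatest.csSup_eq ⟨⟨z2, h23⟩, fun r hr => ?_⟩
    rcases (hrange r).1 hr.1 with h | h | h | h <;> rw [h] <;> first | linarith | skip
    exact absurd hr.2 (by rw [h]; exact lt_irrefl _)
  rw [hp, hq]
  generalize x 0 = x0 at *
  generalize x 1 = x1 at *
  generalize x 2 = x2 at *
  generalize x 3 = x3 at *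
  set k := 1 / l ^ 2 with hk
  have hkpos : 0 < k := by positivity
  have hD : ∀ r, Delta a M l r = -k * r ^ 4 + (1 - a ^ 2 * k) * r ^ 2 - 2 * M * r + a ^ 2 := by
    intro r; unfold Delta; rw [hk]; ring
  rw [hD] at z0 z1 z2 z3
  -- successive divided differences of the quartic at its roots
  have d1 : ∀ {u v : ℝ}, u < v → -k * u ^ 4 + (1 - a ^ 2 * k) * u ^ 2 - 2 * M * u + a ^ 2 = 0 →
      -k * v ^ 4 + (1 - a ^ 2 * k) * v ^ 2 - 2 * M * v + a ^ 2 = 0 →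
      -k * (u ^ 3 + u ^ 2 * v + u * v ^ 2 + v ^ 3) + (1 - a ^ 2 * k) * (u + v) - 2 * M = 0 := by
    intro u v huv hu hv
    have h1 : (v - u) * (-k * (u ^ 3 + u ^ 2 * v + u * v ^ 2 + v ^ 3)
        + (1 - a ^ 2 * k) * (u + v) - 2 * M) = 0 := by linear_combination hv - hu
    exact (mul_eq_zero.1 h1).resolve_left (by linarith)
  have e01 := d1 h01 z0 z1
  have e12 := d1 h12 z1 z2
  have e23 := d1 h23 z2 z3
  have e012 : -k * (x0 ^ 2 + x1 ^ 2 + x2 ^ 2 + x0 * x1 + x1 * x2 + x0 * x2)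
      + (1 - a ^ 2 * k) = 0 := by
    have h1 : (x2 - x0) * (-k * (x0 ^ 2 + x1 ^ 2 + x2 ^ 2 + x0 * x1 + x1 * x2 + x0 * x2)
      + (1 - a ^ 2 * k)) = 0 := by linear_combination e12 - e01
    exact (mul_eq_zero.1 h1).resolve_left (by linarith)
  have e123 : -k * (x1 ^ 2 + x2 ^ 2 + x3 ^ 2 + x1 * x2 + x2 * x3 + x1 * x3)
      + (1 - a ^ 2 * k) = 0 := by
    have h1 : (x3 - x1) * (-k * (x1 ^ 2 + x2 ^ 2 + x3 ^ 2 + x1 * x2 + x2 * x3 + x1 * x3)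
      + (1 - a ^ 2 * k)) = 0 := by linear_combination e23 - e12
    exact (mul_eq_zero.1 h1).resolve_left (by linarith)
  have hsum : x0 = -(x1 + x2 + x3) := by
    have h1 : (k * (x3 - x0)) * (x0 + x1 + x2 + x3) = 0 := by linear_combination e012 - e123
    have := (mul_eq_zero.1 h1).resolve_left (mul_ne_zero hkpos.ne' (by linarith))
    linarith
  have hα : 1 - a ^ 2 * k = k * (x0 ^ 2 + x1 ^ 2 + x2 ^ 2 + x0 * x1 + x1 * x2 + x0 * x2) := by
    linarith
  have hMeq : 2 * M = -k * (x0 * x1 * x2 + x0 * x1 * x3 + x0 * x2 * x3 + x1 * x2 * x3) := by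
    rw [hα] at e01; rw [hsum] at e01 ⊢; linear_combination (-1) * e01
  have ha2 : a ^ 2 = -k * (x0 * x1 * x2 * x3) := by
    rw [hα, hMeq] at z0; rw [hsum] at z0 ⊢; linear_combination z0
  have hx1 : 0 ≤ x1 := by
    by_contra hneg
    push Not at hneg
    have hpos01 : 0 < x0 * x1 := mul_pos_of_neg_of_neg (by linarith) hneg
    have h4 : x2 * x3 ≤ 0 := by
      have : 0 ≤ -k * (x0 * x1) * (x2 * x3) := by
        have := sq_nonneg a; rw [ha2] at this; linarith
      by_contra hh
      push Not at hh
      nlinarith [mul_pos (mul_pos hkpos hpos01) hh]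
    have h5 : 0 < x0 * x1 * x2 + x0 * x1 * x3 + x0 * x2 * x3 + x1 * x2 * x3 := by
      have : x0 * x1 * x2 + x0 * x1 * x3 + x0 * x2 * x3 + x1 * x2 * x3
          = (x2 + x3) * (x0 * x1 - x2 * x3) := by rw [hsum]; ring
      rw [this]
      exact mul_pos (by linarith) (by linarith)
    nlinarith [mul_pos hkpos h5]
  refine ⟨x1, hl, hx1, h12, h23, fun r => ?_⟩
  rw [hD, hα, hMeq, ha2, hsum, hk]
  ring

theorem hasDerivAt_Delta (a M l r : ℝ) : HasDerivAt (Delta a M l) (DeltaD a M l r) r := by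
  have h := (((hasDerivAt_id r).pow 2).add_const (a ^ 2)).mul
    ((((hasDerivAt_id r).pow 2).div_const (l ^ 2)).const_sub 1) |>.sub
      ((hasDerivAt_id r).const_mul (2 * M))
  refine h.congr_deriv ?_
  simp [DeltaD]; ring

theorem hasDerivAt_DeltaD (a M l r : ℝ) : HasDerivAt (DeltaD a M l) (DeltaDD a l r) r := by
  have h := ((((hasDerivAt_id r).const_mul 2).sub
    ((((hasDerivAt_id r).pow 3).const_mul 4).div_const (l ^ 2))).sub
      (((hasDerivAt_id r).const_mul (2 * a ^ 2)).div_const (l ^ 2))).sub_const (2 * M)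
  refine h.congr_deriv ?_
  simp [DeltaDD]; ring

theorem hasDerivAt_DeltaDD (a l r : ℝ) : HasDerivAt (DeltaDD a l) (-24 * r / l ^ 2) r := by
  have h := ((((hasDerivAt_id r).pow 2).const_mul 12).div_const (l ^ 2)).const_sub 2
    |>.sub_const (2 * a ^ 2 / l ^ 2)
  refine h.congr_deriv ?_
  simp; ring

@[fun_prop] theorem continuous_Delta (a M l : ℝ) : Continuous (Delta a M l) :=
  continuous_iff_continuousAt.2 fun r => (hasDerivAt_Delta a M l r).continuousAt

@[fun_prop] theorem continuous_DeltaD (a M l : ℝ) : Continuous (DeltaD a M l) :=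
  continuous_iff_continuousAt.2 fun r => (hasDerivAt_DeltaD a M l r).continuousAt

@[fun_prop] theorem continuous_DeltaDD (a l : ℝ) : Continuous (DeltaDD a l) :=
  continuous_iff_continuousAt.2 fun r => (hasDerivAt_DeltaDD a l r).continuousAt

namespace Horizons

variable {a M l p q s : ℝ} (h : Horizons a M l p q s)
include h

theorem p_pos : 0 < p := h.s_nonneg.trans_lt h.s_lt

theorem q_pos : 0 < q := h.p_pos.trans h.p_lt

theorem pos_of_mem {r : ℝ} (hr : r ∈ Icc p q) : 0 < r := h.p_pos.trans_le hr.1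

theorem Delta_left : Delta a M l p = 0 := by rw [h.factor]; simp

theorem Delta_right : Delta a M l q = 0 := by rw [h.factor]; simp

theorem Delta_pos {r : ℝ} (hr : r ∈ Ioo p q) : 0 < Delta a M l r := by
  have := h.s_nonneg; have := h.s_lt; have := h.p_lt; have := h.l_pos
  rw [h.factor]
  obtain ⟨h1, h2⟩ := hr
  have e1 : 0 < r + (s + p + q) := by linarith
  have e2 : 0 < r - s := by linarith
  positivity

theorem Delta_nonneg {r : ℝ} (hr : r ∈ Icc p q) : 0 ≤ Delta a M l r := by
  rcases eq_or_lt_of_le hr.1 with h1 | h1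
  · rw [← h1, h.Delta_left]
  rcases eq_or_lt_of_le hr.2 with h2 | h2
  · rw [h2, h.Delta_right]
  exact (h.Delta_pos ⟨h1, h2⟩).le

/-- `Δ` is comparable with `(r - p)(q - r)` from below. -/
theorem exists_le_Delta : ∃ c > 0, ∀ r ∈ Icc p q, c * ((r - p) * (q - r)) ≤ Delta a M l r := by
  have := h.s_nonneg; have := h.s_lt; have := h.p_lt; have := h.l_pos
  have := h.p_pos
  refine ⟨p * (p - s) / l ^ 2, by have : 0 < p - s := by linarith
                                  positivity, fun r hr => ?_⟩
  rw [h.factor]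
  have e : (r + (s + p + q)) * (r - s) * (r - p) * (q - r) / l ^ 2
    = (r + (s + p + q)) * (r - s) / l ^ 2 * ((r - p) * (q - r)) := by ring
  rw [e]
  refine mul_le_mul_of_nonneg_right ?_ (mul_nonneg (by linarith [hr.1]) (by linarith [hr.2]))
  refine div_le_div_of_nonneg_right ?_ (by positivity)
  exact mul_le_mul (by linarith [hr.1]) (by linarith [hr.1]) (by linarith) (by linarith [hr.1])

theorem DeltaD_eq (r : ℝ) : DeltaD a M l r =
    ((r - s) * (r - p) * (q - r) + (r + (s + p + q)) * (r - p) * (q - r)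
      + (r + (s + p + q)) * (r - s) * (q - r) - (r + (s + p + q)) * (r - s) * (r - p)) / l ^ 2 := by
  have h1 := hasDerivAt_Delta a M l r
  have h2 : HasDerivAt (fun r => (r + (s + p + q)) * (r - s) * (r - p) * (q - r) / l ^ 2) _ r :=
    (((((hasDerivAt_id r).add_const (s + p + q)).mul ((hasDerivAt_id r).sub_const s)).mul
      ((hasDerivAt_id r).sub_const p)).mul ((hasDerivAt_id r).const_sub q)).div_const (l ^ 2)
  rw [funext h.factor] at h1
  have := h1.unique h2
  rw [this]; simp; ring

theorem DeltaD_left_pos : 0 < DeltaD a M l p := by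
  have := h.s_nonneg; have := h.s_lt; have := h.p_lt; have := h.l_pos; have := h.p_pos
  rw [h.DeltaD_eq]
  have e3 : 0 < p + (s + p + q) := by linarith
  simp only [sub_self, mul_zero, zero_mul, zero_add, sub_zero]
  positivity

theorem DeltaD_right_neg : DeltaD a M l q < 0 := by
  have := h.s_nonneg; have := h.s_lt; have := h.p_lt; have := h.l_pos; have := h.p_pos
  rw [h.DeltaD_eq]
  have e1 : 0 < q - s := by linarith
  have e3 : 0 < q + (s + p + q) := by linarith
  simp only [sub_self, mul_zero, zero_add, zero_sub, neg_div]
  have : 0 < (q + (s + p + q)) * (q - s) * (q - p) / l ^ 2 := by positivity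
  linarith

/-- The quantity that decides the monotonicity of the orbital parameter
`r² + a² - 4rΔ/Δ'` is positive: its derivative is `3Δ'² + 48 r²Δ/l²`. -/
theorem photon_pos {r : ℝ} (hr : r ∈ Icc p q) :
    0 < r * DeltaD a M l r ^ 2 + 2 * Delta a M l r * DeltaD a M l r
      - 2 * r * Delta a M l r * DeltaDD a l r := by
  set E : ℝ → ℝ := fun r => r * DeltaD a M l r ^ 2 + 2 * Delta a M l r * DeltaD a M l r
      - 2 * r * Delta a M l r * DeltaDD a l r with hE
  have hd : ∀ x, HasDerivAt E (3 * DeltaD a M l x ^ 2 + 48 * x ^ 2 * Delta a M l x / l ^ 2) x := by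
    intro x
    have hx := hasDerivAt_id x
    have h0 := hasDerivAt_Delta a M l x
    have h1 := hasDerivAt_DeltaD a M l x
    have h2 := hasDerivAt_DeltaDD a l x
    have := ((hx.mul (h1.pow 2)).add ((h0.const_mul 2).mul h1)).sub
      (((hx.const_mul 2).mul h0).mul h2)
    refine this.congr_deriv ?_
    simp; ring
  have hmono : MonotoneOn E (Icc p q) := by
    refine monotoneOn_of_hasDerivAt (convex_Icc p q) (fun x _ => hd x) fun x hx => ?_
    have := h.Delta_nonneg hx
    have := h.l_pos
    positivity
  have hp := hmono (left_mem_Icc.2 h.p_lt.le) hr hr.1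
  have : 0 < E p := by
    have := h.DeltaD_left_pos
    have := h.p_pos
    simp only [hE, h.Delta_left]
    ring_nf; positivity
  exact this.trans_le hp

/-- Superradiant frequencies are not trapped, inner side of the zero of `K`. -/
theorem left_gap {r : ℝ} (hr : r ∈ Ioo p q) :
    (r ^ 2 - p ^ 2) * DeltaD a M l r < 4 * r * Delta a M l r := by
  have h1 := h.s_nonneg; have h2 := h.s_lt; have h3 := h.p_lt; have h4 := h.l_pos
  have h5 := h.p_pos
  obtain ⟨hr1, hr2⟩ := hr
  have h0 : 0 < r := by linarith
  rw [h.factor, h.DeltaD_eq]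
  set A := r + (s + p + q)
  rw [← sub_pos]
  have e : 4 * r * (A * (r - s) * (r - p) * (q - r) / l ^ 2) - (r ^ 2 - p ^ 2) *
      (((r - s) * (r - p) * (q - r) + A * (r - p) * (q - r) + A * (r - s) * (q - r)
        - A * (r - s) * (r - p)) / l ^ 2)
      = (r - p) / l ^ 2 * ((r - s) * (r - p) * (q - r) * (2 * A - (r + p))
          + (r + p) * A * (q - r) * (p - s)
          + (r + p) * A * (r - s) * (r - p)) := by
    field_simp; ring
  rw [e]
  have i3 : 0 < r - s := by linarith
  have i4 : 0 < 2 * A - (r + p) := by linarith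
  have i6 : 0 < A := by linarith
  positivity

/-- Superradiant frequencies are not trapped, outer side of the zero of `K`. -/
theorem right_gap {r : ℝ} (hr : r ∈ Ioo p q) :
    -((q ^ 2 - r ^ 2) * DeltaD a M l r) < 4 * r * Delta a M l r := by
  have h1 := h.s_nonneg; have h2 := h.s_lt; have h3 := h.p_lt; have h4 := h.l_pos
  have h5 := h.p_pos
  obtain ⟨hr1, hr2⟩ := hr
  have h0 : 0 < r := by linarith
  rw [h.factor, h.DeltaD_eq]
  set A := r + (s + p + q)
  rw [← sub_pos]
  have e : 4 * r * (A * (r - s) * (r - p) * (q - r) / l ^ 2) - -((q ^ 2 - r ^ 2) *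
      (((r - s) * (r - p) * (q - r) + A * (r - p) * (q - r) + A * (r - s) * (q - r)
        - A * (r - s) * (r - p)) / l ^ 2))
      = (q - r) / l ^ 2 * (A * (r - s) * (r - p) * (2 * r)
          + (q - r) * A * (r - s) * (p + q)
          + (q + r) * (q - r) * (r - s) * (r - p)
          + (q + r) * (q - r) * A * (r - p)) := by
    field_simp; ring
  rw [e]
  have i3 : 0 < r - s := by linarith
  have i7 : 0 < q := by linarith
  positivity

theorem exists_inv_Delta_bound {x y : ℝ} (hx : p < x) (hy : y < q) :
    ∃ E > 0, ∀ r ∈ Icc x y, 1 / Delta a M l r ≤ E := by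
  have hIcc : ∀ r ∈ Icc x y, r ∈ Ioo p q := fun r hr => ⟨hx.trans_le hr.1, hr.2.trans_lt hy⟩
  obtain ⟨T, hT⟩ := isCompact_Icc.exists_bound_of_continuousOn
    (s := Icc x y) (f := fun r => 1 / Delta a M l r)
    (ContinuousOn.div (by fun_prop) (by fun_prop) fun r hr => (h.Delta_pos (hIcc r hr)).ne')
  exact ⟨|T| + 1, by positivity, fun r hr =>
    (le_abs_self _).trans (((hT r hr).trans (le_abs_self _)).trans (by linarith))⟩

end Horizons

/-! ### Lower bounds for the angular eigenvalues -/

/-- Real solutions of finite energy of the Sturm–Liouville equation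
`(d sin θ x')' = sin θ V x` on `(0, π)`, written as a first-order system for `x` and
`y = d sin θ x'`. -/
structure SturmMode (D : ℝ) (d V x y : ℝ → ℝ) : Prop where
  one_le : ∀ θ, 1 ≤ d θ
  le_bound : ∀ θ, d θ ≤ D
  deriv_fst : ∀ θ ∈ Ioo 0 π, HasDerivAt x (y θ / (d θ * sin θ)) θ
  deriv_snd : ∀ θ ∈ Ioo 0 π, HasDerivAt y (sin θ * V θ * x θ) θ
  finite_energy :
    IntegrableOn (fun θ => sin θ * (y θ / (d θ * sin θ)) ^ 2) (Ioo 0 π)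

namespace SturmMode

variable {D : ℝ} {d V x y : ℝ → ℝ} (h : SturmMode D d V x y)
include h

theorem reflect (hd : ∀ θ, d (π - θ) = d θ) (hV : ∀ θ, V (π - θ) = V θ) :
    SturmMode D d V (fun θ => x (π - θ)) (fun θ => -y (π - θ)) where
  one_le := h.one_le
  le_bound := h.le_bound
  deriv_fst θ hθ := by
    have hm : π - θ ∈ Ioo 0 π := ⟨by linarith [hθ.2], by linarith [hθ.1]⟩
    have := (h.deriv_fst _ hm).comp_const_sub π θ
    rw [hd, sin_pi_sub] at this
    refine this.congr_deriv ?_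
    ring
  deriv_snd θ hθ := by
    have hm : π - θ ∈ Ioo 0 π := ⟨by linarith [hθ.2], by linarith [hθ.1]⟩
    have := ((h.deriv_snd _ hm).comp_const_sub π θ).neg
    rw [hV, sin_pi_sub] at this
    refine this.congr_deriv ?_
    ring
  finite_energy := by
    have h1 := h.finite_energy
    rw [← intervalIntegrable_iff_integrableOn_Ioo_of_le pi_pos.le] at h1 ⊢
    have h2 := (h1.comp_sub_left π).symm
    simp only [sub_self, sub_zero] at h2
    refine h2.congr ?_
    intro θ _
    simp only [hd, sin_pi_sub]
    ring

/-- A solution of finite energy cannot have energy flux `x y ≤ -c < 0` up to the pole: `x²` would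
diverge logarithmically, whereas `log x²` is controlled by the energy. -/
theorem not_flux_le {b c : ℝ} (hb : b ∈ Ioo 0 π) (hc : 0 < c)
    (hflux : ∀ θ ∈ Ioc 0 b, x θ * y θ ≤ -c) : False := by
  have hD : 1 ≤ D := (h.one_le 0).trans (h.le_bound 0)
  have hsub : ∀ {θ}, θ ∈ Ioc 0 b → θ ∈ Ioo 0 π := fun hθ => ⟨hθ.1, hθ.2.trans_lt hb.2⟩
  have hx0 : ∀ θ ∈ Ioc 0 b, x θ ≠ 0 := by
    intro θ hθ h0
    have := hflux θ hθ
    rw [h0] at this; linarith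
  have hsin : ∀ {θ}, θ ∈ Ioc 0 b → 0 < sin θ := fun hθ =>
    sin_pos_of_pos_of_lt_pi (hsub hθ).1 (hsub hθ).2
  set e : ℝ → ℝ := fun θ => sin θ * (y θ / (d θ * sin θ)) ^ 2 with he
  have he0 : ∀ θ ∈ Ioo 0 π, 0 ≤ e θ := fun θ hθ =>
    mul_nonneg (sin_pos_of_pos_of_lt_pi hθ.1 hθ.2).le (sq_nonneg _)
  set I := D / c * ∫ θ in Ioo 0 π, e θ with hI
  -- the logarithmic bound
  have hlog : ∀ ε ∈ Ioo 0 b, log (x ε) ≤ log (x b) + I := by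
    intro ε hε
    have hIcc : ∀ {θ}, θ ∈ Icc ε b → θ ∈ Ioc 0 b := fun hθ => ⟨hε.1.trans_le hθ.1, hθ.2⟩
    have hint : IntegrableOn (fun θ => D / c * e θ) (Icc ε b) :=
      (h.finite_energy.mono_set fun θ hθ => hsub (hIcc hθ)).const_mul _
    have key := intervalIntegral.sub_le_integral_of_hasDeriv_right_of_le hε.2.le
      (g := fun θ => -log (x θ)) (g' := fun θ => -((y θ / (d θ * sin θ)) / x θ))
      (φ := fun θ => D / c * e θ)
      (fun θ hθ => ((((h.deriv_fst θ (hsub (hIcc hθ))).log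
        (hx0 θ (hIcc hθ))).neg).continuousAt).continuousWithinAt)
      (fun θ hθ => ((((h.deriv_fst θ (hsub (hIcc (Ioo_subset_Icc_self hθ)))).log
        (hx0 θ (hIcc (Ioo_subset_Icc_self hθ)))).neg).hasDerivWithinAt)) hint ?_
    · have hle : ∫ θ in ε..b, D / c * e θ ≤ I := by
        rw [intervalIntegral.integral_of_le hε.2.le, integral_const_mul, hI]
        refine mul_le_mul_of_nonneg_left ?_ (by positivity)
        refine setIntegral_mono_set h.finite_energy ?_ ?_
        · exact (ae_restrict_iff' measurableSet_Ioo).2 (.of_forall he0)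
        · exact .of_forall fun θ hθ => hsub ⟨hε.1.trans hθ.1, hθ.2⟩
      linarith
    · intro θ hθ
      have hm := hIcc (Ioo_subset_Icc_self hθ)
      have hs := hsin hm
      have hd1 := h.one_le θ
      have hd2 := h.le_bound θ
      have hf := hflux θ hm
      have hx := hx0 θ hm
      simp only [he]
      have e1 : -(y θ / (d θ * sin θ) / x θ) = (-(x θ * y θ)) / (d θ * sin θ * x θ ^ 2) := by
        field_simp
      have e2 : D / c * (sin θ * (y θ / (d θ * sin θ)) ^ 2)
          = (D * (x θ * y θ) ^ 2 / (c * d θ)) / (d θ * sin θ * x θ ^ 2) := by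
        field_simp
      rw [e1, e2]
      refine div_le_div_of_nonneg_right ?_ (by positivity)
      rw [le_div_iff₀ (by positivity)]
      set A := -(x θ * y θ) with hA
      have hAc : c ≤ A := by linarith
      have : (x θ * y θ) ^ 2 = A ^ 2 := by rw [hA]; ring
      rw [this]
      have : c * d θ ≤ A * D := mul_le_mul hAc hd2 (by linarith) (by linarith)
      nlinarith
  -- the logarithmic divergence
  have hdiv : ∀ ε ∈ Ioo 0 b, 2 * c / D * (log b - log ε) ≤ x ε ^ 2 := by
    intro ε hε
    have hIcc : ∀ {θ}, θ ∈ Icc ε b → θ ∈ Ioc 0 b := fun hθ => ⟨hε.1.trans_le hθ.1, hθ.2⟩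
    have hder : ∀ θ ∈ Icc ε b, HasDerivAt (fun θ => x θ ^ 2 + 2 * c / D * log θ)
        (2 * x θ * (y θ / (d θ * sin θ)) + 2 * c / D * θ⁻¹) θ := by
      intro θ hθ
      refine (((h.deriv_fst θ (hsub (hIcc hθ))).pow 2).add
        ((hasDerivAt_log (hIcc hθ).1.ne').const_mul (2 * c / D))).congr_deriv ?_
      simp
    have hanti : AntitoneOn (fun θ => x θ ^ 2 + 2 * c / D * log θ) (Icc ε b) := by
      refine antitoneOn_of_hasDerivAt (convex_Icc _ _) hder fun θ hθ' => ?_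
      have hm := hIcc hθ'
      have hs := hsin hm
      have hsle : sin θ ≤ θ := sin_le hm.1.le
      have hf := hflux θ hm
      have hd1 := h.one_le θ
      have hd2 := h.le_bound θ
      have hθpos := hm.1
      have e1 : 2 * x θ * (y θ / (d θ * sin θ)) = 2 * (x θ * y θ) / (d θ * sin θ) := by
        ring
      have e2 : 2 * c / D * θ⁻¹ = 2 * c / (D * θ) := by
        field_simp
      rw [e1, e2]
      have e3 : 2 * (x θ * y θ) / (d θ * sin θ) ≤ (-(2 * c)) / (d θ * sin θ) :=
        div_le_div_of_nonneg_right (by linarith) (by positivity)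
      have e4 : 2 * c / (D * θ) ≤ 2 * c / (d θ * sin θ) :=
        div_le_div_of_nonneg_left (by positivity) (by positivity)
          (mul_le_mul hd2 hsle hs.le (by linarith))
      rw [neg_div] at e3
      linarith
    have := hanti (left_mem_Icc.2 hε.2.le) (right_mem_Icc.2 hε.2.le) hε.2.le
    simp only at this
    have := sq_nonneg (x b)
    linarith
  -- the two are incompatible as `ε → 0`
  set B := (x b) ^ 2 * exp (2 * I) with hB
  have hub : ∀ ε ∈ Ioo 0 b, x ε ^ 2 ≤ B := by
    intro ε hε
    have h1 := hlog ε hε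
    have hxε : 0 < x ε ^ 2 := by
      have := hx0 ε ⟨hε.1, hε.2.le⟩; positivity
    have hxb : 0 < x b ^ 2 := by
      have := hx0 b ⟨hb.1, le_rfl⟩; positivity
    have h2 : log (x ε ^ 2) ≤ log B := by
      rw [hB, log_mul hxb.ne' (exp_pos _).ne', log_exp, log_pow, log_pow]
      push_cast; linarith
    exact (log_le_log_iff hxε (by positivity)).1 h2
  set ε := b * exp (-(D / (2 * c) * (B + 1))) with hεdef
  have hεm : ε ∈ Ioo 0 b := by
    refine ⟨by have := hb.1; positivity, ?_⟩
    have : exp (-(D / (2 * c) * (B + 1))) < 1 := by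
      rw [exp_lt_one_iff]
      have : 0 < D / (2 * c) * (B + 1) := by positivity
      linarith
    nlinarith [hb.1]
  have h1 := hdiv ε hεm
  have h2 := hub ε hεm
  rw [hεdef, log_mul hb.1.ne' (exp_pos _).ne', log_exp] at h1
  have h3 : 2 * c / D * (log b - (log b + -(D / (2 * c) * (B + 1)))) = B + 1 := by
    field_simp; ring
  rw [h3] at h1
  linarith

/-- A positive potential admits no nonzero solution of finite energy. -/
theorem eq_zero_of_pos (hd : ∀ θ, d (π - θ) = d θ) (hV : ∀ θ, V (π - θ) = V θ)
    (hpos : ∀ θ ∈ Ioo 0 π, 0 < V θ) : ∀ θ ∈ Ioo 0 π, x θ = 0 := by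
  have main : ∀ {x y : ℝ → ℝ}, SturmMode D d V x y → ∀ θ ∈ Ioo 0 π, 0 ≤ x θ * y θ ∧
      HasDerivAt (fun θ => x θ * y θ)
        (y θ ^ 2 / (d θ * sin θ) + sin θ * V θ * x θ ^ 2) θ := by
    intro x y h
    have hder : ∀ θ ∈ Ioo 0 π, HasDerivAt (fun θ => x θ * y θ)
        (y θ ^ 2 / (d θ * sin θ) + sin θ * V θ * x θ ^ 2) θ := fun θ hθ =>
      ((h.deriv_fst θ hθ).mul (h.deriv_snd θ hθ)).congr_deriv (by ring)
    have hmono : MonotoneOn (fun θ => x θ * y θ) (Ioo 0 π) := by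
      refine monotoneOn_of_hasDerivAt (convex_Ioo _ _) hder fun θ hθ' => ?_
      have := hpos θ hθ'
      have := sin_pos_of_pos_of_lt_pi hθ'.1 hθ'.2
      have := h.one_le θ
      positivity
    intro θ hθ
    refine ⟨?_, hder θ hθ⟩
    by_contra hneg
    push Not at hneg
    exact h.not_flux_le hθ (c := -(x θ * y θ)) (by linarith) fun t ht => by
      have := hmono ⟨ht.1, ht.2.trans_lt hθ.2⟩ hθ ht.2
      simp only at this
      linarith
  intro θ hθ
  have hzero : ∀ t ∈ Ioo 0 π, x t * y t = 0 := by
    intro t ht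
    have hm : π - t ∈ Ioo 0 π := ⟨by linarith [ht.2], by linarith [ht.1]⟩
    have h1 := (main h t ht).1
    have h2 := (main (h.reflect hd hV) _ hm).1
    simp only [sub_sub_cancel] at h2
    linarith
  have hd0 : HasDerivAt (fun θ => x θ * y θ) 0 θ := by
    refine (hasDerivAt_const θ (0 : ℝ)).congr_of_eventuallyEq ?_
    filter_upwards [isOpen_Ioo.mem_nhds hθ] with t ht using hzero t ht
  have heq := (main h θ hθ).2.unique hd0
  have := hpos θ hθ
  have hs := sin_pos_of_pos_of_lt_pi hθ.1 hθ.2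
  have := h.one_le θ
  have e1 : 0 ≤ y θ ^ 2 / (d θ * sin θ) := by positivity
  have e3 : 0 < sin θ * V θ := by positivity
  have : x θ ^ 2 ≤ 0 := by
    by_contra hh
    push Not at hh
    nlinarith [mul_pos e3 hh]
  exact pow_eq_zero_iff (two_ne_zero) |>.1 (le_antisymm this (sq_nonneg _))

/-- If `-1/4 < V` then a solution that vanishes at a point of the northern hemisphere vanishes from
there up to the pole. -/
theorem eq_zero_of_node {κ : ℝ} (hκ : κ < 1 / 4) (hV : ∀ θ ∈ Ioo 0 π, -κ ≤ V θ) {b : ℝ}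
    (hb : b ∈ Ioc 0 (π / 2)) (hxb : x b = 0) : ∀ θ ∈ Ioo 0 b, x θ = 0 := by
  have hpi := pi_pos
  have hsub : ∀ {θ}, θ ∈ Ioc 0 b → θ ∈ Ioo 0 π := fun hθ =>
    ⟨hθ.1, by linarith [hθ.2, hb.2]⟩
  set M : ℝ → ℝ := fun θ => x θ * y θ + 1 / 2 * ((1 - cos θ) * x θ ^ 2) with hM
  have hder : ∀ θ ∈ Ioc 0 b, HasDerivAt M
      (y θ * (y θ / (d θ * sin θ)) + sin θ * V θ * x θ ^ 2
        + 1 / 2 * (sin θ * x θ ^ 2 +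
          (1 - cos θ) * (2 * x θ * (y θ / (d θ * sin θ))))) θ := by
    intro θ hθ
    have hx := h.deriv_fst θ (hsub hθ)
    have hy := h.deriv_snd θ (hsub hθ)
    refine ((hx.mul hy).add ((((hasDerivAt_cos θ).const_sub 1).mul
      (hx.pow 2)).const_mul (1 / 2))).congr_deriv ?_
    simp; ring
  have hlow : ∀ θ ∈ Ioc 0 b, (1 / 4 - κ) * (sin θ * x θ ^ 2) ≤
      y θ * (y θ / (d θ * sin θ)) + sin θ * V θ * x θ ^ 2
        + 1 / 2 * (sin θ * x θ ^ 2 +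
          (1 - cos θ) * (2 * x θ * (y θ / (d θ * sin θ)))) := by
    intro θ hθ
    have hs := sin_pos_of_pos_of_lt_pi (hsub hθ).1 (hsub hθ).2
    have hd1 := h.one_le θ
    have hv := hV θ (hsub hθ)
    set g := y θ / (d θ * sin θ) with hg
    have hy : y θ = d θ * sin θ * g := by rw [hg]; field_simp
    have hcos : 0 ≤ cos θ :=
      cos_nonneg_of_mem_Icc ⟨by linarith [hθ.1], by linarith [hθ.2, hb.2]⟩
    have hcos1 := cos_le_one θ
    have hsc := sin_sq_add_cos_sq θ
    have h1c : 1 - cos θ ≤ sin θ := by nlinarith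
    rw [hy]
    have k1 : sin θ * g ^ 2 ≤ d θ * sin θ * g * g := by
      have : 0 ≤ sin θ * g ^ 2 := by positivity
      nlinarith
    have k2 : -(κ * (sin θ * x θ ^ 2)) ≤ sin θ * V θ * x θ ^ 2 := by
      have : 0 ≤ sin θ * x θ ^ 2 := by positivity
      nlinarith
    have k3 : -(sin θ * (g ^ 2 + 1 / 4 * x θ ^ 2)) ≤ (1 - cos θ) * (x θ * g) := by
      have a1 : -(g ^ 2 + 1 / 4 * x θ ^ 2) ≤ x θ * g := by nlinarith [sq_nonneg (g + x θ / 2)]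
      nlinarith
    nlinarith
  have hmono : MonotoneOn M (Ioc 0 b) := by
    refine monotoneOn_of_hasDerivAt (convex_Ioc _ _) hder fun θ hθ' => ?_
    refine le_trans ?_ (hlow θ hθ')
    have := sin_pos_of_pos_of_lt_pi (hsub hθ').1 (hsub hθ').2
    have : 0 < 1 / 4 - κ := by linarith
    positivity
  have hnonneg : ∀ θ ∈ Ioc 0 b, 0 ≤ M θ := by
    intro θ hθ
    by_contra hneg
    push Not at hneg
    refine h.not_flux_le (hsub hθ) (c := -M θ) (by linarith) fun t ht => ?_
    have h1 := hmono ⟨ht.1, ht.2.trans hθ.2⟩ hθ ht.2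
    have h2 : 0 ≤ 1 / 2 * ((1 - cos t) * x t ^ 2) := by
      have := cos_le_one t
      have : 0 ≤ 1 - cos t := by linarith
      positivity
    simp only [hM] at h1 ⊢
    linarith
  have hMb : M b = 0 := by simp [hM, hxb]
  have hzero : ∀ t ∈ Ioc 0 b, M t = 0 := fun t ht =>
    le_antisymm ((hmono ht ⟨hb.1, le_rfl⟩ ht.2).trans_eq hMb) (hnonneg t ht)
  intro θ hθ
  have hθ' : θ ∈ Ioc 0 b := ⟨hθ.1, hθ.2.le⟩
  have hd0 : HasDerivAt M 0 θ := by
    refine (hasDerivAt_const θ (0 : ℝ)).congr_of_eventuallyEq ?_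
    filter_upwards [isOpen_Ioo.mem_nhds hθ] with t ht using hzero t ⟨ht.1, ht.2.le⟩
  have heq := (hder θ hθ').unique hd0
  have h1 := hlow θ hθ'
  rw [heq] at h1
  have hs := sin_pos_of_pos_of_lt_pi (hsub hθ').1 (hsub hθ').2
  by_contra hne
  have : 0 < 1 / 4 - κ := by linarith
  have : 0 < x θ ^ 2 := by positivity
  have : 0 < (1 / 4 - κ) * (sin θ * x θ ^ 2) := by positivity
  linarith

/-- Unique continuation towards the equator. -/
theorem eq_zero_of_zero_left {κ : ℝ} (hV : ∀ θ ∈ Ioo 0 π, |V θ| ≤ κ) {b e : ℝ} (hb : 0 < b)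
    (hbe : b ≤ e) (he : e < π) (hx : x b = 0) (hy : y b = 0) : x e = 0 := by
  have hsub : ∀ {θ}, θ ∈ Icc b e → θ ∈ Ioo 0 π := fun hθ =>
    ⟨by linarith [hθ.1], by linarith [hθ.2]⟩
  obtain ⟨t0, ht0, hmin⟩ := isCompact_Icc.exists_isMinOn (nonempty_Icc.2 hbe)
    continuous_sin.continuousOn
  set m := sin t0 with hm
  have hmpos : 0 < m := sin_pos_of_pos_of_lt_pi (hsub ht0).1 (hsub ht0).2
  set C := 1 / m + κ
  have hder : ∀ θ ∈ Icc b e, HasDerivAt (fun θ => (x θ ^ 2 + y θ ^ 2) * exp (-C * θ))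
      ((2 * x θ * (y θ / (d θ * sin θ)) + 2 * y θ * (sin θ * V θ * x θ))
        * exp (-C * θ) + (x θ ^ 2 + y θ ^ 2) * (exp (-C * θ) * (-C))) θ := by
    intro θ hθ
    have h1 := h.deriv_fst θ (hsub hθ)
    have h2 := h.deriv_snd θ (hsub hθ)
    have h3 : HasDerivAt (fun θ => exp (-C * θ)) (exp (-C * θ) * (-C)) θ := by
      refine (((hasDerivAt_id θ).const_mul (-C)).exp).congr_deriv ?_
      simp
    refine (((h1.pow 2).add (h2.pow 2)).mul h3).congr_deriv ?_
    simp
  have hanti : AntitoneOn (fun θ => (x θ ^ 2 + y θ ^ 2) * exp (-C * θ)) (Icc b e) := by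
    refine antitoneOn_of_hasDerivAt (convex_Icc _ _) hder fun θ hθ' => ?_
    have hs : m ≤ sin θ := hmin hθ'
    have hs1 := sin_le_one θ
    have hd1 := h.one_le θ
    have hs0 : 0 < sin θ := hmpos.trans_le hs
    have hinv : |1 / (d θ * sin θ)| ≤ 1 / m := by
      rw [abs_of_nonneg (by positivity)]
      refine one_div_le_one_div_of_le hmpos ?_
      nlinarith
    have hsv : |sin θ * V θ| ≤ κ := by
      rw [abs_mul, abs_of_nonneg (by linarith)]
      calc sin θ * |V θ| ≤ 1 * |V θ| := by gcongr
        _ ≤ κ := by rw [one_mul]; exact hV θ (hsub hθ')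
    have hsum : |1 / (d θ * sin θ) + sin θ * V θ| ≤ C :=
      (abs_add_le _ _).trans (add_le_add hinv hsv)
    have e1 : (2 * x θ * (y θ / (d θ * sin θ)) + 2 * y θ * (sin θ * V θ * x θ))
        = 2 * (x θ * y θ) * (1 / (d θ * sin θ) + sin θ * V θ) := by ring
    have e2 : 2 * (x θ * y θ) * (1 / (d θ * sin θ) + sin θ * V θ)
        ≤ (x θ ^ 2 + y θ ^ 2) * C := by
      refine (le_abs_self _).trans ?_
      rw [abs_mul]
      refine mul_le_mul ?_ hsum (abs_nonneg _) (by positivity)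
      rw [abs_le]
      constructor <;> nlinarith [sq_nonneg (x θ - y θ), sq_nonneg (x θ + y θ)]
    rw [e1]
    have := exp_pos (-C * θ)
    nlinarith
  have hfin := hanti (left_mem_Icc.2 hbe) (right_mem_Icc.2 hbe) hbe
  simp only [hx, hy] at hfin
  by_contra hne
  have : 0 < x e ^ 2 := by positivity
  have : 0 < (x e ^ 2 + y e ^ 2) * exp (-C * e) := by positivity
  have e0 : ((0 : ℝ) ^ 2 + 0 ^ 2) * exp (-C * b) = 0 := by ring
  rw [e0] at hfin
  linarith

/-- If `-1/4 < V < 0` then the derivative at the equator points towards the axis. -/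
theorem flux_equator_neg {κ : ℝ} (hκ : κ < 1 / 4) (hV : ∀ θ ∈ Ioo 0 π, -κ ≤ V θ ∧ V θ < 0)
    (hx : 0 < x (π / 2)) : y (π / 2) < 0 := by
  have hpi := pi_pos
  have hsub : ∀ {θ}, θ ∈ Ioc 0 (π / 2) → θ ∈ Ioo 0 π := fun hθ =>
    ⟨hθ.1, by linarith [hθ.2]⟩
  have hcont : ContinuousOn x (Ioo 0 π) := fun θ hθ =>
    (h.deriv_fst θ hθ).continuousAt.continuousWithinAt
  have hne : ∀ θ ∈ Ioc 0 (π / 2), x θ ≠ 0 := by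
    intro b hb h0
    have hz := h.eq_zero_of_node hκ (fun θ hθ => (hV θ hθ).1) hb h0
    have hm : b / 2 ∈ Ioo 0 b := ⟨by linarith [hb.1], by linarith [hb.1]⟩
    have hm' : b / 2 ∈ Ioo 0 π := ⟨hm.1, by linarith [hm.2, hb.2]⟩
    have hd0 : HasDerivAt x 0 (b / 2) := by
      refine (hasDerivAt_const _ (0 : ℝ)).congr_of_eventuallyEq ?_
      filter_upwards [isOpen_Ioo.mem_nhds hm] with t ht using hz t ht
    have := (h.deriv_fst _ hm').unique hd0
    have hs := sin_pos_of_pos_of_lt_pi hm'.1 hm'.2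
    have hd1 := h.one_le (b / 2)
    have hy0 : y (b / 2) = 0 := by
      rcases div_eq_zero_iff.1 this with h | h
      · exact h
      · exact absurd h (by positivity)
    have := h.eq_zero_of_zero_left (κ := κ) (fun θ hθ => by
      rw [abs_le]; exact ⟨(hV θ hθ).1, by have := hV θ hθ; linarith⟩) hm.1
      (e := π / 2) (by linarith [hb.2, hb.1]) (by linarith) (hz _ hm) hy0
    linarith
  have hpos : ∀ θ ∈ Ioc 0 (π / 2), 0 < x θ := by
    intro θ hθ
    by_contra hneg
    push Not at hneg
    have hc : ContinuousOn x (Icc θ (π / 2)) :=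
      hcont.mono fun t ht => hsub ⟨hθ.1.trans_le ht.1, ht.2⟩
    obtain ⟨t, ht, ht0⟩ := intermediate_value_Icc hθ.2 hc ⟨hneg, hx.le⟩
    exact hne t ⟨hθ.1.trans_le ht.1, ht.2⟩ ht0
  have hanti : StrictAntiOn y (Ioc 0 (π / 2)) := by
    refine strictAntiOn_of_deriv_neg (convex_Ioc _ _)
      (fun θ hθ => (h.deriv_snd θ (hsub hθ)).continuousAt.continuousWithinAt) ?_
    intro θ hθ
    have hθ' := interior_subset hθ
    rw [(h.deriv_snd θ (hsub hθ')).deriv]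
    have := sin_pos_of_pos_of_lt_pi (hsub hθ').1 (hsub hθ').2
    have h1 := mul_pos this (hpos θ hθ')
    nlinarith [(hV θ (hsub hθ')).2]
  by_contra hcon
  push Not at hcon
  set b := π / 4 with hbdef
  have hb : b ∈ Ioc 0 (π / 2) := ⟨by positivity, by linarith⟩
  set c := y b with hc
  have hcpos : 0 < c := hcon.trans_lt (hanti hb ⟨by positivity, le_rfl⟩ (by linarith))
  have hD : 1 ≤ D := (h.one_le 0).trans (h.le_bound 0)
  -- `x` would tend to `-∞` at the pole
  have hdiv : ∀ ε ∈ Ioo 0 b, x ε ≤ x b - c / D * (log b - log ε) := by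
    intro ε hε
    have hIcc : ∀ {θ}, θ ∈ Icc ε b → θ ∈ Ioc 0 (π / 2) := fun hθ =>
      ⟨hε.1.trans_le hθ.1, hθ.2.trans hb.2⟩
    have hder : ∀ θ ∈ Icc ε b, HasDerivAt (fun θ => x θ - c / D * log θ)
        (y θ / (d θ * sin θ) - c / D * θ⁻¹) θ := fun θ hθ =>
      (h.deriv_fst θ (hsub (hIcc hθ))).sub
        ((hasDerivAt_log (hIcc hθ).1.ne').const_mul (c / D))
    have hmono : MonotoneOn (fun θ => x θ - c / D * log θ) (Icc ε b) := by
      refine monotoneOn_of_hasDerivAt (convex_Icc _ _) hder fun θ hθ' => ?_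
      have hm := hIcc hθ'
      have hs := sin_pos_of_pos_of_lt_pi (hsub hm).1 (hsub hm).2
      have hsle : sin θ ≤ θ := sin_le hm.1.le
      have hyc : c ≤ y θ := hanti.antitoneOn hm hb hθ'.2
      have hd1 := h.one_le θ
      have hd2 := h.le_bound θ
      have hθpos := hm.1
      have e2 : c / D * θ⁻¹ = c / (D * θ) := by field_simp
      rw [e2, sub_nonneg]
      exact div_le_div₀ (hcpos.le.trans hyc) hyc (by positivity)
        (mul_le_mul hd2 hsle hs.le (by linarith))
    have := hmono (left_mem_Icc.2 hε.2.le) (right_mem_Icc.2 hε.2.le) hε.2.le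
    simp only at this
    linarith
  set ε := b * exp (-(D / c * x b)) with hεdef
  have hxb := hpos b hb
  have hεm : ε ∈ Ioo 0 b := by
    refine ⟨by have := hb.1; positivity, ?_⟩
    have : exp (-(D / c * x b)) < 1 := by
      rw [exp_lt_one_iff]
      have : 0 < D / c * x b := by positivity
      linarith
    nlinarith [hb.1]
  have h1 := hdiv ε hεm
  have h2 := hpos ε ⟨hεm.1, by linarith [hεm.2, hb.2]⟩
  rw [hεdef, log_mul hb.1.ne' (exp_pos _).ne', log_exp] at h1
  have h3 : c / D * (log b - (log b + -(D / c * x b))) = x b := by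
    field_simp; ring
  rw [h3] at h1
  rw [hεdef] at h2
  linarith

end SturmMode

/-- `L = λ + ξ² - 2mξΞ`; for `ξ = aω` this is `λ̃ - 2maωΞ`, the constant that multiplies `-Δ` in the
radial potential when the squares are completed. -/
noncomputable def shiftedEigenvalue (a l ξ : ℝ) (m : ℤ) (Λ : ℝ) : ℝ :=
  Λ + ξ ^ 2 - 2 * m * ξ * Xi a l

/-- The potential of the angular equation after completing the square. -/
noncomputable def angularPotential (a l musq ξ : ℝ) (m : ℤ) (Λ θ : ℝ) : ℝ :=
  (Xi a l * m / sin θ - ξ * sin θ) ^ 2 / DeltaTheta a l θ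
    + musq * a ^ 2 * sin θ ^ 2 - shiftedEigenvalue a l ξ m Λ

theorem one_le_DeltaTheta (a l θ : ℝ) : 1 ≤ DeltaTheta a l θ := by
  unfold DeltaTheta
  have : 0 ≤ a ^ 2 / l ^ 2 * cos θ ^ 2 := by positivity
  linarith

theorem DeltaTheta_le (a l θ : ℝ) : DeltaTheta a l θ ≤ Xi a l := by
  unfold DeltaTheta Xi
  have h1 : cos θ ^ 2 ≤ 1 := cos_sq_le_one θ
  have : a ^ 2 / l ^ 2 * cos θ ^ 2 ≤ a ^ 2 / l ^ 2 * 1 := by gcongr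
  linarith

theorem one_le_Xi (a l : ℝ) : 1 ≤ Xi a l := (one_le_DeltaTheta a l 0).trans (DeltaTheta_le a l 0)

theorem hasDerivAt_phase (z : ℂ) (m : ℤ) (p : ℝ) :
    HasDerivAt (fun p : ℝ => z * Complex.exp (I * m * p))
      (z * (I * m) * Complex.exp (I * m * p)) p := by
  have h1 : HasDerivAt (fun p : ℝ => I * m * (p : ℂ)) (I * m) p := by
    simpa using (Complex.ofRealCLM.hasDerivAt (x := p)).const_mul (I * (m : ℂ))
  refine (h1.cexp.const_mul z).congr_deriv ?_
  ring

/-- A real part of an angular eigenfunction is a Sturm mode; the conjugated constant `c` lets any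
nonvanishing value of the eigenfunction be made real and positive. -/
theorem IsAngularEigenvalue.exists_sturmMode {a l musq ξ Λ : ℝ} {m : ℤ}
    (h : IsAngularEigenvalue a l musq ξ m Λ) :
    ∃ S : ℝ → ℂ, (∃ θ ∈ Ioo 0 π, S θ ≠ 0) ∧ ∀ c : ℂ, ∃ y : ℝ → ℝ,
      SturmMode (Xi a l) (DeltaTheta a l) (angularPotential a l musq ξ m Λ)
        (fun θ => (S θ * (starRingEnd ℂ) c).re) y := by
  obtain ⟨S, hS, hne, hint, heq⟩ := h
  refine ⟨S, hne, fun c => ?_⟩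
  have hdS : ∀ θ ∈ Ioo 0 π, HasDerivAt S (deriv S θ) θ := fun θ hθ =>
    ((hS.differentiableOn (by simp)).differentiableAt (isOpen_Ioo.mem_nhds hθ)).hasDerivAt
  have hS1 : ContDiffOn ℝ ((⊤ : ℕ∞) : WithTop ℕ∞) (deriv S) (Ioo 0 π) :=
    hS.deriv_of_isOpen isOpen_Ioo (by simp)
  have hdS1 : ∀ θ ∈ Ioo 0 π, DifferentiableAt ℝ (deriv S) θ := fun θ hθ =>
    (hS1.differentiableOn (by simp)).differentiableAt (isOpen_Ioo.mem_nhds hθ)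
  set flux : ℝ → ℂ := fun t => ((DeltaTheta a l t * sin t : ℝ) : ℂ) * deriv S t with hflux
  have hfd : ∀ θ ∈ Ioo 0 π, HasDerivAt flux
      (((sin θ * angularPotential a l musq ξ m Λ θ : ℝ) : ℂ) * S θ) θ := by
    intro θ hθ
    have hs := sin_pos_of_pos_of_lt_pi hθ.1 hθ.2
    have hdiff : DifferentiableAt ℝ flux θ := by
      have hr : DifferentiableAt ℝ (fun t => DeltaTheta a l t * sin t) θ := by
        unfold DeltaTheta
        fun_prop
      exact (hr.hasDerivAt.ofReal_comp.differentiableAt).mul (hdS1 θ hθ)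
    have e := heq θ hθ 0
    unfold angularOp at e
    have p1 : deriv (fun p : ℝ => S θ * Complex.exp (I * m * p))
        = fun p : ℝ => S θ * (I * m) * Complex.exp (I * m * p) :=
      funext fun p => (hasDerivAt_phase (S θ) m p).deriv
    have p2 : deriv (fun p : ℝ => S θ * (I * m) * Complex.exp (I * m * p)) 0
        = S θ * (I * m) * (I * m) := by
      rw [(hasDerivAt_phase (S θ * (I * m)) m 0).deriv]; simp
    rw [p1, p2] at e
    simp only [Complex.ofReal_zero, mul_zero, Complex.exp_zero, mul_one] at e
    refine hdiff.hasDerivAt.congr_deriv ?_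
    have hs' : (sin θ : ℂ) ≠ 0 := by exact_mod_cast hs.ne'
    have hd1 := one_le_DeltaTheta a l θ
    change -((1 / sin θ : ℝ) : ℂ) * deriv flux θ - _ - _ - _ + _ = _ at e
    set F := deriv flux θ
    set c1 := Xi a l ^ 2 / DeltaTheta a l θ * (1 / sin θ ^ 2) with hc1
    set c2 := Xi a l * (ξ ^ 2 / DeltaTheta a l θ) * cos θ ^ 2 with hc2
    set c3 := ξ * (Xi a l / DeltaTheta a l θ) * (a ^ 2 / l ^ 2) * cos θ ^ 2 with hc3
    set c4 := musq * a ^ 2 * sin θ ^ 2 with hc4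
    have hreal : angularPotential a l musq ξ m Λ θ = c1 * m ^ 2 - c2 + 2 * c3 * m + c4 - Λ := by
      have hk : DeltaTheta a l θ = 1 + a ^ 2 / l ^ 2 * (1 - sin θ ^ 2) := by
        have := sin_sq_add_cos_sq θ
        unfold DeltaTheta; rw [show cos θ ^ 2 = 1 - sin θ ^ 2 by linarith]
      have hcos : cos θ ^ 2 = 1 - sin θ ^ 2 := by
        have := sin_sq_add_cos_sq θ; linarith
      have hX : Xi a l = 1 + a ^ 2 / l ^ 2 := rfl
      have hd0 : DeltaTheta a l θ ≠ 0 := by linarith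
      rw [hc1, hc2, hc3, hc4, hcos]
      unfold angularPotential shiftedEigenvalue
      rw [hX]
      rw [hk] at hd0 ⊢
      generalize a ^ 2 / l ^ 2 = k at *
      field_simp
      ring
    rw [hreal]
    clear_value F c1 c2 c3 c4
    generalize sin θ = σ at *
    have hF : F = (σ : ℂ) * (((1 / σ : ℝ) : ℂ) * F) := by
      push_cast
      rw [← mul_assoc, mul_one_div_cancel hs', one_mul]
    rw [hF]
    push_cast at e ⊢
    linear_combination (-(σ : ℂ)) * e
      - (σ : ℂ) * S θ * (c1 * m ^ 2 + 2 * c3 * m) * Complex.I_mul_I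
  refine ⟨fun θ => DeltaTheta a l θ * sin θ * (deriv S θ * (starRingEnd ℂ) c).re,
    one_le_DeltaTheta a l, DeltaTheta_le a l, ?_, ?_, ?_⟩
  · intro θ hθ
    have hs := sin_pos_of_pos_of_lt_pi hθ.1 hθ.2
    have hd := one_le_DeltaTheta a l θ
    have := (Complex.reCLM.hasFDerivAt.comp_hasDerivAt θ ((hdS θ hθ).mul_const ((starRingEnd ℂ) c)))
    refine this.congr_deriv ?_
    rw [mul_div_cancel_left₀ _ (by positivity)]; rfl
  · intro θ hθ
    have := (Complex.reCLM.hasFDerivAt.comp_hasDerivAt θ ((hfd θ hθ).mul_const ((starRingEnd ℂ) c)))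
    refine (this.congr_deriv ?_).congr_of_eventuallyEq (.of_forall fun t => ?_)
    · simp only [Complex.reCLM_apply, mul_assoc, Complex.re_ofReal_mul]
    · simp only [Function.comp, hflux, Complex.reCLM_apply, mul_assoc, Complex.re_ofReal_mul]
  · have hm : ∀ θ ∈ Ioo 0 π, sin θ * (DeltaTheta a l θ * sin θ *
        (deriv S θ * (starRingEnd ℂ) c).re / (DeltaTheta a l θ * sin θ)) ^ 2
        = sin θ * (deriv S θ * (starRingEnd ℂ) c).re ^ 2 := by
      intro θ hθ
      have hs := sin_pos_of_pos_of_lt_pi hθ.1 hθ.2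
      have hd := one_le_DeltaTheta a l θ
      rw [mul_div_cancel_left₀ _ (by positivity)]
    refine IntegrableOn.congr_fun ?_ (fun θ hθ => (hm θ hθ).symm) measurableSet_Ioo
    refine (hint.const_mul (‖c‖ ^ 2)).mono' ?_ ?_
    · refine ContinuousOn.aestronglyMeasurable ?_ measurableSet_Ioo
      have h1 : ContinuousOn (deriv S) (Ioo 0 π) := hS1.continuousOn
      exact continuous_sin.continuousOn.mul
        ((Complex.continuous_re.comp_continuousOn (h1.mul continuousOn_const)).pow 2)
    · refine (ae_restrict_iff' measurableSet_Ioo).2 (.of_forall fun θ hθ => ?_)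
      have hs := sin_pos_of_pos_of_lt_pi hθ.1 hθ.2
      rw [norm_of_nonneg (by positivity)]
      have h1 : |(deriv S θ * (starRingEnd ℂ) c).re| ≤ ‖deriv S θ‖ * ‖c‖ := by
        refine (Complex.abs_re_le_norm _).trans ?_
        rw [norm_mul, Complex.norm_conj]
      have h2 : (deriv S θ * (starRingEnd ℂ) c).re ^ 2 ≤ (‖deriv S θ‖ * ‖c‖) ^ 2 := by
        rw [← sq_abs]; gcongr
      have h4 : sin θ * (deriv S θ * (starRingEnd ℂ) c).re ^ 2 ≤
          sin θ * (‖deriv S θ‖ * ‖c‖) ^ 2 := by gcongr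
      have h5 : 0 ≤ ‖c‖ ^ 2 * (‖S θ‖ ^ 2 + (m : ℝ) ^ 2 / sin θ ^ 2 * ‖S θ‖ ^ 2) * sin θ := by
        positivity
      nlinarith

theorem angularPotential_reflect (a l musq ξ : ℝ) (m : ℤ) (Λ θ : ℝ) :
    angularPotential a l musq ξ m Λ (π - θ) = angularPotential a l musq ξ m Λ θ := by
  simp [angularPotential, DeltaTheta]

theorem DeltaTheta_reflect (a l θ : ℝ) : DeltaTheta a l (π - θ) = DeltaTheta a l θ := by
  simp [DeltaTheta]

/-- The eigenvalue dominates the angular potential at some angle, for otherwise the potential would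
be positive and the eigenfunction zero; `σ` is the sine of that angle. -/
theorem IsAngularEigenvalue.exists_sq_le {a l musq ξ Λ : ℝ} {m : ℤ} (hmu : 0 ≤ musq)
    (h : IsAngularEigenvalue a l musq ξ m Λ) :
    ∃ σ ∈ Icc (0 : ℝ) 1, 0 < σ ∧ (Xi a l * m - ξ * σ ^ 2) ^ 2 ≤
      Xi a l * (σ ^ 2 * shiftedEigenvalue a l ξ m Λ) := by
  by_contra hcon
  push Not at hcon
  obtain ⟨S, ⟨θ, hθ, hSθ⟩, hS⟩ := h.exists_sturmMode
  obtain ⟨y, hy⟩ := hS (S θ)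
  have := hy.eq_zero_of_pos (DeltaTheta_reflect a l) (angularPotential_reflect a l musq ξ m Λ)
    (fun t ht => by
      have hs := sin_pos_of_pos_of_lt_pi ht.1 ht.2
      have h1 := hcon (sin t) ⟨hs.le, sin_le_one t⟩ hs
      have hd := DeltaTheta_le a l t
      have hd1 := one_le_DeltaTheta a l t
      unfold angularPotential
      have h2 : shiftedEigenvalue a l ξ m Λ <
          (Xi a l * m / sin t - ξ * sin t) ^ 2 / Xi a l := by
        rw [lt_div_iff₀ (by linarith)]
        have e : (Xi a l * m / sin t - ξ * sin t) ^ 2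
          = (Xi a l * m - ξ * sin t ^ 2) ^ 2 / sin t ^ 2 := by field_simp
        rw [e, lt_div_iff₀ (by positivity)]
        linarith
      have h3 : (Xi a l * m / sin t - ξ * sin t) ^ 2 / Xi a l ≤
          (Xi a l * m / sin t - ξ * sin t) ^ 2 / DeltaTheta a l t :=
        div_le_div_of_nonneg_left (sq_nonneg _) (by linarith) hd
      have h4 : 0 ≤ musq * a ^ 2 * sin t ^ 2 := by positivity
      linarith) θ hθ
  simp only [mul_conj, Complex.ofReal_re] at this
  exact hSθ (Complex.normSq_eq_zero.1 this)

/-- Spectral gap of the massless axisymmetric operator above its lowest eigenvalue. -/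
theorem IsAngularEigenvalue.gap {a l ξ Λ : ℝ} (h : IsAngularEigenvalue a l 0 ξ 0 Λ) :
    1 / 4 ≤ shiftedEigenvalue a l ξ 0 Λ ∨ shiftedEigenvalue a l ξ 0 Λ ≤ ξ ^ 2 := by
  by_contra hcon
  push Not at hcon
  obtain ⟨h1, h2⟩ := hcon
  obtain ⟨S, ⟨θ, hθ, hSθ⟩, hS⟩ := h.exists_sturmMode
  have hV : ∀ t ∈ Ioo 0 π, -shiftedEigenvalue a l ξ 0 Λ ≤ angularPotential a l 0 ξ 0 Λ t ∧
      angularPotential a l 0 ξ 0 Λ t < 0 := by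
    intro t ht
    have hd1 := one_le_DeltaTheta a l t
    have e : angularPotential a l 0 ξ 0 Λ t = (ξ * sin t) ^ 2 / DeltaTheta a l t
        - shiftedEigenvalue a l ξ 0 Λ := by
      simp [angularPotential]
    rw [e]
    have i1 : 0 ≤ (ξ * sin t) ^ 2 / DeltaTheta a l t := by positivity
    have i2 : (ξ * sin t) ^ 2 / DeltaTheta a l t ≤ ξ ^ 2 := by
      rw [div_le_iff₀ (by linarith)]
      have := sin_sq_le_one t
      have : ξ ^ 2 * sin t ^ 2 ≤ ξ ^ 2 * 1 := by gcongr
      nlinarith [sq_nonneg ξ]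
    constructor <;> linarith
  have hmid : π / 2 ∈ Ioc 0 (π / 2) := ⟨by positivity, le_rfl⟩
  have hrefl : π - π / 2 = π / 2 := by ring
  by_cases h0 : S (π / 2) = 0
  · obtain ⟨y, hy⟩ := hS (S θ)
    have hz := hy.eq_zero_of_node h1 (fun t ht => (hV t ht).1) hmid (by simp [h0])
    have hz' := (hy.reflect (DeltaTheta_reflect a l)
      (angularPotential_reflect a l 0 ξ 0 Λ)).eq_zero_of_node h1 (fun t ht => (hV t ht).1) hmid
      (by simp [h0, hrefl])
    have : (S θ * (starRingEnd ℂ) (S θ)).re = 0 := by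
      rcases lt_trichotomy θ (π / 2) with hlt | heq | hgt
      · exact hz θ ⟨hθ.1, hlt⟩
      · rw [heq, h0]; simp
      · have := hz' (π - θ) ⟨by linarith [hθ.2], by linarith⟩
        simpa using this
    simp only [mul_conj, Complex.ofReal_re] at this
    exact hSθ (Complex.normSq_eq_zero.1 this)
  · obtain ⟨y, hy⟩ := hS (S (π / 2))
    have hx : 0 < (S (π / 2) * (starRingEnd ℂ) (S (π / 2))).re := by
      rw [mul_conj, Complex.ofReal_re]
      exact Complex.normSq_pos.2 h0
    have hl := hy.flux_equator_neg h1 hV hx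
    have hr := (hy.reflect (DeltaTheta_reflect a l)
      (angularPotential_reflect a l 0 ξ 0 Λ)).flux_equator_neg h1 hV (by rw [hrefl]; exact hx)
    rw [hrefl] at hr
    linarith

/-! ### Regular singular endpoints -/

theorem integral_norm_le_sqrt {F : ℝ → ℂ} {x y A : ℝ} (hxy : x ≤ y)
    (hF : ContinuousOn F (Icc x y)) (hA : ∫ t in x..y, ‖F t‖ ^ 2 ≤ A) :
    ∫ t in x..y, ‖F t‖ ≤ √(y - x) * √A := by
  have hn : ContinuousOn (fun t => ‖F t‖) (uIcc x y) := by rw [uIcc_of_le hxy]; exact hF.norm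
  have i1 : IntervalIntegrable (fun t => ‖F t‖) volume x y := hn.intervalIntegrable
  have i2 : IntervalIntegrable (fun t => ‖F t‖ ^ 2) volume x y := (hn.pow 2).intervalIntegrable
  set J := ∫ t in x..y, ‖F t‖ with hJ
  rcases hxy.eq_or_lt with h | h
  · rw [hJ, ← h]; simp
  have key : ∀ ε : ℝ, 0 ≤ A - 2 * ε * J + ε ^ 2 * (y - x) := by
    intro ε
    have h1 : 0 ≤ ∫ t in x..y, (‖F t‖ ^ 2 - 2 * ε * ‖F t‖ + ε ^ 2) := by
      refine intervalIntegral.integral_nonneg hxy fun t _ => ?_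
      nlinarith [sq_nonneg (‖F t‖ - ε)]
    rw [intervalIntegral.integral_add (i2.sub (i1.const_mul _)) (by simp),
      intervalIntegral.integral_sub i2 (i1.const_mul _),
      intervalIntegral.integral_const_mul, intervalIntegral.integral_const, smul_eq_mul] at h1
    linarith
  have hw : 0 < y - x := by linarith
  have h2 := key (J / (y - x))
  have h3 : J ^ 2 ≤ (y - x) * A := by
    have : A - 2 * (J / (y - x)) * J + (J / (y - x)) ^ 2 * (y - x) = A - J ^ 2 / (y - x) := by
      field_simp; ring
    rw [this] at h2
    have : J ^ 2 / (y - x) ≤ A := by linarith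
    rw [div_le_iff₀ hw] at this; linarith
  rw [← sqrt_mul hw.le]
  exact le_sqrt_of_sq_le h3

/-- A rotation `f' = ik f` with real `k` does not change the modulus. -/
theorem abs_norm_sub_le_of_rotation {f g : ℝ → ℂ} {k : ℝ → ℝ} {x y : ℝ} (hxy : x ≤ y)
    (hf : ∀ t ∈ Icc x y, HasDerivAt f (I * k t * f t + g t) t)
    (hk : ContinuousOn k (Icc x y)) (hg : ContinuousOn g (Icc x y)) :
    |‖f y‖ - ‖f x‖| ≤ ∫ t in x..y, ‖g t‖ := by
  set k' : ℝ → ℝ := IccExtend hxy ((Icc x y).domRestrict k) with hk'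
  have hk'c : Continuous k' := (continuousOn_iff_continuous_domRestrict.1 hk).Icc_extend'
  have hk'e : ∀ t ∈ Icc x y, k' t = k t := fun t ht => by
    rw [hk', IccExtend_of_mem _ _ ht]; rfl
  set φ : ℝ → ℝ := fun t => ∫ s in x..t, k' s
  have hφd : ∀ t, HasDerivAt φ (k' t) t := fun t =>
    intervalIntegral.integral_hasDerivAt_right (hk'c.intervalIntegrable _ _)
      (hk'c.stronglyMeasurableAtFilter _ _) hk'c.continuousAt
  have hE : ∀ t, HasDerivAt (fun t => Complex.exp (-(I * φ t)))
      (Complex.exp (-(I * φ t)) * (-(I * k' t))) t := fun t =>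
    (((hφd t).ofReal_comp.const_mul I).neg).cexp
  have hnE : ∀ t, ‖Complex.exp (-(I * φ t))‖ = 1 := by
    intro t
    rw [show -(I * (φ t : ℂ)) = ((-φ t : ℝ) : ℂ) * I by push_cast; ring]
    exact Complex.norm_exp_ofReal_mul_I _
  have hd : ∀ t ∈ Icc x y, HasDerivAt (fun t => Complex.exp (-(I * φ t)) * f t)
      (Complex.exp (-(I * φ t)) * g t) t := by
    intro t ht
    refine ((hE t).mul (hf t ht)).congr_deriv ?_
    rw [hk'e t ht]; ring
  have hcE : Continuous fun t => Complex.exp (-(I * φ t)) :=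
    continuous_iff_continuousAt.2 fun t => (hE t).continuousAt
  have hint : IntervalIntegrable (fun t => Complex.exp (-(I * φ t)) * g t) volume x y := by
    refine ContinuousOn.intervalIntegrable ?_
    rw [uIcc_of_le hxy]
    exact hcE.continuousOn.mul hg
  have hftc := intervalIntegral.integral_eq_sub_of_hasDerivAt
    (fun t ht => hd t (by rwa [uIcc_of_le hxy] at ht)) hint
  have h1 : ‖∫ t in x..y, Complex.exp (-(I * φ t)) * g t‖ ≤ ∫ t in x..y, ‖g t‖ := by
    refine (intervalIntegral.norm_integral_le_integral_norm hxy).trans_eq ?_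
    refine intervalIntegral.integral_congr fun t _ => ?_
    simp only [norm_mul, hnE, one_mul]
  rw [hftc] at h1
  have h2 := (abs_norm_sub_norm_le _ _).trans h1
  simpa only [norm_mul, hnE, one_mul] using h2

/-- The radial system near one of its two regular singular endpoints, placed at `s = 0`: `z` is the
combination of `Ψ` and its derivative that the outgoing condition annihilates. -/
structure EndSystem (T C A : ℝ) (k ζ : ℝ → ℝ) (b Ψ z F : ℝ → ℂ) : Prop where
  deriv_fst : ∀ s ∈ Ioo 0 T, HasDerivAt Ψ (I * (-k s : ℝ) * Ψ s + ζ s * z s) s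
  deriv_snd : ∀ s ∈ Ioo 0 T, HasDerivAt z (I * k s * z s + (b s * Ψ s + F s)) s
  cont_k : ContinuousOn k (Ioo 0 T)
  cont_zeta : ContinuousOn ζ (Ioo 0 T)
  cont_b : ContinuousOn b (Ioo 0 T)
  cont_F : ContinuousOn F (Ioo 0 T)
  zeta_le : ∀ s ∈ Ioo 0 T, |ζ s| ≤ C / s
  b_le : ∀ s ∈ Ioo 0 T, ‖b s‖ ≤ C
  source_integrable : IntegrableOn (fun s => ‖F s‖ ^ 2) (Ioo 0 T)
  source_le : ∫ s in Ioo 0 T, ‖F s‖ ^ 2 ≤ A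

namespace EndSystem

variable {T C A : ℝ} {k ζ : ℝ → ℝ} {b Ψ z F : ℝ → ℂ} (h : EndSystem T C A k ζ b Ψ z F)
include h

theorem C_nonneg (hT : 0 < T) : 0 ≤ C :=
  (norm_nonneg _).trans (h.b_le (T / 2) ⟨by linarith, by linarith⟩)

theorem integral_source_le {x y : ℝ} (hx : 0 < x) (hxy : x ≤ y) (hy : y < T) :
    ∫ t in x..y, ‖F t‖ ≤ √(y - x) * √A := by
  refine integral_norm_le_sqrt hxy (h.cont_F.mono (Icc_subset_Ioo hx hy)) ?_
  refine le_trans ?_ h.source_le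
  rw [intervalIntegral.integral_of_le hxy]
  refine setIntegral_mono_set h.source_integrable (.of_forall fun t => by positivity)
    (.of_forall fun t ht => ⟨hx.trans ht.1, ht.2.trans_lt hy⟩)

theorem snd_le {x y X Y : ℝ} (hx : 0 < x) (hxy : x ≤ y) (hy : y < T)
    (hX : ∀ t ∈ Icc x y, ‖Ψ t‖ ≤ X + Y / √t) :
    ‖z y‖ ≤ ‖z x‖ + C * (X * (y - x) + 2 * Y * (√y - √x)) + √(y - x) * √A := by
  have hs := Icc_subset_Ioo hx hy
  have hΨc : ContinuousOn Ψ (Icc x y) := fun t ht =>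
    (h.deriv_fst t (hs ht)).continuousAt.continuousWithinAt
  have hFc := h.cont_F.mono hs
  have hbc := h.cont_b.mono hs
  have h1 := abs_norm_sub_le_of_rotation hxy (fun t ht => h.deriv_snd t (hs ht)) (h.cont_k.mono hs)
    ((hbc.mul hΨc).add hFc)
  have hC := h.C_nonneg (hx.trans_le hxy |>.trans hy)
  have hFi : IntervalIntegrable (fun t => ‖F t‖) volume x y :=
    ContinuousOn.intervalIntegrable (by rw [uIcc_of_le hxy]; exact hFc.norm)
  have hd : ∀ t ∈ Icc x y, HasDerivAt (fun t => C * (X * t + 2 * Y * √t))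
      (C * (X + Y / √t)) t := by
    intro t ht
    have ht0 : t ≠ 0 := (hs ht).1.ne'
    refine (((hasDerivAt_id t).const_mul X).add
      ((hasDerivAt_sqrt ht0).const_mul (2 * Y))).const_mul C |>.congr_deriv ?_
    have : 0 < √t := sqrt_pos.2 (hs ht).1
    field_simp
  have hi : IntervalIntegrable (fun t => C * (X + Y / √t)) volume x y := by
    refine ContinuousOn.intervalIntegrable ?_
    rw [uIcc_of_le hxy]
    refine continuousOn_const.mul (continuousOn_const.add (continuousOn_const.div
      continuous_sqrt.continuousOn fun t ht => ?_))
    exact (sqrt_pos.2 (hs ht).1).ne'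
  have hftc := intervalIntegral.integral_eq_sub_of_hasDerivAt
    (fun t ht => hd t (by rwa [uIcc_of_le hxy] at ht)) hi
  have h2 : ∫ t in x..y, ‖b t * Ψ t + F t‖ ≤ ∫ t in x..y, (C * (X + Y / √t) + ‖F t‖) := by
    refine intervalIntegral.integral_mono_on hxy ?_ (hi.add hFi) fun t ht => ?_
    · refine ContinuousOn.intervalIntegrable ?_
      rw [uIcc_of_le hxy]
      exact ((hbc.mul hΨc).add hFc).norm
    · refine (norm_add_le _ _).trans (add_le_add_left ?_ _)
      rw [norm_mul]
      exact mul_le_mul (h.b_le t (hs ht)) (hX t ht) (norm_nonneg _) hC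
  rw [intervalIntegral.integral_add hi hFi, hftc] at h2
  have h3 := h.integral_source_le hx hxy hy
  have h4 := (abs_le.1 (h1.trans h2)).2
  linarith

/-- Variation of `|Ψ|`, if `|z| ≤ αt + β√t`. -/
theorem fst_variation {x y α β : ℝ} (hx : 0 < x) (hxy : x ≤ y) (hy : y < T)
    (hz : ∀ t ∈ Icc x y, ‖z t‖ ≤ α * t + β * √t) :
    |‖Ψ y‖ - ‖Ψ x‖| ≤ C * (α * (y - x) + 2 * β * (√y - √x)) := by
  have hs := Icc_subset_Ioo hx hy
  have hzc : ContinuousOn z (Icc x y) := fun t ht =>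
    (h.deriv_snd t (hs ht)).continuousAt.continuousWithinAt
  have hζ : ContinuousOn (fun t => (ζ t : ℂ)) (Icc x y) :=
    Complex.continuous_ofReal.comp_continuousOn (h.cont_zeta.mono hs)
  have h1 := abs_norm_sub_le_of_rotation hxy (fun t ht => h.deriv_fst t (hs ht))
    (h.cont_k.mono hs).neg (hζ.mul hzc)
  have hC := h.C_nonneg (hx.trans_le hxy |>.trans hy)
  refine h1.trans ?_
  have hd : ∀ t ∈ Icc x y, HasDerivAt (fun t => C * (α * t + 2 * β * √t))
      (C * (α + β / √t)) t := by
    intro t ht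
    have ht0 : t ≠ 0 := (hs ht).1.ne'
    refine (((hasDerivAt_id t).const_mul α).add
      ((hasDerivAt_sqrt ht0).const_mul (2 * β))).const_mul C |>.congr_deriv ?_
    have : 0 < √t := sqrt_pos.2 (hs ht).1
    field_simp
  have hc : ContinuousOn (fun t => C * (α + β / √t)) (Icc x y) := by
    refine continuousOn_const.mul (continuousOn_const.add (continuousOn_const.div
      continuous_sqrt.continuousOn fun t ht => ?_))
    exact (sqrt_pos.2 (hs ht).1).ne'
  have hi : IntervalIntegrable (fun t => C * (α + β / √t)) volume x y :=
    ContinuousOn.intervalIntegrable (by rw [uIcc_of_le hxy]; exact hc)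
  have hftc := intervalIntegral.integral_eq_sub_of_hasDerivAt
    (fun t ht => hd t (by rwa [uIcc_of_le hxy] at ht)) hi
  have : C * (α * (y - x) + 2 * β * (√y - √x)) = ∫ t in x..y, C * (α + β / √t) := by
    rw [hftc]; ring
  rw [this]
  refine intervalIntegral.integral_mono_on hxy ?_ hi fun t ht => ?_
  · refine ContinuousOn.intervalIntegrable ?_
    rw [uIcc_of_le hxy]; exact (hζ.mul hzc).norm
  · have ht0 := (hs ht).1
    have hst : 0 < √t := sqrt_pos.2 ht0
    rw [norm_mul, norm_real, norm_eq_abs]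
    calc |ζ t| * ‖z t‖ ≤ C / t * (α * t + β * √t) :=
          mul_le_mul (h.zeta_le t (hs ht)) (hz t ht) (norm_nonneg _) (by positivity)
      _ = C * (α + β / √t) := by
          have e : √t / t = 1 / √t := by
            rw [div_eq_div_iff ht0.ne' hst.ne']; rw [mul_self_sqrt ht0.le]; ring
          have : C / t * (α * t + β * √t) = C * (α * (t / t) + β * (√t / t)) := by ring
          rw [this, e, div_self ht0.ne']; ring

/-- A crude growth bound, from which boundedness is bootstrapped. -/
theorem exists_crude_bound (hT : 0 < T) {κ : ℝ → ℂ} {Cκ : ℝ}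
    (hκ : ∀ s ∈ Ioo 0 T, ‖κ s‖ ≤ Cκ * s)
    (hlim : Tendsto (fun s => z s + κ s * Ψ s) (𝓝[>] 0) (𝓝 0)) :
    ∃ s₀ ∈ Ioo 0 T, ∃ B ≥ 0, ∀ s ∈ Ioc 0 s₀, ‖Ψ s‖ * √s ≤ B := by
  have hC := h.C_nonneg hT
  have hCκ : 0 ≤ Cκ := by
    have h1 := (norm_nonneg _).trans (hκ (T / 2) ⟨by linarith, by linarith⟩)
    by_contra hneg
    push Not at hneg
    nlinarith
  have hev : ∀ᶠ s in 𝓝[>] (0 : ℝ), ‖z s + κ s * Ψ s‖ < 1 := by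
    have := hlim.norm
    rw [norm_zero] at this
    exact this.eventually_lt_const one_pos
  obtain ⟨u, hu, hu1⟩ := mem_nhdsGT_iff_exists_Ioo_subset.1 hev
  have hu0 : (0 : ℝ) < u := hu
  set s₀ := min (u / 2) (T / 2) with hs₀
  have hs0 : 0 < s₀ := by positivity
  have hs0u : s₀ < u := (min_le_left _ _).trans_lt (by linarith)
  have hs0T : s₀ < T := (min_le_right _ _).trans_lt (by linarith)
  set D := C * Cκ with hD
  have hDn : 0 ≤ D := by positivity
  set G := C * exp (D * s₀) with hG
  set Y : ℝ → ℝ := fun s => √(1 + ‖Ψ s‖ ^ 2) with hY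
  have hYpos : ∀ s, 0 < Y s := fun s => sqrt_pos.2 (by positivity)
  have hYge : ∀ s, ‖Ψ s‖ ≤ Y s := fun s => le_sqrt_of_sq_le (by linarith)
  have hmem : ∀ {s}, s ∈ Ioc 0 s₀ → s ∈ Ioo 0 T := fun hs => ⟨hs.1, hs.2.trans_lt hs0T⟩
  have hYd : ∀ s ∈ Ioc 0 s₀, HasDerivAt Y (ζ s * (inner ℝ (Ψ s) (z s)) / Y s) s := by
    intro s hs
    have h1 := ((h.deriv_fst s (hmem hs)).norm_sq.const_add 1).sqrt (by positivity)
    refine h1.congr_deriv ?_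
    have e : inner ℝ (Ψ s) (I * (-k s : ℝ) * Ψ s + ζ s * z s)
        = ζ s * (inner ℝ (Ψ s) (z s)) := by
      rw [inner_add_right]
      have e1 : inner ℝ (Ψ s) (I * (-k s : ℝ) * Ψ s) = 0 := by
        simp [Complex.inner]
        ring
      have e2 : inner ℝ (Ψ s) ((ζ s : ℂ) * z s) = ζ s * inner ℝ (Ψ s) (z s) := by
        simp [Complex.inner]
        ring
      rw [e1, e2, zero_add]
    rw [e]
    have := hYpos s
    simp only [hY] at this ⊢
    field_simp
  have hYd' : ∀ s ∈ Ioc 0 s₀, |ζ s * (inner ℝ (Ψ s) (z s)) / Y s| ≤ C / s + D * Y s := by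
    intro s hs
    have hζ := h.zeta_le s (hmem hs)
    have hs1 := hu1 ⟨hs.1, hs.2.trans_lt hs0u⟩
    have hzb : ‖z s‖ ≤ 1 + Cκ * s * Y s := by
      have : ‖z s‖ ≤ ‖z s + κ s * Ψ s‖ + ‖κ s * Ψ s‖ := by
        have := norm_sub_le (z s + κ s * Ψ s) (κ s * Ψ s)
        simpa using this
      have h2 : ‖κ s * Ψ s‖ ≤ Cκ * s * Y s := by
        rw [norm_mul]
        exact mul_le_mul (hκ s (hmem hs)) (hYge s) (norm_nonneg _)
          (mul_nonneg hCκ hs.1.le)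
      have h3 : ‖z s + κ s * Ψ s‖ < 1 := hs1
      linarith
    rw [abs_div, abs_mul, abs_of_pos (hYpos s), div_le_iff₀ (hYpos s)]
    have hin : |inner ℝ (Ψ s) (z s)| ≤ Y s * (1 + Cκ * s * Y s) :=
      (abs_real_inner_le_norm _ _).trans
        (mul_le_mul (hYge s) hzb (norm_nonneg _) (hYpos s).le)
    have hs0' := hs.1
    calc |ζ s| * |inner ℝ (Ψ s) (z s)| ≤ C / s * (Y s * (1 + Cκ * s * Y s)) :=
          mul_le_mul hζ hin (abs_nonneg _) (by positivity)
      _ = (C / s + D * Y s) * Y s := by rw [hD]; field_simp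
  have hmono : MonotoneOn (fun s => exp (D * s) * Y s + G * log s) (Ioc 0 s₀) := by
    have hder : ∀ s ∈ Ioc 0 s₀, HasDerivAt
        (fun s => exp (D * s) * Y s + G * log s)
        (exp (D * s) * D * Y s + exp (D * s) * (ζ s * (inner ℝ (Ψ s) (z s)) / Y s)
          + G * s⁻¹) s := by
      intro s hs
      have he : HasDerivAt (fun s => exp (D * s)) (exp (D * s) * D) s := by
        refine (((hasDerivAt_id s).const_mul D).exp).congr_deriv ?_
        simp
      exact (he.mul (hYd s hs)).add ((hasDerivAt_log hs.1.ne').const_mul G)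
    refine monotoneOn_of_hasDerivAt (convex_Ioc _ _) hder fun s hs' => ?_
    have h1 := (abs_le.1 (hYd' s hs')).1
    have h2 := exp_pos (D * s)
    have h3 : exp (D * s) ≤ exp (D * s₀) :=
      exp_le_exp.2 (mul_le_mul_of_nonneg_left hs'.2 hDn)
    have hs0' := hs'.1
    have h4 : exp (D * s) * (C / s) ≤ G * s⁻¹ := by
      rw [hG, div_eq_mul_inv]
      have : exp (D * s) * (C * s⁻¹) ≤ exp (D * s₀) * (C * s⁻¹) := by gcongr
      linarith
    nlinarith
  refine ⟨s₀, ⟨hs0, hs0T⟩, (exp (D * s₀) * Y s₀ + G * |log s₀|) * √s₀ + 2 * G,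
    by have := hYpos s₀; positivity, fun s hs => ?_⟩
  have h1 := hmono hs ⟨hs0, le_rfl⟩ hs.2
  simp only at h1
  have hGn : 0 ≤ G := by positivity
  have h2 : ‖Ψ s‖ ≤ exp (D * s) * Y s := by
    have : 1 ≤ exp (D * s) := one_le_exp (mul_nonneg hDn hs.1.le)
    nlinarith [hYge s, hYpos s]
  have hsq : 0 < √s := sqrt_pos.2 hs.1
  have h3 : -log s * √s ≤ 2 := by
    have h5 := add_one_le_exp (log (1 / √s))
    rw [exp_log (by positivity)] at h5
    have h6 : log (1 / √s) = -(log s / 2) := by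
      rw [one_div, log_inv, log_sqrt hs.1.le]
    rw [h6] at h5
    have h7 : -log s ≤ 2 * (1 / √s) := by linarith
    calc -log s * √s ≤ 2 * (1 / √s) * √s := by gcongr
      _ = 2 := by field_simp
  have h4 : √s ≤ √s₀ := sqrt_le_sqrt hs.2
  have h8 : ‖Ψ s‖ ≤ (exp (D * s₀) * Y s₀ + G * |log s₀|) + G * (-log s) := by
    have := le_abs_self (log s₀)
    nlinarith
  calc ‖Ψ s‖ * √s ≤ ((exp (D * s₀) * Y s₀ + G * |log s₀|) + G * (-log s)) * √s := by
        gcongr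
    _ = (exp (D * s₀) * Y s₀ + G * |log s₀|) * √s + G * (-log s * √s) := by ring
    _ ≤ (exp (D * s₀) * Y s₀ + G * |log s₀|) * √s₀ + G * 2 := by gcongr
    _ = _ := by ring

/-- Outgoing solutions are bounded near the endpoint and `|Ψ|` has a limit there. -/
theorem exists_limit (hT : 0 < T) {κ : ℝ → ℂ} {Cκ : ℝ} (hκ : ∀ s ∈ Ioo 0 T, ‖κ s‖ ≤ Cκ * s)
    (hlim : Tendsto (fun s => z s + κ s * Ψ s) (𝓝[>] 0) (𝓝 0)) :
    Tendsto z (𝓝[>] 0) (𝓝 0) ∧ (∃ ν, Tendsto (fun s => ‖Ψ s‖) (𝓝[>] 0) (𝓝 ν)) ∧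
      ∃ s₀ ∈ Ioo 0 T, ∃ X, ∀ s ∈ Ioc 0 s₀, ‖Ψ s‖ ≤ X := by
  obtain ⟨s₀, hs₀, B, hB, hcrude⟩ := h.exists_crude_bound hT hκ hlim
  have hC := h.C_nonneg hT
  have hmem : ∀ {s}, s ∈ Ioc 0 s₀ → s ∈ Ioo 0 T := fun hs => ⟨hs.1, hs.2.trans_lt hs₀.2⟩
  have hevs : ∀ᶠ s in 𝓝[>] (0 : ℝ), s ∈ Ioc 0 s₀ := Ioc_mem_nhdsGT hs₀.1
  have hsqrt : Tendsto (fun s : ℝ => √s) (𝓝[>] 0) (𝓝 0) := by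
    have := (continuous_sqrt.tendsto 0).mono_left (nhdsWithin_le_nhds (s := Ioi 0))
    simpa using this
  have hΨB : ∀ s ∈ Ioc 0 s₀, ‖Ψ s‖ ≤ 0 + B / √s := by
    intro s hs
    rw [zero_add, le_div_iff₀ (sqrt_pos.2 hs.1)]
    exact hcrude s hs
  have hκΨ : Tendsto (fun s => κ s * Ψ s) (𝓝[>] 0) (𝓝 0) := by
    refine squeeze_zero_norm' (a := fun s => |Cκ| * B * √s) ?_ ?_
    · filter_upwards [hevs] with s hs
      have h1 := hκ s (hmem hs)
      have hsq := sqrt_pos.2 hs.1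
      have h2 : ‖κ s‖ ≤ |Cκ| * s := h1.trans (by have := le_abs_self Cκ; have := hs.1; gcongr)
      rw [norm_mul]
      calc ‖κ s‖ * ‖Ψ s‖ ≤ |Cκ| * s * ‖Ψ s‖ := by gcongr
        _ = |Cκ| * √s * (‖Ψ s‖ * √s) := by
            nth_rewrite 1 [← mul_self_sqrt hs.1.le]; ring
        _ ≤ |Cκ| * √s * B := by gcongr; exact hcrude s hs
        _ = |Cκ| * B * √s := by ring
    · simpa using hsqrt.const_mul (|Cκ| * B)
  have hz : Tendsto z (𝓝[>] 0) (𝓝 0) := by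
    have := hlim.sub hκΨ
    simpa using this
  set β := 2 * C * B + √A with hβ
  have hzle : ∀ y ∈ Ioc 0 s₀, ‖z y‖ ≤ 0 * y + β * √y := by
    intro y hy
    have hl : Tendsto (fun x => ‖z x‖ + β * √y) (𝓝[>] 0) (𝓝 (0 + β * √y)) := by
      have := hz.norm
      rw [norm_zero] at this
      exact this.add_const _
    rw [zero_mul]
    refine ge_of_tendsto hl ?_
    filter_upwards [Ioc_mem_nhdsGT hy.1] with x hx
    have h1 := h.snd_le hx.1 hx.2 (hmem hy).2
      (fun t ht => hΨB t ⟨hx.1.trans_le ht.1, ht.2.trans hy.2⟩)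
    have h2 : √(y - x) ≤ √y := sqrt_le_sqrt (by linarith [hx.1])
    have h3 : √(y - x) * √A ≤ √y * √A := by gcongr
    have h4 : C * (0 * (y - x) + 2 * B * (√y - √x)) ≤ 2 * C * B * √y := by
      have : 0 ≤ C * B * √x := by positivity
      nlinarith
    rw [hβ]
    linarith
  have hvar : ∀ x ∈ Ioc 0 s₀, ∀ y ∈ Ioc 0 s₀, x ≤ y →
      |‖Ψ y‖ - ‖Ψ x‖| ≤ 2 * C * β * (√y - √x) := by
    intro x hx y hy hxy
    have := h.fst_variation hx.1 hxy (hmem hy).2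
      (fun t ht => hzle t ⟨hx.1.trans_le ht.1, ht.2.trans hy.2⟩)
    linarith
  refine ⟨hz, ?_, s₀, hs₀, ‖Ψ s₀‖ + 2 * C * β * √s₀, fun s hs => ?_⟩
  · have hmono : MonotoneOn (fun s => ‖Ψ s‖ + 2 * C * β * √s) (Ioo 0 s₀) := by
      intro x hx y hy hxy
      have := (abs_le.1 (hvar x ⟨hx.1, hx.2.le⟩ y ⟨hy.1, hy.2.le⟩ hxy)).1
      simp only
      linarith
    have hbdd : BddBelow ((fun s => ‖Ψ s‖ + 2 * C * β * √s) '' Ioo 0 s₀) := by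
      refine ⟨0, ?_⟩
      rintro _ ⟨s, _, rfl⟩
      simp only
      positivity
    have hl := hmono.tendsto_nhdsWithin_Ioo_right (nonempty_Ioo.2 hs₀.1) hbdd
    refine ⟨_, (hl.sub (hsqrt.const_mul (2 * C * β))).congr fun s => ?_⟩
    simp
  · have := (abs_le.1 (hvar s hs s₀ ⟨hs₀.1, le_rfl⟩ hs.2)).1
    have : 0 ≤ 2 * C * β * √s := by positivity
    linarith

/-- The outgoing combination is small near the endpoint. -/
theorem snd_le_of_bound {y X : ℝ} (hy : y ∈ Ioo 0 T) (hz : Tendsto z (𝓝[>] 0) (𝓝 0))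
    (hX : ∀ t ∈ Ioc 0 y, ‖Ψ t‖ ≤ X) : ‖z y‖ ≤ C * X * y + √A * √y := by
  have hC := h.C_nonneg (hy.1.trans hy.2)
  have hX0 : 0 ≤ X := (norm_nonneg _).trans (hX y ⟨hy.1, le_rfl⟩)
  have hl : Tendsto (fun x => ‖z x‖ + (C * X * y + √A * √y)) (𝓝[>] 0)
      (𝓝 (0 + (C * X * y + √A * √y))) := by
    have := hz.norm
    rw [norm_zero] at this
    exact this.add_const _
  rw [zero_add] at hl
  refine ge_of_tendsto hl ?_
  filter_upwards [Ioc_mem_nhdsGT hy.1] with x hx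
  have h1 := h.snd_le (X := X) (Y := 0) hx.1 hx.2 hy.2
    (fun t ht => by simpa using hX t ⟨hx.1.trans_le ht.1, ht.2⟩)
  have h2 : √(y - x) ≤ √y := sqrt_le_sqrt (by linarith [hx.1])
  have h3 : √(y - x) * √A ≤ √y * √A := by gcongr
  have h4 : 0 ≤ C * X * x := by have := hx.1; positivity
  linarith

/-- On a short interval `(0, y₀]` the modulus `|Ψ|` is nearly constant, up to the source. -/
theorem fst_le_of_limit {y₀ X ν : ℝ} (hy₀ : y₀ ∈ Ioo 0 T) (hsmall : C ^ 2 * y₀ ≤ 1 / 2)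
    (hz : Tendsto z (𝓝[>] 0) (𝓝 0)) (hν : Tendsto (fun s => ‖Ψ s‖) (𝓝[>] 0) (𝓝 ν))
    (hX : ∀ t ∈ Ioc 0 y₀, ‖Ψ t‖ ≤ X) : ∀ t ∈ Ioc 0 y₀,
      ‖Ψ t‖ ≤ 2 * (‖Ψ y₀‖ + 2 * C * √A * √y₀) ∧ ‖Ψ t‖ ≤ 2 * (ν + 2 * C * √A * √y₀) := by
  have hC := h.C_nonneg (hy₀.1.trans hy₀.2)
  -- the smallest bound
  set Z := sSup ((fun s => ‖Ψ s‖) '' Ioc 0 y₀)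
  have hbdd : BddAbove ((fun s => ‖Ψ s‖) '' Ioc 0 y₀) := by
    refine ⟨X, ?_⟩
    rintro _ ⟨t, ht, rfl⟩
    exact hX t ht
  have hne : ((fun s => ‖Ψ s‖) '' Ioc 0 y₀).Nonempty := ⟨_, y₀, ⟨hy₀.1, le_rfl⟩, rfl⟩
  have hZle : ∀ t ∈ Ioc 0 y₀, ‖Ψ t‖ ≤ Z := fun t ht => le_csSup hbdd ⟨t, ht, rfl⟩
  have hZ0 : 0 ≤ Z := (norm_nonneg _).trans (hZle y₀ ⟨hy₀.1, le_rfl⟩)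
  have hvar : ∀ x ∈ Ioc 0 y₀, ∀ y ∈ Ioc 0 y₀, x ≤ y →
      |‖Ψ y‖ - ‖Ψ x‖| ≤ Z / 2 + 2 * C * √A * √y₀ := by
    intro x hx y hy hxy
    have h1 := h.fst_variation (α := C * Z) (β := √A) hx.1 hxy (hy.2.trans_lt hy₀.2)
      (fun t ht => by
        have ht' : t ∈ Ioc 0 y₀ := ⟨hx.1.trans_le ht.1, ht.2.trans hy.2⟩
        exact h.snd_le_of_bound ⟨ht'.1, ht'.2.trans_lt hy₀.2⟩ hz
          (fun u hu => hZle u ⟨hu.1, hu.2.trans ht'.2⟩))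
    have h2 : √y - √x ≤ √y₀ := by
      have := sqrt_le_sqrt hy.2
      have := sqrt_nonneg x
      linarith
    have h3 : C * (C * Z * (y - x)) ≤ Z / 2 := by
      have : y - x ≤ y₀ := by linarith [hx.1, hy.2]
      have e : C * (C * Z * (y - x)) = C ^ 2 * (y - x) * Z := by ring
      have : C ^ 2 * (y - x) ≤ C ^ 2 * y₀ := by gcongr
      rw [e]; nlinarith
    have h4 : C * (2 * √A * (√y - √x)) ≤ 2 * C * √A * √y₀ := by
      have : C * (2 * √A * (√y - √x)) = 2 * C * √A * (√y - √x) := by ring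
      rw [this]; gcongr
    linarith
  have hν' : ∀ y ∈ Ioc 0 y₀, |‖Ψ y‖ - ν| ≤ Z / 2 + 2 * C * √A * √y₀ := by
    intro y hy
    have hl : Tendsto (fun x => |‖Ψ y‖ - ‖Ψ x‖|) (𝓝[>] 0) (𝓝 |‖Ψ y‖ - ν|) :=
      (hν.const_sub _).abs
    refine le_of_tendsto hl ?_
    filter_upwards [Ioc_mem_nhdsGT hy.1] with x hx
    exact hvar x ⟨hx.1, hx.2.trans hy.2⟩ y hy hx.2
  have b1 : Z ≤ ‖Ψ y₀‖ + (Z / 2 + 2 * C * √A * √y₀) := by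
    refine csSup_le hne ?_
    rintro _ ⟨t, ht, rfl⟩
    have := (abs_le.1 (hvar t ht y₀ ⟨hy₀.1, le_rfl⟩ ht.2)).1
    simp only
    linarith
  have b2 : Z ≤ ν + (Z / 2 + 2 * C * √A * √y₀) := by
    refine csSup_le hne ?_
    rintro _ ⟨t, ht, rfl⟩
    have := (abs_le.1 (hν' t ht)).2
    simp only
    linarith
  intro t ht
  have := hZle t ht
  constructor <;> linarith

end EndSystem

/-! ### The radial system -/

/-- `K = ω(r² + a²) - aΞm`; its values at the horizons decide superradiance. -/
noncomputable def carterK (a l ω m r : ℝ) : ℝ := ω * (r ^ 2 + a ^ 2) - a * Xi a l * m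

/-- `G = K² - Δ(L + μ²(r² + a²))`, which equals `(r² + a²)²(ω² - V₀ - V_μ)`. -/
noncomputable def radialG (a M l musq ω m L r : ℝ) : ℝ :=
  carterK a l ω m r ^ 2 - Delta a M l r * (L + musq * (r ^ 2 + a ^ 2))

theorem hasDerivAt_carterK (a l ω m r : ℝ) : HasDerivAt (carterK a l ω m) (2 * ω * r) r := by
  have h := ((((hasDerivAt_id r).pow 2).add_const (a ^ 2)).const_mul ω).sub_const (a * Xi a l * m)
  refine h.congr_deriv ?_
  simp; ring

@[fun_prop] theorem continuous_carterK (a l ω m : ℝ) : Continuous (carterK a l ω m) :=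
  continuous_iff_continuousAt.2 fun r => (hasDerivAt_carterK a l ω m r).continuousAt

@[fun_prop] theorem continuous_radialG (a M l musq ω m L : ℝ) :
    Continuous (radialG a M l musq ω m L) := by
  unfold radialG; fun_prop

/-- The radial equation as a first-order system in `r` for `Ψ = u / √(r² + a²)` and `w = Δ Ψ_r`,
with source `F = (r² + a²)^{3/2} H / Δ`. -/
structure RadialEq (a M l musq ω m L p q : ℝ) (Ψ w F : ℝ → ℂ) : Prop where
  deriv_fst : ∀ r ∈ Ioo p q, HasDerivAt Ψ (((1 / Delta a M l r : ℝ) : ℂ) * w r) r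
  deriv_snd : ∀ r ∈ Ioo p q, HasDerivAt w
    (F r - ((radialG a M l musq ω m L r / Delta a M l r : ℝ) : ℂ) * Ψ r) r
  cont_F : ContinuousOn F (Ioo p q)
  source_integrable : IntegrableOn (fun r => ‖F r‖ ^ 2) (Ioo p q)

/-- A solution of the radial system that is bounded and satisfies the outgoing conditions at both
horizons; `P` and `Q` are the boundary values of `|Ψ|²`. -/
structure RadialSolution (a M l musq ω m L p q : ℝ) (Ψ w F : ℝ → ℂ) (P Q : ℝ) : Prop
    extends RadialEq a M l musq ω m L p q Ψ w F where
  lim_left : Tendsto (fun r => ‖Ψ r‖ ^ 2) (𝓝[>] p) (𝓝 P)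
  lim_right : Tendsto (fun r => ‖Ψ r‖ ^ 2) (𝓝[<] q) (𝓝 Q)
  in_left : Tendsto (fun r => w r + I * carterK a l ω m r * Ψ r) (𝓝[>] p) (𝓝 0)
  out_right : Tendsto (fun r => w r - I * carterK a l ω m r * Ψ r) (𝓝[<] q) (𝓝 0)
  bounded : ∃ X, ∀ r ∈ Ioo p q, ‖Ψ r‖ ≤ X ∧ ‖w r‖ ≤ X

theorem Horizons.exists_Delta_le {a M l p q s : ℝ} (h : Horizons a M l p q s) :
    ∃ D > 0, ∀ r ∈ Icc p q, Delta a M l r ≤ D * ((r - p) * (q - r)) := by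
  have := h.s_nonneg; have := h.s_lt; have := h.p_lt; have := h.l_pos
  have := h.p_pos
  have hq := h.q_pos
  refine ⟨(q + (s + p + q)) * q / l ^ 2, by positivity, fun r hr => ?_⟩
  rw [h.factor]
  have e : (r + (s + p + q)) * (r - s) * (r - p) * (q - r) / l ^ 2
    = (r + (s + p + q)) * (r - s) / l ^ 2 * ((r - p) * (q - r)) := by ring
  rw [e]
  refine mul_le_mul_of_nonneg_right ?_ (mul_nonneg (by linarith [hr.1]) (by linarith [hr.2]))
  refine div_le_div_of_nonneg_right ?_ (by positivity)
  exact mul_le_mul (by linarith [hr.2]) (by linarith [hr.2]) (by linarith [hr.1])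
    (by linarith [hr.1])

/-- Near each horizon `1/Δ` is at most a constant over the distance. -/
theorem Horizons.exists_inv_Delta_le {a M l p q s : ℝ} (h : Horizons a M l p q s) :
    ∃ C > 0, ∀ t ∈ Ioo 0 ((q - p) / 2), 1 / Delta a M l (p + t) ≤ C / t ∧
      1 / Delta a M l (q - t) ≤ C / t := by
  obtain ⟨c, hc, hΔ⟩ := h.exists_le_Delta
  have hpq := h.p_lt
  have hw : 0 < q - p := by linarith
  refine ⟨2 / (c * (q - p)), by positivity, fun t ht => ?_⟩
  obtain ⟨h1, h2⟩ := ht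
  have e : 2 / (c * (q - p)) / t = 1 / (c * (t * ((q - p) / 2))) := by field_simp
  rw [e]
  constructor
  · refine one_div_le_one_div_of_le (by positivity) ((hΔ (p + t) ⟨by linarith, by linarith⟩).trans' ?_)
    have : (q - p) / 2 ≤ q - (p + t) := by linarith
    rw [add_sub_cancel_left]; gcongr
  · refine one_div_le_one_div_of_le (by positivity) ((hΔ (q - t) ⟨by linarith, by linarith⟩).trans' ?_)
    have : (q - p) / 2 ≤ q - t - p := by linarith
    rw [sub_sub_cancel, mul_comm t]; gcongr

namespace RadialEq

variable {a M l musq ω m L p q s : ℝ} {Ψ w F : ℝ → ℂ}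

theorem sourceIntervalIntegrable (h : RadialEq a M l musq ω m L p q Ψ w F) (hpq : p ≤ q) :
    IntervalIntegrable (fun r => ‖F r‖ ^ 2) volume p q :=
  (intervalIntegrable_iff_integrableOn_Ioo_of_le hpq).2 h.source_integrable

theorem norm_coeff_le {C q t : ℝ} (hmu : 0 ≤ musq) (hL : |L| + musq * (q ^ 2 + a ^ 2) + 2 * |ω| * q ≤ C)
    (ht : t ∈ Icc 0 q) (ε ε' : ℝ) (hε : |ε| = 1) (hε' : |ε'| = 1) :
    ‖((ε * (L + musq * (t ^ 2 + a ^ 2)) : ℝ) : ℂ) + I * (ε' * (2 * ω * t) : ℝ)‖ ≤ C := by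
  refine (norm_add_le _ _).trans (le_trans ?_ hL)
  rw [norm_mul, norm_I, one_mul, norm_real, norm_real, norm_eq_abs,
    norm_eq_abs, abs_mul, abs_mul ε', hε, hε', one_mul, one_mul]
  have h1 : |L + musq * (t ^ 2 + a ^ 2)| ≤ |L| + musq * (q ^ 2 + a ^ 2) := by
    refine (abs_add_le _ _).trans ?_
    rw [abs_of_nonneg (by positivity : 0 ≤ musq * (t ^ 2 + a ^ 2))]
    have : t ^ 2 ≤ q ^ 2 := pow_le_pow_left₀ ht.1 ht.2 2
    gcongr
  have h2 : |2 * ω * t| ≤ 2 * |ω| * q := by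
    rw [abs_mul, abs_mul, abs_two, abs_of_nonneg ht.1]
    have := ht.2
    gcongr
  linarith

theorem endSystem_left (hh : Horizons a M l p q s) (h : RadialEq a M l musq ω m L p q Ψ w F)
    (hmu : 0 ≤ musq) {C : ℝ}
    (hC : ∀ t ∈ Ioo 0 ((q - p) / 2), 1 / Delta a M l (p + t) ≤ C / t ∧
      1 / Delta a M l (q - t) ≤ C / t)
    (hL : |L| + musq * (q ^ 2 + a ^ 2) + 2 * |ω| * q ≤ C) :
    EndSystem ((q - p) / 2) C (∫ r in p..q, ‖F r‖ ^ 2)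
      (fun t => carterK a l ω m (p + t) / Delta a M l (p + t)) (fun t => 1 / Delta a M l (p + t))
      (fun t => ((1 * (L + musq * ((p + t) ^ 2 + a ^ 2)) : ℝ) : ℂ)
        + I * (1 * (2 * ω * (p + t)) : ℝ))
      (fun t => Ψ (p + t))
      (fun t => w (p + t) + I * carterK a l ω m (p + t) * Ψ (p + t))
      (fun t => F (p + t)) := by
  have hpq := hh.p_lt
  have hp := hh.p_pos
  have hmem : ∀ {t}, t ∈ Ioo 0 ((q - p) / 2) → p + t ∈ Ioo p q := fun ht =>
    ⟨by linarith [ht.1], by linarith [ht.2]⟩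
  have hΔ : ∀ {t}, t ∈ Ioo 0 ((q - p) / 2) → Delta a M l (p + t) ≠ 0 := fun ht =>
    (hh.Delta_pos (hmem ht)).ne'
  have hi := h.sourceIntervalIntegrable hpq.le
  have hi1 : IntervalIntegrable (fun r => ‖F r‖ ^ 2) volume p (p + (q - p) / 2) :=
    hi.mono_set (by rw [uIcc_of_le (by linarith), uIcc_of_le hpq.le]
                    exact Icc_subset_Icc le_rfl (by linarith))
  refine ⟨?_, ?_, ?_, ?_, ?_, ?_, ?_, ?_, ?_, ?_⟩
  · intro t ht
    refine ((h.deriv_fst _ (hmem ht)).comp_const_add p t).congr_deriv ?_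
    push_cast
    ring
  · intro t ht
    have hd1 := (h.deriv_fst _ (hmem ht)).comp_const_add p t
    have hd2 := (h.deriv_snd _ (hmem ht)).comp_const_add p t
    have hd3 := ((hasDerivAt_carterK a l ω m (p + t)).comp_const_add p t).ofReal_comp
    refine (hd2.add ((hd3.const_mul I).mul hd1)).congr_deriv ?_
    have hne : (Delta a M l (p + t) : ℂ) ≠ 0 := by exact_mod_cast hΔ ht
    unfold radialG
    push_cast
    field_simp
    linear_combination (-(carterK a l ω m (p + t) : ℂ) ^ 2 * Ψ (p + t)) * I_sq
  · exact ContinuousOn.div (by fun_prop) (by fun_prop) fun t ht => hΔ ht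
  · exact ContinuousOn.div (by fun_prop) (by fun_prop) fun t ht => hΔ ht
  · fun_prop
  · exact h.cont_F.comp (by fun_prop) fun t ht => hmem ht
  · intro t ht
    rw [abs_of_pos (one_div_pos.2 (hh.Delta_pos (hmem ht)))]
    exact (hC t ht).1
  · intro t ht
    exact norm_coeff_le hmu hL ⟨by linarith [ht.1], by linarith [ht.2]⟩ 1 1 (by simp) (by simp)
  · rw [← intervalIntegrable_iff_integrableOn_Ioo_of_le (by linarith)]
    have := hi1.comp_add_left p
    simpa using this
  · rw [← integral_Ioc_eq_integral_Ioo, ← intervalIntegral.integral_of_le (by linarith),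
      intervalIntegral.integral_comp_add_left (fun r => ‖F r‖ ^ 2), add_zero]
    exact intervalIntegral.integral_mono_interval le_rfl (by linarith) (by linarith)
      (.of_forall fun _ => by positivity) hi

theorem endSystem_right (hh : Horizons a M l p q s) (h : RadialEq a M l musq ω m L p q Ψ w F)
    (hmu : 0 ≤ musq) {C : ℝ}
    (hC : ∀ t ∈ Ioo 0 ((q - p) / 2), 1 / Delta a M l (p + t) ≤ C / t ∧
      1 / Delta a M l (q - t) ≤ C / t)
    (hL : |L| + musq * (q ^ 2 + a ^ 2) + 2 * |ω| * q ≤ C) :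
    EndSystem ((q - p) / 2) C (∫ r in p..q, ‖F r‖ ^ 2)
      (fun t => carterK a l ω m (q - t) / Delta a M l (q - t)) (fun t => -(1 / Delta a M l (q - t)))
      (fun t => ((-1 * (L + musq * ((q - t) ^ 2 + a ^ 2)) : ℝ) : ℂ)
        + I * (1 * (2 * ω * (q - t)) : ℝ))
      (fun t => Ψ (q - t))
      (fun t => w (q - t) - I * carterK a l ω m (q - t) * Ψ (q - t))
      (fun t => -F (q - t)) := by
  have hpq := hh.p_lt
  have hp := hh.p_pos
  have hmem : ∀ {t}, t ∈ Ioo 0 ((q - p) / 2) → q - t ∈ Ioo p q := fun ht =>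
    ⟨by linarith [ht.2], by linarith [ht.1]⟩
  have hΔ : ∀ {t}, t ∈ Ioo 0 ((q - p) / 2) → Delta a M l (q - t) ≠ 0 := fun ht =>
    (hh.Delta_pos (hmem ht)).ne'
  have hi := h.sourceIntervalIntegrable hpq.le
  have hi1 : IntervalIntegrable (fun r => ‖F r‖ ^ 2) volume (q - (q - p) / 2) q :=
    hi.mono_set (by rw [uIcc_of_le (by linarith), uIcc_of_le hpq.le]
                    exact Icc_subset_Icc (by linarith) le_rfl)
  refine ⟨?_, ?_, ?_, ?_, ?_, ?_, ?_, ?_, ?_, ?_⟩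
  · intro t ht
    refine ((h.deriv_fst _ (hmem ht)).comp_const_sub q t).congr_deriv ?_
    push_cast
    ring
  · intro t ht
    have hd1 := (h.deriv_fst _ (hmem ht)).comp_const_sub q t
    have hd2 := (h.deriv_snd _ (hmem ht)).comp_const_sub q t
    have hd3 := ((hasDerivAt_carterK a l ω m (q - t)).comp_const_sub q t).ofReal_comp
    refine (hd2.sub ((hd3.const_mul I).mul hd1)).congr_deriv ?_
    have hne : (Delta a M l (q - t) : ℂ) ≠ 0 := by exact_mod_cast hΔ ht
    unfold radialG
    push_cast
    field_simp
    linear_combination ((carterK a l ω m (q - t) : ℂ) ^ 2 * Ψ (q - t)) * I_sq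
  · exact ContinuousOn.div (by fun_prop) (by fun_prop) fun t ht => hΔ ht
  · exact (ContinuousOn.div (by fun_prop) (by fun_prop) fun t ht => hΔ ht).neg
  · fun_prop
  · exact (h.cont_F.comp (by fun_prop) fun t ht => hmem ht).neg
  · intro t ht
    rw [abs_neg, abs_of_pos (one_div_pos.2 (hh.Delta_pos (hmem ht)))]
    exact (hC t ht).2
  · intro t ht
    exact norm_coeff_le hmu hL ⟨by linarith [ht.2], by linarith [ht.1]⟩ (-1) 1 (by simp) (by simp)
  · rw [← intervalIntegrable_iff_integrableOn_Ioo_of_le (by linarith)]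
    have := (hi1.comp_sub_left q).symm
    simpa using this
  · simp only [norm_neg]
    rw [← integral_Ioc_eq_integral_Ioo, ← intervalIntegral.integral_of_le (by linarith),
      intervalIntegral.integral_comp_sub_left (fun r => ‖F r‖ ^ 2), sub_zero]
    exact intervalIntegral.integral_mono_interval (by linarith) (by linarith) le_rfl
      (.of_forall fun _ => by positivity) hi

end RadialEq

section

theorem measurable_starDensity (a M l : ℝ) :
    Measurable fun r => ENNReal.ofReal ((r ^ 2 + a ^ 2) / Delta a M l r) :=
  ENNReal.measurable_ofReal.comp
    (Measurable.div (by fun_prop) (continuous_Delta a M l).measurable)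

theorem integrable_starMeasure_iff {a M l p q s : ℝ} (h : Horizons a M l p q s)
    (hp : rPlus a M l = p) (hq : rCosmo a M l = q) {g : ℝ → ℝ} :
    Integrable g (starMeasure a M l) ↔
      IntegrableOn (fun r => (r ^ 2 + a ^ 2) / Delta a M l r * g r) (Ioo p q) := by
  unfold starMeasure
  rw [integrable_withDensity_iff (measurable_starDensity a M l)
    (.of_forall fun _ => ENNReal.ofReal_lt_top), hp, hq]
  refine integrableOn_congr_fun (fun r hr => ?_) measurableSet_Ioo
  have := h.Delta_pos hr
  rw [ENNReal.toReal_ofReal (by positivity), mul_comm]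

theorem setIntegral_starMeasure {a M l p q s : ℝ} (h : Horizons a M l p q s)
    (hp : rPlus a M l = p) (hq : rCosmo a M l = q) (g : ℝ → ℝ) {S : Set ℝ} (hS : MeasurableSet S)
    (hsub : S ⊆ Ioo p q) :
    ∫ r in S, g r ∂(starMeasure a M l) = ∫ r in S, (r ^ 2 + a ^ 2) / Delta a M l r * g r := by
  unfold starMeasure
  rw [setIntegral_withDensity_eq_setIntegral_toReal_smul (measurable_starDensity a M l)
    (.of_forall fun _ => ENNReal.ofReal_lt_top) _ hS, hp, hq,
    Measure.restrict_restrict hS, inter_eq_left.2 hsub]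
  refine setIntegral_congr_fun hS (fun r hr => ?_)
  have := h.Delta_pos (hsub hr)
  simp only [smul_eq_mul]
  rw [ENNReal.toReal_ofReal (by positivity)]

theorem integral_starMeasure {a M l p q s : ℝ} (h : Horizons a M l p q s)
    (hp : rPlus a M l = p) (hq : rCosmo a M l = q) (g : ℝ → ℝ) :
    ∫ r, g r ∂(starMeasure a M l) = ∫ r in Ioo p q, (r ^ 2 + a ^ 2) / Delta a M l r * g r := by
  rw [← setIntegral_starMeasure h hp hq g measurableSet_Ioo Subset.rfl]
  congr 1
  unfold starMeasure
  rw [hp, hq, restrict_withDensity measurableSet_Ioo, Measure.restrict_restrict measurableSet_Ioo,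
    inter_self]

/-- `√(r² + a²)`. -/
noncomputable def rho (a r : ℝ) : ℝ := √(r ^ 2 + a ^ 2)

theorem rho_sq (a r : ℝ) : rho a r ^ 2 = r ^ 2 + a ^ 2 := sq_sqrt (by positivity)

theorem rho_pos {a r : ℝ} (hr : 0 < r) : 0 < rho a r := sqrt_pos.2 (by positivity)

theorem hasDerivAt_rho {a r : ℝ} (hr : 0 < r) : HasDerivAt (rho a) (r / rho a r) r := by
  have h := (((hasDerivAt_id r).pow 2).add_const (a ^ 2)).sqrt
    (by have : 0 < r ^ 2 + a ^ 2 := by positivity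
        simpa using this.ne')
  refine h.congr_deriv ?_
  have := rho_pos (a := a) hr
  simp [rho] at this ⊢
  field_simp

/-- The radial momentum `w = ΔΨ_r` in terms of `u`. -/
noncomputable def radialMomentum (a M l : ℝ) (u : ℝ → ℂ) (r : ℝ) : ℂ :=
  rho a r * starDeriv a M l u r - ((Delta a M l r * r / rho a r ^ 3 : ℝ) : ℂ) * u r

/-- The source `F = (r² + a²)^{3/2} H / Δ` of the first-order system. -/
noncomputable def radialSource (a M l : ℝ) (H : ℝ → ℂ) (r : ℝ) : ℂ :=
  ((rho a r ^ 3 / Delta a M l r : ℝ) : ℂ) * H r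

theorem psi_eq (a : ℝ) (u : ℝ → ℂ) (r : ℝ) : psi a u r = ((1 / rho a r : ℝ) : ℂ) * u r := by
  unfold psi rho; push_cast; ring

variable {a M l musq ω Λ p q s : ℝ} {m : ℤ} {u H : ℝ → ℂ}

theorem hasDerivAt_psi (hh : Horizons a M l p q s) {r : ℝ} (hr : r ∈ Ioo p q)
    (hu : HasDerivAt u (deriv u r) r) :
    HasDerivAt (psi a u) (((1 / Delta a M l r : ℝ) : ℂ) * radialMomentum a M l u r) r := by
  have hr0 : 0 < r := hh.p_pos.trans hr.1
  have hρ := rho_pos (a := a) hr0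
  have hΔ := hh.Delta_pos hr
  have h1 := ((hasDerivAt_rho (a := a) hr0).inv hρ.ne').ofReal_comp.mul hu
  have h2 : psi a u = fun y => (((rho a)⁻¹ y : ℝ) : ℂ) * u y := by
    funext y; rw [psi_eq, one_div]; rfl
  rw [h2]
  refine h1.congr_deriv ?_
  unfold radialMomentum starDeriv
  rw [← rho_sq]
  have hρ' : (rho a r : ℂ) ≠ 0 := by exact_mod_cast hρ.ne'
  have hΔ' : (Delta a M l r : ℂ) ≠ 0 := by exact_mod_cast hΔ.ne'
  simp only [Pi.inv_apply]
  push_cast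
  field_simp
  ring

/-- Carter's equation in first-order form. -/
theorem IsOutgoingSolution.radialEq (hh : Horizons a M l p q s) (hp : rPlus a M l = p)
    (hq : rCosmo a M l = q) (hu : IsOutgoingSolution a M l musq ω m Λ u H)
    (hH : Integrable (fun r => ‖H r‖ ^ 2 / Delta a M l r) (starMeasure a M l)) :
    RadialEq a M l musq ω m (shiftedEigenvalue a l (a * ω) m Λ) p q (psi a u)
      (radialMomentum a M l u) (radialSource a M l H) := by
  have hsm := hu.smooth
  have hode := hu.ode
  rw [hp, hq] at hsm hode
  have hpos : ∀ {r}, r ∈ Ioo p q → 0 < r := fun hr => hh.p_pos.trans hr.1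
  have hud : ∀ r ∈ Ioo p q, HasDerivAt u (deriv u r) r := fun r hr =>
    ((hsm.differentiableOn (by simp)).differentiableAt (isOpen_Ioo.mem_nhds hr)).hasDerivAt
  have hu1 : ContDiffOn ℝ ((⊤ : ℕ∞) : WithTop ℕ∞) (deriv u) (Ioo p q) :=
    hsm.deriv_of_isOpen isOpen_Ioo (by simp)
  have hcoef : ContDiffOn ℝ ((⊤ : ℕ∞) : WithTop ℕ∞)
      (fun r => ((Delta a M l r / (r ^ 2 + a ^ 2) : ℝ) : ℂ)) (Ioo p q) := by
    refine Complex.ofRealCLM.contDiff.comp_contDiffOn (ContDiffOn.div ?_ ?_ ?_)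
    · unfold Delta; fun_prop
    · fun_prop
    · intro r hr; have := hpos hr; positivity
  have hv : ContDiffOn ℝ ((⊤ : ℕ∞) : WithTop ℕ∞) (starDeriv a M l u) (Ioo p q) := hcoef.mul hu1
  have hvd : ∀ r ∈ Ioo p q, HasDerivAt (starDeriv a M l u) (deriv (starDeriv a M l u) r) r :=
    fun r hr =>
    ((hv.differentiableOn (by simp)).differentiableAt (isOpen_Ioo.mem_nhds hr)).hasDerivAt
  have hv1 : ContinuousOn (starDeriv a M l (starDeriv a M l u)) (Ioo p q) :=
    hcoef.continuousOn.mul (hv.deriv_of_isOpen isOpen_Ioo (m := ((⊤ : ℕ∞) : WithTop ℕ∞))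
      (by simp)).continuousOn
  have hpot : ContinuousOn (potential a M l musq ω m Λ) (Ioo p q) := by
    unfold potential potentialSL potentialZero
    have hc := (continuous_Delta a M l).continuousOn (s := Ioo p q)
    have hne : ∀ n : ℕ, ∀ r ∈ Ioo p q, (r ^ 2 + a ^ 2) ^ n ≠ 0 := fun n r hr => by
      have := hpos hr; positivity
    refine ((((hc.pow 2).neg.mul (ContinuousOn.div (by fun_prop) (by fun_prop) (hne 4))).add
      (hc.mul (ContinuousOn.div (by fun_prop) (by fun_prop) (hne 3)))).add
      (ContinuousOn.div (by fun_prop) (by fun_prop) (hne 2))).add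
      (continuousOn_const.mul (hc.div (by fun_prop) fun r hr => by simpa using hne 1 r hr))
  have hHc : ContinuousOn H (Ioo p q) := by
    refine ContinuousOn.congr (f := fun r => starDeriv a M l (starDeriv a M l u) r
      + ((ω ^ 2 - potential a M l musq ω m Λ r : ℝ) : ℂ) * u r) ?_ fun r hr => (hode r hr).symm
    exact hv1.add ((Complex.continuous_ofReal.comp_continuousOn
      (continuousOn_const.sub hpot)).mul hsm.continuousOn)
  have hρc : ContinuousOn (rho a) (Ioo p q) := fun r hr =>
    (hasDerivAt_rho (hpos hr)).continuousAt.continuousWithinAt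
  refine ⟨fun r hr => hasDerivAt_psi hh hr (hud r hr), fun r hr => ?_, ?_, ?_⟩
  · have hr0 := hpos hr
    have hρ := rho_pos (a := a) hr0
    have hΔ := hh.Delta_pos hr
    have dρ := hasDerivAt_rho (a := a) hr0
    have hc := (((hasDerivAt_Delta a M l r).mul (hasDerivAt_id r)).div (dρ.pow 3)
      (pow_ne_zero 3 hρ.ne'))
    have h1 := (dρ.ofReal_comp.mul (hvd r hr)).sub (hc.ofReal_comp.mul (hud r hr))
    refine h1.congr_deriv ?_
    have hρ' : (rho a r : ℂ) ≠ 0 := by exact_mod_cast hρ.ne'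
    have hΔ' : (Delta a M l r : ℂ) ≠ 0 := by exact_mod_cast hΔ.ne'
    have e1 : starDeriv a M l u r = ((Delta a M l r / (r ^ 2 + a ^ 2) : ℝ) : ℂ) * deriv u r := rfl
    have e2 := hode r hr
    have e3 : starDeriv a M l (starDeriv a M l u) r
      = ((Delta a M l r / (r ^ 2 + a ^ 2) : ℝ) : ℂ) * deriv (starDeriv a M l u) r := rfl
    rw [e3] at e2
    -- the identity `(√(r²+a²))'' = V_SL √(r²+a²)` and the definition of `G`
    have key : rho a r ^ 4 * (ω ^ 2 - potential a M l musq ω m Λ r)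
        = radialG a M l musq ω m (shiftedEigenvalue a l (a * ω) m Λ) r
          - Delta a M l r * (DeltaD a M l r * r + Delta a M l r - 3 * Delta a M l r * r ^ 2
            / rho a r ^ 2) / rho a r ^ 2 := by
      have : 0 < r ^ 2 + a ^ 2 := by positivity
      unfold potential potentialSL potentialZero radialG carterK shiftedEigenvalue
      rw [show rho a r ^ 4 = (rho a r ^ 2) ^ 2 by ring, rho_sq]
      have e : DeltaD a M l r * r + Delta a M l r = -5 * (r ^ 4 / l ^ 2)
          + 3 * r ^ 2 * (1 - a ^ 2 / l ^ 2) - 4 * M * r + a ^ 2 := by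
        unfold DeltaD Delta; ring
      rw [e]
      generalize Delta a M l r = D
      field_simp
      ring
    have key' : radialG a M l musq ω m (shiftedEigenvalue a l (a * ω) m Λ) r
        = rho a r ^ 4 * (ω ^ 2 - potential a M l musq ω m Λ r)
          + Delta a M l r * (DeltaD a M l r * r + Delta a M l r - 3 * Delta a M l r * r ^ 2
            / rho a r ^ 2) / rho a r ^ 2 := by linarith
    rw [psi_eq, key']
    unfold radialSource
    rw [← e2, e1, ← rho_sq]
    simp only [Pi.mul_apply, Pi.pow_apply, Pi.div_apply, id]
    generalize deriv (starDeriv a M l u) r = v1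
    generalize ω ^ 2 - potential a M l musq ω m Λ r = W
    generalize deriv u r = ud
    generalize u r = ur
    generalize DeltaD a M l r = D1
    generalize Delta a M l r = D at *
    generalize rho a r = ρ at *
    push_cast
    field_simp
    ring
  · refine ContinuousOn.mul ?_ hHc
    exact Complex.continuous_ofReal.comp_continuousOn ((hρc.pow 3).div (by fun_prop)
      fun r hr => (hh.Delta_pos hr).ne')
  · rw [integrable_starMeasure_iff hh hp hq] at hH
    obtain ⟨B, hB⟩ : ∃ B : ℝ, ∀ r ∈ Ioo p q, rho a r ^ 4 ≤ B := by
      refine ⟨(q ^ 2 + a ^ 2) ^ 2, fun r hr => ?_⟩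
      rw [show rho a r ^ 4 = (rho a r ^ 2) ^ 2 by ring, rho_sq]
      have := hpos hr
      have h2 : r ^ 2 ≤ q ^ 2 := pow_le_pow_left₀ this.le hr.2.le 2
      gcongr
    refine (hH.const_mul B).mono' ?_ ?_
    · refine ContinuousOn.aestronglyMeasurable ?_ measurableSet_Ioo
      refine ContinuousOn.pow (ContinuousOn.norm (ContinuousOn.mul ?_ hHc)) 2
      exact Complex.continuous_ofReal.comp_continuousOn ((hρc.pow 3).div (by fun_prop)
        fun r hr => (hh.Delta_pos hr).ne')
    · refine (ae_restrict_iff' measurableSet_Ioo).2 (.of_forall fun r hr => ?_)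
      have hΔ := hh.Delta_pos hr
      have hr0 := hpos hr
      rw [norm_of_nonneg (by positivity)]
      have hρ := rho_pos (a := a) hr0
      unfold radialSource
      rw [norm_mul, norm_real, norm_of_nonneg (by positivity), ← rho_sq]
      have e : (rho a r ^ 3 / Delta a M l r * ‖H r‖) ^ 2
        = rho a r ^ 4 * (rho a r ^ 2 / Delta a M l r * (‖H r‖ ^ 2 / Delta a M l r)) := by
        field_simp
      rw [e]
      have := hB r hr
      gcongr

end

section

theorem tendsto_const_add_nhdsGT (p : ℝ) : Tendsto (fun t => p + t) (𝓝[>] 0) (𝓝[>] p) := by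
  refine tendsto_nhdsWithin_of_tendsto_nhds_of_eventually_within _ ?_ ?_
  · have : Tendsto (fun t : ℝ => p + t) (𝓝 0) (𝓝 (p + 0)) := by
      exact (continuous_const.add continuous_id).tendsto 0
    rw [add_zero] at this
    exact this.mono_left nhdsWithin_le_nhds
  · filter_upwards [self_mem_nhdsWithin] with t ht
    simpa using ht

theorem tendsto_const_sub_nhdsLT (q : ℝ) : Tendsto (fun t => q - t) (𝓝[>] 0) (𝓝[<] q) := by
  refine tendsto_nhdsWithin_of_tendsto_nhds_of_eventually_within _ ?_ ?_
  · have : Tendsto (fun t : ℝ => q - t) (𝓝 0) (𝓝 (q - 0)) := by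
      exact (continuous_const.sub continuous_id).tendsto 0
    rw [sub_zero] at this
    exact this.mono_left nhdsWithin_le_nhds
  · filter_upwards [self_mem_nhdsWithin] with t ht
    simpa using ht

theorem tendsto_sub_const_nhdsGT (p : ℝ) : Tendsto (fun r => r - p) (𝓝[>] p) (𝓝[>] 0) := by
  refine tendsto_nhdsWithin_of_tendsto_nhds_of_eventually_within _ ?_ ?_
  · have : Tendsto (fun t : ℝ => t - p) (𝓝 p) (𝓝 (p - p)) := by
      exact (continuous_id.sub continuous_const).tendsto p
    rw [sub_self] at this
    exact this.mono_left nhdsWithin_le_nhds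
  · filter_upwards [self_mem_nhdsWithin] with t ht
    simpa using ht

theorem tendsto_const_sub_nhdsGT (q : ℝ) : Tendsto (fun r => q - r) (𝓝[<] q) (𝓝[>] 0) := by
  refine tendsto_nhdsWithin_of_tendsto_nhds_of_eventually_within _ ?_ ?_
  · have : Tendsto (fun t : ℝ => q - t) (𝓝 q) (𝓝 (q - q)) := by
      exact (continuous_const.sub continuous_id).tendsto q
    rw [sub_self] at this
    exact this.mono_left nhdsWithin_le_nhds
  · filter_upwards [self_mem_nhdsWithin] with t ht
    simpa using ht

theorem exists_bound_of_ends {f : ℝ → ℂ} {p q X Y : ℝ} (hpq : p < q)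
    (hf : ContinuousOn f (Ioo p q)) (hp : ∀ᶠ r in 𝓝[>] p, ‖f r‖ ≤ X)
    (hq : ∀ᶠ r in 𝓝[<] q, ‖f r‖ ≤ Y) : ∃ Z, ∀ r ∈ Ioo p q, ‖f r‖ ≤ Z := by
  obtain ⟨x, hx, hx1⟩ := mem_nhdsGT_iff_exists_Ioo_subset.1 hp
  obtain ⟨y, hy, hy1⟩ := mem_nhdsLT_iff_exists_Ioo_subset.1 hq
  have hx' : p < x := hx
  have hy' : y < q := hy
  set x' := min x ((p + q) / 2)
  set y' := max y ((p + q) / 2)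
  have h1 : p < x' := lt_min hx' (by linarith)
  have h2 : y' < q := max_lt hy' (by linarith)
  obtain ⟨Z, hZ⟩ := isCompact_Icc.exists_bound_of_continuousOn
    (hf.mono (Icc_subset_Ioo h1 h2 : Icc x' y' ⊆ Ioo p q))
  refine ⟨max Z (max X Y), fun r hr => ?_⟩
  by_cases c1 : r < x'
  · have : r ∈ Ioo p x := ⟨hr.1, c1.trans_le (min_le_left _ _)⟩
    exact (hx1 this).trans ((le_max_left X Y).trans (le_max_right Z _))
  by_cases c2 : y' < r
  · have : r ∈ Ioo y q := ⟨(le_max_left _ _).trans_lt c2, hr.2⟩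
    exact (hy1 this).trans ((le_max_right X Y).trans (le_max_right Z _))
  push Not at c1 c2
  exact (hZ r ⟨c1, c2⟩).trans (le_max_left _ _)

variable {a M l musq ω Λ p q s : ℝ} {m : ℤ} {u H : ℝ → ℂ}

theorem rho_mul_psi {a r : ℝ} (hr : 0 < r) (u : ℝ → ℂ) : (rho a r : ℂ) * psi a u r = u r := by
  have : (rho a r : ℂ) ≠ 0 := by exact_mod_cast (rho_pos (a := a) hr).ne'
  rw [psi_eq]; push_cast; field_simp

/-- The difference between the outgoing conditions for `u` at `r₀` and for the first-order
system. -/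
noncomputable def endCorrection (a M l r₀ : ℝ) (m : ℤ) (ε r : ℝ) : ℂ :=
  ε * I * ((-(a * Xi a l * m * (r ^ 2 - r₀ ^ 2) / (r₀ ^ 2 + a ^ 2)) : ℝ) : ℂ)
    + ((Delta a M l r * r / rho a r ^ 2 : ℝ) : ℂ)

theorem outgoing_eq {r₀ r : ℝ} (hr₀ : 0 < r₀) (hr : 0 < r) (ε : ℝ) :
    (radialMomentum a M l u r + ε * I * carterK a l ω m r * psi a u r)
      + endCorrection a M l r₀ m ε r * psi a u r
      = rho a r * (starDeriv a M l u r
        + ε * I * ((ω - a * Xi a l / (r₀ ^ 2 + a ^ 2) * m : ℝ) : ℂ) * u r) := by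
  rw [← rho_mul_psi (a := a) hr u]
  unfold radialMomentum endCorrection carterK
  rw [← rho_mul_psi (a := a) hr u]
  have hρ' : (rho a r : ℂ) ≠ 0 := by exact_mod_cast (rho_pos (a := a) hr).ne'
  have h0 : (r₀ ^ 2 + a ^ 2 : ℂ) ≠ 0 := by
    have : 0 < r₀ ^ 2 + a ^ 2 := by positivity
    exact_mod_cast this.ne'
  have hsq : (a : ℂ) ^ 2 = rho a r ^ 2 - r ^ 2 := by
    have := rho_sq a r
    have h2 : (rho a r : ℂ) ^ 2 = r ^ 2 + a ^ 2 := by exact_mod_cast this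
    rw [h2]; ring
  push_cast
  generalize psi a u r = Ψ
  field_simp
  rw [hsq]
  ring

theorem norm_endCorrection_le (hh : Horizons a M l p q s) (m : ℤ) {r₀ ε : ℝ}
    (hr₀ : r₀ ∈ Icc p q) (hε : |ε| = 1) (hr : r₀ = p ∨ r₀ = q) :
    ∃ C, ∀ r ∈ Ioo p q, ‖endCorrection a M l r₀ m ε r‖ ≤ C * |r - r₀| := by
  obtain ⟨D, hD, hΔ⟩ := hh.exists_Delta_le
  have hp := hh.p_pos
  refine ⟨|a * Xi a l * m| * (2 * q) / (r₀ ^ 2 + a ^ 2) + D * (q - p) / p, fun r hr' => ?_⟩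
  have hr0 : 0 < r := hp.trans hr'.1
  have hr00 : 0 < r₀ := hh.pos_of_mem hr₀
  unfold endCorrection
  refine (norm_add_le _ _).trans ?_
  rw [add_mul]
  refine add_le_add ?_ ?_
  · rw [norm_mul, norm_mul, norm_I, norm_real, norm_real, norm_eq_abs,
      norm_eq_abs, hε, one_mul, one_mul, abs_neg, abs_div,
      abs_mul (a * Xi a l * m), abs_of_pos (by positivity : 0 < r₀ ^ 2 + a ^ 2)]
    have e : r ^ 2 - r₀ ^ 2 = (r + r₀) * (r - r₀) := by ring
    rw [e, abs_mul (r + r₀), abs_of_pos (by positivity : 0 < r + r₀)]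
    have h2 : r + r₀ ≤ 2 * q := by linarith [hr'.2, hr₀.2]
    have : |a * Xi a l * m| * ((r + r₀) * |r - r₀|) / (r₀ ^ 2 + a ^ 2)
      ≤ |a * Xi a l * m| * ((2 * q) * |r - r₀|) / (r₀ ^ 2 + a ^ 2) := by gcongr
    refine this.trans_eq ?_
    ring
  · have hΔr := hΔ r ⟨hr'.1.le, hr'.2.le⟩
    have hΔ0 := hh.Delta_pos hr'
    have hρ := rho_pos (a := a) hr0
    rw [norm_real, norm_of_nonneg (by positivity)]
    have h1 : (r - p) * (q - r) ≤ (q - p) * |r - r₀| := by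
      rcases hr with h | h
      · rw [h, abs_of_pos (by linarith [hr'.1]), mul_comm]
        exact mul_le_mul_of_nonneg_right (by linarith [hr'.1]) (by linarith [hr'.1])
      · rw [h, abs_sub_comm, abs_of_pos (by linarith [hr'.2])]
        exact mul_le_mul_of_nonneg_right (by linarith [hr'.2]) (by linarith [hr'.2])
    have h2 : Delta a M l r * r / rho a r ^ 2 ≤ Delta a M l r / p := by
      rw [div_le_div_iff₀ (by positivity) hp, rho_sq]
      have : r * p ≤ r ^ 2 + a ^ 2 := by nlinarith [hr'.1, sq_nonneg a]
      nlinarith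
    refine h2.trans ?_
    rw [div_mul_eq_mul_div]
    refine div_le_div_of_nonneg_right ?_ hp.le
    calc Delta a M l r ≤ D * ((r - p) * (q - r)) := hΔr
      _ ≤ D * ((q - p) * |r - r₀|) := by gcongr
      _ = D * (q - p) * |r - r₀| := by ring

/-- An outgoing solution of Carter's equation gives a bounded outgoing solution of the radial
system, with boundary values of `|Ψ|²` at both horizons. -/
theorem IsOutgoingSolution.exists_radialSolution (hh : Horizons a M l p q s)
    (hp : rPlus a M l = p) (hq : rCosmo a M l = q) (hmu : 0 ≤ musq)
    (hu : IsOutgoingSolution a M l musq ω m Λ u H)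
    (hH : Integrable (fun r => ‖H r‖ ^ 2 / Delta a M l r) (starMeasure a M l)) :
    ∃ P Q, RadialSolution a M l musq ω m (shiftedEigenvalue a l (a * ω) m Λ) p q (psi a u)
      (radialMomentum a M l u) (radialSource a M l H) P Q := by
  have he := hu.radialEq hh hp hq hH
  set Ψ := psi a u
  set w := radialMomentum a M l u
  set F := radialSource a M l H
  set L := shiftedEigenvalue a l (a * ω) m Λ
  have hpq := hh.p_lt
  have hp0 := hh.p_pos
  have hq0 := hh.q_pos
  set T := (q - p) / 2 with hT
  have hT0 : 0 < T := by rw [hT]; linarith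
  obtain ⟨C₁, _, hC₁⟩ := hh.exists_inv_Delta_le
  set C := max C₁ (|L| + musq * (q ^ 2 + a ^ 2) + 2 * |ω| * q)
  have hC : ∀ t ∈ Ioo 0 ((q - p) / 2), 1 / Delta a M l (p + t) ≤ C / t ∧
      1 / Delta a M l (q - t) ≤ C / t := by
    intro t ht
    have ht0 := ht.1
    have : C₁ / t ≤ C / t := by
      have : C₁ ≤ C := le_max_left _ _
      gcongr
    exact ⟨(hC₁ t ht).1.trans this, (hC₁ t ht).2.trans this⟩
  have hl := he.endSystem_left hh hmu hC (le_max_right _ _)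
  have hr := he.endSystem_right hh hmu hC (le_max_right _ _)
  obtain ⟨c1, hc1⟩ := norm_endCorrection_le hh m (left_mem_Icc.2 hpq.le) (ε := 1) (by simp)
    (Or.inl rfl)
  obtain ⟨c2, hc2⟩ := norm_endCorrection_le hh m (right_mem_Icc.2 hpq.le) (ε := -1) (by simp)
    (Or.inr rfl)
  have hρt : ∀ {r₀ : ℝ}, 0 < r₀ → Tendsto (fun r => (rho a r : ℂ)) (𝓝 r₀) (𝓝 (rho a r₀ : ℂ)) :=
    fun h0 => (Complex.continuous_ofReal.tendsto _).comp (hasDerivAt_rho h0).continuousAt.tendsto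
  have hposL : ∀ᶠ r in 𝓝[>] p, 0 < r := by
    filter_upwards [self_mem_nhdsWithin] with r hr using hp0.trans hr
  have hposR : ∀ᶠ r in 𝓝[<] q, 0 < r := by
    filter_upwards [Ioo_mem_nhdsLT hpq] with r hr using hp0.trans hr.1
  have hlimL : Tendsto (fun r => (w r + ((1 : ℝ) : ℂ) * I * carterK a l ω m r * Ψ r)
      + endCorrection a M l p m 1 r * Ψ r) (𝓝[>] p) (𝓝 0) := by
    have h1 := ((hρt hp0).mono_left (nhdsWithin_le_nhds (s := Ioi p))).mul
      (by have := hu.horizon; unfold omegaPlus at this; rw [hp] at this; exact this)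
    rw [mul_zero] at h1
    refine h1.congr' ?_
    filter_upwards [hposL] with r hr
    rw [outgoing_eq hp0 hr]
    simp
  have hlimR : Tendsto (fun r => (w r + ((-1 : ℝ) : ℂ) * I * carterK a l ω m r * Ψ r)
      + endCorrection a M l q m (-1) r * Ψ r) (𝓝[<] q) (𝓝 0) := by
    have h1 := ((hρt hq0).mono_left (nhdsWithin_le_nhds (s := Iio q))).mul
      (by have := hu.cosmological; unfold omegaCosmo at this; rw [hq] at this; exact this)
    rw [mul_zero] at h1
    refine h1.congr' ?_
    filter_upwards [hposR] with r hr
    rw [outgoing_eq hq0 hr]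
    push_cast
    ring
  have hmemL : ∀ {t}, t ∈ Ioo 0 T → p + t ∈ Ioo p q := fun ht =>
    ⟨by linarith [ht.1], by linarith [ht.2]⟩
  have hmemR : ∀ {t}, t ∈ Ioo 0 T → q - t ∈ Ioo p q := fun ht =>
    ⟨by linarith [ht.2], by linarith [ht.1]⟩
  obtain ⟨zl, ⟨ν, hν⟩, sl, hsl, Xl, hXl⟩ := hl.exists_limit hT0
    (κ := fun t => endCorrection a M l p m 1 (p + t)) (Cκ := c1)
    (fun t ht => by
      have := hc1 (p + t) (hmemL ht)
      rwa [add_sub_cancel_left, abs_of_pos ht.1] at this)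
    (by refine (hlimL.comp (tendsto_const_add_nhdsGT p)).congr fun t => ?_
        simp)
  obtain ⟨zr, ⟨ν', hν'⟩, sr, hsr, Xr, hXr⟩ := hr.exists_limit hT0
    (κ := fun t => endCorrection a M l q m (-1) (q - t)) (Cκ := c2)
    (fun t ht => by
      have := hc2 (q - t) (hmemR ht)
      rwa [show q - t - q = -t by ring, abs_neg, abs_of_pos ht.1] at this)
    (by refine (hlimR.comp (tendsto_const_sub_nhdsLT q)).congr fun t => ?_
        simp [sub_eq_add_neg])
  have inL : Tendsto (fun r => w r + I * carterK a l ω m r * Ψ r) (𝓝[>] p) (𝓝 0) := by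
    refine (zl.comp (tendsto_sub_const_nhdsGT p)).congr fun r => ?_
    simp
  have outR : Tendsto (fun r => w r - I * carterK a l ω m r * Ψ r) (𝓝[<] q) (𝓝 0) := by
    refine (zr.comp (tendsto_const_sub_nhdsGT q)).congr fun r => ?_
    simp
  have nL : Tendsto (fun r => ‖Ψ r‖) (𝓝[>] p) (𝓝 ν) := by
    refine (hν.comp (tendsto_sub_const_nhdsGT p)).congr fun r => ?_
    simp
  have nR : Tendsto (fun r => ‖Ψ r‖) (𝓝[<] q) (𝓝 ν') := by
    refine (hν'.comp (tendsto_const_sub_nhdsGT q)).congr fun r => ?_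
    simp
  refine ⟨ν ^ 2, ν' ^ 2, he, nL.pow 2, nR.pow 2, inL, outR, ?_⟩
  have hΨc : ContinuousOn Ψ (Ioo p q) := fun r hr =>
    (he.deriv_fst r hr).continuousAt.continuousWithinAt
  have hwc : ContinuousOn w (Ioo p q) := fun r hr =>
    (he.deriv_snd r hr).continuousAt.continuousWithinAt
  have bL : ∀ᶠ r in 𝓝[>] p, ‖Ψ r‖ ≤ ν + 1 :=
    (nL.eventually_lt_const (by linarith : ν < ν + 1)).mono fun _ h => h.le
  have bR : ∀ᶠ r in 𝓝[<] q, ‖Ψ r‖ ≤ ν' + 1 :=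
    (nR.eventually_lt_const (by linarith : ν' < ν' + 1)).mono fun _ h => h.le
  obtain ⟨X, hX⟩ := exists_bound_of_ends hpq hΨc bL bR
  obtain ⟨Kb, hKb⟩ := isCompact_Icc.exists_bound_of_continuousOn
    (continuous_carterK a l ω m).continuousOn (s := Icc p q)
  have hterm : ∀ r ∈ Ioo p q, ‖I * carterK a l ω m r * Ψ r‖ ≤ Kb * X := by
    intro r hr
    have h1 := hKb r ⟨hr.1.le, hr.2.le⟩
    rw [norm_mul, norm_mul, norm_I, one_mul, norm_real]
    exact mul_le_mul h1 (hX r hr) (norm_nonneg _) ((norm_nonneg _).trans h1)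
  have wL : ∀ᶠ r in 𝓝[>] p, ‖w r‖ ≤ 1 + Kb * X := by
    have h1 := inL.norm
    rw [norm_zero] at h1
    filter_upwards [h1.eventually_lt_const one_pos, Ioo_mem_nhdsGT hpq] with r hr hr'
    have := norm_sub_le (w r + I * carterK a l ω m r * Ψ r)
      (I * carterK a l ω m r * Ψ r)
    rw [add_sub_cancel_right] at this
    linarith [hterm r hr']
  have wR : ∀ᶠ r in 𝓝[<] q, ‖w r‖ ≤ 1 + Kb * X := by
    have h1 := outR.norm
    rw [norm_zero] at h1
    filter_upwards [h1.eventually_lt_const one_pos, Ioo_mem_nhdsLT hpq] with r hr hr'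
    have := norm_add_le (w r - I * carterK a l ω m r * Ψ r)
      (I * carterK a l ω m r * Ψ r)
    rw [sub_add_cancel] at this
    linarith [hterm r hr']
  obtain ⟨Y, hY⟩ := exists_bound_of_ends hpq hwc wL wR
  exact ⟨max X Y, fun r hr => ⟨(hX r hr).trans (le_max_left _ _), (hY r hr).trans (le_max_right _ _)⟩⟩

end

/-! ### Multiplier and energy identities -/

theorem inner_ofReal_mul_right (x y : ℂ) (c : ℝ) : inner ℝ x ((c : ℂ) * y) = c * inner ℝ x y := by
  simp [Complex.inner]; ring

theorem inner_ofReal_mul_left (x y : ℂ) (c : ℝ) : inner ℝ ((c : ℂ) * x) y = c * inner ℝ x y := by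
  simp [Complex.inner]; ring

theorem inner_I_mul (x y : ℂ) : inner ℝ (I * x) y = ((starRingEnd ℂ) x * y).im := by
  simp [Complex.inner]; ring

theorem inner_I_mul_self (x : ℂ) : inner ℝ (I * x) x = 0 := by
  simp [Complex.inner]; ring

namespace RadialSolution

variable {a M l musq ω m L p q s P Q : ℝ} {Ψ w F : ℝ → ℂ}

theorem continuousOn_fst (h : RadialEq a M l musq ω m L p q Ψ w F) : ContinuousOn Ψ (Ioo p q) :=
  fun r hr => (h.deriv_fst r hr).continuousAt.continuousWithinAt

theorem continuousOn_snd (h : RadialEq a M l musq ω m L p q Ψ w F) : ContinuousOn w (Ioo p q) :=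
  fun r hr => (h.deriv_snd r hr).continuousAt.continuousWithinAt

/-- Continuous functions on `(p, q)` that are dominated by the source are integrable. -/
theorem integrable_of_le (h : RadialEq a M l musq ω m L p q Ψ w F) (hpq : p ≤ q) {g : ℝ → ℝ}
    (hg : ContinuousOn g (Ioo p q)) {C : ℝ} (hC : ∀ r ∈ Ioo p q, |g r| ≤ C * (1 + ‖F r‖ ^ 2)) :
    IntervalIntegrable g volume p q := by
  rw [intervalIntegrable_iff_integrableOn_Ioo_of_le hpq]
  have h1 : IntegrableOn (fun r => C * (1 + ‖F r‖ ^ 2)) (Ioo p q) :=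
    (Integrable.add (by simp) h.source_integrable).const_mul C
  refine h1.mono' (hg.aestronglyMeasurable measurableSet_Ioo) ?_
  exact (ae_restrict_iff' measurableSet_Ioo).2 (.of_forall fun r hr => hC r hr)

variable (h : RadialSolution a M l musq ω m L p q Ψ w F P Q)
include h

theorem P_nonneg : 0 ≤ P := ge_of_tendsto h.lim_left (.of_forall fun _ => by positivity)

theorem Q_nonneg : 0 ≤ Q := ge_of_tendsto h.lim_right (.of_forall fun _ => by positivity)

theorem tendsto_norm_left : Tendsto (fun r => ‖Ψ r‖) (𝓝[>] p) (𝓝 (√P)) := by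
  refine (h.lim_left.sqrt).congr fun r => ?_
  exact sqrt_sq (norm_nonneg _)

theorem tendsto_norm_right : Tendsto (fun r => ‖Ψ r‖) (𝓝[<] q) (𝓝 (√Q)) := by
  refine (h.lim_right.sqrt).congr fun r => ?_
  exact sqrt_sq (norm_nonneg _)

theorem tendsto_momentum_left :
    Tendsto (fun r => ‖w r‖ ^ 2) (𝓝[>] p) (𝓝 (carterK a l ω m p ^ 2 * P)) := by
  have hK : Tendsto (carterK a l ω m) (𝓝[>] p) (𝓝 (carterK a l ω m p)) :=
    ((continuous_carterK a l ω m).tendsto p).mono_left nhdsWithin_le_nhds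
  have h1 : Tendsto (fun r => |carterK a l ω m r| * ‖Ψ r‖) (𝓝[>] p)
      (𝓝 (|carterK a l ω m p| * √P)) := hK.abs.mul h.tendsto_norm_left
  have h2 : Tendsto (fun r => ‖w r‖ - |carterK a l ω m r| * ‖Ψ r‖) (𝓝[>] p) (𝓝 0) := by
    have h3 := h.in_left.norm
    rw [norm_zero] at h3
    refine squeeze_zero_norm (fun r => ?_) h3
    have := abs_norm_sub_norm_le (w r) (-(I * carterK a l ω m r * Ψ r))
    rw [sub_neg_eq_add, norm_neg, norm_mul, norm_mul, norm_I, one_mul,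
      norm_real] at this
    simpa using this
  have h4 := ((h2.add h1).pow 2)
  simp only [sub_add_cancel, zero_add] at h4
  rwa [mul_pow, sq_abs, sq_sqrt h.P_nonneg] at h4

theorem tendsto_momentum_right :
    Tendsto (fun r => ‖w r‖ ^ 2) (𝓝[<] q) (𝓝 (carterK a l ω m q ^ 2 * Q)) := by
  have hK : Tendsto (carterK a l ω m) (𝓝[<] q) (𝓝 (carterK a l ω m q)) :=
    ((continuous_carterK a l ω m).tendsto q).mono_left nhdsWithin_le_nhds
  have h1 : Tendsto (fun r => |carterK a l ω m r| * ‖Ψ r‖) (𝓝[<] q)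
      (𝓝 (|carterK a l ω m q| * √Q)) := hK.abs.mul h.tendsto_norm_right
  have h2 : Tendsto (fun r => ‖w r‖ - |carterK a l ω m r| * ‖Ψ r‖) (𝓝[<] q) (𝓝 0) := by
    have h3 := h.out_right.norm
    rw [norm_zero] at h3
    refine squeeze_zero_norm (fun r => ?_) h3
    have := abs_norm_sub_norm_le (w r) (I * carterK a l ω m r * Ψ r)
    rw [norm_mul, norm_mul, norm_I, one_mul, norm_real] at this
    simpa using this
  have h4 := ((h2.add h1).pow 2)
  simp only [sub_add_cancel, zero_add] at h4
  rwa [mul_pow, sq_abs, sq_sqrt h.Q_nonneg] at h4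

/-- Products with a factor that tends to `0` and a factor built from the bounded solution. -/
theorem tendsto_zero_mul {lf : Filter ℝ} (hl : ∀ᶠ r in lf, r ∈ Ioo p q) {φ : ℝ → ℝ}
    (hφ : Tendsto φ lf (𝓝 0)) : Tendsto (fun r => φ r * inner ℝ (Ψ r) (w r)) lf (𝓝 0) := by
  obtain ⟨X, hX⟩ := h.bounded
  refine squeeze_zero_norm' (a := fun r => |φ r| * (X * X)) ?_ ?_
  · filter_upwards [hl] with r hr
    obtain ⟨h1, h2⟩ := hX r hr
    rw [norm_mul, norm_eq_abs, norm_eq_abs]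
    refine mul_le_mul_of_nonneg_left ?_ (abs_nonneg _)
    exact (abs_real_inner_le_norm _ _).trans
      (mul_le_mul h1 h2 (norm_nonneg _) ((norm_nonneg _).trans h1))
  · simpa using hφ.abs.mul_const (X * X)

theorem tendsto_flux_left : Tendsto (fun r => inner ℝ (I * Ψ r) (w r)) (𝓝[>] p)
    (𝓝 (-(carterK a l ω m p * P))) := by
  have hK : Tendsto (carterK a l ω m) (𝓝[>] p) (𝓝 (carterK a l ω m p)) :=
    ((continuous_carterK a l ω m).tendsto p).mono_left nhdsWithin_le_nhds
  have h1 : Tendsto (fun r => inner ℝ (I * Ψ r)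
      (w r + I * carterK a l ω m r * Ψ r)) (𝓝[>] p) (𝓝 0) := by
    have h3 := h.tendsto_norm_left.mul h.in_left.norm
    rw [norm_zero, mul_zero] at h3
    refine squeeze_zero_norm (fun r => ?_) h3
    refine (norm_inner_le_norm _ _).trans_eq ?_
    rw [norm_mul, norm_I, one_mul]
  have h2 := h1.sub (hK.mul h.lim_left)
  rw [zero_sub] at h2
  refine h2.congr fun r => ?_
  have e : I * (carterK a l ω m r : ℂ) * Ψ r = (carterK a l ω m r : ℂ) * (I * Ψ r) := by
    ring
  rw [inner_add_right, e, inner_ofReal_mul_right, real_inner_self_eq_norm_sq, norm_mul,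
    norm_I, one_mul]
  ring

theorem tendsto_flux_right : Tendsto (fun r => inner ℝ (I * Ψ r) (w r)) (𝓝[<] q)
    (𝓝 (carterK a l ω m q * Q)) := by
  have hK : Tendsto (carterK a l ω m) (𝓝[<] q) (𝓝 (carterK a l ω m q)) :=
    ((continuous_carterK a l ω m).tendsto q).mono_left nhdsWithin_le_nhds
  have h1 : Tendsto (fun r => inner ℝ (I * Ψ r)
      (w r - I * carterK a l ω m r * Ψ r)) (𝓝[<] q) (𝓝 0) := by
    have h3 := h.tendsto_norm_right.mul h.out_right.norm
    rw [norm_zero, mul_zero] at h3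
    refine squeeze_zero_norm (fun r => ?_) h3
    refine (norm_inner_le_norm _ _).trans_eq ?_
    rw [norm_mul, norm_I, one_mul]
  have h2 := h1.add (hK.mul h.lim_right)
  rw [zero_add] at h2
  refine h2.congr fun r => ?_
  have e : I * (carterK a l ω m r : ℂ) * Ψ r = (carterK a l ω m r : ℂ) * (I * Ψ r) := by
    ring
  rw [inner_sub_right, e, inner_ofReal_mul_right, real_inner_self_eq_norm_sq, norm_mul,
    norm_I, one_mul]
  ring

omit h in
theorem hasDerivAt_flux (h : RadialEq a M l musq ω m L p q Ψ w F) {r : ℝ} (hr : r ∈ Ioo p q) :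
    HasDerivAt (fun r => inner ℝ (I * Ψ r) (w r)) (inner ℝ (I * Ψ r) (F r)) r := by
  have h1 := ((h.deriv_fst r hr).const_mul I).inner ℝ (h.deriv_snd r hr)
  refine h1.congr_deriv ?_
  have e : I * (((1 / Delta a M l r : ℝ) : ℂ) * w r)
      = ((1 / Delta a M l r : ℝ) : ℂ) * (I * w r) := by ring
  rw [e, inner_sub_right, inner_ofReal_mul_right, inner_ofReal_mul_left, inner_I_mul_self,
    inner_I_mul_self]
  ring

theorem integrable_source_flux (hpq : p ≤ q) {χ : ℝ → ℝ} (hχ : ContinuousOn χ (Icc p q)) :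
    IntervalIntegrable (fun r => χ r * inner ℝ (I * Ψ r) (F r)) volume p q := by
  obtain ⟨X, hX⟩ := h.bounded
  obtain ⟨Y, hY⟩ := isCompact_Icc.exists_bound_of_continuousOn hχ
  have hΨ := continuousOn_fst h.toRadialEq
  refine integrable_of_le h.toRadialEq hpq (C := Y * X)
    ((hχ.mono Ioo_subset_Icc_self).mul ((continuousOn_const.mul hΨ).inner h.cont_F)) fun r hr => ?_
  have h1 := (hX r hr).1
  have h2 := hY r ⟨hr.1.le, hr.2.le⟩
  have hX0 := (norm_nonneg _).trans h1
  have hY0 := (norm_nonneg _).trans h2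
  rw [abs_mul]
  have h3 : |inner ℝ (I * Ψ r) (F r)| ≤ X * (1 + ‖F r‖ ^ 2) := by
    refine (abs_real_inner_le_norm _ _).trans ?_
    rw [norm_mul, norm_I, one_mul]
    have : ‖F r‖ ≤ 1 + ‖F r‖ ^ 2 := by nlinarith [sq_nonneg (‖F r‖ - 1)]
    gcongr
  calc |χ r| * |inner ℝ (I * Ψ r) (F r)| ≤ Y * (X * (1 + ‖F r‖ ^ 2)) := by
        refine mul_le_mul h2 h3 (abs_nonneg _) hY0
    _ = _ := by ring

theorem integrable_sq (hpq : p ≤ q) {φ ψ : ℝ → ℝ} (hφ : ContinuousOn φ (Icc p q))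
    (hψ : ContinuousOn ψ (Icc p q)) :
    IntervalIntegrable (fun r => φ r * ‖w r‖ ^ 2 + ψ r * ‖Ψ r‖ ^ 2) volume p q := by
  obtain ⟨X, hX⟩ := h.bounded
  obtain ⟨Y, hY⟩ := isCompact_Icc.exists_bound_of_continuousOn hφ
  obtain ⟨Z, hZ⟩ := isCompact_Icc.exists_bound_of_continuousOn hψ
  have hΨ := continuousOn_fst h.toRadialEq
  have hw := continuousOn_snd h.toRadialEq
  refine integrable_of_le h.toRadialEq hpq (C := Y * X ^ 2 + Z * X ^ 2)
    (((hφ.mono Ioo_subset_Icc_self).mul (hw.norm.pow 2)).add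
      ((hψ.mono Ioo_subset_Icc_self).mul (hΨ.norm.pow 2))) fun r hr => ?_
  obtain ⟨h1, h2⟩ := hX r hr
  have h3 := hY r ⟨hr.1.le, hr.2.le⟩
  have h4 := hZ r ⟨hr.1.le, hr.2.le⟩
  have hY0 := (norm_nonneg _).trans h3
  have hZ0 := (norm_nonneg _).trans h4
  refine (abs_add_le _ _).trans ?_
  rw [abs_mul, abs_mul, abs_of_nonneg (sq_nonneg ‖w r‖), abs_of_nonneg (sq_nonneg ‖Ψ r‖)]
  have e1 : |φ r| * ‖w r‖ ^ 2 ≤ Y * X ^ 2 :=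
    mul_le_mul h3 (pow_le_pow_left₀ (norm_nonneg _) h2 2) (by positivity) hY0
  have e2 : |ψ r| * ‖Ψ r‖ ^ 2 ≤ Z * X ^ 2 :=
    mul_le_mul h4 (pow_le_pow_left₀ (norm_nonneg _) h1 2) (by positivity) hZ0
  have e3 : 0 ≤ (Y * X ^ 2 + Z * X ^ 2) * ‖F r‖ ^ 2 := by positivity
  nlinarith

theorem integrable_cross (hpq : p ≤ q) {φ : ℝ → ℝ} (hφ : ContinuousOn φ (Icc p q)) :
    IntervalIntegrable (fun r => φ r * inner ℝ (I * Ψ r) (w r)) volume p q := by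
  obtain ⟨X, hX⟩ := h.bounded
  obtain ⟨Y, hY⟩ := isCompact_Icc.exists_bound_of_continuousOn hφ
  have hΨ := continuousOn_fst h.toRadialEq
  have hw := continuousOn_snd h.toRadialEq
  refine integrable_of_le h.toRadialEq hpq (C := Y * (X * X))
    ((hφ.mono Ioo_subset_Icc_self).mul ((continuousOn_const.mul hΨ).inner hw)) fun r hr => ?_
  obtain ⟨h1, h2⟩ := hX r hr
  have h3 := hY r ⟨hr.1.le, hr.2.le⟩
  have hX0 := (norm_nonneg _).trans h1
  have hY0 := (norm_nonneg _).trans h3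
  rw [abs_mul]
  have h4 : |inner ℝ (I * Ψ r) (w r)| ≤ X * X := by
    refine (abs_real_inner_le_norm _ _).trans ?_
    rw [norm_mul, norm_I, one_mul]
    exact mul_le_mul h1 h2 (norm_nonneg _) hX0
  have h5 : |φ r| * |inner ℝ (I * Ψ r) (w r)| ≤ Y * (X * X) :=
    mul_le_mul h3 h4 (abs_nonneg _) hY0
  have : 0 ≤ Y * (X * X) * ‖F r‖ ^ 2 := by positivity
  nlinarith

/-- The localized energy identity. -/
theorem energy_identity (hpq : p < q) {χ χ' : ℝ → ℝ} (hd : ∀ r, HasDerivAt χ (χ' r) r)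
    (hc : Continuous χ') :
    ∫ r in p..q, (χ' r * inner ℝ (I * Ψ r) (w r)
        + χ r * inner ℝ (I * Ψ r) (F r))
      = χ q * (carterK a l ω m q * Q) + χ p * (carterK a l ω m p * P) := by
  have hχc : Continuous χ := continuous_iff_continuousAt.2 fun r => (hd r).continuousAt
  have := intervalIntegral.integral_eq_sub_of_hasDerivAt_of_tendsto hpq
    (f := fun r => χ r * inner ℝ (I * Ψ r) (w r))
    (fun r hr => (hd r).mul (hasDerivAt_flux h.toRadialEq hr))
    ((h.integrable_cross hpq.le hc.continuousOn).add
      (h.integrable_source_flux hpq.le hχc.continuousOn))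
    (((hχc.tendsto p).mono_left nhdsWithin_le_nhds).mul h.tendsto_flux_left)
    (((hχc.tendsto q).mono_left nhdsWithin_le_nhds).mul h.tendsto_flux_right)
  rw [this]
  ring

/-- Conservation of the microlocal energy flux through the two horizons. -/
theorem flux_identity (hpq : p < q) :
    ∫ r in p..q, inner ℝ (I * Ψ r) (F r)
      = carterK a l ω m q * Q + carterK a l ω m p * P := by
  have := h.energy_identity hpq (χ := fun _ => 1) (χ' := fun _ => 0)
    (fun r => hasDerivAt_const r 1) continuous_const
  simpa using this

omit h in
/-- The density produced by the multipliers `f w̄ + Δ k Ψ̄` and the total derivative of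
`Δ ε |Ψ|²`; `k₁, k₂, ε₁, f₁` are derivatives. -/
noncomputable def multiplierDensity (a M l musq ω m L : ℝ) (f f₁ k k₁ k₂ ε ε₁ : ℝ → ℝ)
    (Ψ w F : ℝ → ℂ) (r : ℝ) : ℝ :=
  (f₁ r + k r) * ‖w r‖ ^ 2
    + (f₁ r * radialG a M l musq ω m L r
      + f r * (2 * carterK a l ω m r * (2 * ω * r) - DeltaD a M l r * (L + musq * (r ^ 2 + a ^ 2))
        - Delta a M l r * (musq * (2 * r)))
      - k r * radialG a M l musq ω m L r
      - 1 / 2 * (DeltaD a M l r * (DeltaD a M l r * k r + Delta a M l r * k₁ r)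
        + Delta a M l r * (DeltaDD a l r * k r + 2 * (DeltaD a M l r * k₁ r)
          + Delta a M l r * k₂ r))
      + (DeltaD a M l r * ε r + Delta a M l r * ε₁ r)) * ‖Ψ r‖ ^ 2
    + 2 * f r * inner ℝ (w r) (F r) + Delta a M l r * k r * inner ℝ (Ψ r) (F r)
    + 2 * ε r * inner ℝ (Ψ r) (w r)

/-- The integrated multiplier identity: a pointwise lower bound for the multiplier density gives an
integral bound with boundary terms at the horizons, where only the multiplier `f` contributes. -/
theorem multiplier_estimate (hh : Horizons a M l p q s) {f f₁ k k₁ k₂ ε ε₁ : ℝ → ℝ}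
    (hf : ∀ r ∈ Icc p q, HasDerivAt f (f₁ r) r) (hk : ∀ r ∈ Icc p q, HasDerivAt k (k₁ r) r)
    (hk₁ : ∀ r ∈ Icc p q, HasDerivAt k₁ (k₂ r) r) (hε : ∀ r ∈ Icc p q, HasDerivAt ε (ε₁ r) r)
    (cf : ContinuousOn f₁ (Icc p q)) (ck : ContinuousOn k₂ (Icc p q))
    (cε : ContinuousOn ε₁ (Icc p q)) {b : ℝ → ℝ} {C : ℝ} (hb : IntervalIntegrable b volume p q)
    (hpt : ∀ r ∈ Ioo p q,
      b r ≤ multiplierDensity a M l musq ω m L f f₁ k k₁ k₂ ε ε₁ Ψ w F r + C * ‖F r‖ ^ 2) :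
    ∫ r in p..q, b r ≤ 2 * f q * (carterK a l ω m q ^ 2 * Q)
      - 2 * f p * (carterK a l ω m p ^ 2 * P) + C * ∫ r in p..q, ‖F r‖ ^ 2 := by
  have hpq := hh.p_lt
  set G := radialG a M l musq ω m L with hG
  set G' : ℝ → ℝ := fun r => 2 * carterK a l ω m r * (2 * ω * r)
    - DeltaD a M l r * (L + musq * (r ^ 2 + a ^ 2)) - Delta a M l r * (musq * (2 * r)) with hG'
  have hGd : ∀ r, HasDerivAt G (G' r) r := by
    intro r
    have h1 := ((hasDerivAt_carterK a l ω m r).pow 2).sub ((hasDerivAt_Delta a M l r).mul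
      ((((((hasDerivAt_id r).pow 2).add_const (a ^ 2)).const_mul musq).const_add L)))
    refine h1.congr_deriv ?_
    simp [hG']
    ring
  have hDk : ∀ r ∈ Icc p q, HasDerivAt (fun r => Delta a M l r * k r)
      (DeltaD a M l r * k r + Delta a M l r * k₁ r) r := fun r hr =>
    (hasDerivAt_Delta a M l r).mul (hk r hr)
  set j : ℝ → ℝ := fun r => Delta a M l r * (DeltaD a M l r * k r + Delta a M l r * k₁ r) with hj
  have hjd : ∀ r ∈ Icc p q, HasDerivAt j
      (DeltaD a M l r * (DeltaD a M l r * k r + Delta a M l r * k₁ r)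
        + Delta a M l r * (DeltaDD a l r * k r + 2 * (DeltaD a M l r * k₁ r)
          + Delta a M l r * k₂ r)) r := by
    intro r hr
    have h1 := (hasDerivAt_Delta a M l r).mul
      (((hasDerivAt_DeltaD a M l r).mul (hk r hr)).add ((hasDerivAt_Delta a M l r).mul (hk₁ r hr)))
    refine h1.congr_deriv ?_
    simp only [Pi.add_apply, Pi.mul_apply]
    ring
  have hEd : ∀ r ∈ Icc p q, HasDerivAt (fun r => Delta a M l r * ε r)
      (DeltaD a M l r * ε r + Delta a M l r * ε₁ r) r := fun r hr =>
    (hasDerivAt_Delta a M l r).mul (hε r hr)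
  set J : ℝ → ℝ := fun r => f r * (‖w r‖ ^ 2 + G r * ‖Ψ r‖ ^ 2)
    + Delta a M l r * k r * inner ℝ (Ψ r) (w r) - 1 / 2 * (j r * ‖Ψ r‖ ^ 2)
    + Delta a M l r * ε r * ‖Ψ r‖ ^ 2 with hJ
  have hJd : ∀ r ∈ Ioo p q, HasDerivAt J
      (multiplierDensity a M l musq ω m L f f₁ k k₁ k₂ ε ε₁ Ψ w F r) r := by
    intro r hr
    have hr' : r ∈ Icc p q := ⟨hr.1.le, hr.2.le⟩
    have dΨ := h.deriv_fst r hr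
    have dw := h.deriv_snd r hr
    have hΔ := hh.Delta_pos hr
    have d1 := (hf r hr').mul (dw.norm_sq.add ((hGd r).mul dΨ.norm_sq))
    have d2 := (hDk r hr').mul (dΨ.inner ℝ dw)
    have d3 := ((hjd r hr').mul dΨ.norm_sq).const_mul (1 / 2)
    have d4 := (hEd r hr').mul dΨ.norm_sq
    refine (((d1.add d2).sub d3).add d4).congr_deriv ?_
    simp only [Pi.add_apply, Pi.mul_apply]
    rw [inner_sub_right, inner_sub_right, inner_ofReal_mul_right, inner_ofReal_mul_right,
      inner_ofReal_mul_right, inner_ofReal_mul_left, real_inner_self_eq_norm_sq,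
      real_inner_self_eq_norm_sq, real_inner_comm (Ψ r) (w r)]
    unfold multiplierDensity
    simp only [hj, ← hG]
    rw [show (2 * carterK a l ω m r * (2 * ω * r) - DeltaD a M l r * (L + musq * (r ^ 2 + a ^ 2))
        - Delta a M l r * (musq * (2 * r))) = G' r from rfl]
    field_simp
    ring
  have cf0 : ContinuousOn f (Icc p q) := fun r hr => (hf r hr).continuousAt.continuousWithinAt
  have ck0 : ContinuousOn k (Icc p q) := fun r hr => (hk r hr).continuousAt.continuousWithinAt
  have ck1 : ContinuousOn k₁ (Icc p q) := fun r hr => (hk₁ r hr).continuousAt.continuousWithinAt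
  have cε0 : ContinuousOn ε (Icc p q) := fun r hr => (hε r hr).continuousAt.continuousWithinAt
  have hint : IntervalIntegrable (multiplierDensity a M l musq ω m L f f₁ k k₁ k₂ ε ε₁ Ψ w F)
      volume p q := by
    obtain ⟨X, hX⟩ := h.bounded
    have hΨ := continuousOn_fst h.toRadialEq
    have hw := continuousOn_snd h.toRadialEq
    have key : ∀ {φ : ℝ → ℝ} {x y : ℝ → ℂ} {Z : ℝ}, ContinuousOn φ (Icc p q) →
        ContinuousOn x (Ioo p q) → ContinuousOn y (Ioo p q) →
        (∀ r ∈ Ioo p q, ‖x r‖ * ‖y r‖ ≤ Z * (1 + ‖F r‖ ^ 2)) →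
        IntervalIntegrable (fun r => φ r * inner ℝ (x r) (y r)) volume p q := by
      intro φ x y Z hφ hx hy hxy
      obtain ⟨Y, hY⟩ := isCompact_Icc.exists_bound_of_continuousOn hφ
      refine integrable_of_le h.toRadialEq hpq.le (C := Y * Z)
        ((hφ.mono Ioo_subset_Icc_self).mul (hx.inner hy)) fun r hr => ?_
      have h2 := hY r ⟨hr.1.le, hr.2.le⟩
      rw [abs_mul]
      calc |φ r| * |inner ℝ (x r) (y r)| ≤ Y * (‖x r‖ * ‖y r‖) :=
            mul_le_mul h2 (abs_real_inner_le_norm _ _) (abs_nonneg _) ((norm_nonneg _).trans h2)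
        _ ≤ Y * (Z * (1 + ‖F r‖ ^ 2)) :=
            mul_le_mul_of_nonneg_left (hxy r hr) ((norm_nonneg _).trans h2)
        _ = _ := by ring
    have hF1 : ∀ r, ‖F r‖ ≤ 1 + ‖F r‖ ^ 2 := fun r => by nlinarith [sq_nonneg (‖F r‖ - 1)]
    have i1 := h.integrable_sq hpq.le (cf.add ck0)
      (ψ := fun r => f₁ r * radialG a M l musq ω m L r
      + f r * (2 * carterK a l ω m r * (2 * ω * r) - DeltaD a M l r * (L + musq * (r ^ 2 + a ^ 2))
        - Delta a M l r * (musq * (2 * r)))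
      - k r * radialG a M l musq ω m L r
      - 1 / 2 * (DeltaD a M l r * (DeltaD a M l r * k r + Delta a M l r * k₁ r)
        + Delta a M l r * (DeltaDD a l r * k r + 2 * (DeltaD a M l r * k₁ r)
          + Delta a M l r * k₂ r))
      + (DeltaD a M l r * ε r + Delta a M l r * ε₁ r)) (by fun_prop)
    have i2 := key (φ := fun r => 2 * f r) (Z := X) (by fun_prop) hw h.cont_F (fun r hr =>
      mul_le_mul (hX r hr).2 (hF1 r) (norm_nonneg _) ((norm_nonneg _).trans (hX r hr).2))
    have i3 := key (φ := fun r => Delta a M l r * k r) (Z := X) (by fun_prop) hΨ h.cont_F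
      (fun r hr =>
      mul_le_mul (hX r hr).1 (hF1 r) (norm_nonneg _) ((norm_nonneg _).trans (hX r hr).1))
    have i4 := key (φ := fun r => 2 * ε r) (Z := X * X) (by fun_prop) hΨ hw (fun r hr => by
      have e := mul_le_mul (hX r hr).1 (hX r hr).2 (norm_nonneg _)
        ((norm_nonneg _).trans (hX r hr).1)
      have : 0 ≤ X * X * ‖F r‖ ^ 2 := by
        have := mul_self_nonneg X
        positivity
      linarith)
    exact ((i1.add i2).add i3).add i4
  have hwithin : ∀ {φ : ℝ → ℝ}, ContinuousOn φ (Icc p q) →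
      Tendsto φ (𝓝[>] p) (𝓝 (φ p)) ∧ Tendsto φ (𝓝[<] q) (𝓝 (φ q)) := by
    intro φ hφ
    constructor
    · have := (hφ p (left_mem_Icc.2 hpq.le)).tendsto
      refine this.mono_left ?_
      rw [nhdsWithin_Icc_eq_nhdsGE hpq]
      exact nhdsWithin_mono _ Ioi_subset_Ici_self
    · have := (hφ q (right_mem_Icc.2 hpq.le)).tendsto
      refine this.mono_left ?_
      rw [nhdsWithin_Icc_eq_nhdsLE hpq]
      exact nhdsWithin_mono _ Iio_subset_Iic_self
  have hGc : ContinuousOn G (Icc p q) := fun r _ => (hGd r).continuousAt.continuousWithinAt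
  have hzp : Delta a M l p = 0 := hh.Delta_left
  have hzq : Delta a M l q = 0 := hh.Delta_right
  have hGp : G p = carterK a l ω m p ^ 2 := by simp [hG, radialG, hzp]
  have hGq : G q = carterK a l ω m q ^ 2 := by simp [hG, radialG, hzq]
  have hjc : ContinuousOn j (Icc p q) := by simp only [hj]; fun_prop
  have cΔk : ContinuousOn (fun r => Delta a M l r * k r) (Icc p q) := by fun_prop
  have cΔε : ContinuousOn (fun r => Delta a M l r * ε r) (Icc p q) := by fun_prop
  have hJp : Tendsto J (𝓝[>] p) (𝓝 (2 * f p * (carterK a l ω m p ^ 2 * P))) := by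
    have t1 := (hwithin cf0).1.mul (h.tendsto_momentum_left.add ((hwithin hGc).1.mul h.lim_left))
    have t2 := h.tendsto_zero_mul (Ioo_mem_nhdsGT hpq) (φ := fun r => Delta a M l r * k r)
      (by have := (hwithin cΔk).1; simpa [hzp] using this)
    have t3 := ((hwithin hjc).1.mul h.lim_left).const_mul (1 / 2)
    have t4 := (hwithin cΔε).1.mul h.lim_left
    have t := ((t1.add t2).sub t3).add t4
    rw [hGp, hzp, show j p = 0 by simp [hj, hzp]] at t
    convert t using 2
    ring
  have hJq : Tendsto J (𝓝[<] q) (𝓝 (2 * f q * (carterK a l ω m q ^ 2 * Q))) := by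
    have t1 := (hwithin cf0).2.mul (h.tendsto_momentum_right.add ((hwithin hGc).2.mul h.lim_right))
    have t2 := h.tendsto_zero_mul (Ioo_mem_nhdsLT hpq) (φ := fun r => Delta a M l r * k r)
      (by have := (hwithin cΔk).2; simpa [hzq] using this)
    have t3 := ((hwithin hjc).2.mul h.lim_right).const_mul (1 / 2)
    have t4 := (hwithin cΔε).2.mul h.lim_right
    have t := ((t1.add t2).sub t3).add t4
    rw [hGq, hzq, show j q = 0 by simp [hj, hzq]] at t
    convert t using 2
    ring
  have hftc := intervalIntegral.integral_eq_sub_of_hasDerivAt_of_tendsto hpq hJd hint hJp hJq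
  have hFi := h.sourceIntervalIntegrable hpq.le
  have hle := intervalIntegral.integral_mono_on_of_le_Ioo hpq.le hb (hint.add (hFi.const_mul C)) hpt
  rw [intervalIntegral.integral_add hint (hFi.const_mul C), hftc,
    intervalIntegral.integral_const_mul] at hle
  linarith

end RadialSolution

/-! ### Normalised frequencies and the absence of superradiant trapping -/

/-- The constraint that the angular equation imposes on the frequencies `(ω, m, L)`: all that the
estimates use about the angular eigenvalue, apart from the spectral gap. It is invariant under
scaling `(ω, m, L)` to `(ω / N, m / N, L / N²)`, and `σ` is the sine of an angle. -/
def IsAdmissible (a l ω m L : ℝ) : Prop :=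
  0 ≤ L ∧ ∃ σ ∈ Icc (0 : ℝ) 1, (Xi a l * m - a * ω * σ ^ 2) ^ 2 ≤ Xi a l * (σ ^ 2 * L)

theorem IsAngularEigenvalue.isAdmissible {a l musq ω Λ : ℝ} {m : ℤ} (hmu : 0 ≤ musq)
    (h : IsAngularEigenvalue a l musq (a * ω) m Λ) :
    IsAdmissible a l ω m (shiftedEigenvalue a l (a * ω) m Λ) := by
  obtain ⟨σ, hσ, hpos, hle⟩ := h.exists_sq_le hmu
  have hX : 0 < Xi a l := by linarith [one_le_Xi a l]
  refine ⟨?_, σ, hσ, hle⟩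
  by_contra hneg
  push Not at hneg
  have : Xi a l * (σ ^ 2 * shiftedEigenvalue a l (a * ω) m Λ) < 0 :=
    mul_neg_of_pos_of_neg hX (mul_neg_of_pos_of_neg (by positivity) hneg)
  linarith [sq_nonneg (Xi a l * m - a * ω * σ ^ 2)]

/-- The normalised admissible frequencies `(ω, m, L)` together with the parameter `σ` of the
constraint. -/
def unitFrequencies (a l : ℝ) : Set (ℝ × ℝ × ℝ × ℝ) :=
  {z | z.1 ^ 2 + z.2.1 ^ 2 + z.2.2.1 = 1 ∧ 0 ≤ z.2.2.1 ∧ 0 ≤ z.2.2.2 ∧ z.2.2.2 ≤ 1 ∧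
    (Xi a l * z.2.1 - a * z.1 * z.2.2.2 ^ 2) ^ 2 ≤ Xi a l * (z.2.2.2 ^ 2 * z.2.2.1)}

theorem isCompact_unitFrequencies (a l : ℝ) : IsCompact (unitFrequencies a l) := by
  refine (isCompact_Icc (a := ((-1, -1, -1, -1) : ℝ × ℝ × ℝ × ℝ)) (b := (1, 1, 1, 1))).of_isClosed_subset
    ?_ ?_
  · simp only [unitFrequencies, Set.ofPred_and]
    exact (isClosed_eq (by fun_prop) (by fun_prop)).inter
      ((isClosed_le (by fun_prop) (by fun_prop)).inter
      ((isClosed_le (by fun_prop) (by fun_prop)).inter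
      ((isClosed_le (by fun_prop) (by fun_prop)).inter
      (isClosed_le (by fun_prop) (by fun_prop)))))
  · rintro ⟨ω, m, L, σ⟩ ⟨h1, h2, h3, h4, -⟩
    simp only at h1 h2 h3 h4
    have e3 := abs_le.1 (abs_le_one_iff_mul_self_le_one.2 (by nlinarith : ω * ω ≤ 1))
    have e4 := abs_le.1 (abs_le_one_iff_mul_self_le_one.2 (by nlinarith : m * m ≤ 1))
    simp only [mem_Icc, Prod.mk_le_mk]
    refine ⟨⟨e3.1, e4.1, by linarith, by linarith⟩, e3.2, e4.2, ?_, h4⟩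
    nlinarith [sq_nonneg m, sq_nonneg ω]

/-- The principal part `K² - ΔL` of the radial potential. -/
noncomputable def principalG (a M l ω m L r : ℝ) : ℝ :=
  carterK a l ω m r ^ 2 - Delta a M l r * L

/-- The derivative of `principalG`. -/
noncomputable def principalGD (a M l ω m L r : ℝ) : ℝ :=
  2 * carterK a l ω m r * (2 * ω * r) - DeltaD a M l r * L

/-- The second derivative of `principalG`. -/
noncomputable def principalGDD (a l ω m L r : ℝ) : ℝ :=
  2 * (2 * ω * r) ^ 2 + 2 * carterK a l ω m r * (2 * ω) - DeltaDD a l r * L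

theorem hasDerivAt_principalG (a M l ω m L r : ℝ) :
    HasDerivAt (principalG a M l ω m L) (principalGD a M l ω m L r) r := by
  refine (((hasDerivAt_carterK a l ω m r).pow 2).sub
    ((hasDerivAt_Delta a M l r).mul_const L)).congr_deriv ?_
  simp [principalGD]

theorem hasDerivAt_principalGD (a M l ω m L r : ℝ) :
    HasDerivAt (principalGD a M l ω m L) (principalGDD a l ω m L r) r := by
  have h := (((hasDerivAt_carterK a l ω m r).const_mul 2).mul
    ((hasDerivAt_id r).const_mul (2 * ω))).sub ((hasDerivAt_DeltaD a M l r).mul_const L)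
  refine h.congr_deriv ?_
  simp [principalGDD]; ring

@[fun_prop] theorem continuous_principalG (a M l ω m L : ℝ) :
    Continuous (principalG a M l ω m L) := by unfold principalG; fun_prop

@[fun_prop] theorem continuous_principalGD (a M l ω m L : ℝ) :
    Continuous (principalGD a M l ω m L) := by unfold principalGD; fun_prop

@[fun_prop] theorem continuous_principalGDD (a l ω m L : ℝ) :
    Continuous (principalGDD a l ω m L) := by unfold principalGDD; fun_prop

/-- A positive continuous function on a compact set is bounded away from zero. -/
theorem exists_pos_le_of_isCompact {X : Type*} [TopologicalSpace X] {S : Set X} (hS : IsCompact S)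
    {f : X → ℝ} (hf : ContinuousOn f S) (hpos : ∀ x ∈ S, 0 < f x) : ∃ c > 0, ∀ x ∈ S, c ≤ f x :=
  hS.exists_forall_le' hf hpos

theorem abs_le_one_of_unit {ω m L : ℝ} (hL : 0 ≤ L) (h : ω ^ 2 + m ^ 2 + L = 1) :
    |ω| ≤ 1 ∧ |m| ≤ 1 ∧ L ≤ 1 := by
  refine ⟨abs_le_one_iff_mul_self_le_one.2 (by nlinarith [sq_nonneg m]),
    abs_le_one_iff_mul_self_le_one.2 (by nlinarith [sq_nonneg ω]), ?_⟩
  nlinarith [sq_nonneg m, sq_nonneg ω]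

/-- Uniform bounds for the coefficients at normalised frequencies. -/
theorem exists_unit_bound (a M l p q : ℝ) : ∃ C ≥ 1, ∀ ω m L, 0 ≤ L → ω ^ 2 + m ^ 2 + L = 1 →
    ∀ r ∈ Icc p q, |carterK a l ω m r| ≤ C ∧ |2 * ω * r| ≤ C ∧ |principalG a M l ω m L r| ≤ C ∧
      |principalGD a M l ω m L r| ≤ C ∧ |principalGDD a l ω m L r| ≤ C := by
  have hc : IsCompact (Icc ((-1, -1, 0) : ℝ × ℝ × ℝ) (1, 1, 1) ×ˢ Icc p q) :=
    isCompact_Icc.prod isCompact_Icc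
  have key : ∀ f : (ℝ × ℝ × ℝ) × ℝ → ℝ, Continuous f → ∃ C, ∀ ω m L, 0 ≤ L →
      ω ^ 2 + m ^ 2 + L = 1 → ∀ r ∈ Icc p q, |f ((ω, m, L), r)| ≤ C := by
    intro f hf
    obtain ⟨C, hC⟩ := hc.exists_bound_of_continuousOn hf.continuousOn
    refine ⟨C, fun ω m L hL h r hr => hC _ ⟨?_, hr⟩⟩
    obtain ⟨h1, h2, h3⟩ := abs_le_one_of_unit hL h
    rw [abs_le] at h1 h2
    exact ⟨⟨h1.1, h2.1, hL⟩, h1.2, h2.2, h3⟩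
  obtain ⟨C1, h1⟩ := key (fun z => carterK a l z.1.1 z.1.2.1 z.2) (by unfold carterK; fun_prop)
  obtain ⟨C2, h2⟩ := key (fun z => 2 * z.1.1 * z.2) (by fun_prop)
  obtain ⟨C3, h3⟩ := key (fun z => principalG a M l z.1.1 z.1.2.1 z.1.2.2 z.2)
    (by unfold principalG carterK; fun_prop)
  obtain ⟨C4, h4⟩ := key (fun z => principalGD a M l z.1.1 z.1.2.1 z.1.2.2 z.2)
    (by unfold principalGD carterK; fun_prop)
  obtain ⟨C5, h5⟩ := key (fun z => principalGDD a l z.1.1 z.1.2.1 z.1.2.2 z.2)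
    (by unfold principalGDD carterK; fun_prop)
  refine ⟨1 + |C1| + |C2| + |C3| + |C4| + |C5|, ?_, fun ω m L hL h r hr => ?_⟩
  · have := abs_nonneg C1; have := abs_nonneg C2; have := abs_nonneg C3
    have := abs_nonneg C4; have := abs_nonneg C5
    linarith
  · have := abs_nonneg C1; have := abs_nonneg C2; have := abs_nonneg C3
    have := abs_nonneg C4; have := abs_nonneg C5
    have := le_abs_self C1; have := le_abs_self C2; have := le_abs_self C3
    have := le_abs_self C4; have := le_abs_self C5
    have := h1 ω m L hL h r hr; have := h2 ω m L hL h r hr; have := h3 ω m L hL h r hr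
    have := h4 ω m L hL h r hr; have := h5 ω m L hL h r hr
    dsimp only at *
    refine ⟨?_, ?_, ?_, ?_, ?_⟩ <;> linarith

/-- If `K` vanishes somewhere, then `L` does not. -/
theorem pos_of_carterK_eq_zero {a l ω m L σ s : ℝ} (hs : 0 < s) (h : ω ^ 2 + m ^ 2 + L = 1)
    (hL : 0 ≤ L) (hσ0 : 0 ≤ σ) (hσ : σ ≤ 1)
    (hle : (Xi a l * m - a * ω * σ ^ 2) ^ 2 ≤ Xi a l * (σ ^ 2 * L))
    (hK : carterK a l ω m s = 0) : 0 < L := by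
  refine hL.lt_of_ne' fun h0 => ?_
  rw [h0, mul_zero, mul_zero] at hle
  have h1 : Xi a l * m = a * ω * σ ^ 2 := by nlinarith [sq_nonneg (Xi a l * m - a * ω * σ ^ 2)]
  have h2 : ω * (s ^ 2 + a ^ 2 * (1 - σ ^ 2)) = 0 := by
    have : a * Xi a l * m = a * (a * ω * σ ^ 2) := by rw [← h1]; ring
    unfold carterK at hK
    rw [this] at hK
    linear_combination hK
  have h3 : 0 < s ^ 2 + a ^ 2 * (1 - σ ^ 2) := by
    have : σ ^ 2 ≤ 1 := by nlinarith
    have : 0 ≤ a ^ 2 * (1 - σ ^ 2) := mul_nonneg (sq_nonneg a) (by linarith)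
    positivity
  have h4 : ω = 0 := (mul_eq_zero.1 h2).resolve_right h3.ne'
  have hX : Xi a l ≠ 0 := by have := one_le_Xi a l; positivity
  rw [h4] at h1 h
  have h5 : m = 0 := by simpa [hX] using h1
  rw [h5, h0] at h
  norm_num at h

/-- If `K` vanishes at some radius `t` between the horizons, then the principal part has no critical
point where it is nonnegative. -/
theorem Horizons.principalGD_ne_zero {a M l p q s ω m L t r : ℝ} (hh : Horizons a M l p q s)
    (ht : t ∈ Icc p q) (hK : carterK a l ω m t = 0) (hL : 0 < L) :
    principalGD a M l ω m L p < 0 ∧ 0 < principalGD a M l ω m L q ∧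
      (r ∈ Icc p q → 0 ≤ principalG a M l ω m L r → principalGD a M l ω m L r ≠ 0) := by
  have hp := hh.p_pos
  have hq := hh.q_pos
  have hKr : ∀ r, carterK a l ω m r = ω * (r ^ 2 - t ^ 2) := fun r => by
    have : carterK a l ω m r = carterK a l ω m r - carterK a l ω m t := by rw [hK, sub_zero]
    rw [this]; unfold carterK; ring
  have hleft : principalGD a M l ω m L p < 0 := by
    unfold principalGD
    rw [hKr]
    have h1 := mul_pos hh.DeltaD_left_pos hL
    have h2 : 0 ≤ 4 * ω ^ 2 * p * (t ^ 2 - p ^ 2) :=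
      mul_nonneg (by positivity) (by nlinarith [ht.1])
    nlinarith
  have hright : 0 < principalGD a M l ω m L q := by
    unfold principalGD
    rw [hKr]
    have h1 := mul_pos (neg_pos.2 hh.DeltaD_right_neg) hL
    have h2 : 0 ≤ 4 * ω ^ 2 * q * (q ^ 2 - t ^ 2) :=
      mul_nonneg (by positivity) (by nlinarith [ht.2, ht.1])
    nlinarith
  refine ⟨hleft, hright, fun hr hG h0 => ?_⟩
  rcases eq_or_lt_of_le hr.1 with e | hr1
  · rw [← e] at h0; exact hleft.ne h0
  rcases eq_or_lt_of_le hr.2 with e | hr2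
  · rw [e] at h0; exact hright.ne' h0
  have hΔ := hh.Delta_pos ⟨hr1, hr2⟩
  have hr0 : 0 < r := hp.trans hr1
  have g1 := hh.left_gap ⟨hr1, hr2⟩
  have g2 := hh.right_gap ⟨hr1, hr2⟩
  unfold principalG at hG
  unfold principalGD at h0
  rw [hKr] at hG h0
  -- at a critical point `(r² - t²) Δ' L = 4 r ω² (r² - t²)² ≥ 4 r Δ L`
  have key : 4 * r * (Delta a M l r * L) ≤ (r ^ 2 - t ^ 2) * DeltaD a M l r * L := by
    have e : (r ^ 2 - t ^ 2) * DeltaD a M l r * L = 4 * r * (ω * (r ^ 2 - t ^ 2)) ^ 2 := by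
      linear_combination (-(r ^ 2 - t ^ 2)) * h0
    rw [e]
    exact mul_le_mul_of_nonneg_left (by linarith) (by positivity)
  have key2 : 4 * r * Delta a M l r ≤ (r ^ 2 - t ^ 2) * DeltaD a M l r := by
    by_contra hc
    push Not at hc
    have := mul_lt_mul_of_pos_right hc hL
    linarith
  have hpos : 0 < (r ^ 2 - t ^ 2) * DeltaD a M l r := by
    have : 0 < 4 * r * Delta a M l r := by positivity
    linarith
  rcases pos_and_pos_or_neg_and_neg_of_mul_pos hpos with ⟨h1, h2⟩ | ⟨h1, h2⟩
  · have : (r ^ 2 - t ^ 2) * DeltaD a M l r ≤ (r ^ 2 - p ^ 2) * DeltaD a M l r :=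
      mul_le_mul_of_nonneg_right (by nlinarith [ht.1]) h2.le
    linarith
  · have : (r ^ 2 - t ^ 2) * DeltaD a M l r ≤ -((q ^ 2 - r ^ 2) * DeltaD a M l r) := by
      have : (q ^ 2 - t ^ 2) * DeltaD a M l r ≤ 0 :=
        mul_nonpos_of_nonneg_of_nonpos (by nlinarith [ht.1, ht.2]) h2.le
      linarith
    linarith

/-- Quantitative form of the absence of superradiant trapping: when `K` is small somewhere, the
principal part has no critical point outside the barrier, and a barrier exists. -/
theorem Horizons.exists_separation {a M l p q s : ℝ} (hh : Horizons a M l p q s) :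
    ∃ η > 0, ∀ ω m L, IsAdmissible a l ω m L → ω ^ 2 + m ^ 2 + L = 1 →
      ∀ t ∈ Icc p q, |carterK a l ω m t| < η →
        principalGD a M l ω m L p ≤ -η ∧ η ≤ principalGD a M l ω m L q ∧
        ∀ r ∈ Icc p q, -η ≤ principalG a M l ω m L r → η ≤ |principalGD a M l ω m L r| := by
  have hc : IsCompact (unitFrequencies a l ×ˢ (Icc p q ×ˢ Icc p q)) :=
    (isCompact_unitFrequencies a l).prod (isCompact_Icc.prod isCompact_Icc)
  set f : (ℝ × ℝ × ℝ × ℝ) × ℝ × ℝ → ℝ := fun z => max |carterK a l z.1.1 z.1.2.1 z.2.1|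
    (min (min (-principalGD a M l z.1.1 z.1.2.1 z.1.2.2.1 p)
      (principalGD a M l z.1.1 z.1.2.1 z.1.2.2.1 q))
      (max (-principalG a M l z.1.1 z.1.2.1 z.1.2.2.1 z.2.2)
        |principalGD a M l z.1.1 z.1.2.1 z.1.2.2.1 z.2.2|)) with hf
  have hfc : Continuous f := by
    simp only [hf, principalG, principalGD, carterK]
    fun_prop
  obtain ⟨η, hη, hle⟩ := exists_pos_le_of_isCompact hc hfc.continuousOn (by
    rintro ⟨⟨ω, m, L, σ⟩, t, r⟩ ⟨⟨h1, h2, h3, h4, h5⟩, ht, hr⟩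
    simp only at h1 h2 h3 h4 h5 ht hr
    simp only [hf, lt_max_iff, lt_min_iff]
    by_cases hK : carterK a l ω m t = 0
    · right
      have hL := pos_of_carterK_eq_zero (hh.pos_of_mem ht) h1 h2 h3 h4 h5 hK
      obtain ⟨g1, g2, g3⟩ := hh.principalGD_ne_zero (r := r) ht hK hL
      refine ⟨⟨by linarith, g2⟩, ?_⟩
      by_cases hG : 0 ≤ principalG a M l ω m L r
      · exact Or.inr (abs_pos.2 (g3 hr hG))
      · left; push Not at hG; linarith
    · exact Or.inl (abs_pos.2 hK))
  refine ⟨η / 2, by positivity, fun ω m L had h1 t ht hK => ?_⟩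
  obtain ⟨hL, σ, hσ, hσle⟩ := had
  have key : ∀ r ∈ Icc p q, (η ≤ -principalGD a M l ω m L p ∧ η ≤ principalGD a M l ω m L q) ∧
      (η ≤ -principalG a M l ω m L r ∨ η ≤ |principalGD a M l ω m L r|) := by
    intro r hr
    have := hle ((ω, m, L, σ), t, r) ⟨⟨h1, hL, hσ.1, hσ.2, hσle⟩, ht, hr⟩
    simp only [hf, le_max_iff, le_min_iff] at this
    rcases this with h | h
    · linarith
    · exact h
  have k0 := (key p (left_mem_Icc.2 hh.p_lt.le)).1
  refine ⟨by linarith, by linarith, fun r hr hG => ?_⟩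
  rcases (key r hr).2 with h | h <;> linarith

/-! ### Frequencies with a barrier -/

set_option maxHeartbeats 1000000 in
/-- Exponential weights: for `x = g`, `y = g'`, `z = g''` the two expressions are the coefficients
that the multipliers `f = β g' e^{βg}` and `k = s₀ e^{-γg}` produce. -/
theorem exists_exponential_weights {η C : ℝ} (hη : 0 < η) (hC : 1 ≤ C) :
    ∃ β > 0, ∃ s₀ > 0, ∃ c > 0, ∀ M : ℝ, ∃ γ > 0, ∀ x y z : ℝ, |x| ≤ C → |y| ≤ C → |z| ≤ C →
      (-η ≤ x → η ≤ |y|) →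
      (c ≤ (β * z + β ^ 2 * y ^ 2) * exp (β * x) + s₀ * exp (-γ * x) ∧
        c ≤ ((β * z + β ^ 2 * y ^ 2) * x + β * y ^ 2) * exp (β * x)
          - s₀ * exp (-γ * x) * x) ∧
      (x ≤ -(η / 2) →
        M ≤ (β * z + β ^ 2 * y ^ 2) * exp (β * x) + s₀ * exp (-γ * x) ∧
        M ≤ ((β * z + β ^ 2 * y ^ 2) * x + β * y ^ 2) * exp (β * x)
          - s₀ * exp (-γ * x) * x) := by
  have hC0 : 0 < C := by linarith
  set β := 2 * C / η ^ 2 with hβ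
  have hβ0 : 0 < β := by positivity
  have hβη : β * η ^ 2 = 2 * C := by rw [hβ]; field_simp
  set s₀ := β * C
  have hs0 : 0 < s₀ := by positivity
  set x₀ := min (min (1 / (2 * β)) (η ^ 2 / (4 * C))) (η / 2) with hx₀
  have hx0 : 0 < x₀ := by simp only [hx₀, lt_min_iff]; exact ⟨⟨by positivity, by positivity⟩, by positivity⟩
  have hx1 : x₀ ≤ 1 / (2 * β) := (min_le_left _ _).trans (min_le_left _ _)
  have hx2 : x₀ ≤ η ^ 2 / (4 * C) := (min_le_left _ _).trans (min_le_right _ _)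
  have hx3 : x₀ ≤ η / 2 := min_le_right _ _
  set c := min (β * C / 2) (β * η ^ 2 / 8) with hc
  have hc0 : 0 < c := by simp only [hc, lt_min_iff]; exact ⟨by positivity, by positivity⟩
  have hc1 : c ≤ β * C / 2 := min_le_left _ _
  have hc2 : c ≤ β * η ^ 2 / 8 := min_le_right _ _
  refine ⟨β, hβ0, s₀, hs0, c, hc0, fun M => ?_⟩
  set R := |M| + c + β * C + (β * C + β ^ 2 * C ^ 2) * C
  have hR0 : 0 < R := by
    have := abs_nonneg M
    positivity
  set γ := R / (s₀ * x₀) * (1 / x₀ + 1) with hγ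
  have hγ0 : 0 < γ := by positivity
  have hexp : ∀ x, x ≤ -x₀ → R ≤ s₀ * exp (-γ * x) ∧ R ≤ -(s₀ * exp (-γ * x) * x) := by
    intro x hx
    have h1 : γ * x₀ + 1 ≤ exp (-γ * x) :=
      (add_one_le_exp _).trans (exp_le_exp.2 (by
        have := mul_le_mul_of_nonneg_left hx hγ0.le; linarith))
    have h2 : γ * x₀ = R / (s₀ * x₀) + R / s₀ := by rw [hγ]; field_simp
    have h3 : 0 < R / (s₀ * x₀) := by positivity
    have h4 : 0 < R / s₀ := by positivity
    constructor
    · have : R = s₀ * (R / s₀) := by field_simp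
      rw [this]
      exact mul_le_mul_of_nonneg_left (by linarith) hs0.le
    · have e : R = s₀ * (R / (s₀ * x₀)) * x₀ := by field_simp
      have : s₀ * (R / (s₀ * x₀)) * x₀ ≤ s₀ * exp (-γ * x) * (-x) := by
        refine mul_le_mul ?_ (by linarith) hx0.le (by positivity)
        exact mul_le_mul_of_nonneg_left (by linarith) hs0.le
      linarith
  refine ⟨γ, hγ0, fun x y z hx hy hz hxy => ?_⟩
  have hy2 : y ^ 2 ≤ C ^ 2 := sq_le_sq' (by linarith [(abs_le.1 hy).1]) (abs_le.1 hy).2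
  have hbarrier : x ≤ -x₀ →
      |M| + c ≤ (β * z + β ^ 2 * y ^ 2) * exp (β * x) + s₀ * exp (-γ * x) ∧
      |M| + c ≤ ((β * z + β ^ 2 * y ^ 2) * x + β * y ^ 2) * exp (β * x)
          - s₀ * exp (-γ * x) * x := by
    intro hx'
    obtain ⟨e1, e2⟩ := hexp x hx'
    have he : exp (β * x) ≤ 1 := exp_le_one_iff.2
      (mul_nonpos_of_nonneg_of_nonpos hβ0.le (by linarith))
    have he0 := exp_pos (β * x)
    have n1 : -(β * C) ≤ β * z + β ^ 2 * y ^ 2 := by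
      have : β * (-C) ≤ β * z := mul_le_mul_of_nonneg_left (abs_le.1 hz).1 hβ0.le
      have : 0 ≤ β ^ 2 * y ^ 2 := by positivity
      linarith
    have n2 : β * z + β ^ 2 * y ^ 2 ≤ β * C + β ^ 2 * C ^ 2 := by
      have : β * z ≤ β * C := mul_le_mul_of_nonneg_left (abs_le.1 hz).2 hβ0.le
      have : β ^ 2 * y ^ 2 ≤ β ^ 2 * C ^ 2 := mul_le_mul_of_nonneg_left hy2 (sq_nonneg β)
      linarith
    have n3 : -(β * C) ≤ (β * z + β ^ 2 * y ^ 2) * exp (β * x) := by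
      have h0 : 0 ≤ β * C := by positivity
      have m2 : -(β * C) * exp (β * x) ≤ (β * z + β ^ 2 * y ^ 2) * exp (β * x) :=
        mul_le_mul_of_nonneg_right n1 he0.le
      have m3 := mul_le_mul_of_nonneg_left he h0
      linarith
    have h0 : 0 ≤ (β * C + β ^ 2 * C ^ 2) * C := by positivity
    have n4 : -((β * C + β ^ 2 * C ^ 2) * C) ≤
        ((β * z + β ^ 2 * y ^ 2) * x + β * y ^ 2) * exp (β * x) := by
      have m1 : -((β * C + β ^ 2 * C ^ 2) * C) ≤ (β * z + β ^ 2 * y ^ 2) * x + β * y ^ 2 := by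
        have : (β * z + β ^ 2 * y ^ 2) * (-x) ≤ (β * C + β ^ 2 * C ^ 2) * C := by
          calc (β * z + β ^ 2 * y ^ 2) * (-x) ≤ (β * C + β ^ 2 * C ^ 2) * (-x) :=
                mul_le_mul_of_nonneg_right n2 (by linarith)
            _ ≤ _ := mul_le_mul_of_nonneg_left (by linarith [(abs_le.1 hx).1]) (by positivity)
        have : 0 ≤ β * y ^ 2 := by positivity
        linarith
      have m2 := mul_le_mul_of_nonneg_right m1 he0.le
      have m3 := mul_le_mul_of_nonneg_left he h0
      linarith
    constructor <;> linarith
  constructor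
  · by_cases h1 : x ≤ -x₀
    · have := hbarrier h1
      have := abs_nonneg M
      constructor <;> linarith
    push Not at h1
    have hyη : η ^ 2 ≤ y ^ 2 := by
      rw [← sq_abs y]; exact pow_le_pow_left₀ hη.le (hxy (by linarith)) 2
    -- `β g'² ≥ β η² = 2C` absorbs `g''`
    have hA : β * C ≤ β * z + β ^ 2 * y ^ 2 := by
      have i1 : β * (-C) ≤ β * z := mul_le_mul_of_nonneg_left (abs_le.1 hz).1 hβ0.le
      have i2 : β ^ 2 * η ^ 2 ≤ β ^ 2 * y ^ 2 := mul_le_mul_of_nonneg_left hyη (sq_nonneg β)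
      have i3 : β ^ 2 * η ^ 2 = 2 * (β * C) := by linear_combination β * hβη
      linarith
    have hβy : β * η ^ 2 ≤ β * y ^ 2 := mul_le_mul_of_nonneg_left hyη hβ0.le
    by_cases h2 : 0 ≤ x
    · have he : 1 ≤ exp (β * x) := one_le_exp (by positivity)
      have he' : exp (-γ * x) ≤ 1 := exp_le_one_iff.2 (by
        have := mul_nonneg hγ0.le h2; linarith)
      have hkpos : 0 < s₀ * exp (-γ * x) := by positivity
      have hk : s₀ * exp (-γ * x) * x ≤ β * C * x := by
        refine mul_le_mul_of_nonneg_right ?_ h2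
        have := mul_le_mul_of_nonneg_left he' hs0.le
        linarith
      have hβC : 0 < β * C := by positivity
      constructor
      · have : β * C * 1 ≤ (β * z + β ^ 2 * y ^ 2) * exp (β * x) :=
          mul_le_mul hA he zero_le_one (by linarith)
        linarith
      · have i1 : β * C * x + β * η ^ 2 ≤ (β * z + β ^ 2 * y ^ 2) * x + β * y ^ 2 :=
          add_le_add (mul_le_mul_of_nonneg_right hA h2) hβy
        have i0 : 0 ≤ β * C * x + β * η ^ 2 := by positivity
        have : (β * C * x + β * η ^ 2) * 1 ≤
            ((β * z + β ^ 2 * y ^ 2) * x + β * y ^ 2) * exp (β * x) :=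
          mul_le_mul i1 he zero_le_one (by linarith)
        have : 0 < β * η ^ 2 := by positivity
        linarith
    · push Not at h2
      have hβx : -(1 / 2) ≤ β * x := by
        have : β * x₀ ≤ β * (1 / (2 * β)) := mul_le_mul_of_nonneg_left hx1 hβ0.le
        have e : β * (1 / (2 * β)) = 1 / 2 := by field_simp
        have := mul_le_mul_of_nonneg_left h1.le hβ0.le
        linarith
      have he : 1 / 2 ≤ exp (β * x) := by
        have := add_one_le_exp (β * x); linarith
      have hk0 : 0 < s₀ * exp (-γ * x) := by positivity
      have hβC : 0 < β * C := by positivity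
      constructor
      · have : β * C * (1 / 2) ≤ (β * z + β ^ 2 * y ^ 2) * exp (β * x) :=
          mul_le_mul hA he (by norm_num) (by linarith)
        linarith
      · have i1 : β * η ^ 2 / 4 ≤ (β * z + β ^ 2 * y ^ 2) * x + β * y ^ 2 := by
          have j1 : β * z * x ≥ -(β * η ^ 2 / 4) := by
            have : |z * x| ≤ C * x₀ := by
              rw [abs_mul]
              exact mul_le_mul hz (by rw [abs_of_neg h2]; linarith) (abs_nonneg _) hC0.le
            have h3 : C * x₀ ≤ C * (η ^ 2 / (4 * C)) := mul_le_mul_of_nonneg_left hx2 hC0.le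
            have e : C * (η ^ 2 / (4 * C)) = η ^ 2 / 4 := by field_simp
            have h4 := (abs_le.1 (this.trans (h3.trans_eq e))).1
            have : β * (-(η ^ 2 / 4)) ≤ β * (z * x) := mul_le_mul_of_nonneg_left h4 hβ0.le
            linarith
          have j2 : β * y ^ 2 * (1 / 2) ≤ β * y ^ 2 * (1 + β * x) :=
            mul_le_mul_of_nonneg_left (by linarith) (by positivity)
          linarith
        have : β * η ^ 2 / 4 * (1 / 2) ≤
            ((β * z + β ^ 2 * y ^ 2) * x + β * y ^ 2) * exp (β * x) :=
          mul_le_mul i1 he (by norm_num) (le_trans (by positivity) i1)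
        have : s₀ * exp (-γ * x) * x ≤ 0 := mul_nonpos_of_nonneg_of_nonpos hk0.le h2.le
        linarith
  · intro hx'
    have := hbarrier (by linarith)
    have := le_abs_self M
    constructor <;> linarith

/-- Lower bound for the multiplier density; the terms that do not grow with the frequency are
collected in the constant `D`. -/
theorem Horizons.exists_multiplierDensity_ge {a M l p q s : ℝ} (hh : Horizons a M l p q s)
    (musq : ℝ) : ∃ D ≥ 1, ∀ (ω m L Y δ : ℝ) (f f₁ k k₁ k₂ ε ε₁ : ℝ → ℝ) (Ψ w F : ℝ → ℂ),
      0 < δ → ∀ r ∈ Icc p q, |f r| ≤ Y → |f₁ r| ≤ Y → |k r| ≤ Y → |k₁ r| ≤ Y → |k₂ r| ≤ Y →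
      (f₁ r + k r - δ) * ‖w r‖ ^ 2
        + (f₁ r * principalG a M l ω m L r + f r * principalGD a M l ω m L r
          - k r * principalG a M l ω m L r - D * Y - 1
          + (DeltaD a M l r * ε r + Delta a M l r * ε₁ r)) * ‖Ψ r‖ ^ 2
        + 2 * ε r * inner ℝ (Ψ r) (w r)
      ≤ RadialSolution.multiplierDensity a M l musq ω m L f f₁ k k₁ k₂ ε ε₁ Ψ w F r
        + (Y ^ 2 / δ + (D * Y) ^ 2) * ‖F r‖ ^ 2 := by
  have hb : ∀ g : ℝ → ℝ, Continuous g → ∃ B ≥ 0, ∀ r ∈ Icc p q, |g r| ≤ B := by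
    intro g hg
    obtain ⟨B, hB⟩ := isCompact_Icc.exists_bound_of_continuousOn (s := Icc p q) hg.continuousOn
    exact ⟨B, (norm_nonneg _).trans (hB p (left_mem_Icc.2 hh.p_lt.le)), hB⟩
  obtain ⟨b1, n1, h1⟩ := hb (fun r => Delta a M l r * (musq * (r ^ 2 + a ^ 2))) (by fun_prop)
  obtain ⟨b2, n2, h2⟩ := hb (fun r => DeltaD a M l r * (musq * (r ^ 2 + a ^ 2))
    + Delta a M l r * (musq * (2 * r))) (by fun_prop)
  obtain ⟨b3, n3, h3⟩ := hb (fun r => 1 / 2 * (DeltaD a M l r ^ 2 + Delta a M l r * DeltaDD a l r))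
    (by fun_prop)
  obtain ⟨b4, n4, h4⟩ := hb (fun r => 3 / 2 * (DeltaD a M l r * Delta a M l r)) (by fun_prop)
  obtain ⟨b5, n5, h5⟩ := hb (fun r => 1 / 2 * Delta a M l r ^ 2) (by fun_prop)
  obtain ⟨b6, n6, h6⟩ := hb (Delta a M l) (by fun_prop)
  refine ⟨1 + (2 * b1 + b2 + b3 + b4 + b5) + b6, by linarith, ?_⟩
  intro ω m L Y δ f f₁ k k₁ k₂ ε ε₁ Ψ w F hδ r hr hf hf₁ hk hk₁ hk₂
  set D := 1 + (2 * b1 + b2 + b3 + b4 + b5) + b6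
  have hY : 0 ≤ Y := (abs_nonneg _).trans hf
  have pr : ∀ {x y X Z : ℝ}, |x| ≤ X → |y| ≤ Z → -(X * Z) ≤ x * y := by
    intro x y X Z hx hy
    have h1 : |x * y| ≤ X * Z := by
      rw [abs_mul]; exact mul_le_mul hx hy (abs_nonneg _) ((abs_nonneg _).trans hx)
    exact (abs_le.1 h1).1
  have e1 := pr (h1 r hr) (by rw [abs_neg]; exact hf₁ : |-f₁ r| ≤ Y)
  have e1' := pr (h1 r hr) hk
  have e2 := pr (h2 r hr) (by rw [abs_neg]; exact hf : |-f r| ≤ Y)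
  have e3 := pr (h3 r hr) (by rw [abs_neg]; exact hk : |-k r| ≤ Y)
  have e4 := pr (h4 r hr) (by rw [abs_neg]; exact hk₁ : |-k₁ r| ≤ Y)
  have e5 := pr (h5 r hr) (by rw [abs_neg]; exact hk₂ : |-k₂ r| ≤ Y)
  have hcoef : f₁ r * principalG a M l ω m L r + f r * principalGD a M l ω m L r
          - k r * principalG a M l ω m L r - D * Y
        ≤ f₁ r * radialG a M l musq ω m L r
      + f r * (2 * carterK a l ω m r * (2 * ω * r) - DeltaD a M l r * (L + musq * (r ^ 2 + a ^ 2))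
        - Delta a M l r * (musq * (2 * r)))
      - k r * radialG a M l musq ω m L r
      - 1 / 2 * (DeltaD a M l r * (DeltaD a M l r * k r + Delta a M l r * k₁ r)
        + Delta a M l r * (DeltaDD a l r * k r + 2 * (DeltaD a M l r * k₁ r)
          + Delta a M l r * k₂ r)) := by
    have hDY : (2 * b1 + b2 + b3 + b4 + b5) * Y ≤ D * Y :=
      mul_le_mul_of_nonneg_right (by linarith) hY
    have e : f₁ r * radialG a M l musq ω m L r
      + f r * (2 * carterK a l ω m r * (2 * ω * r) - DeltaD a M l r * (L + musq * (r ^ 2 + a ^ 2))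
        - Delta a M l r * (musq * (2 * r)))
      - k r * radialG a M l musq ω m L r
      - 1 / 2 * (DeltaD a M l r * (DeltaD a M l r * k r + Delta a M l r * k₁ r)
        + Delta a M l r * (DeltaDD a l r * k r + 2 * (DeltaD a M l r * k₁ r)
          + Delta a M l r * k₂ r))
      = f₁ r * principalG a M l ω m L r + f r * principalGD a M l ω m L r
          - k r * principalG a M l ω m L r
        + (Delta a M l r * (musq * (r ^ 2 + a ^ 2)) * -f₁ r
          + Delta a M l r * (musq * (r ^ 2 + a ^ 2)) * k r
          + (DeltaD a M l r * (musq * (r ^ 2 + a ^ 2)) + Delta a M l r * (musq * (2 * r))) * -f r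
          + 1 / 2 * (DeltaD a M l r ^ 2 + Delta a M l r * DeltaDD a l r) * -k r
          + 3 / 2 * (DeltaD a M l r * Delta a M l r) * -k₁ r
          + 1 / 2 * Delta a M l r ^ 2 * -k₂ r) := by
      unfold principalG principalGD radialG; ring
    rw [e]
    clear e
    linarith only [e1, e1', e2, e3, e4, e5, hDY]
  have cw : -(δ * ‖w r‖ ^ 2) - Y ^ 2 / δ * ‖F r‖ ^ 2 ≤ 2 * f r * inner ℝ (w r) (F r) := by
    have i1 : |f r * inner ℝ (w r) (F r)| ≤ Y * (‖w r‖ * ‖F r‖) := by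
      rw [abs_mul]
      exact mul_le_mul hf (abs_real_inner_le_norm _ _) (abs_nonneg _) hY
    have i2 : 2 * (Y * (‖w r‖ * ‖F r‖)) ≤ δ * ‖w r‖ ^ 2 + Y ^ 2 / δ * ‖F r‖ ^ 2 := by
      have e : δ * ‖w r‖ ^ 2 + Y ^ 2 / δ * ‖F r‖ ^ 2 - 2 * (Y * (‖w r‖ * ‖F r‖))
          = (δ * ‖w r‖ - Y * ‖F r‖) ^ 2 / δ := by field_simp; ring
      have : 0 ≤ (δ * ‖w r‖ - Y * ‖F r‖) ^ 2 / δ := by positivity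
      linarith
    have := (abs_le.1 i1).1
    linarith
  have cp : -(‖Ψ r‖ ^ 2) - (D * Y) ^ 2 * ‖F r‖ ^ 2
      ≤ Delta a M l r * k r * inner ℝ (Ψ r) (F r) := by
    have i0 : |Delta a M l r * k r| ≤ D * Y := by
      rw [abs_mul]
      exact mul_le_mul ((h6 r hr).trans (by linarith)) hk (abs_nonneg _) (by linarith)
    have i1 : |Delta a M l r * k r * inner ℝ (Ψ r) (F r)| ≤ D * Y * (‖Ψ r‖ * ‖F r‖) := by
      rw [abs_mul]
      exact mul_le_mul i0 (abs_real_inner_le_norm _ _) (abs_nonneg _) (by positivity)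
    have i2 := (abs_le.1 i1).1
    have i3 : ∀ x y z : ℝ, z * (x * y) ≤ x ^ 2 + z ^ 2 * y ^ 2 := fun x y z => by
      nlinarith [sq_nonneg (x - z * y), sq_nonneg x, sq_nonneg (z * y)]
    have i4 := i3 ‖Ψ r‖ ‖F r‖ (D * Y)
    linarith only [i2, i4]
  have hm := mul_le_mul_of_nonneg_right hcoef (sq_nonneg ‖Ψ r‖)
  unfold RadialSolution.multiplierDensity
  linarith only [hm, cp, cw]

/-- The boundary terms are controlled by the solution on the support of `φ`. -/
theorem RadialSolution.boundary_le {a M l musq ω m L p q s P Q : ℝ} {Ψ w F : ℝ → ℂ}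
    (h : RadialSolution a M l musq ω m L p q Ψ w F P Q) (hh : Horizons a M l p q s)
    {φ : ℝ → ℝ} (hφ : Continuous φ) (hφ0 : ∀ r, 0 ≤ φ r) {κ : ℝ} (hκ : 0 < κ)
    (hκφ : κ ≤ ∫ r in p..q, φ r) {N C τ : ℝ} (hN : 0 < N) (hτ : 0 < τ)
    (hKp : |carterK a l ω m p| ≤ C * N) (hKq : |carterK a l ω m q| ≤ C * N) :
    carterK a l ω m q ^ 2 * Q + carterK a l ω m p ^ 2 * P ≤
      ∫ r in p..q, (C / κ * φ r * (‖w r‖ ^ 2 + N ^ 2 * ‖Ψ r‖ ^ 2) + τ * (N ^ 2 * ‖Ψ r‖ ^ 2)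
        + C ^ 2 / τ * ‖F r‖ ^ 2) := by
  have hpq := hh.p_lt
  have hC : 0 ≤ C := by
    by_contra hc
    push Not at hc
    have := mul_neg_of_neg_of_pos hc hN
    linarith [abs_nonneg (carterK a l ω m p)]
  set κ' := ∫ r in p..q, φ r
  have hκ'0 : 0 < κ' := hκ.trans_le hκφ
  set χ : ℝ → ℝ := fun r => (∫ t in p..r, φ t) / κ' with hχ
  have hχd : ∀ r, HasDerivAt χ (φ r / κ') r := fun r =>
    (intervalIntegral.integral_hasDerivAt_right (hφ.intervalIntegrable _ _)
      hφ.aestronglyMeasurable.stronglyMeasurableAtFilter hφ.continuousAt).div_const _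
  have hχp : χ p = 0 := by simp [hχ]
  have hχq : χ q = 1 := by simp only [hχ]; exact div_self hκ'0.ne'
  have hχ01 : ∀ r ∈ Icc p q, 0 ≤ χ r ∧ χ r ≤ 1 := by
    intro r hr
    have i1 : 0 ≤ ∫ t in p..r, φ t :=
      intervalIntegral.integral_nonneg hr.1 fun t _ => hφ0 t
    have i2 : ∫ t in p..r, φ t ≤ κ' :=
      intervalIntegral.integral_mono_interval le_rfl hr.1 hr.2
        (.of_forall fun t => hφ0 t) (hφ.intervalIntegrable _ _)
    exact ⟨div_nonneg i1 hκ'0.le, (div_le_one hκ'0).2 i2⟩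
  have hφc : Continuous fun r => φ r / κ' := hφ.div_const _
  have id1 := h.energy_identity hpq hχd hφc
  have id2 := h.energy_identity hpq (χ := fun r => χ r - 1) (fun r => (hχd r).sub_const 1) hφc
  rw [hχp, hχq] at id1
  rw [hχp, hχq] at id2
  have hχc : Continuous χ := continuous_iff_continuousAt.2 fun r => (hχd r).continuousAt
  have in1 := ((h.integrable_cross hpq.le hφc.continuousOn).add
    (h.integrable_source_flux hpq.le hχc.continuousOn)).const_mul (carterK a l ω m q)
  have in2 := ((h.integrable_cross hpq.le hφc.continuousOn).add
    (h.integrable_source_flux hpq.le (χ := fun r => χ r - 1)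
      (by fun_prop))).const_mul (-carterK a l ω m p)
  have in3 : IntervalIntegrable (fun r => C / κ * φ r * (‖w r‖ ^ 2 + N ^ 2 * ‖Ψ r‖ ^ 2)
      + τ * (N ^ 2 * ‖Ψ r‖ ^ 2) + C ^ 2 / τ * ‖F r‖ ^ 2) volume p q := by
    have := (h.integrable_sq hpq.le (φ := fun r => C / κ * φ r)
      (ψ := fun r => C / κ * φ r * N ^ 2 + τ * N ^ 2) (by fun_prop) (by fun_prop)).add
      ((h.sourceIntervalIntegrable hpq.le).const_mul (C ^ 2 / τ))
    refine this.congr fun r _ => ?_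
    ring
  have hle := intervalIntegral.integral_mono_on_of_le_Ioo hpq.le (in1.add in2) in3 (by
    intro r hr
    have hr' : r ∈ Icc p q := ⟨hr.1.le, hr.2.le⟩
    obtain ⟨c0, c1⟩ := hχ01 r hr'
    have hφr := hφ0 r
    set X := ‖Ψ r‖
    set Z := ‖w r‖
    set V := ‖F r‖
    have iw : |inner ℝ (I * Ψ r) (w r)| ≤ X * Z := by
      refine (abs_real_inner_le_norm _ _).trans_eq ?_
      rw [norm_mul, norm_I, one_mul]
    have iF : |inner ℝ (I * Ψ r) (F r)| ≤ X * V := by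
      refine (abs_real_inner_le_norm _ _).trans_eq ?_
      rw [norm_mul, norm_I, one_mul]
    have bound : ∀ K χ₁ : ℝ, |K| ≤ C * N → |χ₁| ≤ 1 →
        K * (φ r / κ' * inner ℝ (I * Ψ r) (w r)
          + χ₁ * inner ℝ (I * Ψ r) (F r)) ≤ C * N * (φ r / κ * (X * Z) + X * V) := by
      intro K χ₁ hK hχ₁
      refine (le_abs_self _).trans ?_
      rw [abs_mul]
      refine mul_le_mul hK ?_ (abs_nonneg _) (by positivity)
      refine (abs_add_le _ _).trans (add_le_add ?_ ?_)
      · rw [abs_mul, abs_of_nonneg (by positivity)]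
        refine mul_le_mul ?_ iw (abs_nonneg _) (by positivity)
        exact div_le_div_of_nonneg_left hφr hκ hκφ
      · rw [abs_mul]
        calc |χ₁| * |inner ℝ (I * Ψ r) (F r)| ≤ 1 * (X * V) :=
              mul_le_mul hχ₁ iF (abs_nonneg _) zero_le_one
          _ = _ := one_mul _
    have b1 := bound _ (χ r) hKq (by rw [abs_of_nonneg c0]; exact c1)
    have b2 := bound (-carterK a l ω m p) (χ r - 1) (by rw [abs_neg]; exact hKp)
      (by rw [abs_le]; constructor <;> linarith)
    have s1 : 2 * (N * X * Z) ≤ Z ^ 2 + N ^ 2 * X ^ 2 := by nlinarith [sq_nonneg (Z - N * X)]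
    have s2 : 2 * (C * N * X * V) ≤ τ * (N ^ 2 * X ^ 2) + C ^ 2 / τ * V ^ 2 := by
      have e : τ * (N ^ 2 * X ^ 2) + C ^ 2 / τ * V ^ 2 - 2 * (C * N * X * V)
          = (τ * (N * X) - C * V) ^ 2 / τ := by field_simp; ring
      have : 0 ≤ (τ * (N * X) - C * V) ^ 2 / τ := by positivity
      linarith
    have s3 := mul_le_mul_of_nonneg_left s1 (by positivity : 0 ≤ C / κ * φ r)
    have e : 2 * (C * N * (φ r / κ * (X * Z) + X * V))
        = C / κ * φ r * (2 * (N * X * Z)) + 2 * (C * N * X * V) := by ring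
    calc _ ≤ 2 * (C * N * (φ r / κ * (X * Z) + X * V)) := by linarith
      _ ≤ _ := by rw [e]; linarith)
  rw [intervalIntegral.integral_add in1 in2, intervalIntegral.integral_const_mul,
    intervalIntegral.integral_const_mul, id1, id2] at hle
  linarith

theorem carterK_scale (a l ω m N r : ℝ) :
    carterK a l (N * ω) (N * m) r = N * carterK a l ω m r := by unfold carterK; ring

theorem principalG_scale (a M l ω m L N r : ℝ) :
    principalG a M l (N * ω) (N * m) (N ^ 2 * L) r = N ^ 2 * principalG a M l ω m L r := by
  unfold principalG; rw [carterK_scale]; ring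

theorem principalGD_scale (a M l ω m L N r : ℝ) :
    principalGD a M l (N * ω) (N * m) (N ^ 2 * L) r = N ^ 2 * principalGD a M l ω m L r := by
  unfold principalGD; rw [carterK_scale]; ring

/-- A well of the principal part: an interval of fixed length on which it is negative. -/
theorem Horizons.exists_well {a M l p q s ω m L η C : ℝ} (hh : Horizons a M l p q s) (hη : 0 < η)
    (hC : 1 ≤ C) (hg : ∀ r ∈ Icc p q, |principalGD a M l ω m L r| ≤ C)
    (hleft : principalGD a M l ω m L p ≤ -η) (hright : η ≤ principalGD a M l ω m L q)
    (hsep : ∀ r ∈ Icc p q, -η ≤ principalG a M l ω m L r → η ≤ |principalGD a M l ω m L r|) :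
    ∃ b, p ≤ b - η / (2 * C) ∧ b + η / (2 * C) ≤ q ∧
      ∀ r ∈ Icc p q, |r - b| ≤ η / (2 * C) → principalG a M l ω m L r ≤ -(η / 2) := by
  have hpq := hh.p_lt
  set g := principalG a M l ω m L
  set g' := principalGD a M l ω m L
  have hC0 : 0 < C := by linarith
  obtain ⟨b, hb, hb0⟩ := intermediate_value_Icc hpq.le
    (continuous_principalGD a M l ω m L).continuousOn
    (show (0 : ℝ) ∈ Icc (g' p) (g' q) from ⟨by linarith, by linarith⟩)
  have hgb : g b < -η := by
    by_contra hc
    push Not at hc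
    have := hsep b hb hc
    change g' b = 0 at hb0
    rw [hb0, abs_zero] at this
    linarith
  have hlip : ∀ r ∈ Icc p q, |g r - g b| ≤ C * |r - b| := fun r hr =>
    (convex_Icc p q).norm_image_sub_le_of_norm_hasDerivWithin_le
      (fun x _ => (hasDerivAt_principalG a M l ω m L x).hasDerivWithinAt) hg hb hr
  have hwell : ∀ r ∈ Icc p q, |r - b| ≤ η / (2 * C) → g r ≤ -(η / 2) := by
    intro r hr hrb
    have h1 := hlip r hr
    have h2 : C * |r - b| ≤ C * (η / (2 * C)) := mul_le_mul_of_nonneg_left hrb hC0.le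
    have e : C * (η / (2 * C)) = η / 2 := by field_simp
    have := (abs_le.1 (h1.trans (h2.trans_eq e))).2
    linarith
  have hgp : 0 ≤ g p := by
    change 0 ≤ carterK a l ω m p ^ 2 - Delta a M l p * L
    rw [hh.Delta_left, zero_mul, sub_zero]; positivity
  have hgq : 0 ≤ g q := by
    change 0 ≤ carterK a l ω m q ^ 2 - Delta a M l q * L
    rw [hh.Delta_right, zero_mul, sub_zero]; positivity
  refine ⟨b, ?_, ?_, hwell⟩
  · by_contra hc
    push Not at hc
    have := hwell p (left_mem_Icc.2 hpq.le) (by rw [abs_of_nonpos (by linarith [hb.1])]; linarith)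
    linarith
  · by_contra hc
    push Not at hc
    have := hwell q (right_mem_Icc.2 hpq.le) (by rw [abs_of_nonneg (by linarith [hb.2])]; linarith)
    linarith

theorem tent_integral_ge {p q b d : ℝ} (hd : 0 < d) (h1 : p ≤ b - d) (h2 : b + d ≤ q) :
    d ^ 2 / 2 ≤ ∫ r in p..q, max 0 (d - |r - b|) := by
  have hc : Continuous fun r : ℝ => max 0 (d - |r - b|) := by fun_prop
  calc d ^ 2 / 2 = ∫ r in (b - d / 2)..(b + d / 2), d / 2 := by
        rw [intervalIntegral.integral_const, smul_eq_mul]; ring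
    _ ≤ ∫ r in (b - d / 2)..(b + d / 2), max 0 (d - |r - b|) := by
        refine intervalIntegral.integral_mono_on (by linarith) (by simp)
          (hc.intervalIntegrable _ _) fun r hr => ?_
        have : |r - b| ≤ d / 2 := by rw [abs_le]; constructor <;> linarith [hr.1, hr.2]
        exact le_max_of_le_right (by linarith)
    _ ≤ _ := intervalIntegral.integral_mono_interval (by linarith) (by linarith) (by linarith)
        (.of_forall fun r => le_max_left _ _) (hc.intervalIntegrable _ _)

set_option maxHeartbeats 1000000 in
/-- The estimate at high frequencies for which `K` is small at some point: these frequencies are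
superradiant or close to it, they are not trapped, and the barrier between the two classically
allowed regions absorbs the boundary terms. -/
theorem Horizons.exists_barrier_estimate {a M l p q s : ℝ} (hh : Horizons a M l p q s)
    (musq : ℝ) : ∃ η > 0, ∃ N₀ > 0, ∃ C > 0, ∀ ω m L, IsAdmissible a l ω m L →
      ω ^ 2 + m ^ 2 + L = 1 → ∀ t ∈ Icc p q, |carterK a l ω m t| < η → ∀ N ≥ N₀,
      ∀ (Ψ w F : ℝ → ℂ) (P Q : ℝ),
        RadialSolution a M l musq (N * ω) (N * m) (N ^ 2 * L) p q Ψ w F P Q →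
        ∫ r in p..q, (‖w r‖ ^ 2 + N ^ 2 * ‖Ψ r‖ ^ 2) ≤ C * ∫ r in p..q, ‖F r‖ ^ 2 := by
  have hpq := hh.p_lt
  obtain ⟨η, hη, hsep⟩ := hh.exists_separation
  obtain ⟨C, hC, hbd⟩ := exists_unit_bound a M l p q
  obtain ⟨D, hD, hmult⟩ := hh.exists_multiplierDensity_ge musq
  obtain ⟨β, hβ, s₀, hs₀, c, hc, hw⟩ := exists_exponential_weights hη hC
  set d := η / (2 * C) with hd
  have hd0 : 0 < d := by positivity
  set κ := d ^ 2 / 2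
  have hκ0 : 0 < κ := by positivity
  -- the bound of `f` does not involve the exponent `γ`
  set Y₀ := β * C * exp (β * C) with hY₀
  have hY₀0 : 0 < Y₀ := by positivity
  set X := 2 * Y₀ * (C / κ) with hX
  have hX0 : 0 < X := by positivity
  obtain ⟨γ, hγ, hγw⟩ := hw (X * d + c)
  set Y₁ := (β * C + β ^ 2 * C ^ 2) * exp (β * C) with hY₁
  set Z := s₀ * exp (γ * C)
  set Y := Y₀ + Y₁ + (1 + γ * C + (γ ^ 2 * C ^ 2 + γ * C)) * Z with hY
  have hY₁0 : 0 < Y₁ := by positivity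
  have hZ0 : 0 < Z := by positivity
  set C₁ := Y ^ 2 / (c / 4) + (D * Y) ^ 2
  set N₀ := √(1 + (D * Y + 1) / (c / 4))
  have hYpos : 0 < Y := by positivity
  have hN₀0 : 0 < N₀ := sqrt_pos.2 (by positivity)
  set τ := c / (8 * Y₀) with hτ
  have hτ0 : 0 < τ := by positivity
  refine ⟨η, hη, N₀, hN₀0, (C₁ + 2 * Y₀ * (C ^ 2 / τ)) / (c / 4), by positivity, ?_⟩
  intro ω m L had hunit t ht hK N hN Ψ w F P Q h
  have hL := had.1
  obtain ⟨s1, s2, s3⟩ := hsep ω m L had hunit t ht hK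
  have hb := hbd ω m L hL hunit
  obtain ⟨b, hb1, hb2, hwell⟩ := hh.exists_well hη hC (fun r hr => (hb r hr).2.2.2.1) s1 s2 s3
  have hNpos : 0 < N := hN₀0.trans_le hN
  have hN2 : D * Y + 1 ≤ c / 4 * N ^ 2 := by
    have h1 : 1 + (D * Y + 1) / (c / 4) ≤ N ^ 2 := by
      rw [← sq_sqrt (by positivity : 0 ≤ 1 + (D * Y + 1) / (c / 4))]
      exact pow_le_pow_left₀ hN₀0.le hN 2
    have h2 : c / 4 * (1 + (D * Y + 1) / (c / 4)) = c / 4 + (D * Y + 1) := by field_simp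
    have := mul_le_mul_of_nonneg_left h1 (by positivity : 0 ≤ c / 4)
    linarith
  set g := principalG a M l ω m L with hg
  set g' := principalGD a M l ω m L
  set g'' := principalGDD a l ω m L
  have dg : ∀ r, HasDerivAt g (g' r) r := hasDerivAt_principalG a M l ω m L
  have dg' : ∀ r, HasDerivAt g' (g'' r) r := hasDerivAt_principalGD a M l ω m L
  set f : ℝ → ℝ := fun r => β * g' r * exp (β * g r) with hf
  set f₁ : ℝ → ℝ := fun r => (β * g'' r + β ^ 2 * g' r ^ 2) * exp (β * g r) with hf₁
  set k : ℝ → ℝ := fun r => s₀ * exp (-γ * g r) with hk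
  set k₁ : ℝ → ℝ := fun r => -γ * g' r * (s₀ * exp (-γ * g r)) with hk₁
  set k₂ : ℝ → ℝ := fun r => (γ ^ 2 * g' r ^ 2 - γ * g'' r) * (s₀ * exp (-γ * g r)) with hk₂
  have df : ∀ r, HasDerivAt f (f₁ r) r := by
    intro r
    refine (((dg' r).const_mul β).mul ((dg r).const_mul β).exp).congr_deriv ?_
    simp only [hf₁]; ring
  have dk : ∀ r, HasDerivAt k (k₁ r) r := by
    intro r
    refine ((((dg r).const_mul (-γ)).exp).const_mul s₀).congr_deriv ?_
    simp only [hk₁]; ring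
  have dk₁ : ∀ r, HasDerivAt k₁ (k₂ r) r := by
    intro r
    refine (((dg' r).const_mul (-γ)).mul ((((dg r).const_mul (-γ)).exp).const_mul s₀)).congr_deriv ?_
    simp only [hk₂]; ring
  set φ : ℝ → ℝ := fun r => max 0 (d - |r - b|) with hφ
  have cφ : Continuous φ := by simp only [hφ]; fun_prop
  have hφ0 : ∀ r, 0 ≤ φ r := fun r => le_max_left _ _
  have hφd : ∀ r, φ r ≤ d := fun r => max_le hd0.le (by linarith [abs_nonneg (r - b)])
  have hbdf : ∀ r ∈ Icc p q, |f r| ≤ Y₀ := by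
    intro r hr
    obtain ⟨-, -, h3, h4, h5⟩ := hb r hr
    rw [hf, hY₀]
    dsimp only
    rw [abs_mul, abs_mul, abs_of_pos hβ, abs_exp]
    refine mul_le_mul (mul_le_mul_of_nonneg_left h4 hβ.le) ?_ (exp_pos _).le (by positivity)
    exact exp_le_exp.2 (mul_le_mul_of_nonneg_left (abs_le.1 h3).2 hβ.le)
  have hbds : ∀ r ∈ Icc p q, |f₁ r| ≤ Y ∧ |k r| ≤ Y ∧ |k₁ r| ≤ Y ∧ |k₂ r| ≤ Y := by
    intro r hr
    obtain ⟨-, -, h3, h4, h5⟩ := hb r hr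
    have hkZ : |s₀ * exp (-γ * g r)| ≤ Z := by
      rw [abs_mul, abs_of_pos hs₀, abs_exp]
      refine mul_le_mul_of_nonneg_left (exp_le_exp.2 ?_) hs₀.le
      have := mul_le_mul_of_nonneg_left (abs_le.1 h3).1 hγ.le
      linarith
    have hsq : |g' r ^ 2| ≤ C ^ 2 := by rw [abs_pow]; exact pow_le_pow_left₀ (abs_nonneg _) h4 2
    have hf1 : |f₁ r| ≤ Y₁ := by
      simp only [hf₁, hY₁]
      rw [abs_mul, abs_exp]
      refine mul_le_mul ?_ (exp_le_exp.2 (mul_le_mul_of_nonneg_left (abs_le.1 h3).2 hβ.le))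
        (exp_pos _).le (by positivity)
      refine (abs_add_le _ _).trans ?_
      rw [abs_mul, abs_mul, abs_of_pos hβ, abs_of_pos (pow_pos hβ 2)]
      exact add_le_add (mul_le_mul_of_nonneg_left h5 hβ.le)
        (mul_le_mul_of_nonneg_left hsq (sq_nonneg β))
    have p1 : 0 ≤ γ * C * Z := by positivity
    have p2 : 0 ≤ (γ ^ 2 * C ^ 2 + γ * C) * Z := by positivity
    refine ⟨by linarith, by simp only [hk]; linarith, ?_, ?_⟩
    · have : |k₁ r| ≤ γ * C * Z := by
        simp only [hk₁]
        rw [abs_mul]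
        refine mul_le_mul ?_ hkZ (abs_nonneg _) (by positivity)
        rw [abs_mul, abs_neg, abs_of_pos hγ]
        exact mul_le_mul_of_nonneg_left h4 hγ.le
      linarith
    · have : |k₂ r| ≤ (γ ^ 2 * C ^ 2 + γ * C) * Z := by
        simp only [hk₂]
        rw [abs_mul]
        refine mul_le_mul ?_ hkZ (abs_nonneg _) (by positivity)
        refine (abs_sub _ _).trans ?_
        rw [abs_mul, abs_mul, abs_of_pos hγ, abs_of_pos (pow_pos hγ 2)]
        exact add_le_add (mul_le_mul_of_nonneg_left hsq (sq_nonneg γ))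
          (mul_le_mul_of_nonneg_left h5 hγ.le)
      linarith
  -- the boundary terms, absorbed by the barrier
  have hbdry := h.boundary_le hh cφ hφ0 hκ0 (tent_integral_ge hd0 hb1 hb2) hNpos hτ0 (C := C)
    (by rw [carterK_scale, abs_mul, abs_of_pos hNpos, mul_comm]
        exact mul_le_mul_of_nonneg_right (hb p (left_mem_Icc.2 hpq.le)).1 hNpos.le)
    (by rw [carterK_scale, abs_mul, abs_of_pos hNpos, mul_comm]
        exact mul_le_mul_of_nonneg_right (hb q (right_mem_Icc.2 hpq.le)).1 hNpos.le)
  have ib : IntervalIntegrable (fun r => (c / 2 + X * φ r) * ‖w r‖ ^ 2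
      + ((c / 2 + X * φ r) * N ^ 2) * ‖Ψ r‖ ^ 2) volume p q :=
    h.integrable_sq hpq.le (by fun_prop) (by fun_prop)
  have hest := h.multiplier_estimate hh (fun r _ => df r) (fun r _ => dk r) (fun r _ => dk₁ r)
    (ε := fun _ => 0) (ε₁ := fun _ => 0) (fun r _ => hasDerivAt_const r 0)
    (by simp only [hf₁]; fun_prop) (by simp only [hk₂]; fun_prop) continuousOn_const ib (C := C₁)
    (by
      intro r hr
      have hr' : r ∈ Icc p q := ⟨hr.1.le, hr.2.le⟩
      obtain ⟨-, -, h3, h4, h5⟩ := hb r hr'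
      obtain ⟨b1, b2, b3, b4⟩ := hbds r hr'
      have hfY : |f r| ≤ Y := (hbdf r hr').trans (by
        have : 0 ≤ (1 + γ * C + (γ ^ 2 * C ^ 2 + γ * C)) * Z := by positivity
        linarith)
      have hm := hmult (N * ω) (N * m) (N ^ 2 * L) Y (c / 4) f f₁ k k₁ k₂ (fun _ => 0) (fun _ => 0)
        Ψ w F (by positivity) r hr' hfY b1 b2 b3 b4
      rw [principalG_scale, principalGD_scale] at hm
      refine le_trans ?_ hm
      obtain ⟨⟨w1, w2⟩, w3⟩ := hγw (g r) (g' r) (g'' r) h3 h4 h5 (s3 r hr')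
      have hA : c + X * φ r ≤ f₁ r + k r ∧
          c + X * φ r ≤ f₁ r * g r + f r * g' r - k r * g r := by
        have e : ((β * g'' r + β ^ 2 * g' r ^ 2) * g r + β * g' r ^ 2) * exp (β * g r)
            - s₀ * exp (-γ * g r) * g r = f₁ r * g r + f r * g' r - k r * g r := by
          simp only [hf₁, hf, hk]; ring
        rw [e] at w2 w3
        by_cases hx : |r - b| ≤ d
        · obtain ⟨v1, v2⟩ := w3 (hwell r hr' hx)
          have : X * φ r ≤ X * d := mul_le_mul_of_nonneg_left (hφd r) hX0.le
          exact ⟨by linarith, by linarith⟩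
        · have : φ r = 0 := max_eq_left (by push Not at hx; linarith)
          rw [this, mul_zero, add_zero]
          exact ⟨w1, w2⟩
      obtain ⟨hA1, hA2⟩ := hA
      have hNn : 0 ≤ N ^ 2 := sq_nonneg N
      have t1 : (c / 2 + X * φ r) * ‖w r‖ ^ 2 ≤ (f₁ r + k r - c / 4) * ‖w r‖ ^ 2 :=
        mul_le_mul_of_nonneg_right (by linarith) (sq_nonneg _)
      have t2 : (c / 2 + X * φ r) * N ^ 2 ≤ f₁ r * (N ^ 2 * g r) + f r * (N ^ 2 * g' r)
          - k r * (N ^ 2 * g r) - D * Y - 1 + (DeltaD a M l r * 0 + Delta a M l r * 0) := by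
        have := mul_le_mul_of_nonneg_right hA2 hNn
        have hcN : 0 ≤ c * N ^ 2 := by positivity
        linarith
      have t3 := mul_le_mul_of_nonneg_right t2 (sq_nonneg ‖Ψ r‖)
      linarith)
  have hFi := h.sourceIntervalIntegrable hpq.le
  have hP := h.P_nonneg
  have hQ := h.Q_nonneg
  have hfq := (abs_le.1 (hbdf q (right_mem_Icc.2 hpq.le))).2
  have hfp := (abs_le.1 (hbdf p (left_mem_Icc.2 hpq.le))).1
  have hterm : 2 * f q * (carterK a l (N * ω) (N * m) q ^ 2 * Q)
      - 2 * f p * (carterK a l (N * ω) (N * m) p ^ 2 * P) ≤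
      2 * Y₀ * (carterK a l (N * ω) (N * m) q ^ 2 * Q + carterK a l (N * ω) (N * m) p ^ 2 * P) := by
    have := mul_le_mul_of_nonneg_right hfq
      (by positivity : 0 ≤ carterK a l (N * ω) (N * m) q ^ 2 * Q)
    have := mul_le_mul_of_nonneg_right hfp
      (by positivity : 0 ≤ carterK a l (N * ω) (N * m) p ^ 2 * P)
    linarith
  have hcomb := mul_le_mul_of_nonneg_left hbdry (by positivity : 0 ≤ 2 * Y₀)
  rw [← intervalIntegral.integral_const_mul] at hcomb
  have i0 : IntervalIntegrable (fun r => ‖w r‖ ^ 2 + N ^ 2 * ‖Ψ r‖ ^ 2) volume p q := by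
    have := h.integrable_sq hpq.le (φ := fun _ => 1) (ψ := fun _ => N ^ 2) continuousOn_const
      continuousOn_const
    simpa using this
  have i1 : IntervalIntegrable (fun r => 2 * Y₀ * (C / κ * φ r * (‖w r‖ ^ 2 + N ^ 2 * ‖Ψ r‖ ^ 2)
      + τ * (N ^ 2 * ‖Ψ r‖ ^ 2) + C ^ 2 / τ * ‖F r‖ ^ 2)) volume p q := by
    have := (h.integrable_sq hpq.le (φ := fun r => 2 * Y₀ * (C / κ * φ r))
      (ψ := fun r => 2 * Y₀ * (C / κ * φ r * N ^ 2 + τ * N ^ 2)) (by fun_prop) (by fun_prop)).add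
      (hFi.const_mul (2 * Y₀ * (C ^ 2 / τ)))
    refine this.congr fun r _ => ?_
    ring
  have hfinal : ∫ r in p..q, (c / 4 * (‖w r‖ ^ 2 + N ^ 2 * ‖Ψ r‖ ^ 2)
      + 2 * Y₀ * (C / κ * φ r * (‖w r‖ ^ 2 + N ^ 2 * ‖Ψ r‖ ^ 2)
      + τ * (N ^ 2 * ‖Ψ r‖ ^ 2) + C ^ 2 / τ * ‖F r‖ ^ 2)) ≤
      ∫ r in p..q, (((c / 2 + X * φ r) * ‖w r‖ ^ 2
      + ((c / 2 + X * φ r) * N ^ 2) * ‖Ψ r‖ ^ 2) + 2 * Y₀ * (C ^ 2 / τ) * ‖F r‖ ^ 2) := by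
    refine intervalIntegral.integral_mono_on hpq.le ((i0.const_mul (c / 4)).add i1)
      (ib.add (hFi.const_mul _)) fun r _ => ?_
    have e : 2 * Y₀ * τ = c / 4 := by rw [hτ]; field_simp; norm_num
    have e2 : 2 * Y₀ * (τ * (N ^ 2 * ‖Ψ r‖ ^ 2)) = c / 4 * (N ^ 2 * ‖Ψ r‖ ^ 2) := by
      rw [← e]; ring
    have e3 : 2 * Y₀ * (C / κ * φ r * (‖w r‖ ^ 2 + N ^ 2 * ‖Ψ r‖ ^ 2))
        = X * φ r * (‖w r‖ ^ 2 + N ^ 2 * ‖Ψ r‖ ^ 2) := by rw [hX]; ring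
    have : 0 ≤ c * ‖w r‖ ^ 2 := by positivity
    linarith only [e2, e3, this]
  rw [intervalIntegral.integral_add (i0.const_mul (c / 4)) i1,
    intervalIntegral.integral_add ib (hFi.const_mul _), intervalIntegral.integral_const_mul,
    intervalIntegral.integral_const_mul (2 * Y₀ * (C ^ 2 / τ))] at hfinal
  have : c / 4 * ∫ r in p..q, (‖w r‖ ^ 2 + N ^ 2 * ‖Ψ r‖ ^ 2) ≤
      (C₁ + 2 * Y₀ * (C ^ 2 / τ)) * ∫ r in p..q, ‖F r‖ ^ 2 := by linarith
  rw [div_mul_eq_mul_div, le_div_iff₀ (by positivity)]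
  linarith

/-! ### The trapping radius -/

/-- `K (Δ' K - 2 Δ K')`, which is `K³` times the derivative of `-K²/Δ` up to a positive factor; its
zero is the radius of the trapped orbit. -/
noncomputable def trappingFn (a M l ω m r : ℝ) : ℝ :=
  carterK a l ω m r * (DeltaD a M l r * carterK a l ω m r - 2 * Delta a M l r * (2 * ω * r))

/-- The derivative of `trappingFn`. -/
noncomputable def trappingFnD (a M l ω m r : ℝ) : ℝ :=
  2 * ω * r * (DeltaD a M l r * carterK a l ω m r - 2 * Delta a M l r * (2 * ω * r))
    + carterK a l ω m r * (DeltaDD a l r * carterK a l ω m r - DeltaD a M l r * (2 * ω * r)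
      - 2 * Delta a M l r * (2 * ω))

theorem hasDerivAt_trappingFn (a M l ω m r : ℝ) :
    HasDerivAt (trappingFn a M l ω m) (trappingFnD a M l ω m r) r := by
  have hK := hasDerivAt_carterK a l ω m r
  have h := hK.mul (((hasDerivAt_DeltaD a M l r).mul hK).sub
    (((hasDerivAt_Delta a M l r).const_mul 2).mul ((hasDerivAt_id r).const_mul (2 * ω))))
  refine h.congr_deriv ?_
  simp only [trappingFnD, Pi.sub_apply, Pi.mul_apply, id]; ring

/-- A zero of `trappingFn` is nondegenerate. -/
theorem Horizons.trappingFnD_neg {a M l p q s ω m r : ℝ} (hh : Horizons a M l p q s)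
    (hr : r ∈ Icc p q) (hK : carterK a l ω m r ≠ 0) (h0 : trappingFn a M l ω m r = 0) :
    trappingFnD a M l ω m r < 0 := by
  have hT := (mul_eq_zero.1 h0).resolve_left hK
  have hΔ : 0 < Delta a M l r := by
    refine (hh.Delta_nonneg hr).lt_of_ne fun hz => ?_
    rw [← hz, mul_zero, zero_mul, sub_zero] at hT
    have hD := (mul_eq_zero.1 hT).resolve_right hK
    have := hh.photon_pos hr
    rw [hD, ← hz] at this
    norm_num at this
  have hr0 := hh.pos_of_mem hr
  have hE := hh.photon_pos hr
  have key : 2 * Delta a M l r * r * trappingFnD a M l ω m r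
      = -(carterK a l ω m r ^ 2 * (r * DeltaD a M l r ^ 2 + 2 * Delta a M l r * DeltaD a M l r
        - 2 * r * Delta a M l r * DeltaDD a l r)) := by
    unfold trappingFnD
    rw [hT]
    linear_combination (carterK a l ω m r * (r * DeltaD a M l r + 2 * Delta a M l r)) * hT
  have hneg : 2 * Delta a M l r * r * trappingFnD a M l ω m r < 0 := by
    rw [key]
    have : 0 < carterK a l ω m r ^ 2 := by positivity
    exact neg_neg_of_pos (mul_pos this hE)
  by_contra hc
  push Not at hc
  have : 0 ≤ 2 * Delta a M l r * r * trappingFnD a M l ω m r := by positivity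
  linarith

/-- A function that decreases at a definite rate wherever it is small changes sign once, with a
quantitative bound. -/
theorem sq_le_of_decreasing_near_zero {h h' : ℝ → ℝ} {p q η η' c : ℝ}
    (hd : ∀ x, HasDerivAt h (h' x) x) (hdec : ∀ x ∈ Icc p q, |h x| < η → h' x ≤ -η)
    (hη' : 0 ≤ η') (h1 : η' < η) (h2 : η' * (q - p) < η) (hc : c ∈ Icc p q) (h0 : h c = 0)
    {r : ℝ} (hr : r ∈ Icc p q) : η' * (r - c) ^ 2 ≤ (c - r) * h r := by
  have hcont : Continuous h := continuous_iff_continuousAt.2 fun x => (hd x).continuousAt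
  have hB : ∀ δ x, HasDerivAt (fun x => η' * (c - x) - δ) (-η') x := fun δ x => by
    refine ((((hasDerivAt_id x).const_sub c).const_mul η').sub_const δ).congr_deriv ?_
    ring
  rcases le_total c r with hcr | hrc
  · have := image_le_of_deriv_right_lt_deriv_boundary (f := h) (f' := h') (a := c) (b := r)
      hcont.continuousOn (fun x _ => (hd x).hasDerivWithinAt)
      (B := fun x => η' * (c - x) - 0) (B' := fun _ => -η') (by simp [h0]) (hB 0) (by
        intro x hx hxB
        have hx' : x ∈ Icc p q := ⟨hc.1.trans hx.1, hx.2.le.trans hr.2⟩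
        have : |h x| < η := by
          rw [hxB, sub_zero, abs_mul, abs_of_nonneg hη', abs_of_nonpos (by linarith [hx.1])]
          refine lt_of_le_of_lt (mul_le_mul_of_nonneg_left ?_ hη') h2
          linarith [hx'.2, hc.1]
        linarith [hdec x hx' this]) (right_mem_Icc.2 hcr)
    have h3 := mul_le_mul_of_nonneg_left this (by linarith : 0 ≤ r - c)
    nlinarith
  · have hge : η' * (c - r) ≤ h r := by
      by_contra hcon
      push Not at hcon
      -- the fence `η' (c - x) - δ` starts above `h` and ends below `0 = h c`
      obtain ⟨δ, hδ0, hδ1⟩ : ∃ δ > 0, δ < min (η - η' * (q - p)) (η' * (c - r) - h r) :=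
        exists_between (lt_min (by linarith) (by linarith))
      have hδ2 := hδ1.trans_le (min_le_left _ _)
      have hδ3 := hδ1.trans_le (min_le_right _ _)
      have := image_le_of_deriv_right_lt_deriv_boundary (f := h) (f' := h') (a := r) (b := c)
        hcont.continuousOn (fun x _ => (hd x).hasDerivWithinAt)
        (B := fun x => η' * (c - x) - δ) (B' := fun _ => -η') (by linarith) (hB δ) (by
          intro x hx hxB
          have hx' : x ∈ Icc p q := ⟨hr.1.trans hx.1, hx.2.le.trans hc.2⟩
          have h4 : η' * (c - x) ≤ η' * (q - p) :=
            mul_le_mul_of_nonneg_left (by linarith [hx'.1, hc.2]) hη'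
          have h5 : 0 ≤ η' * (c - x) := mul_nonneg hη' (by linarith [hx.2])
          have : |h x| < η := by
            rw [hxB, abs_lt]
            constructor <;> linarith
          linarith [hdec x hx' this]) (right_mem_Icc.2 hrc)
      simp only [h0, sub_self, mul_zero, zero_sub] at this
      linarith
    have h3 := mul_le_mul_of_nonneg_left hge (by linarith : 0 ≤ c - r)
    nlinarith

/-- Away from the superradiant frequencies there is exactly one trapped orbit; it stays away from
the horizons and is uniformly unstable. -/
theorem Horizons.exists_trapping_radius {a M l p q s c : ℝ} (hh : Horizons a M l p q s)
    (hc : 0 < c) : ∃ Rm Rp c₂, p < Rm ∧ Rm < Rp ∧ Rp < q ∧ 0 < c₂ ∧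
      ∀ ω m, ω ^ 2 + m ^ 2 = 1 → (∀ r ∈ Icc p q, c ≤ |carterK a l ω m r|) →
        ∃ rc ∈ Ioo Rm Rp, ∀ r ∈ Icc p q, c₂ * (r - rc) ^ 2 ≤ (rc - r) * trappingFn a M l ω m r := by
  have hpq := hh.p_lt
  set S : Set ((ℝ × ℝ) × ℝ) := {z : ℝ × ℝ | z.1 ^ 2 + z.2 ^ 2 = 1} ×ˢ Icc p q
  have hcirc : IsCompact {z : ℝ × ℝ | z.1 ^ 2 + z.2 ^ 2 = 1} := by
    refine (isCompact_Icc (a := ((-1, -1) : ℝ × ℝ)) (b := (1, 1))).of_isClosed_subset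
      (isClosed_eq (by fun_prop) (by fun_prop)) ?_
    rintro ⟨x, y⟩ hxy
    simp only [mem_ofPred_eq] at hxy
    have e1 := abs_le.1 (abs_le_one_iff_mul_self_le_one.2 (by nlinarith [sq_nonneg y] : x * x ≤ 1))
    have e2 := abs_le.1 (abs_le_one_iff_mul_self_le_one.2 (by nlinarith [sq_nonneg x] : y * y ≤ 1))
    exact ⟨⟨e1.1, e2.1⟩, e1.2, e2.2⟩
  have hSc : IsCompact S := hcirc.prod isCompact_Icc
  obtain ⟨η, hη, hsep⟩ := exists_pos_le_of_isCompact hSc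
    (f := fun z => max (max |trappingFn a M l z.1.1 z.1.2 z.2| (-trappingFnD a M l z.1.1 z.1.2 z.2))
      (c - |carterK a l z.1.1 z.1.2 z.2|))
    (by
      refine Continuous.continuousOn ?_
      unfold trappingFn trappingFnD carterK
      fun_prop)
    (by
      rintro ⟨⟨ω, m⟩, r⟩ ⟨-, hr⟩
      simp only at hr
      simp only [lt_max_iff]
      by_cases hK : carterK a l ω m r = 0
      · right; rw [hK, abs_zero]; linarith
      · left
        by_cases h0 : trappingFn a M l ω m r = 0
        · right; linarith [hh.trappingFnD_neg hr hK h0]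
        · left; exact abs_pos.2 h0)
  obtain ⟨B, hB⟩ := hSc.exists_bound_of_continuousOn
    (f := fun z => trappingFnD a M l z.1.1 z.1.2 z.2)
    (by
      refine Continuous.continuousOn ?_
      unfold trappingFnD carterK
      fun_prop)
  set B' := max B 1
  have hB'0 : 0 < B' := lt_max_of_lt_right one_pos
  set e := min (min (c ^ 2 * DeltaD a M l p / B') (c ^ 2 * -DeltaD a M l q / B')) ((q - p) / 2)
    with he
  have hDp := hh.DeltaD_left_pos
  have hDq := hh.DeltaD_right_neg
  have he0 : 0 < e := by
    have : 0 < -DeltaD a M l q := by linarith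
    simp only [he, lt_min_iff]
    exact ⟨⟨by positivity, by positivity⟩, by linarith⟩
  have he1 : e ≤ c ^ 2 * DeltaD a M l p / B' := (min_le_left _ _).trans (min_le_left _ _)
  have he2 : e ≤ c ^ 2 * -DeltaD a M l q / B' := (min_le_left _ _).trans (min_le_right _ _)
  have he3 : e ≤ (q - p) / 2 := min_le_right _ _
  set η' := min (η / 2) (η / (2 * (q - p))) with hη'
  have hW : 0 < q - p := by linarith
  have hη'0 : 0 < η' := by simp only [hη', lt_min_iff]; exact ⟨by positivity, by positivity⟩
  have hη'1 : η' < η := (min_le_left _ _).trans_lt (by linarith)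
  have hη'2 : η' * (q - p) < η := by
    have h1 : η' * (q - p) ≤ η / (2 * (q - p)) * (q - p) :=
      mul_le_mul_of_nonneg_right (min_le_right _ _) hW.le
    have h2 : η / (2 * (q - p)) * (q - p) = η / 2 := by field_simp
    linarith
  refine ⟨p + e / 2, q - e / 2, η', by linarith, by linarith, by linarith, hη'0, ?_⟩
  intro ω m hun hK
  have hKp := hK p (left_mem_Icc.2 hpq.le)
  have hKq := hK q (right_mem_Icc.2 hpq.le)
  have sqK : ∀ {x : ℝ}, c ≤ |x| → c ^ 2 ≤ x ^ 2 := fun {x} hx => by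
    rw [← sq_abs x]; exact pow_le_pow_left₀ hc.le hx 2
  have hTp : c ^ 2 * DeltaD a M l p ≤ trappingFn a M l ω m p := by
    have : trappingFn a M l ω m p = carterK a l ω m p ^ 2 * DeltaD a M l p := by
      unfold trappingFn; rw [hh.Delta_left]; ring
    rw [this]
    exact mul_le_mul_of_nonneg_right (sqK hKp) hDp.le
  have hTq : trappingFn a M l ω m q ≤ c ^ 2 * DeltaD a M l q := by
    have : trappingFn a M l ω m q = carterK a l ω m q ^ 2 * DeltaD a M l q := by
      unfold trappingFn; rw [hh.Delta_right]; ring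
    rw [this]
    exact mul_le_mul_of_nonpos_right (sqK hKq) hDq.le
  have hcont : Continuous (trappingFn a M l ω m) :=
    continuous_iff_continuousAt.2 fun x => (hasDerivAt_trappingFn a M l ω m x).continuousAt
  have hc2 : 0 < c ^ 2 := by positivity
  obtain ⟨rc, hrc, hrc0⟩ := intermediate_value_Icc' hpq.le hcont.continuousOn
    (show (0 : ℝ) ∈ Icc (trappingFn a M l ω m q) (trappingFn a M l ω m p) from
      ⟨hTq.trans (mul_nonpos_of_nonneg_of_nonpos hc2.le hDq.le),
        le_trans (by positivity) hTp⟩)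
  have hlip : ∀ r ∈ Icc p q, |trappingFn a M l ω m r| ≤ B' * |r - rc| := by
    intro r hr
    have := (convex_Icc p q).norm_image_sub_le_of_norm_hasDerivWithin_le
      (fun x _ => (hasDerivAt_trappingFn a M l ω m x).hasDerivWithinAt)
      (fun x hx => (hB ((ω, m), x) ⟨hun, hx⟩).trans (le_max_left B 1)) hrc hr
    rw [hrc0, sub_zero] at this
    exact this
  refine ⟨rc, ⟨?_, ?_⟩, fun r hr => ?_⟩
  · have h1 := hTp.trans ((le_abs_self _).trans (hlip p (left_mem_Icc.2 hpq.le)))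
    rw [abs_of_nonpos (by linarith [hrc.1]), ← div_le_iff₀' hB'0] at h1
    linarith
  · have h1 := (neg_le_neg hTq).trans ((neg_le_abs _).trans (hlip q (right_mem_Icc.2 hpq.le)))
    rw [abs_of_nonneg (by linarith [hrc.2]), ← mul_neg, ← div_le_iff₀' hB'0] at h1
    linarith
  · refine sq_le_of_decreasing_near_zero (hasDerivAt_trappingFn a M l ω m) (η := η) ?_ hη'0.le
      hη'1 hη'2 hrc hrc0 hr
    intro x hx hxη
    have := hsep ((ω, m), x) ⟨hun, hx⟩
    simp only [le_max_iff] at this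
    rcases this with (h | h) | h
    · linarith
    · linarith
    · linarith [hK x hx]

theorem trappingFn_scale (a M l ω m N r : ℝ) :
    trappingFn a M l (N * ω) (N * m) r = N ^ 2 * trappingFn a M l ω m r := by
  unfold trappingFn; rw [carterK_scale]; ring

/-! ### High frequencies without superradiance -/

theorem mul_le_of_sq_le {c N D : ℝ} (hc : 0 < c) (hN : √(D / c) ≤ N) : D ≤ c * N ^ 2 := by
  have h1 : D / c ≤ N ^ 2 := by
    rcases le_total 0 (D / c) with h | h
    · rw [← sq_sqrt h]; exact pow_le_pow_left₀ (sqrt_nonneg _) hN 2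
    · exact h.trans (sq_nonneg N)
  rwa [div_le_iff₀' hc] at h1

/-- The estimate when `K² - ΔL` is bounded below and no orbit is trapped: an exponential weight. -/
theorem Horizons.exists_untrapped_estimate {a M l p q s c : ℝ} (hh : Horizons a M l p q s)
    (musq : ℝ) (hc : 0 < c) : ∃ ε > 0, ∃ N₀ > 0, ∃ C > 0, ∀ ω m L, 0 ≤ L → L ≤ ε →
      ω ^ 2 + m ^ 2 + L = 1 → (∀ r ∈ Icc p q, c ≤ |carterK a l ω m r|) → ∀ N ≥ N₀,
      ∀ (Ψ w F : ℝ → ℂ) (P Q : ℝ),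
        RadialSolution a M l musq (N * ω) (N * m) (N ^ 2 * L) p q Ψ w F P Q →
        ∫ r in p..q, (‖w r‖ ^ 2 + N ^ 2 * ‖Ψ r‖ ^ 2) ≤
          C * (carterK a l (N * ω) (N * m) q ^ 2 * Q + carterK a l (N * ω) (N * m) p ^ 2 * P
            + ∫ r in p..q, ‖F r‖ ^ 2) := by
  have hpq := hh.p_lt
  have hp := hh.p_pos
  obtain ⟨C, hC, hbd⟩ := exists_unit_bound a M l p q
  obtain ⟨D, hD, hmult⟩ := hh.exists_multiplierDensity_ge musq
  obtain ⟨D', hD'⟩ := isCompact_Icc.exists_bound_of_continuousOn (s := Icc p q)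
    (continuous_Delta a M l).continuousOn
  set ε := c ^ 2 / (2 * (|D'| + 1)) with hε
  have hD'1 : 0 < |D'| + 1 := by positivity
  set A := 2 * (C + 1) / c ^ 2 + 1 with hA
  have hA0 : 0 < A := by positivity
  set Y := (A + 1) * exp (A * q) with hY
  have hY0 : 0 < Y := by positivity
  set C₁ := Y ^ 2 / (A / 2) + (D * Y) ^ 2
  set κ := min (A / 2) (1 / 2) with hκ
  have hκ0 : 0 < κ := by simp only [hκ, lt_min_iff]; exact ⟨by positivity, by norm_num⟩
  refine ⟨ε, by positivity, √((D * Y + 1) / (1 / 2)), sqrt_pos.2 (by positivity),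
    (2 * Y + C₁) / κ, by positivity, ?_⟩
  intro ω m L hL hLε hunit hK N hN Ψ w F P Q h
  have hb := hbd ω m L hL hunit
  have hN2 := mul_le_of_sq_le (by norm_num) hN
  set f : ℝ → ℝ := fun r => exp (A * r) with hf
  set f₁ : ℝ → ℝ := fun r => A * exp (A * r) with hf₁
  have df : ∀ r, HasDerivAt f (f₁ r) r := by
    intro r
    refine (((hasDerivAt_id r).const_mul A).exp).congr_deriv ?_
    simp only [hf₁, id]; ring
  have hexp : ∀ r ∈ Icc p q, exp (A * r) ≤ exp (A * q) := fun r hr =>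
    exp_le_exp.2 (mul_le_mul_of_nonneg_left hr.2 hA0.le)
  have hfY : ∀ r ∈ Icc p q, |f r| ≤ Y := fun r hr => by
    simp only [hf]
    rw [abs_exp]
    have := hexp r hr
    have : 0 < A * exp (A * q) := by positivity
    rw [hY]; linarith
  have hf1Y : ∀ r ∈ Icc p q, |f₁ r| ≤ Y := fun r hr => by
    simp only [hf₁]
    rw [abs_mul, abs_exp, abs_of_pos hA0]
    have := mul_le_mul_of_nonneg_left (hexp r hr) hA0.le
    have : 0 < exp (A * q) := by positivity
    rw [hY]; linarith
  have ib : IntervalIntegrable (fun r => κ * ‖w r‖ ^ 2 + (κ * N ^ 2) * ‖Ψ r‖ ^ 2) volume p q :=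
    h.integrable_sq hpq.le (by fun_prop) (by fun_prop)
  have hest := h.multiplier_estimate hh (fun r _ => df r) (k := fun _ => 0) (k₁ := fun _ => 0)
    (k₂ := fun _ => 0) (fun r _ => hasDerivAt_const r 0) (fun r _ => hasDerivAt_const r 0)
    (ε := fun _ => 0) (ε₁ := fun _ => 0) (fun r _ => hasDerivAt_const r 0)
    (by simp only [hf₁]; fun_prop) continuousOn_const continuousOn_const ib (C := C₁)
    (by
      intro r hr
      have hr' : r ∈ Icc p q := ⟨hr.1.le, hr.2.le⟩
      obtain ⟨-, -, h3, h4, h5⟩ := hb r hr'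
      have hm := hmult (N * ω) (N * m) (N ^ 2 * L) Y (A / 2) f f₁ (fun _ => 0) (fun _ => 0)
        (fun _ => 0) (fun _ => 0) (fun _ => 0)
        Ψ w F (by positivity) r hr' (hfY r hr') (hf1Y r hr') (by simpa using hY0.le)
        (by simpa using hY0.le) (by simpa using hY0.le)
      rw [principalG_scale, principalGD_scale] at hm
      refine le_trans ?_ hm
      have hexp1 : 1 ≤ exp (A * r) :=
        one_le_exp (mul_nonneg hA0.le (hp.le.trans hr'.1))
      have hg : c ^ 2 / 2 ≤ principalG a M l ω m L r := by
        have h1 : c ^ 2 ≤ carterK a l ω m r ^ 2 := by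
          rw [← sq_abs (carterK a l ω m r)]; exact pow_le_pow_left₀ hc.le (hK r hr') 2
        have h2 : Delta a M l r * L ≤ (|D'| + 1) * ε :=
          mul_le_mul (((le_abs_self _).trans (hD' r hr')).trans
            ((le_abs_self D').trans (by linarith))) hLε hL hD'1.le
        have e : (|D'| + 1) * ε = c ^ 2 / 2 := by rw [hε]; field_simp
        unfold principalG
        linarith
      have hcoef : 1 ≤ f₁ r * principalG a M l ω m L r + f r * principalGD a M l ω m L r := by
        have h1 : A * (c ^ 2 / 2) ≤ A * principalG a M l ω m L r :=
          mul_le_mul_of_nonneg_left hg hA0.le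
        have h2 : A * (c ^ 2 / 2) = C + 1 + c ^ 2 / 2 := by rw [hA]; field_simp
        have h3 := (abs_le.1 h4).1
        have h4 : 1 ≤ A * principalG a M l ω m L r + principalGD a M l ω m L r := by
          have : 0 < c ^ 2 / 2 := by positivity
          linarith
        have e : f₁ r * principalG a M l ω m L r + f r * principalGD a M l ω m L r
            = exp (A * r) * (A * principalG a M l ω m L r + principalGD a M l ω m L r) := by
          simp only [hf₁, hf]; ring
        rw [e]
        exact one_le_mul_of_one_le_of_one_le hexp1 h4
      have t1 : κ * ‖w r‖ ^ 2 ≤ (f₁ r + 0 - A / 2) * ‖w r‖ ^ 2 := by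
        refine mul_le_mul_of_nonneg_right ?_ (sq_nonneg _)
        have : κ ≤ A / 2 := min_le_left _ _
        have := mul_le_mul_of_nonneg_left hexp1 hA0.le
        simp only [hf₁]; linarith
      have t2 : κ * N ^ 2 ≤ f₁ r * (N ^ 2 * principalG a M l ω m L r)
          + f r * (N ^ 2 * principalGD a M l ω m L r) - 0 * (N ^ 2 * principalG a M l ω m L r)
          - D * Y - 1 + (DeltaD a M l r * 0 + Delta a M l r * 0) := by
        have i1 := mul_le_mul_of_nonneg_right hcoef (sq_nonneg N)
        have i2 : κ * N ^ 2 ≤ 1 / 2 * N ^ 2 :=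
          mul_le_mul_of_nonneg_right (min_le_right _ _) (sq_nonneg N)
        linarith
      have t3 := mul_le_mul_of_nonneg_right t2 (sq_nonneg ‖Ψ r‖)
      linarith)
  have hP := h.P_nonneg
  have hQ := h.Q_nonneg
  set X := carterK a l (N * ω) (N * m) q ^ 2 * Q
  set Z := carterK a l (N * ω) (N * m) p ^ 2 * P
  have hX : 0 ≤ X := by positivity
  have hZ : 0 ≤ Z := by positivity
  have hFn : 0 ≤ ∫ r in p..q, ‖F r‖ ^ 2 :=
    intervalIntegral.integral_nonneg hpq.le fun r _ => by positivity
  have e : ∫ r in p..q, (κ * ‖w r‖ ^ 2 + (κ * N ^ 2) * ‖Ψ r‖ ^ 2)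
      = κ * ∫ r in p..q, (‖w r‖ ^ 2 + N ^ 2 * ‖Ψ r‖ ^ 2) := by
    rw [← intervalIntegral.integral_const_mul]
    congr 1; ext r; ring
  rw [e] at hest
  rw [div_mul_eq_mul_div, le_div_iff₀ hκ0]
  have i1 := mul_le_mul_of_nonneg_right ((le_abs_self _).trans (hfY q (right_mem_Icc.2 hpq.le))) hX
  have i2 : 0 ≤ f p * Z := mul_nonneg (exp_pos _).le hZ
  have i3 : 0 ≤ C₁ * X := by positivity
  have i4 : 0 ≤ C₁ * Z := by positivity
  have i5 : 0 ≤ Y * Z := by positivity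
  have i6 : 0 ≤ Y * ∫ r in p..q, ‖F r‖ ^ 2 := by positivity
  linarith

/-- A continuous function that is bounded away from zero on an interval has a constant sign. -/
theorem exists_sign_mul_ge {K : ℝ → ℝ} {p q c : ℝ} (hpq : p ≤ q) (hc : 0 < c)
    (hcont : ContinuousOn K (Icc p q)) (hK : ∀ r ∈ Icc p q, c ≤ |K r|) :
    ∃ e : ℝ, e ^ 2 = 1 ∧ ∀ r ∈ Icc p q, c ≤ e * K r := by
  have hpm : p ∈ Icc p q := left_mem_Icc.2 hpq
  have hne : ∀ x ∈ Icc p q, K x ≠ 0 := fun x hx h0 => by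
    have := hK x hx
    rw [h0, abs_zero] at this
    linarith
  rcases le_total 0 (K p) with hs | hs
  · refine ⟨1, by norm_num, fun r hr => ?_⟩
    have : 0 ≤ K r := by
      by_contra hneg
      push Not at hneg
      obtain ⟨x, hx, hx0⟩ := isPreconnected_Icc.intermediate_value hr hpm hcont ⟨hneg.le, hs⟩
      exact hne x hx hx0
    rw [one_mul, ← abs_of_nonneg this]
    exact hK r hr
  · refine ⟨-1, by norm_num, fun r hr => ?_⟩
    have : K r ≤ 0 := by
      by_contra hneg
      push Not at hneg
      obtain ⟨x, hx, hx0⟩ := isPreconnected_Icc.intermediate_value hpm hr hcont ⟨hs, hneg.le⟩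
      exact hne x hx hx0
    rw [neg_one_mul, ← abs_of_nonpos this]
    exact hK r hr

/-- The multiplier `(r - c) / k`. -/
noncomputable def shiftedQuot (c : ℝ) (k : ℝ → ℝ) (r : ℝ) : ℝ := (r - c) / k r

/-- The derivative of `(r - c) / k`. -/
noncomputable def shiftedQuotD (c : ℝ) (k k' : ℝ → ℝ) (r : ℝ) : ℝ :=
  1 / k r - (r - c) * k' r / k r ^ 2

/-- The weight `((r - c) k)' / k²`. -/
noncomputable def shiftedWeight (c : ℝ) (k k' : ℝ → ℝ) (r : ℝ) : ℝ :=
  1 / k r + (r - c) * k' r / k r ^ 2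

/-- The derivative of `shiftedWeight`, when `k'' = k₂` is constant. -/
noncomputable def shiftedWeightD (c : ℝ) (k k' : ℝ → ℝ) (k₂ r : ℝ) : ℝ :=
  (r - c) * (k₂ / k r ^ 2 - 2 * k' r ^ 2 / k r ^ 3)

/-- The second derivative of `shiftedWeight`, when `k'' = k₂` is constant. -/
noncomputable def shiftedWeightDD (c : ℝ) (k k' : ℝ → ℝ) (k₂ r : ℝ) : ℝ :=
  (k₂ / k r ^ 2 - 2 * k' r ^ 2 / k r ^ 3)
    + (r - c) * (6 * k' r ^ 3 / k r ^ 4 - 6 * k' r * k₂ / k r ^ 3)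

section

variable {k k' : ℝ → ℝ} {k₂ c r : ℝ}

theorem hasDerivAt_shiftedQuot (hk : HasDerivAt k (k' r) r) (h0 : k r ≠ 0) :
    HasDerivAt (shiftedQuot c k) (shiftedQuotD c k k' r) r := by
  refine (((hasDerivAt_id r).sub_const c).div hk h0).congr_deriv ?_
  simp only [shiftedQuotD, id]; field_simp

theorem hasDerivAt_shiftedWeight (hk : HasDerivAt k (k' r) r) (hk' : HasDerivAt k' k₂ r)
    (h0 : k r ≠ 0) : HasDerivAt (shiftedWeight c k k') (shiftedWeightD c k k' k₂ r) r := by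
  refine (((hasDerivAt_const r (1 : ℝ)).div hk h0).add
    ((((hasDerivAt_id r).sub_const c).mul hk').div (hk.pow 2) (pow_ne_zero 2 h0))).congr_deriv ?_
  simp only [shiftedWeightD, Pi.mul_apply, Pi.pow_apply, id]; field_simp; ring

theorem hasDerivAt_shiftedWeightD (hk : HasDerivAt k (k' r) r) (hk' : HasDerivAt k' k₂ r)
    (h0 : k r ≠ 0) :
    HasDerivAt (shiftedWeightD c k k' k₂) (shiftedWeightDD c k k' k₂ r) r := by
  refine (((hasDerivAt_id r).sub_const c).mul
    (((hasDerivAt_const r k₂).div (hk.pow 2) (pow_ne_zero 2 h0)).sub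
      (((hk'.pow 2).const_mul 2).div (hk.pow 3) (pow_ne_zero 3 h0)))).congr_deriv ?_
  simp only [shiftedWeightDD, Pi.sub_apply, Pi.div_apply, Pi.pow_apply, id]; field_simp; ring

theorem continuousOn_shiftedQuotD {S : Set ℝ} (hk : Continuous k) (hk' : Continuous k')
    (h0 : ∀ r ∈ S, k r ≠ 0) : ContinuousOn (shiftedQuotD c k k') S :=
  (continuousOn_const.div hk.continuousOn h0).sub
    (ContinuousOn.div (by fun_prop) (by fun_prop) fun r hr => pow_ne_zero 2 (h0 r hr))

theorem continuousOn_shiftedWeightDD {S : Set ℝ} (hk : Continuous k) (hk' : Continuous k')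
    (h0 : ∀ r ∈ S, k r ≠ 0) : ContinuousOn (shiftedWeightDD c k k' k₂) S := by
  have n1 : ∀ n : ℕ, ∀ r ∈ S, k r ^ n ≠ 0 := fun n r hr => pow_ne_zero n (h0 r hr)
  exact ((continuousOn_const.div (by fun_prop) (n1 2)).sub
    (ContinuousOn.div (by fun_prop) (by fun_prop) (n1 3))).add
    (ContinuousOn.mul (by fun_prop) ((ContinuousOn.div (by fun_prop) (by fun_prop) (n1 4)).sub
      (ContinuousOn.div (by fun_prop) (by fun_prop) (n1 3))))

theorem abs_shifted_le {T : ℝ} (hT1 : 1 ≤ T) (hx : |r - c| ≤ T) (hi : |(k r)⁻¹| ≤ T)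
    (hy : |k' r| ≤ T) (hz : |k₂| ≤ T) :
    |shiftedQuot c k r| ≤ 20 * T ^ 8 ∧ |shiftedQuotD c k k' r| ≤ 20 * T ^ 8 ∧
      |shiftedWeight c k k' r| ≤ 20 * T ^ 8 ∧ |shiftedWeightD c k k' k₂ r| ≤ 20 * T ^ 8 ∧
      |shiftedWeightDD c k k' k₂ r| ≤ 20 * T ^ 8 := by
  have e1 : shiftedQuot c k r = (r - c) * (k r)⁻¹ := div_eq_mul_inv _ _
  have e2 : shiftedQuotD c k k' r = (k r)⁻¹ - (r - c) * k' r * (k r)⁻¹ ^ 2 := by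
    rw [shiftedQuotD, div_eq_mul_inv, div_eq_mul_inv, one_mul, inv_pow]
  have e3 : shiftedWeight c k k' r = (k r)⁻¹ + (r - c) * k' r * (k r)⁻¹ ^ 2 := by
    rw [shiftedWeight, div_eq_mul_inv, div_eq_mul_inv, one_mul, inv_pow]
  have e4 : shiftedWeightD c k k' k₂ r
      = (r - c) * (k₂ * (k r)⁻¹ ^ 2) - 2 * ((r - c) * (k' r ^ 2 * (k r)⁻¹ ^ 3)) := by
    rw [shiftedWeightD, div_eq_mul_inv, div_eq_mul_inv, inv_pow, inv_pow]; ring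
  have e5 : shiftedWeightDD c k k' k₂ r
      = k₂ * (k r)⁻¹ ^ 2 - 2 * (k' r ^ 2 * (k r)⁻¹ ^ 3)
        + 6 * ((r - c) * (k' r ^ 3 * (k r)⁻¹ ^ 4))
        - 6 * ((r - c) * (k' r * k₂ * (k r)⁻¹ ^ 3)) := by
    simp only [shiftedWeightDD, div_eq_mul_inv, inv_pow]; ring
  rw [e1, e2, e3, e4, e5]
  clear e1 e2 e3 e4 e5
  generalize r - c = x at *
  generalize (k r)⁻¹ = i at *
  generalize k' r = y at *
  have hT0 : 0 ≤ T := by linarith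
  -- every monomial of degree at most eight in these quantities is at most `T ^ 8`
  have pw : ∀ {n : ℕ}, n ≤ 8 → T ^ n ≤ T ^ 8 := fun hn => pow_le_pow_right₀ hT1 hn
  have ap : ∀ {u : ℝ} (n : ℕ), |u| ≤ T → |u ^ n| ≤ T ^ n := fun n hu => by
    rw [abs_pow]; exact pow_le_pow_left₀ (abs_nonneg _) hu n
  have am : ∀ {u v : ℝ} {i j : ℕ}, |u| ≤ T ^ i → |v| ≤ T ^ j → |u * v| ≤ T ^ (i + j) :=
    fun hu hv => by
      rw [abs_mul, pow_add]; exact mul_le_mul hu hv (abs_nonneg _) (by positivity)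
  have h1 : ∀ {u : ℝ}, |u| ≤ T → |u| ≤ T ^ 1 := fun hu => by rwa [pow_one]
  have m1 := (h1 hi).trans (pw (by norm_num))
  have m2 := (am (h1 hx) (h1 hi)).trans (pw (by norm_num))
  have m3 := (am (am (h1 hx) (h1 hy)) (ap 2 hi)).trans (pw (by norm_num))
  have m4 := (am (h1 hx) (am (h1 hz) (ap 2 hi))).trans (pw (by norm_num))
  have m5 := (am (h1 hx) (am (ap 2 hy) (ap 3 hi))).trans (pw (by norm_num))
  have m6 := (am (h1 hz) (ap 2 hi)).trans (pw (by norm_num))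
  have m7 := (am (ap 2 hy) (ap 3 hi)).trans (pw (by norm_num))
  have m8 := (am (h1 hx) (am (ap 3 hy) (ap 4 hi))).trans (pw (by norm_num))
  have m9 := (am (h1 hx) (am (am (h1 hy) (h1 hz)) (ap 3 hi))).trans (pw (by norm_num))
  have hT8 : 0 < T ^ 8 := by positivity
  clear pw ap am h1 hx hi hy hz hT0 hT1
  generalize x * i = v2 at *
  generalize x * y * i ^ 2 = v3 at *
  generalize x * (k₂ * i ^ 2) = v4 at *
  generalize x * (y ^ 2 * i ^ 3) = v5 at *
  generalize x * (y ^ 3 * i ^ 4) = v8 at *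
  generalize x * (y * k₂ * i ^ 3) = v9 at *
  generalize k₂ * i ^ 2 = v6 at *
  generalize y ^ 2 * i ^ 3 = v7 at *
  generalize T ^ 8 = V at *
  rw [abs_le] at m1 m2 m3 m4 m5 m6 m7 m8 m9
  simp only [abs_le]
  refine ⟨⟨?_, ?_⟩, ⟨?_, ?_⟩, ⟨?_, ?_⟩, ⟨?_, ?_⟩, ⟨?_, ?_⟩⟩ <;> linarith

end

/-- The bulk coefficient of the trapping multiplier: the terms without `L` cancel. -/
theorem shifted_bulk_eq {a M l ω m L e c r : ℝ} (he : e ^ 2 = 1) (hne : carterK a l ω m r ≠ 0) :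
    shiftedQuotD c (fun r => e * carterK a l ω m r) (fun r => e * (2 * ω * r)) r
        * principalG a M l ω m L r
      + shiftedQuot c (fun r => e * carterK a l ω m r) r * principalGD a M l ω m L r
      - shiftedWeight c (fun r => e * carterK a l ω m r) (fun r => e * (2 * ω * r)) r
        * principalG a M l ω m L r
      = L * ((c - r) * trappingFn a M l ω m r) / (e * carterK a l ω m r) ^ 3 := by
  have hene : e ≠ 0 := by rintro rfl; norm_num at he
  have he3 : e ^ 3 = e := by rw [pow_succ, he, one_mul]
  simp only [shiftedQuotD, shiftedQuot, shiftedWeight, principalG, principalGD, trappingFn]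
  rw [mul_pow, mul_pow, he, he3]
  generalize carterK a l ω m r = K at *
  field_simp
  rw [he]
  ring

/-- The derivative of `(r - c) Δ` is positive near `c`. -/
theorem deriv_shifted_Delta_ge {a M l p q B Δ₀ c r : ℝ} (hΔ₀ : 0 < Δ₀)
    (hB : ∀ x ∈ Icc p q, |DeltaD a M l x| ≤ B) (hc : c ∈ Icc p q) (hr : r ∈ Icc p q)
    (hΔ : Δ₀ ≤ Delta a M l c) :
    Δ₀ / 2 - 2 * B ^ 2 / Δ₀ * (r - c) ^ 2 ≤ DeltaD a M l r * (r - c) + Delta a M l r := by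
  have h1 := (convex_Icc p q).norm_image_sub_le_of_norm_hasDerivWithin_le
    (fun x _ => (hasDerivAt_Delta a M l x).hasDerivWithinAt) hB hc hr
  have h2 : |DeltaD a M l r * (r - c)| ≤ B * |r - c| := by
    rw [abs_mul]; exact mul_le_mul_of_nonneg_right (hB r hr) (abs_nonneg _)
  have e : Δ₀ / 2 + 2 * B ^ 2 / Δ₀ * (r - c) ^ 2 - 2 * (B * |r - c|)
      = (Δ₀ - 2 * B * |r - c|) ^ 2 / (2 * Δ₀) := by
    rw [← sq_abs (r - c)]; field_simp; ring
  have h3 : 0 ≤ (Δ₀ - 2 * B * |r - c|) ^ 2 / (2 * Δ₀) := by positivity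
  rw [norm_eq_abs, norm_eq_abs] at h1
  linarith [(abs_le.1 h1).1, (abs_le.1 h2).1]

theorem two_mul_inner_ge (x y : ℂ) (t : ℝ) {δ : ℝ} (hδ : 0 < δ) :
    -(δ * ‖y‖ ^ 2) - t ^ 2 / δ * ‖x‖ ^ 2 ≤ 2 * t * inner ℝ x y := by
  have h1 : |t * inner ℝ x y| ≤ |t| * (‖x‖ * ‖y‖) := by
    rw [abs_mul]
    exact mul_le_mul_of_nonneg_left (abs_real_inner_le_norm _ _) (abs_nonneg _)
  have e : δ * ‖y‖ ^ 2 + t ^ 2 / δ * ‖x‖ ^ 2 - 2 * (|t| * (‖x‖ * ‖y‖))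
      = (δ * ‖y‖ - |t| * ‖x‖) ^ 2 / δ := by
    rw [← sq_abs t]; field_simp; ring
  have : 0 ≤ (δ * ‖y‖ - |t| * ‖x‖) ^ 2 / δ := by positivity
  linarith [(abs_le.1 h1).1]

theorem unit_frequency_lower_bound {a l ω m p c : ℝ} (hp : 0 < p) (hc : 0 < c)
    (hK : c ≤ |carterK a l ω m p|) :
    c ^ 2 / (2 * ((p ^ 2 + a ^ 2) ^ 2 + (a * Xi a l) ^ 2)) ≤ ω ^ 2 + m ^ 2 := by
  have h2 : c ^ 2 ≤ carterK a l ω m p ^ 2 := by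
    rw [← sq_abs (carterK a l ω m p)]; exact pow_le_pow_left₀ hc.le hK 2
  have h4 : ∀ u v y z : ℝ, (u * y - z * v) ^ 2 ≤ (u ^ 2 + v ^ 2) * (2 * (y ^ 2 + z ^ 2)) :=
    fun u v y z => by
      nlinarith [sq_nonneg (u * y + z * v), sq_nonneg (u * z), sq_nonneg (v * y)]
  rw [div_le_iff₀ (by positivity)]
  exact h2.trans (h4 ω m (p ^ 2 + a ^ 2) (a * Xi a l))

set_option maxHeartbeats 1000000 in
/-- The estimate near and away from the trapped orbit: a current that changes sign at the
trapping radius `rc`, with weight degenerating quadratically there. -/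
theorem Horizons.exists_trapped_estimate {a M l p q s c ε Rm Rp c₂ : ℝ}
    (hh : Horizons a M l p q s) (musq : ℝ) (hc : 0 < c) (hε : 0 < ε) (hRm : p < Rm)
    (hRp : Rp < q) (hR : Rm < Rp) (hc₂ : 0 < c₂) : ∃ N₀ > 0, ∃ C > 0, ∀ ω m L, 0 ≤ L → ε ≤ L →
      ω ^ 2 + m ^ 2 + L = 1 → (∀ r ∈ Icc p q, c ≤ |carterK a l ω m r|) →
      ∀ rc ∈ Icc Rm Rp, (∀ r ∈ Icc p q,
        c₂ * (ω ^ 2 + m ^ 2) * (r - rc) ^ 2 ≤ (rc - r) * trappingFn a M l ω m r) → ∀ N ≥ N₀,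
      ∀ (Ψ w F : ℝ → ℂ) (P Q : ℝ),
        RadialSolution a M l musq (N * ω) (N * m) (N ^ 2 * L) p q Ψ w F P Q →
        ∫ r in p..q, (‖w r‖ ^ 2 + (1 + N ^ 2 * (r - rc) ^ 2) * ‖Ψ r‖ ^ 2) ≤
          C * (carterK a l (N * ω) (N * m) q ^ 2 * Q + carterK a l (N * ω) (N * m) p ^ 2 * P
            + ∫ r in p..q, ‖F r‖ ^ 2) := by
  have hpq := hh.p_lt
  have hp := hh.p_pos
  obtain ⟨C, hC, hbd⟩ := exists_unit_bound a M l p q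
  obtain ⟨D, hD, hmult⟩ := hh.exists_multiplierDensity_ge musq
  obtain ⟨B, hB⟩ := isCompact_Icc.exists_bound_of_continuousOn (s := Icc p q)
    (continuous_DeltaD a M l).continuousOn
  obtain ⟨Δ₀, hΔ₀, hΔ⟩ := exists_pos_le_of_isCompact (isCompact_Icc (a := Rm) (b := Rp))
    (continuous_Delta a M l).continuousOn
    (fun r hr => hh.Delta_pos ⟨hRm.trans_le hr.1, hr.2.trans_lt hRp⟩)
  have hci : 0 < 1 / c := by positivity
  obtain ⟨T, hT⟩ : ∃ T, T = C + 2 + 1 / c + (q - p) := ⟨_, rfl⟩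
  have hT1 : 1 ≤ T := by linarith
  obtain ⟨Y, hY⟩ : ∃ Y, Y = 20 * T ^ 8 := ⟨_, rfl⟩
  have hY0 : 0 < Y := by rw [hY]; positivity
  obtain ⟨n₀, hn₀⟩ : ∃ n, n = c ^ 2 / (2 * ((p ^ 2 + a ^ 2) ^ 2 + (a * Xi a l) ^ 2)) := ⟨_, rfl⟩
  have hn₀0 : 0 < n₀ := by rw [hn₀]; positivity
  obtain ⟨c₃, hc₃⟩ : ∃ x, x = ε * (c₂ * n₀) / C ^ 3 := ⟨_, rfl⟩
  have hc₃0 : 0 < c₃ := by rw [hc₃]; positivity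
  obtain ⟨κ₀, hκ₀⟩ : ∃ x, x = 2 * (D * Y + 2) / Δ₀ := ⟨_, rfl⟩
  have hκ₀0 : 0 < κ₀ := by rw [hκ₀]; positivity
  obtain ⟨δ, hδ⟩ : ∃ x, x = 1 / (2 * C) := ⟨_, rfl⟩
  have hδ0 : 0 < δ := by rw [hδ]; positivity
  have hCδ : 2 / C = 4 * δ := by rw [hδ]; field_simp; norm_num
  obtain ⟨C₁, hC₁⟩ : ∃ x, x = Y ^ 2 / δ + (D * Y) ^ 2 := ⟨_, rfl⟩
  have hC₁0 : 0 < C₁ := by rw [hC₁]; positivity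
  obtain ⟨Z, hZ⟩ : ∃ x, x = κ₀ * (2 * B ^ 2 / Δ₀) + κ₀ ^ 2 / δ := ⟨_, rfl⟩
  have hZ0 : 0 < Z := by rw [hZ]; positivity
  obtain ⟨κ, hκ0, hκ1, hκ2, hκ3⟩ : ∃ κ > 0, κ ≤ 2 * δ ∧ κ ≤ 1 ∧ κ ≤ c₃ / 2 :=
    ⟨min (2 * δ) (min 1 (c₃ / 2)), by
      simp only [lt_min_iff, gt_iff_lt]; exact ⟨by positivity, by norm_num, by positivity⟩,
      min_le_left _ _, (min_le_right _ _).trans (min_le_left _ _),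
      (min_le_right _ _).trans (min_le_right _ _)⟩
  refine ⟨√(Z / (c₃ / 2)), sqrt_pos.2 (by positivity), (2 * Y + C₁) / κ, by positivity, ?_⟩
  intro ω m L hL hLε hunit hK rc hrc hΘ N hN Ψ w F P Q h
  have hb := hbd ω m L hL hunit
  have hN2 := mul_le_of_sq_le (by positivity) hN
  have hrc' : rc ∈ Icc p q := ⟨hRm.le.trans hrc.1, hrc.2.trans hRp.le⟩
  have hn : n₀ ≤ ω ^ 2 + m ^ 2 := by
    rw [hn₀]; exact unit_frequency_lower_bound hp hc (hK p (left_mem_Icc.2 hpq.le))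
  have hω := (abs_le_one_of_unit hL hunit).1
  obtain ⟨e, he, hpos⟩ := exists_sign_mul_ge hpq.le hc (continuous_carterK a l ω m).continuousOn hK
  have heabs : |e| = 1 := by
    have : |e| ^ 2 = 1 := by rw [sq_abs, he]
    exact (pow_eq_one_iff_of_nonneg (abs_nonneg _) two_ne_zero).1 this
  have hbulk : ∀ r ∈ Icc p q, _ := fun r hr => shifted_bulk_eq (a := a) (M := M) (l := l) (ω := ω)
    (m := m) (L := L) (c := rc) (r := r) he
    (fun h0 => by have := hpos r hr; rw [h0, mul_zero] at this; linarith)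
  obtain ⟨k0, hk0⟩ : ∃ k0 : ℝ → ℝ, k0 = fun r => e * carterK a l ω m r := ⟨_, rfl⟩
  obtain ⟨k1, hk1⟩ : ∃ k1 : ℝ → ℝ, k1 = fun r => e * (2 * ω * r) := ⟨_, rfl⟩
  obtain ⟨k2, hk2⟩ : ∃ k2 : ℝ, k2 = e * (2 * ω) := ⟨_, rfl⟩
  have dk0 : ∀ r, HasDerivAt k0 (k1 r) r := fun r => by
    rw [hk0, hk1]; exact (hasDerivAt_carterK a l ω m r).const_mul e
  have dk1 : ∀ r, HasDerivAt k1 k2 r := fun r => by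
    rw [hk1, hk2]
    exact (((hasDerivAt_id r).const_mul (2 * ω)).const_mul e).congr_deriv (by simp)
  have hkc : ∀ r ∈ Icc p q, c ≤ k0 r := fun r hr => by rw [hk0]; exact hpos r hr
  have hkC : ∀ r ∈ Icc p q, k0 r ≤ C := fun r hr => by
    rw [hk0]
    refine (le_abs_self _).trans ?_
    rw [abs_mul, heabs, one_mul]
    exact (hb r hr).1
  have hk1C : ∀ r ∈ Icc p q, |k1 r| ≤ T := fun r hr => by
    rw [hk1]
    simp only
    rw [abs_mul, heabs, one_mul]
    linarith [(hb r hr).2.1]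
  have hk2C : |k2| ≤ T := by
    rw [hk2, abs_mul, heabs, one_mul, abs_mul, abs_two]
    linarith
  rw [← hk0, ← hk1] at hbulk
  have hkr : ∀ r, e * carterK a l ω m r = k0 r := fun r => by rw [hk0]
  clear hpos hk0 hk1 hk2
  have hkne : ∀ r ∈ Icc p q, k0 r ≠ 0 := fun r hr => (hc.trans_le (hkc r hr)).ne'
  have ck0 : Continuous k0 := continuous_iff_continuousAt.2 fun r => (dk0 r).continuousAt
  have ck1 : Continuous k1 := continuous_iff_continuousAt.2 fun r => (dk1 r).continuousAt
  have hbds : ∀ r ∈ Icc p q, _ := fun r hr => abs_shifted_le (k := k0) (k' := k1) (k₂ := k2)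
    (c := rc) (r := r) hT1
    (by rw [abs_le]; constructor <;> linarith [hr.1, hr.2, hrc'.1, hrc'.2])
    (by
      rw [abs_of_pos (inv_pos.2 (hc.trans_le (hkc r hr)))]
      have := inv_anti₀ hc (hkc r hr)
      rw [← one_div c] at this
      linarith) (hk1C r hr) hk2C
  rw [← hY] at hbds
  have ib : IntervalIntegrable (fun r => κ * ‖w r‖ ^ 2
      + (κ * (1 + N ^ 2 * (r - rc) ^ 2)) * ‖Ψ r‖ ^ 2) volume p q :=
    h.integrable_sq hpq.le (by fun_prop) (by fun_prop)
  have hpt : ∀ r ∈ Ioo p q, κ * ‖w r‖ ^ 2 + (κ * (1 + N ^ 2 * (r - rc) ^ 2)) * ‖Ψ r‖ ^ 2 ≤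
      RadialSolution.multiplierDensity a M l musq (N * ω) (N * m) (N ^ 2 * L)
        (shiftedQuot rc k0) (shiftedQuotD rc k0 k1) (shiftedWeight rc k0 k1)
        (shiftedWeightD rc k0 k1 k2) (shiftedWeightDD rc k0 k1 k2) (fun r => κ₀ * (r - rc))
        (fun _ => κ₀) Ψ w F r + C₁ * ‖F r‖ ^ 2 := by
    intro r hr
    have hr' : r ∈ Icc p q := ⟨hr.1.le, hr.2.le⟩
    obtain ⟨b1, b2, b3, b4, b5⟩ := hbds r hr'
    have hm := hmult (N * ω) (N * m) (N ^ 2 * L) Y δ (shiftedQuot rc k0) (shiftedQuotD rc k0 k1)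
      (shiftedWeight rc k0 k1) (shiftedWeightD rc k0 k1 k2) (shiftedWeightDD rc k0 k1 k2)
      (fun r => κ₀ * (r - rc)) (fun _ => κ₀) Ψ w F hδ0 r hr' b1 b2 b3 b4 b5
    rw [principalG_scale, principalGD_scale, ← hC₁] at hm
    refine le_trans ?_ hm
    have hkp := hc.trans_le (hkc r hr')
    -- the coefficient of `|w|²`
    have hA : 4 * δ ≤ shiftedQuotD rc k0 k1 r + shiftedWeight rc k0 k1 r := by
      have : shiftedQuotD rc k0 k1 r + shiftedWeight rc k0 k1 r = 2 / k0 r := by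
        unfold shiftedQuotD shiftedWeight; ring
      rw [this, ← hCδ]
      exact div_le_div_of_nonneg_left (by norm_num) hkp (hkC r hr')
    -- the coefficient of `|Ψ|²`
    have hG : c₃ * (r - rc) ^ 2 ≤ shiftedQuotD rc k0 k1 r * principalG a M l ω m L r
        + shiftedQuot rc k0 r * principalGD a M l ω m L r
        - shiftedWeight rc k0 k1 r * principalG a M l ω m L r := by
      have hb0 := hbulk r hr'
      rw [hb0, hkr]
      have h1 : ε * (c₂ * n₀ * (r - rc) ^ 2) ≤ L * ((rc - r) * trappingFn a M l ω m r) := by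
        refine mul_le_mul hLε (le_trans ?_ (hΘ r hr')) (by positivity) hL
        exact mul_le_mul_of_nonneg_right (mul_le_mul_of_nonneg_left hn hc₂.le) (sq_nonneg _)
      have h2 : c₃ * (r - rc) ^ 2 = ε * (c₂ * n₀ * (r - rc) ^ 2) / C ^ 3 := by rw [hc₃]; ring
      rw [h2]
      exact div_le_div₀ (le_trans (by positivity) h1) h1 (pow_pos hkp 3)
        (pow_le_pow_left₀ hkp.le (hkC r hr') 3)
    have hE := mul_le_mul_of_nonneg_left (deriv_shifted_Delta_ge hΔ₀ hB hrc' hr' (hΔ rc hrc))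
      hκ₀0.le
    have hκΔ : κ₀ * (Δ₀ / 2) = D * Y + 2 := by rw [hκ₀]; field_simp
    have hcross := two_mul_inner_ge (Ψ r) (w r) (κ₀ * (r - rc)) hδ0
    generalize shiftedQuotD rc k0 k1 r = A1 at *
    generalize shiftedQuot rc k0 r = A2 at *
    generalize shiftedWeight rc k0 k1 r = A3 at *
    generalize principalG a M l ω m L r = g0 at *
    generalize principalGD a M l ω m L r = g1 at *
    have t1 : κ * ‖w r‖ ^ 2 ≤ (A1 + A3 - δ - δ) * ‖w r‖ ^ 2 :=
      mul_le_mul_of_nonneg_right (by linarith only [hA, hκ1]) (sq_nonneg _)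
    have t2 : κ * (1 + N ^ 2 * (r - rc) ^ 2) + (κ₀ * (r - rc)) ^ 2 / δ ≤
        A1 * (N ^ 2 * g0) + A2 * (N ^ 2 * g1) - A3 * (N ^ 2 * g0)
        - D * Y - 1 + (DeltaD a M l r * (κ₀ * (r - rc)) + Delta a M l r * κ₀) := by
      have i1 := mul_le_mul_of_nonneg_right hG (sq_nonneg N)
      have i2 := mul_le_mul_of_nonneg_right hN2 (sq_nonneg (r - rc))
      have i3 : κ * (N ^ 2 * (r - rc) ^ 2) ≤ c₃ / 2 * (N ^ 2 * (r - rc) ^ 2) :=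
        mul_le_mul_of_nonneg_right hκ3 (by positivity)
      have i4 : Z * (r - rc) ^ 2 = κ₀ * (2 * B ^ 2 / Δ₀ * (r - rc) ^ 2)
          + (κ₀ * (r - rc)) ^ 2 / δ := by rw [hZ]; ring
      generalize (κ₀ * (r - rc)) ^ 2 / δ = v1 at *
      generalize 2 * B ^ 2 / Δ₀ = v2 at *
      linarith only [i1, i2, i3, i4, hE, hκΔ, hκ2]
    have t3 := mul_le_mul_of_nonneg_right t2 (sq_nonneg ‖Ψ r‖)
    linarith only [t1, t3, hcross]
  have hest := h.multiplier_estimate hh (fun r hr => hasDerivAt_shiftedQuot (dk0 r) (hkne r hr))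
    (fun r hr => hasDerivAt_shiftedWeight (dk0 r) (dk1 r) (hkne r hr))
    (fun r hr => hasDerivAt_shiftedWeightD (dk0 r) (dk1 r) (hkne r hr))
    (fun r _ => (((hasDerivAt_id r).sub_const rc).const_mul κ₀).congr_deriv (mul_one _))
    (continuousOn_shiftedQuotD ck0 ck1 hkne) (continuousOn_shiftedWeightDD ck0 ck1 hkne)
    continuousOn_const ib hpt
  have hP := h.P_nonneg
  have hQ := h.Q_nonneg
  have hFn : 0 ≤ ∫ r in p..q, ‖F r‖ ^ 2 :=
    intervalIntegral.integral_nonneg hpq.le fun r _ => by positivity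
  have ee : ∫ r in p..q, (κ * ‖w r‖ ^ 2 + (κ * (1 + N ^ 2 * (r - rc) ^ 2)) * ‖Ψ r‖ ^ 2)
      = κ * ∫ r in p..q, (‖w r‖ ^ 2 + (1 + N ^ 2 * (r - rc) ^ 2) * ‖Ψ r‖ ^ 2) := by
    rw [← intervalIntegral.integral_const_mul]
    congr 1; ext r; ring
  rw [ee] at hest
  rw [div_mul_eq_mul_div, le_div_iff₀ hκ0]
  have hX : 0 ≤ carterK a l (N * ω) (N * m) q ^ 2 * Q := by positivity
  have hX' : 0 ≤ carterK a l (N * ω) (N * m) p ^ 2 * P := by positivity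
  generalize carterK a l (N * ω) (N * m) q ^ 2 * Q = X at *
  generalize carterK a l (N * ω) (N * m) p ^ 2 * P = X' at *
  have i1 := mul_le_mul_of_nonneg_right
    ((le_abs_self _).trans (hbds q (right_mem_Icc.2 hpq.le)).1) hX
  have i2 := mul_le_mul_of_nonneg_right (abs_le.1 (hbds p (left_mem_Icc.2 hpq.le)).1).1 hX'
  have i3 : 0 ≤ C₁ * X := by positivity
  have i4 : 0 ≤ C₁ * X' := by positivity
  have i6 : 0 ≤ Y * ∫ r in p..q, ‖F r‖ ^ 2 := by positivity
  linarith only [i1, i2, i3, i4, i6, hest]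

/-- `rc` is the radius of the trapped orbit for the frequencies `(ω, m)`, with a quantitative
nondegeneracy. -/
def IsTrappingRadius (a M l p q c ω m rc : ℝ) : Prop :=
  ∀ r ∈ Icc p q, c * (ω ^ 2 + m ^ 2) * (r - rc) ^ 2 ≤ (rc - r) * trappingFn a M l ω m r

theorem isTrappingRadius_scale {a M l p q c ω m rc N : ℝ} (hN : 0 < N) :
    IsTrappingRadius a M l p q c (N * ω) (N * m) rc ↔ IsTrappingRadius a M l p q c ω m rc := by
  unfold IsTrappingRadius
  refine forall₂_congr fun r _ => ?_
  rw [trappingFn_scale]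
  have e1 : c * ((N * ω) ^ 2 + (N * m) ^ 2) * (r - rc) ^ 2
      = N ^ 2 * (c * (ω ^ 2 + m ^ 2) * (r - rc) ^ 2) := by ring
  have e2 : (rc - r) * (N ^ 2 * trappingFn a M l ω m r)
      = N ^ 2 * ((rc - r) * trappingFn a M l ω m r) := by ring
  rw [e1, e2]
  exact mul_le_mul_iff_right₀ (by positivity)

theorem isAdmissible_scale {a l ω m L N : ℝ} (hN : 0 < N)
    (h : IsAdmissible a l (N * ω) (N * m) (N ^ 2 * L)) : IsAdmissible a l ω m L := by
  obtain ⟨hL, σ, hσ, hle⟩ := h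
  have hN2 : 0 < N ^ 2 := by positivity
  refine ⟨nonneg_of_mul_nonneg_right hL hN2, σ, hσ, ?_⟩
  have e1 : (Xi a l * (N * m) - a * (N * ω) * σ ^ 2) ^ 2
      = N ^ 2 * (Xi a l * m - a * ω * σ ^ 2) ^ 2 := by ring
  have e2 : Xi a l * (σ ^ 2 * (N ^ 2 * L)) = N ^ 2 * (Xi a l * (σ ^ 2 * L)) := by ring
  rw [e1, e2] at hle
  exact le_of_mul_le_mul_left hle hN2

/-- Existence of the trapping radius for frequencies with `|K| ≥ c (ω² + m²)^{1/2}`. -/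
theorem Horizons.exists_isTrappingRadius {a M l p q s c : ℝ} (hh : Horizons a M l p q s)
    (hc : 0 < c) : ∃ Rm Rp c₂, p < Rm ∧ Rm < Rp ∧ Rp < q ∧ 0 < c₂ ∧
      ∀ ω m N, 0 < N → ω ^ 2 + m ^ 2 ≤ N ^ 2 → (∀ r ∈ Icc p q, c * N ≤ |carterK a l ω m r|) →
        ∃ rc ∈ Ioo Rm Rp, IsTrappingRadius a M l p q c₂ ω m rc := by
  obtain ⟨Rm, Rp, c₂, h1, h2, h3, h4, h5⟩ := hh.exists_trapping_radius hc
  refine ⟨Rm, Rp, c₂, h1, h2, h3, h4, fun ω m N hN hle hK => ?_⟩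
  have hpm : p ∈ Icc p q := left_mem_Icc.2 hh.p_lt.le
  have hpos : 0 < ω ^ 2 + m ^ 2 := by
    by_contra hcon
    push Not at hcon
    have e1 : ω = 0 := by nlinarith [sq_nonneg ω, sq_nonneg m]
    have e2 : m = 0 := by nlinarith [sq_nonneg ω, sq_nonneg m]
    have := hK p hpm
    rw [e1, e2] at this
    simp only [carterK, zero_mul, mul_zero, sub_zero, abs_zero] at this
    nlinarith
  set n := √(ω ^ 2 + m ^ 2)
  have hn0 : 0 < n := sqrt_pos.2 hpos
  have hn2 : n ^ 2 = ω ^ 2 + m ^ 2 := sq_sqrt hpos.le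
  have hnN : n ≤ N := sqrt_le_iff.2 ⟨hN.le, hle⟩
  have eω : ω = n * (ω / n) := by field_simp
  have em : m = n * (m / n) := by field_simp
  obtain ⟨rc, hrc, h⟩ := h5 (ω / n) (m / n) (by rw [div_pow, div_pow, ← add_div, hn2]; exact div_self hpos.ne')
    (fun r hr => by
      have h6 := hK r hr
      rw [eω, em, carterK_scale, abs_mul, abs_of_pos hn0] at h6
      have h7 : c * n ≤ n * |carterK a l (ω / n) (m / n) r| :=
        (mul_le_mul_of_nonneg_left hnN hc.le).trans h6
      rw [mul_comm c] at h7
      exact le_of_mul_le_mul_left h7 hn0)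
  refine ⟨rc, hrc, ?_⟩
  rw [eω, em, isTrappingRadius_scale hn0]
  intro r hr
  have e : (ω / n) ^ 2 + (m / n) ^ 2 = 1 := by
    rw [div_pow, div_pow, ← add_div, hn2]; exact div_self hpos.ne'
  rw [e, mul_one]
  exact h r hr

/-- The estimates at high frequencies `N² = ω² + m² + L`. If `K` is small somewhere, there is no
loss and no boundary term; otherwise there is a trapped orbit, and the boundary terms have to be
controlled by the flux. -/
theorem Horizons.exists_high_frequency_estimate {a M l p q s : ℝ} (hh : Horizons a M l p q s)
    (musq : ℝ) : ∃ Rm Rp c₂ η N₀ C, p < Rm ∧ Rm < Rp ∧ Rp < q ∧ 0 < c₂ ∧ 0 < η ∧ 0 < N₀ ∧ 0 < C ∧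
      ∀ ω m L N, IsAdmissible a l ω m L → N₀ ≤ N → N ^ 2 = ω ^ 2 + m ^ 2 + L →
        ((∃ t ∈ Icc p q, |carterK a l ω m t| < η * N) → ∀ (Ψ w F : ℝ → ℂ) (P Q : ℝ),
          RadialSolution a M l musq ω m L p q Ψ w F P Q →
          ∫ r in p..q, (‖w r‖ ^ 2 + N ^ 2 * ‖Ψ r‖ ^ 2) ≤ C * ∫ r in p..q, ‖F r‖ ^ 2) ∧
        ((∀ t ∈ Icc p q, η * N ≤ |carterK a l ω m t|) →
          (∃ rc ∈ Ioo Rm Rp, IsTrappingRadius a M l p q c₂ ω m rc) ∧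
          ∀ rc ∈ Ioo Rm Rp, IsTrappingRadius a M l p q c₂ ω m rc → ∀ (Ψ w F : ℝ → ℂ) (P Q : ℝ),
          RadialSolution a M l musq ω m L p q Ψ w F P Q →
          ∫ r in p..q, (‖w r‖ ^ 2 + (1 + N ^ 2 * (r - rc) ^ 2) * ‖Ψ r‖ ^ 2) ≤
            C * (carterK a l ω m q ^ 2 * Q + carterK a l ω m p ^ 2 * P
              + ∫ r in p..q, ‖F r‖ ^ 2)) := by
  have hpq := hh.p_lt
  obtain ⟨η, hη, N₁, hN₁, C₁, hC₁, H1⟩ := hh.exists_barrier_estimate musq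
  obtain ⟨Rm, Rp, c₂, g1, g2, g3, g4, g5⟩ := hh.exists_isTrappingRadius hη
  obtain ⟨ε, hε, N₂, hN₂, C₂, hC₂, H2⟩ := hh.exists_untrapped_estimate musq hη
  obtain ⟨N₃, hN₃, C₃, hC₃, H3⟩ := hh.exists_trapped_estimate musq hη hε g1 g3 g2 g4
  obtain ⟨N₀, hN0, i1, i2, i3⟩ : ∃ N₀ > 0, N₁ ≤ N₀ ∧ N₂ ≤ N₀ ∧ N₃ ≤ N₀ :=
    ⟨max N₁ (max N₂ N₃), lt_max_of_lt_left hN₁, le_max_left _ _,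
      (le_max_left _ _).trans (le_max_right _ _), (le_max_right _ _).trans (le_max_right _ _)⟩
  obtain ⟨A, hA⟩ : ∃ A, A = 1 / N₀ ^ 2 + (q - p) ^ 2 + 1 := ⟨_, rfl⟩
  have hA0 : 1 ≤ A := by rw [hA]; have : 0 ≤ 1 / N₀ ^ 2 + (q - p) ^ 2 := by positivity
                         linarith
  refine ⟨Rm, Rp, c₂, η, N₀, C₁ + A * C₂ + C₃, g1, g2, g3, g4, hη, hN0, by positivity, ?_⟩
  intro ω m L N had hN hNe
  have hNpos : 0 < N := hN0.trans_le hN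
  have hN2 : 0 < N ^ 2 := by positivity
  have eω : ω = N * (ω / N) := by field_simp
  have em : m = N * (m / N) := by field_simp
  have eL : L = N ^ 2 * (L / N ^ 2) := by field_simp
  have hL := had.1
  have hunit : (ω / N) ^ 2 + (m / N) ^ 2 + L / N ^ 2 = 1 := by
    rw [div_pow, div_pow, ← add_div, ← add_div, ← hNe]; exact div_self hN2.ne'
  have hFn : ∀ F : ℝ → ℂ, 0 ≤ ∫ r in p..q, ‖F r‖ ^ 2 := fun F =>
    intervalIntegral.integral_nonneg hpq.le fun r _ => by positivity
  have hle : ω ^ 2 + m ^ 2 ≤ N ^ 2 := by linarith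
  generalize ω / N = ω' at *
  generalize m / N = m' at *
  generalize L / N ^ 2 = L' at *
  subst eω em eL
  have hL' : 0 ≤ L' := nonneg_of_mul_nonneg_right hL hN2
  have hKs : ∀ r, |carterK a l (N * ω') (N * m') r| = |carterK a l ω' m' r| * N := fun r => by
    rw [carterK_scale, abs_mul, abs_of_pos hNpos, mul_comm]
  refine ⟨?_, fun hK => ⟨g5 _ _ N hNpos hle hK, ?_⟩⟩
  · rintro ⟨t, ht, hKt⟩ Ψ w F P Q h
    rw [hKs] at hKt
    refine (H1 ω' m' L' (isAdmissible_scale hNpos had) hunit t ht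
      (lt_of_mul_lt_mul_right hKt hNpos.le) N (i1.trans hN) Ψ w F P Q h).trans ?_
    refine mul_le_mul_of_nonneg_right ?_ (hFn F)
    have : 0 < A * C₂ := by positivity
    linarith
  · intro rc hrc htrap Ψ w F P Q h
    have hK' : ∀ r ∈ Icc p q, η ≤ |carterK a l ω' m' r| := fun r hr => by
      have := hK r hr
      rw [hKs] at this
      exact le_of_mul_le_mul_right this hNpos
    have hP := h.P_nonneg
    have hQ := h.Q_nonneg
    have hFn' := hFn F
    have hX : 0 ≤ carterK a l (N * ω') (N * m') q ^ 2 * Q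
        + carterK a l (N * ω') (N * m') p ^ 2 * P + ∫ r in p..q, ‖F r‖ ^ 2 := by positivity
    rcases le_total L' ε with hLε | hLε
    · have h1 := H2 ω' m' L' hL' hLε hunit hK' N (i2.trans hN) Ψ w F P Q h
      have h2 : ∫ r in p..q, (‖w r‖ ^ 2 + (1 + N ^ 2 * (r - rc) ^ 2) * ‖Ψ r‖ ^ 2)
          ≤ A * ∫ r in p..q, (‖w r‖ ^ 2 + N ^ 2 * ‖Ψ r‖ ^ 2) := by
        rw [← intervalIntegral.integral_const_mul]
        refine intervalIntegral.integral_mono_on hpq.le ?_ ?_ fun r hr => ?_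
        · have := h.integrable_sq hpq.le (φ := fun _ => 1)
            (ψ := fun r => 1 + N ^ 2 * (r - rc) ^ 2) continuousOn_const (by fun_prop)
          simpa using this
        · have := (h.integrable_sq hpq.le (φ := fun _ => 1) (ψ := fun _ => N ^ 2)
            continuousOn_const continuousOn_const).const_mul A
          simpa using this
        · have e1 : (r - rc) ^ 2 ≤ (q - p) ^ 2 := by
            refine sq_le_sq' ?_ ?_ <;> linarith [hr.1, hr.2, hrc.1, hrc.2]
          have e2 : 1 ≤ 1 / N₀ ^ 2 * N ^ 2 := by
            rw [one_div_mul_eq_div, one_le_div (by positivity)]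
            exact pow_le_pow_left₀ hN0.le hN 2
          have e3 : 1 + N ^ 2 * (r - rc) ^ 2 ≤ A * N ^ 2 := by
            have := mul_le_mul_of_nonneg_left e1 hN2.le
            rw [hA]
            linarith
          have e4 := mul_le_mul_of_nonneg_right e3 (sq_nonneg ‖Ψ r‖)
          have e5 := mul_le_mul_of_nonneg_right hA0 (sq_nonneg ‖w r‖)
          linarith
      refine h2.trans ((mul_le_mul_of_nonneg_left h1 (by linarith)).trans ?_)
      rw [← mul_assoc]
      exact mul_le_mul_of_nonneg_right (by linarith) hX
    · refine (H3 ω' m' L' hL' hLε hunit hK' rc ⟨hrc.1.le, hrc.2.le⟩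
        ((isTrappingRadius_scale hNpos).1 htrap) N (i3.trans hN) Ψ w F P Q h).trans ?_
      refine mul_le_mul_of_nonneg_right ?_ hX
      have : 0 < A * C₂ := by positivity
      linarith

/-! ### Uniform bounds at bounded frequencies -/

/-- On a short interval at the endpoint the solution is controlled by its value at the far end, and
by its limit at the endpoint. -/
theorem EndSystem.sq_le {T C A : ℝ} {k ζ : ℝ → ℝ} {b Ψ z F w : ℝ → ℂ}
    (h : EndSystem T C A k ζ b Ψ z F) (hA : 0 ≤ A) {y₀ κ X ν : ℝ} (hy₀ : y₀ ∈ Ioo 0 T)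
    (hy1 : y₀ ≤ 1) (hsmall : C ^ 2 * y₀ ≤ 1 / 2) (hκ : 0 ≤ κ)
    (hz : Tendsto z (𝓝[>] 0) (𝓝 0)) (hν : Tendsto (fun s => ‖Ψ s‖) (𝓝[>] 0) (𝓝 ν))
    (hX : ∀ t ∈ Ioc 0 y₀, ‖Ψ t‖ ≤ X)
    (hw : ∀ t ∈ Ioc 0 y₀, ‖w t‖ ≤ ‖z t‖ + κ * ‖Ψ t‖) {t : ℝ} (ht : t ∈ Ioc 0 y₀) :
    ‖Ψ t‖ ^ 2 + ‖w t‖ ^ 2 ≤ 4 * ((2 * C + 2 * κ + 2) * (2 * C + 1)) ^ 2 * (‖Ψ y₀‖ ^ 2 + A) ∧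
    ‖Ψ t‖ ^ 2 + ‖w t‖ ^ 2 ≤ 4 * ((2 * C + 2 * κ + 2) * (2 * C + 1)) ^ 2 * (ν ^ 2 + A) := by
  have hC := h.C_nonneg (hy₀.1.trans hy₀.2)
  have hfst := h.fst_le_of_limit hy₀ hsmall hz hν hX
  have hν0 : 0 ≤ ν := ge_of_tendsto hν (.of_forall fun _ => norm_nonneg _)
  have hsA := sqrt_nonneg A
  have hsy : √y₀ ≤ 1 := sqrt_le_one.2 hy1
  have key : ∀ x : ℝ, 0 ≤ x → (∀ t ∈ Ioc 0 y₀, ‖Ψ t‖ ≤ 2 * (x + 2 * C * √A * √y₀)) →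
      ‖Ψ t‖ ^ 2 + ‖w t‖ ^ 2 ≤ 4 * ((2 * C + 2 * κ + 2) * (2 * C + 1)) ^ 2 * (x ^ 2 + A) := by
    intro x hx hb
    set α := x + 2 * C * √A with hα
    have hα0 : 0 ≤ α := by positivity
    have h1 : ∀ t ∈ Ioc 0 y₀, ‖Ψ t‖ ≤ 2 * α := fun t ht => (hb t ht).trans (by
      have : 2 * C * √A * √y₀ ≤ 2 * C * √A * 1 := mul_le_mul_of_nonneg_left hsy (by positivity)
      linarith)
    have h2 : ‖z t‖ ≤ 2 * C * α + √A := by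
      have hst : √t ≤ 1 := sqrt_le_one.2 (ht.2.trans hy1)
      refine (h.snd_le_of_bound ⟨ht.1, ht.2.trans_lt hy₀.2⟩ hz
        (fun s hs => h1 s ⟨hs.1, hs.2.trans ht.2⟩)).trans ?_
      have i1 : C * (2 * α) * t ≤ C * (2 * α) * 1 :=
        mul_le_mul_of_nonneg_left (ht.2.trans hy1) (by positivity)
      have i2 : √A * √t ≤ √A * 1 := mul_le_mul_of_nonneg_left hst hsA
      linarith
    have h3 : ‖w t‖ ≤ (2 * C + 2 * κ) * α + √A := by
      have := mul_le_mul_of_nonneg_left (h1 t ht) hκ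
      linarith [hw t ht]
    set R := (2 * C + 2 * κ + 2) * (2 * C + 1) with hR
    have hαR : (2 * C + 2 * κ + 1) * α ≤ (2 * C + 2 * κ + 1) * ((2 * C + 1) * (x + √A)) := by
      refine mul_le_mul_of_nonneg_left ?_ (by positivity)
      have : 0 ≤ 2 * C * x := by positivity
      rw [hα]; linarith
    have hAle : √A ≤ (2 * C + 1) * (x + √A) := by
      have : 0 ≤ 2 * C * (x + √A) := by positivity
      linarith
    have h4 : ‖w t‖ ≤ R * (x + √A) := by rw [hR]; linarith
    have h5 : ‖Ψ t‖ ≤ R * (x + √A) := by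
      have i1 : 0 ≤ (2 * C + 2 * κ) * ((2 * C + 1) * (x + √A)) := by positivity
      have i2 : 2 * α ≤ 2 * ((2 * C + 1) * (x + √A)) := by
        have : 0 ≤ 2 * C * x := by positivity
        rw [hα]; linarith
      have := h1 t ht
      rw [hR]; linarith
    have h6 := pow_le_pow_left₀ (norm_nonneg _) h4 2
    have h7 := pow_le_pow_left₀ (norm_nonneg _) h5 2
    have h8 : (x + √A) ^ 2 ≤ 2 * (x ^ 2 + A) := by
      nlinarith [sq_nonneg (x - √A), sq_sqrt hA]
    have h9 := mul_le_mul_of_nonneg_left h8 (sq_nonneg R)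
    rw [mul_pow] at h6 h7
    linarith
  exact ⟨key _ (norm_nonneg _) fun t ht => (hfst t ht).1, key _ hν0 fun t ht => (hfst t ht).2⟩

theorem EndSystem.inner_le {T C A : ℝ} {k ζ : ℝ → ℝ} {b Ψ z F : ℝ → ℂ}
    (h : EndSystem T C A k ζ b Ψ z F) (hA : 0 ≤ A) {y S : ℝ} (hy : y ∈ Ioo 0 T)
    (hz : Tendsto z (𝓝[>] 0) (𝓝 0)) (hS : ∀ t ∈ Ioc 0 y, ‖Ψ t‖ ^ 2 ≤ S) :
    ‖Ψ y‖ * ‖z y‖ ≤ (C + 1) * (y * S + A) := by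
  have hC := h.C_nonneg (hy.1.trans hy.2)
  have hS0 : 0 ≤ S := (sq_nonneg _).trans (hS y ⟨hy.1, le_rfl⟩)
  have hX : ∀ t ∈ Ioc 0 y, ‖Ψ t‖ ≤ √S := fun t ht => le_sqrt_of_sq_le (hS t ht)
  have h1 := h.snd_le_of_bound hy hz hX
  have h2 := hX y ⟨hy.1, le_rfl⟩
  have h3 : ‖Ψ y‖ * ‖z y‖ ≤ √S * (C * √S * y + √A * √y) :=
    mul_le_mul h2 h1 (norm_nonneg _) (sqrt_nonneg _)
  have e1 := sq_sqrt hS0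
  have e2 := sq_sqrt hA
  have e3 := sq_sqrt hy.1.le
  have h4 : √S * (C * √S * y) = C * (y * S) := by linear_combination C * y * e1
  have h5 : √S * (√A * √y) ≤ y * S + A := by
    have : (√S * √y) ^ 2 = y * S := by rw [mul_pow, e1, e3, mul_comm]
    nlinarith [sq_nonneg (√S * √y - √A), sq_nonneg (√S * √y), sq_nonneg √A]
  have h6 : 0 ≤ C * A := by positivity
  linarith

/-- Growth of `|Ψ|² + |w|²` over an interval on which the system is regular. -/
theorem RadialEq.gronwall {a M l musq ω m L p q x y c : ℝ} {Ψ w F : ℝ → ℂ}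
    (h : RadialEq a M l musq ω m L p q Ψ w F) (hpq : p ≤ q) (hp : 0 < p) (hx : p < x)
    (hxy : x ≤ y) (hy : y < q) (hc : 0 ≤ c)
    (hcoef : ∀ r ∈ Icc x y, |1 / Delta a M l r| + |radialG a M l musq ω m L r / Delta a M l r| + 1
      ≤ c) :
    ‖Ψ y‖ ^ 2 + ‖w y‖ ^ 2 ≤ exp (c * q) *
        (‖Ψ x‖ ^ 2 + ‖w x‖ ^ 2 + ∫ r in p..q, ‖F r‖ ^ 2) ∧
      ‖Ψ x‖ ^ 2 + ‖w x‖ ^ 2 ≤ exp (c * q) *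
        (‖Ψ y‖ ^ 2 + ‖w y‖ ^ 2 + ∫ r in p..q, ‖F r‖ ^ 2) := by
  set S : ℝ → ℝ := fun r => ‖Ψ r‖ ^ 2 + ‖w r‖ ^ 2 with hS
  have hsub : ∀ {r}, r ∈ Icc x y → r ∈ Ioo p q := fun hr =>
    ⟨hx.trans_le hr.1, hr.2.trans_lt hy⟩
  set S' : ℝ → ℝ := fun r => 2 * inner ℝ (Ψ r) (((1 / Delta a M l r : ℝ) : ℂ) * w r)
    + 2 * inner ℝ (w r) (F r - ((radialG a M l musq ω m L r / Delta a M l r : ℝ) : ℂ) * Ψ r)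
    with hS'
  have hSd : ∀ r ∈ Icc x y, HasDerivAt S (S' r) r := fun r hr =>
    (h.deriv_fst r (hsub hr)).norm_sq.add (h.deriv_snd r (hsub hr)).norm_sq
  have hS0 : ∀ r, 0 ≤ S r := fun r => by simp only [hS]; positivity
  have hbd : ∀ r ∈ Icc x y, |S' r| ≤ c * S r + ‖F r‖ ^ 2 := by
    intro r hr
    have h1 := hcoef r hr
    simp only [hS', hS]
    rw [inner_ofReal_mul_right, inner_sub_right, inner_ofReal_mul_right]
    set u := |1 / Delta a M l r|
    set v := |radialG a M l musq ω m L r / Delta a M l r|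
    have i1 : |1 / Delta a M l r * inner ℝ (Ψ r) (w r)| ≤ u * (‖Ψ r‖ * ‖w r‖) := by
      rw [abs_mul]; exact mul_le_mul_of_nonneg_left (abs_real_inner_le_norm _ _) (abs_nonneg _)
    have i2 : |radialG a M l musq ω m L r / Delta a M l r * inner ℝ (w r) (Ψ r)|
        ≤ v * (‖Ψ r‖ * ‖w r‖) := by
      rw [abs_mul, mul_comm ‖Ψ r‖]
      exact mul_le_mul_of_nonneg_left (abs_real_inner_le_norm _ _) (abs_nonneg _)
    have i3 : |inner ℝ (w r) (F r)| ≤ ‖w r‖ * ‖F r‖ := abs_real_inner_le_norm _ _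
    have j1 : (u + v) * (2 * (‖Ψ r‖ * ‖w r‖)) ≤ (u + v) * (‖Ψ r‖ ^ 2 + ‖w r‖ ^ 2) :=
      mul_le_mul_of_nonneg_left (by nlinarith [sq_nonneg (‖Ψ r‖ - ‖w r‖)])
        (add_nonneg (abs_nonneg _) (abs_nonneg _))
    have j2 : 2 * (‖w r‖ * ‖F r‖) ≤ ‖w r‖ ^ 2 + ‖F r‖ ^ 2 := by
      nlinarith [sq_nonneg (‖w r‖ - ‖F r‖)]
    have j3 : (u + v + 1) * (‖Ψ r‖ ^ 2 + ‖w r‖ ^ 2) ≤ c * (‖Ψ r‖ ^ 2 + ‖w r‖ ^ 2) :=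
      mul_le_mul_of_nonneg_right h1 (by positivity)
    have j4 : 0 ≤ ‖Ψ r‖ ^ 2 := by positivity
    rw [abs_le] at i1 i2 i3 ⊢
    constructor <;> linarith [i1.1, i1.2, i2.1, i2.2, i3.1, i3.2]
  have hFi : IntervalIntegrable (fun r => ‖F r‖ ^ 2) volume x y :=
    (h.sourceIntervalIntegrable hpq).mono_set (by
      rw [uIcc_of_le hxy, uIcc_of_le hpq]; exact Icc_subset_Icc hx.le hy.le)
  have hFle : ∫ r in x..y, ‖F r‖ ^ 2 ≤ ∫ r in p..q, ‖F r‖ ^ 2 :=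
    intervalIntegral.integral_mono_interval hx.le hxy hy.le
      (.of_forall fun r => by positivity) (h.sourceIntervalIntegrable hpq)
  have hSc : ContinuousOn S (Icc x y) := fun r hr => (hSd r hr).continuousAt.continuousWithinAt
  have hE : ∀ (σ : ℝ) r, HasDerivAt (fun r => exp (σ * r)) (σ * exp (σ * r)) r :=
    fun σ r => by
      refine (((hasDerivAt_id r).const_mul σ).exp).congr_deriv ?_
      simp only [id]; ring
  have hFint : IntegrableOn (fun r => ‖F r‖ ^ 2) (Icc x y) :=
    (intervalIntegrable_iff_integrableOn_Icc_of_le hxy).1 hFi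
  have hFxy : 0 ≤ ∫ r in x..y, ‖F r‖ ^ 2 :=
    intervalIntegral.integral_nonneg hxy fun r _ => by positivity
  constructor
  · have h1 := intervalIntegral.sub_le_integral_of_hasDeriv_right_of_le hxy
      (g := fun r => exp (-c * r) * S r) (φ := fun r => ‖F r‖ ^ 2)
      (ContinuousOn.mul (by fun_prop) hSc)
      (fun r hr => ((hE (-c) r).mul (hSd r ⟨hr.1.le, hr.2.le⟩)).hasDerivWithinAt) hFint (by
        intro r hr
        have hr' : r ∈ Icc x y := ⟨hr.1.le, hr.2.le⟩
        have h2 := (abs_le.1 (hbd r hr')).2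
        have h3 : exp (-c * r) ≤ 1 := exp_le_one_iff.2 (by
          have : 0 ≤ c * r := mul_nonneg hc (hp.le.trans (hx.le.trans hr'.1))
          linarith)
        have h4 := mul_le_mul_of_nonneg_left h2 (exp_pos (-c * r)).le
        have h5 := mul_le_mul_of_nonneg_right h3 (sq_nonneg ‖F r‖)
        linarith)
    have h2 := mul_le_mul_of_nonneg_left (h1.trans hFle) (exp_pos (c * y)).le
    have e1 : exp (c * y) * (exp (-c * y) * S y) = S y := by
      rw [← mul_assoc, ← exp_add]; simp
    have h3 : exp (-c * x) ≤ 1 := exp_le_one_iff.2 (by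
      have : 0 ≤ c * x := mul_nonneg hc (hp.le.trans hx.le)
      linarith)
    have h4 : exp (c * y) ≤ exp (c * q) :=
      exp_le_exp.2 (mul_le_mul_of_nonneg_left hy.le hc)
    have h5 := mul_le_mul_of_nonneg_right h3 (hS0 x)
    have h6 : S y ≤ exp (c * y) * (S x + ∫ r in p..q, ‖F r‖ ^ 2) := by
      have := mul_le_mul_of_nonneg_left h5 (exp_pos (c * y)).le
      rw [mul_sub, e1] at h2
      linarith
    refine h6.trans (mul_le_mul_of_nonneg_right h4 ?_)
    have := hS0 x
    linarith
  · have h1 := intervalIntegral.sub_le_integral_of_hasDeriv_right_of_le hxy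
      (g := fun r => -(exp (c * r) * S r)) (φ := fun r => exp (c * q) * ‖F r‖ ^ 2)
      (ContinuousOn.mul (by fun_prop) hSc).neg
      (fun r hr => ((hE c r).mul (hSd r ⟨hr.1.le, hr.2.le⟩)).neg.hasDerivWithinAt)
      (hFint.const_mul _) (by
        intro r hr
        have hr' : r ∈ Icc x y := ⟨hr.1.le, hr.2.le⟩
        have h2 := (abs_le.1 (hbd r hr')).1
        have h3 : exp (c * r) ≤ exp (c * q) :=
          exp_le_exp.2 (mul_le_mul_of_nonneg_left (hr'.2.trans hy.le) hc)
        have h4 := mul_le_mul_of_nonneg_left h2 (exp_pos (c * r)).le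
        have h5 := mul_le_mul_of_nonneg_right h3 (sq_nonneg ‖F r‖)
        linarith)
    rw [intervalIntegral.integral_const_mul] at h1
    have h2 : 1 ≤ exp (c * x) := one_le_exp (mul_nonneg hc (hp.le.trans hx.le))
    have h3 := mul_le_mul_of_nonneg_right h2 (hS0 x)
    have h4 : exp (c * y) ≤ exp (c * q) :=
      exp_le_exp.2 (mul_le_mul_of_nonneg_left hy.le hc)
    have h5 := mul_le_mul_of_nonneg_right h4 (hS0 y)
    have h6 := mul_le_mul_of_nonneg_left hFle (exp_pos (c * q)).le
    have e : exp (c * q) * (S y + ∫ r in p..q, ‖F r‖ ^ 2)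
        = exp (c * q) * S y + exp (c * q) * ∫ r in p..q, ‖F r‖ ^ 2 := by ring
    change S x ≤ exp (c * q) * (S y + ∫ r in p..q, ‖F r‖ ^ 2)
    rw [e]
    linarith

section

variable {a M l p q s musq : ℝ}

/-- At bounded frequencies the solution is controlled, up to the source, by its value at an interior
point, and by its limit at either horizon. -/
theorem Horizons.exists_sup_bound (hh : Horizons a M l p q s) (hmu : 0 ≤ musq) (N : ℝ) :
    ∃ K > 0, ∃ y₀ > 0, y₀ ≤ (q - p) / 4 ∧ ∀ ω m L : ℝ, |ω| ≤ N → |m| ≤ N → |L| ≤ N →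
      ∀ (Ψ w F : ℝ → ℂ) (P Q : ℝ), RadialSolution a M l musq ω m L p q Ψ w F P Q →
      (∀ x ∈ Ioo p q,
        (∀ r ∈ Icc (p + y₀) (q - y₀), ‖Ψ x‖ ^ 2 + ‖w x‖ ^ 2 ≤
          K * (‖Ψ r‖ ^ 2 + ‖w r‖ ^ 2 + ∫ r in p..q, ‖F r‖ ^ 2)) ∧
        ‖Ψ x‖ ^ 2 + ‖w x‖ ^ 2 ≤ K * (P + ∫ r in p..q, ‖F r‖ ^ 2) ∧
        ‖Ψ x‖ ^ 2 + ‖w x‖ ^ 2 ≤ K * (Q + ∫ r in p..q, ‖F r‖ ^ 2)) ∧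
      ∀ S, (∀ x ∈ Ioo p q, ‖Ψ x‖ ^ 2 ≤ S) → ∀ y ∈ Ioc 0 y₀,
        |inner ℝ (Ψ (p + y)) (w (p + y))| ≤ K * (y * S + ∫ r in p..q, ‖F r‖ ^ 2) ∧
        |inner ℝ (Ψ (q - y)) (w (q - y))| ≤ K * (y * S + ∫ r in p..q, ‖F r‖ ^ 2) := by
  have hpq := hh.p_lt
  have hp := hh.p_pos
  have hq := hh.q_pos
  obtain ⟨C₀, hC₀, hC₀b⟩ := hh.exists_inv_Delta_le
  obtain ⟨C, hC⟩ : ∃ C, C = C₀ + |N| + musq * (q ^ 2 + a ^ 2) + 2 * |N| * q := ⟨_, rfl⟩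
  have hN0 := abs_nonneg N
  have hC1 : C₀ ≤ C := by
    have : 0 ≤ |N| + musq * (q ^ 2 + a ^ 2) + 2 * |N| * q := by positivity
    linarith
  have hCpos : 0 < C := hC₀.trans_le hC1
  have hCb : ∀ t ∈ Ioo 0 ((q - p) / 2), 1 / Delta a M l (p + t) ≤ C / t ∧
      1 / Delta a M l (q - t) ≤ C / t := fun t ht => by
    have := div_le_div_of_nonneg_right hC1 ht.1.le
    exact ⟨(hC₀b t ht).1.trans this, (hC₀b t ht).2.trans this⟩
  obtain ⟨y₀, hy0, hy1, hy2, hy3⟩ : ∃ y₀ > 0, y₀ ≤ 1 ∧ y₀ ≤ (q - p) / 4 ∧ C ^ 2 * y₀ ≤ 1 / 2 := by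
    refine ⟨min 1 (min ((q - p) / 4) (1 / (2 * C ^ 2))), ?_, min_le_left _ _,
      (min_le_right _ _).trans (min_le_left _ _), ?_⟩
    · simp only [gt_iff_lt, lt_min_iff]
      exact ⟨by norm_num, by linarith, by positivity⟩
    · have h1 : min 1 (min ((q - p) / 4) (1 / (2 * C ^ 2))) ≤ 1 / (2 * C ^ 2) :=
        (min_le_right _ _).trans (min_le_right _ _)
      have h2 := mul_le_mul_of_nonneg_left h1 (sq_nonneg C)
      have e : C ^ 2 * (1 / (2 * C ^ 2)) = 1 / 2 := by field_simp
      linarith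
  obtain ⟨κ, hκ⟩ : ∃ κ, κ = |N| * (q ^ 2 + a ^ 2) + |a * Xi a l| * |N| := ⟨_, rfl⟩
  have hκ0 : 0 ≤ κ := by rw [hκ]; positivity
  obtain ⟨E, hE⟩ : ∃ E, E = 4 * ((2 * C + 2 * κ + 2) * (2 * C + 1)) ^ 2 := ⟨_, rfl⟩
  have hE1 : 1 ≤ E := by
    have h1 : 1 ≤ (2 * C + 2 * κ + 2) * (2 * C + 1) :=
      one_le_mul_of_one_le_of_one_le (by linarith) (by linarith)
    have h2 := one_le_pow₀ h1 (n := 2)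
    rw [hE]; linarith
  -- the middle region
  have hmid : ∀ r ∈ Icc (p + y₀) (q - y₀), r ∈ Ioo p q := fun r hr =>
    ⟨by linarith [hr.1], by linarith [hr.2]⟩
  obtain ⟨D, hD0, hD⟩ := hh.exists_inv_Delta_bound (x := p + y₀) (y := q - y₀) (by linarith)
    (by linarith)
  obtain ⟨B, hB⟩ := isCompact_Icc.exists_bound_of_continuousOn (s := Icc p q)
    (continuous_Delta a M l).continuousOn
  have hB0 : 0 ≤ B := (norm_nonneg _).trans (hB p (left_mem_Icc.2 hpq.le))
  obtain ⟨c, hc⟩ : ∃ c, c = D + (κ ^ 2 + B * (|N| + musq * (q ^ 2 + a ^ 2))) * D + 1 := ⟨_, rfl⟩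
  have hc0 : 0 ≤ c := by rw [hc]; positivity
  obtain ⟨G, hG⟩ : ∃ G, G = exp (c * q) := ⟨_, rfl⟩
  have hG1 : 1 ≤ G := by rw [hG]; exact one_le_exp (by positivity)
  obtain ⟨K, hK⟩ : ∃ K, K = E * (G * (E + 1) + 1) + G * (E + 1) + E + C + 1 := ⟨_, rfl⟩
  have hK0 : 0 < K := by rw [hK]; positivity
  refine ⟨K, hK0, y₀, hy0, hy2, fun ω m L hω hm hL Ψ w F P Q h => ?_⟩
  have hNN : |N| = N := abs_of_nonneg ((abs_nonneg _).trans hω)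
  have hcoef : |L| + musq * (q ^ 2 + a ^ 2) + 2 * |ω| * q ≤ C := by
    have : 2 * |ω| * q ≤ 2 * |N| * q := by rw [hNN]; gcongr
    rw [hC]; rw [hNN] at *; linarith
  have hel := h.toRadialEq.endSystem_left hh hmu hCb hcoef
  have her := h.toRadialEq.endSystem_right hh hmu hCb hcoef
  obtain ⟨A, hA⟩ : ∃ A, A = ∫ r in p..q, ‖F r‖ ^ 2 := ⟨_, rfl⟩
  have hA0 : 0 ≤ A := by
    rw [hA]; exact intervalIntegral.integral_nonneg hpq.le fun r _ => by positivity
  have hT : y₀ ∈ Ioo 0 ((q - p) / 2) := ⟨hy0, by linarith⟩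
  have hKb : ∀ r ∈ Icc p q, |carterK a l ω m r| ≤ κ := by
    intro r hr
    have h1 : r ^ 2 ≤ q ^ 2 := pow_le_pow_left₀ (hp.le.trans hr.1) hr.2 2
    unfold carterK
    refine (abs_sub _ _).trans ?_
    rw [abs_mul, abs_mul (a * Xi a l), abs_of_nonneg (by positivity : 0 ≤ r ^ 2 + a ^ 2), hκ, hNN]
    have hN1 : 0 ≤ N := hNN ▸ hN0
    gcongr
  have hzl : Tendsto (fun t => w (p + t) + I * carterK a l ω m (p + t) * Ψ (p + t))
      (𝓝[>] 0) (𝓝 0) := h.in_left.comp (tendsto_const_add_nhdsGT p)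
  have hzr : Tendsto (fun t => w (q - t) - I * carterK a l ω m (q - t) * Ψ (q - t))
      (𝓝[>] 0) (𝓝 0) := h.out_right.comp (tendsto_const_sub_nhdsLT q)
  have hνl : Tendsto (fun t => ‖Ψ (p + t)‖) (𝓝[>] 0) (𝓝 (√P)) :=
    h.tendsto_norm_left.comp (tendsto_const_add_nhdsGT p)
  have hνr : Tendsto (fun t => ‖Ψ (q - t)‖) (𝓝[>] 0) (𝓝 (√Q)) :=
    h.tendsto_norm_right.comp (tendsto_const_sub_nhdsLT q)
  obtain ⟨X, hX⟩ := h.bounded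
  have memp : ∀ t ∈ Ioc 0 y₀, p + t ∈ Ioo p q := fun t ht =>
    ⟨by linarith [ht.1], by linarith [ht.2]⟩
  have memq : ∀ t ∈ Ioc 0 y₀, q - t ∈ Ioo p q := fun t ht =>
    ⟨by linarith [ht.2], by linarith [ht.1]⟩
  have hwz : ∀ (r : ℝ) (z : ℂ) (ε : ℝ), |ε| = 1 → r ∈ Icc p q →
      z = w r + ε * (I * carterK a l ω m r * Ψ r) → ‖w r‖ ≤ ‖z‖ + κ * ‖Ψ r‖ := by
    intro r z ε hε hr hz
    have e : w r = z - ε * (I * carterK a l ω m r * Ψ r) := by rw [hz]; ring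
    rw [e]
    refine (norm_sub_le _ _).trans ?_
    rw [norm_mul, norm_mul, norm_mul, norm_I, one_mul, norm_real,
      norm_real, norm_eq_abs, norm_eq_abs, hε, one_mul]
    have := mul_le_mul_of_nonneg_right (hKb r hr) (norm_nonneg (Ψ r))
    linarith
  have hl := fun t (ht : t ∈ Ioc 0 y₀) => hel.sq_le (by rw [← hA]; exact hA0) hT hy1 hy3 hκ0 hzl hνl
    (fun t ht => (hX _ (memp t ht)).1) (w := fun t => w (p + t))
    (fun t ht => hwz (p + t) _ 1 (by simp) ⟨(memp t ht).1.le, (memp t ht).2.le⟩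
      (by push_cast; ring)) ht
  have hr := fun t (ht : t ∈ Ioc 0 y₀) => her.sq_le (by rw [← hA]; exact hA0) hT hy1 hy3 hκ0 hzr hνr
    (fun t ht => (hX _ (memq t ht)).1) (w := fun t => w (q - t))
    (fun t ht => hwz (q - t) _ (-1) (by simp) ⟨(memq t ht).1.le, (memq t ht).2.le⟩
      (by push_cast; ring)) ht
  rw [← hA, ← hE, sq_sqrt h.P_nonneg] at hl
  rw [← hA, ← hE, sq_sqrt h.Q_nonneg] at hr
  have hgron : ∀ x y, x ∈ Icc (p + y₀) (q - y₀) → y ∈ Icc (p + y₀) (q - y₀) →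
      ‖Ψ y‖ ^ 2 + ‖w y‖ ^ 2 ≤ G * (‖Ψ x‖ ^ 2 + ‖w x‖ ^ 2 + A) := by
    have hco : ∀ r ∈ Icc (p + y₀) (q - y₀),
        |1 / Delta a M l r| + |radialG a M l musq ω m L r / Delta a M l r| + 1 ≤ c := by
      intro r hr
      have hr' : r ∈ Icc p q := ⟨(hmid r hr).1.le, (hmid r hr).2.le⟩
      have h1 : |1 / Delta a M l r| ≤ D := by
        rw [abs_of_nonneg (one_div_nonneg.2 (hh.Delta_pos (hmid r hr)).le)]
        exact hD r hr
      have h2 : |radialG a M l musq ω m L r| ≤ κ ^ 2 + B * (|N| + musq * (q ^ 2 + a ^ 2)) := by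
        unfold radialG
        refine (abs_sub _ _).trans ?_
        rw [abs_pow, abs_mul]
        have i1 : |L + musq * (r ^ 2 + a ^ 2)| ≤ |N| + musq * (q ^ 2 + a ^ 2) := by
          refine (abs_add_le _ _).trans ?_
          rw [abs_of_nonneg (by positivity : 0 ≤ musq * (r ^ 2 + a ^ 2)), hNN]
          have : r ^ 2 ≤ q ^ 2 := pow_le_pow_left₀ (hp.le.trans hr'.1) hr'.2 2
          gcongr
        exact add_le_add (pow_le_pow_left₀ (abs_nonneg _) (hKb r hr') 2)
          (mul_le_mul (hB r hr') i1 (abs_nonneg _) hB0)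
      have h3 : |radialG a M l musq ω m L r / Delta a M l r|
          ≤ (κ ^ 2 + B * (|N| + musq * (q ^ 2 + a ^ 2))) * D := by
        rw [div_eq_mul_one_div, abs_mul]
        exact mul_le_mul h2 h1 (abs_nonneg _) (by positivity)
      rw [hc]
      linarith
    intro x y hx hy
    rcases le_total x y with hxy | hxy
    · have := (h.toRadialEq.gronwall hpq.le hp (hmid x hx).1 hxy (hmid y hy).2 hc0
        (fun r hr => hco r ⟨hx.1.trans hr.1, hr.2.trans hy.2⟩)).1
      rwa [← hA, ← hG] at this
    · have := (h.toRadialEq.gronwall hpq.le hp (hmid y hy).1 hxy (hmid x hx).2 hc0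
        (fun r hr => hco r ⟨hy.1.trans hr.1, hr.2.trans hx.2⟩)).2
      rwa [← hA, ← hG] at this
  have hSn : ∀ r, 0 ≤ ‖Ψ r‖ ^ 2 + ‖w r‖ ^ 2 := fun r => by positivity
  have hpy : p + y₀ ∈ Icc (p + y₀) (q - y₀) := ⟨le_rfl, by linarith⟩
  have hqy : q - y₀ ∈ Icc (p + y₀) (q - y₀) := ⟨by linarith, le_rfl⟩
  have hy00 : y₀ ∈ Ioc 0 y₀ := ⟨hy0, le_rfl⟩
  have hE0 : 0 ≤ E := by linarith
  have hG0 : 0 ≤ G := by linarith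
  -- from an interior point
  have main : ∀ x ∈ Ioo p q, ∀ r ∈ Icc (p + y₀) (q - y₀),
      ‖Ψ x‖ ^ 2 + ‖w x‖ ^ 2 ≤ E * (G * (‖Ψ r‖ ^ 2 + ‖w r‖ ^ 2 + A) + A) := by
    intro x hx r hr'
    have hge : 0 ≤ G * (‖Ψ r‖ ^ 2 + ‖w r‖ ^ 2 + A) + A := by
      have := hSn r
      positivity
    rcases lt_or_ge x (p + y₀) with h1 | h1
    · have h2 := (hl (x - p) ⟨by linarith [hx.1], by linarith⟩).1
      simp only [add_sub_cancel] at h2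
      have h3 := hgron r (p + y₀) hr' hpy
      refine h2.trans (mul_le_mul_of_nonneg_left ?_ hE0)
      have := sq_nonneg ‖w (p + y₀)‖
      linarith
    rcases lt_or_ge (q - y₀) x with h2 | h2
    · have h3 := (hr (q - x) ⟨by linarith [hx.2], by linarith⟩).1
      simp only [sub_sub_cancel] at h3
      have h4 := hgron r (q - y₀) hr' hqy
      refine h3.trans (mul_le_mul_of_nonneg_left ?_ hE0)
      have := sq_nonneg ‖w (q - y₀)‖
      linarith
    · have h3 := hgron r x hr' ⟨h1, h2⟩
      have h4 := mul_le_mul_of_nonneg_right hE1 hge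
      linarith
  have hP := h.P_nonneg
  have hQ := h.Q_nonneg
  rw [← hA]
  refine ⟨fun x hx => ⟨fun r hr' => ?_, ?_, ?_⟩, fun S hS y hy => ⟨?_, ?_⟩⟩
  · refine (main x hx r hr').trans ?_
    have := hSn r
    generalize ‖Ψ r‖ ^ 2 + ‖w r‖ ^ 2 = v at *
    have i1 : E * (G * (v + A) + A) ≤ E * (G * (E + 1) + 1) * (v + A) := by
      have : 0 ≤ E * (G * (E * (v + A))) := by positivity
      have : 0 ≤ E * v := by positivity
      linarith
    have i2 : 0 ≤ (G * (E + 1) + E + C + 1) * (v + A) := by positivity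
    rw [hK]; linarith
  · have h1 := main x hx (p + y₀) hpy
    have h2 := (hl y₀ hy00).2
    refine h1.trans ?_
    have i0 : E * (G * (‖Ψ (p + y₀)‖ ^ 2 + ‖w (p + y₀)‖ ^ 2 + A) + A)
        ≤ E * (G * (E * (P + A) + A) + A) :=
      mul_le_mul_of_nonneg_left (by
        have := mul_le_mul_of_nonneg_left (add_le_add_left h2 A) hG0
        linarith) hE0
    refine i0.trans ?_
    have i1 : 0 ≤ E * (G * P) := by positivity
    have i2 : 0 ≤ E * P := by positivity
    have i3 : 0 ≤ (G * (E + 1) + E + C + 1) * (P + A) := by positivity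
    rw [hK]; linarith
  · have h1 := main x hx (q - y₀) hqy
    have h2 := (hr y₀ hy00).2
    refine h1.trans ?_
    have i0 : E * (G * (‖Ψ (q - y₀)‖ ^ 2 + ‖w (q - y₀)‖ ^ 2 + A) + A)
        ≤ E * (G * (E * (Q + A) + A) + A) :=
      mul_le_mul_of_nonneg_left (by
        have := mul_le_mul_of_nonneg_left (add_le_add_left h2 A) hG0
        linarith) hE0
    refine i0.trans ?_
    have i1 : 0 ≤ E * (G * Q) := by positivity
    have i2 : 0 ≤ E * Q := by positivity
    have i3 : 0 ≤ (G * (E + 1) + E + C + 1) * (Q + A) := by positivity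
    rw [hK]; linarith
  all_goals
    have hS0 : 0 ≤ S := (sq_nonneg _).trans (hS _ (memp y hy))
    have hyA : 0 ≤ y * S + A := by have := hy.1; positivity
    have hCK : (C + 1) * (y * S + A) ≤ K * (y * S + A) :=
      mul_le_mul_of_nonneg_right (by
        have : 0 ≤ E * (G * (E + 1) + 1) + G * (E + 1) + E := by positivity
        rw [hK]; linarith) hyA
  · have h1 := hel.inner_le (by rw [← hA]; exact hA0) ⟨hy.1, hy.2.trans_lt hT.2⟩ hzl
      (fun t ht => hS _ (memp t ⟨ht.1, ht.2.trans hy.2⟩))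
    rw [← hA] at h1
    refine le_trans ?_ (h1.trans hCK)
    have e : inner ℝ (Ψ (p + y)) (w (p + y)) = inner ℝ (Ψ (p + y))
        (w (p + y) + I * carterK a l ω m (p + y) * Ψ (p + y)) := by
      have e1 : I * (carterK a l ω m (p + y) : ℂ) * Ψ (p + y)
          = (carterK a l ω m (p + y) : ℂ) * (I * Ψ (p + y)) := by ring
      rw [inner_add_right, e1, inner_ofReal_mul_right, real_inner_comm (I * _),
        inner_I_mul_self]
      ring
    rw [e]
    exact abs_real_inner_le_norm _ _
  · have h1 := her.inner_le (by rw [← hA]; exact hA0) ⟨hy.1, hy.2.trans_lt hT.2⟩ hzr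
      (fun t ht => hS _ (memq t ⟨ht.1, ht.2.trans hy.2⟩))
    rw [← hA] at h1
    refine le_trans ?_ (h1.trans hCK)
    have e : inner ℝ (Ψ (q - y)) (w (q - y)) = inner ℝ (Ψ (q - y))
        (w (q - y) - I * carterK a l ω m (q - y) * Ψ (q - y)) := by
      have e1 : I * (carterK a l ω m (q - y) : ℂ) * Ψ (q - y)
          = (carterK a l ω m (q - y) : ℂ) * (I * Ψ (q - y)) := by ring
      rw [inner_sub_right, e1, inner_ofReal_mul_right, real_inner_comm (I * _),
        inner_I_mul_self]
      ring
    rw [e]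
    exact abs_real_inner_le_norm _ _

end

section

/-! ### Estimates at bounded frequencies -/

namespace RadialSolution

variable {a M l musq ω m L p q P Q : ℝ} {Ψ w F : ℝ → ℂ}
variable (h : RadialSolution a M l musq ω m L p q Ψ w F P Q)
include h

theorem integral_source_nonneg (hpq : p ≤ q) : 0 ≤ ∫ r in p..q, ‖F r‖ ^ 2 :=
  intervalIntegral.integral_nonneg hpq fun r _ => by positivity

theorem left_le {S : ℝ} (hpq : p < q) (hS : ∀ x ∈ Ioo p q, ‖Ψ x‖ ^ 2 ≤ S) : P ≤ S := by
  refine le_of_tendsto h.lim_left ?_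
  filter_upwards [Ioo_mem_nhdsGT hpq] with r hr
  exact hS r hr

theorem right_le {S : ℝ} (hpq : p < q) (hS : ∀ x ∈ Ioo p q, ‖Ψ x‖ ^ 2 ≤ S) : Q ≤ S := by
  refine le_of_tendsto h.lim_right ?_
  filter_upwards [Ioo_mem_nhdsLT hpq] with r hr
  exact hS r hr

theorem abs_flux_le (hpq : p < q) {S ε : ℝ} (hε : 0 < ε) (hS : ∀ x ∈ Ioo p q, ‖Ψ x‖ ^ 2 ≤ S) :
    |carterK a l ω m q * Q + carterK a l ω m p * P|
      ≤ ε * (q - p) * S + (∫ r in p..q, ‖F r‖ ^ 2) / (4 * ε) := by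
  rw [← h.flux_identity hpq]
  have hF := h.sourceIntervalIntegrable hpq.le
  have hi : IntervalIntegrable (fun r => inner ℝ (I * Ψ r) (F r)) volume p q := by
    simpa using h.integrable_source_flux hpq.le (χ := fun _ => 1) continuousOn_const
  have hg : IntervalIntegrable (fun r => ε * S + ‖F r‖ ^ 2 * (1 / (4 * ε))) volume p q :=
    intervalIntegrable_const.add (hF.mul_const _)
  have hpt : ∀ r ∈ Ioo p q, |inner ℝ (I * Ψ r) (F r)|
      ≤ ε * S + ‖F r‖ ^ 2 * (1 / (4 * ε)) := by
    intro r hr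
    have h1 := mul_le_mul_of_nonneg_left (hS r hr) hε.le
    have h2 := abs_inner_le_young (I * Ψ r) (F r) hε
    rw [norm_mul, norm_I, one_mul] at h2
    linarith
  have hval : ∫ r in p..q, (ε * S + ‖F r‖ ^ 2 * (1 / (4 * ε)))
      = ε * (q - p) * S + (∫ r in p..q, ‖F r‖ ^ 2) / (4 * ε) := by
    rw [intervalIntegral.integral_add intervalIntegrable_const (hF.mul_const _),
      intervalIntegral.integral_const, intervalIntegral.integral_mul_const, smul_eq_mul]
    ring
  rw [← hval, abs_le]
  constructor
  · rw [← intervalIntegral.integral_neg]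
    exact intervalIntegral.integral_mono_on_of_le_Ioo hpq.le hg.neg hi
      fun r hr => (abs_le.1 (hpt r hr)).1
  · exact intervalIntegral.integral_mono_on_of_le_Ioo hpq.le hi hg
      fun r hr => (abs_le.1 (hpt r hr)).2

/-- If the flux through a horizon is controlled by the total flux, the energy identity bounds
the solution there. -/
theorem sq_mul_le_of_flux (hpq : p < q) {K V c : ℝ} (hK : 0 < K)
    (hc : 0 ≤ c) (hS : ∀ x ∈ Ioo p q, ‖Ψ x‖ ^ 2 ≤ K * (V + ∫ r in p..q, ‖F r‖ ^ 2))
    (hfl : c * V ≤ |carterK a l ω m q * Q + carterK a l ω m p * P|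
      + c * ∫ r in p..q, ‖F r‖ ^ 2) :
    c ^ 2 * V ≤ (3 * c ^ 2 + (q - p) * K) * ∫ r in p..q, ‖F r‖ ^ 2 := by
  have hA := h.integral_source_nonneg hpq.le
  have hw : 0 < q - p := sub_pos.2 hpq
  rcases hc.eq_or_lt with hc | hc
  · rw [← hc]; simp only [ne_eq, OfNat.ofNat_ne_zero, not_false_eq_true, zero_pow, zero_mul,
      mul_zero, zero_add]
    positivity
  have h1 := h.abs_flux_le hpq (ε := c / (2 * (q - p) * K)) (by positivity) hS
  generalize ∫ r in p..q, ‖F r‖ ^ 2 = A at *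
  have e : c / (2 * (q - p) * K) * (q - p) * (K * (V + A)) + A / (4 * (c / (2 * (q - p) * K)))
      = c / 2 * (V + A) + (q - p) * K / (2 * c) * A := by
    field_simp
    ring
  rw [e] at h1
  have h2 : c * V ≤ c / 2 * (V + A) + (q - p) * K / (2 * c) * A + c * A := by linarith
  have h3 := mul_le_mul_of_nonneg_left h2 hc.le
  have e2 : c * (c / 2 * (V + A) + (q - p) * K / (2 * c) * A + c * A)
      = c ^ 2 / 2 * (V + A) + (q - p) * K / 2 * A + c ^ 2 * A := by field_simp
  rw [e2] at h3
  linarith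

end RadialSolution

variable {a M l p q s musq : ℝ}

theorem abs_add_of_mul_nonneg {x y : ℝ} (h : 0 ≤ x * y) : |x + y| = |x| + |y| := by
  refine abs_add_eq_add_abs_iff x y |>.2 ?_
  rcases lt_trichotomy x 0 with hx | hx | hx
  · exact .inr ⟨hx.le, nonpos_of_mul_nonneg_right h hx⟩
  · rcases le_total 0 y with hy | hy
    · exact .inl ⟨hx.ge, hy⟩
    · exact .inr ⟨hx.le, hy⟩
  · exact .inl ⟨hx.le, nonneg_of_mul_nonneg_right h hx⟩

/-- In the rotating case `K` cannot be small at both horizons. -/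
theorem Horizons.le_abs_carterK_add (hh : Horizons a M l p q s) {ω m : ℝ} (hm : 1 ≤ |m|) :
    |a| * (q ^ 2 - p ^ 2) / (q ^ 2 + a ^ 2) ≤ |carterK a l ω m p| + |carterK a l ω m q| := by
  have hp := hh.p_pos
  have hq := hh.q_pos
  have hpq := hh.p_lt
  have hX := one_le_Xi a l
  have hsq : 0 ≤ q ^ 2 - p ^ 2 := by nlinarith
  rw [div_le_iff₀ (by positivity)]
  have e : (q ^ 2 + a ^ 2) * carterK a l ω m p - (p ^ 2 + a ^ 2) * carterK a l ω m q
      = -(a * Xi a l * m * (q ^ 2 - p ^ 2)) := by unfold carterK; ring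
  have h1 : |(q ^ 2 + a ^ 2) * carterK a l ω m p - (p ^ 2 + a ^ 2) * carterK a l ω m q|
      = |a| * (Xi a l * |m|) * (q ^ 2 - p ^ 2) := by
    rw [e, abs_neg, abs_mul, abs_mul, abs_mul, abs_of_nonneg hsq,
      abs_of_nonneg (by linarith : 0 ≤ Xi a l)]
    ring
  have h2 := abs_sub ((q ^ 2 + a ^ 2) * carterK a l ω m p) ((p ^ 2 + a ^ 2) * carterK a l ω m q)
  rw [h1, abs_mul, abs_mul, abs_of_nonneg (by positivity : 0 ≤ q ^ 2 + a ^ 2),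
    abs_of_nonneg (by positivity : 0 ≤ p ^ 2 + a ^ 2)] at h2
  have h3 : 1 ≤ Xi a l * |m| := one_le_mul_of_one_le_of_one_le hX hm
  have h4 : |a| * (q ^ 2 - p ^ 2) * 1 ≤ |a| * (q ^ 2 - p ^ 2) * (Xi a l * |m|) :=
    mul_le_mul_of_nonneg_left h3 (mul_nonneg (abs_nonneg _) hsq)
  have h5 := mul_nonneg (abs_nonneg (carterK a l ω m q)) hsq
  linarith

/-- In a bounded rotating frequency range the source controls the solution, unless the frequency is
superradiant and away from both thresholds. -/
theorem Horizons.exists_rotating_bound (hh : Horizons a M l p q s) (hmu : 0 ≤ musq) (ha : a ≠ 0)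
    (N : ℝ) : ∃ η > 0, ∃ B > 0, ∀ ω m L : ℝ, |ω| ≤ N → |m| ≤ N → |L| ≤ N → 1 ≤ |m| →
      (0 ≤ carterK a l ω m p * carterK a l ω m q ∨ |carterK a l ω m p| ≤ η ∨
        |carterK a l ω m q| ≤ η) →
      ∀ (Ψ w F : ℝ → ℂ) (P Q : ℝ), RadialSolution a M l musq ω m L p q Ψ w F P Q →
        ∀ x ∈ Ioo p q, ‖Ψ x‖ ^ 2 + ‖w x‖ ^ 2 ≤ B * ∫ r in p..q, ‖F r‖ ^ 2 := by
  obtain ⟨K, hK, y₀, -, -, hsup⟩ := hh.exists_sup_bound hmu N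
  have hp := hh.p_pos
  have hq := hh.q_pos
  have hpq := hh.p_lt
  obtain ⟨c, hc⟩ : ∃ c, c = |a| * (q ^ 2 - p ^ 2) / (q ^ 2 + a ^ 2) / 4 := ⟨_, rfl⟩
  have hc0 : 0 < c := by
    have h1 : 0 < |a| := abs_pos.2 ha
    have h2 : 0 < q ^ 2 - p ^ 2 := by nlinarith
    rw [hc]; positivity
  obtain ⟨η, hη⟩ : ∃ η, η = c / (K + 1) := ⟨_, rfl⟩
  have hη0 : 0 < η := by rw [hη]; positivity
  have hηK : η * K ≤ c := by
    rw [hη, div_mul_eq_mul_div, div_le_iff₀ (by positivity)]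
    exact mul_le_mul_of_nonneg_left (by linarith) hc0.le
  have hηc : η ≤ c := by rw [hη]; exact div_le_self hc0.le (by linarith)
  refine ⟨η, hη0, K * ((3 * c ^ 2 + (q - p) * K) / c ^ 2 + 1), by positivity, ?_⟩
  intro ω m L hω hm hL hm1 hcase Ψ w F P Q h x hx
  have hs := (hsup ω m L hω hm hL Ψ w F P Q h).1
  have hA := h.integral_source_nonneg hpq.le
  have hP := h.P_nonneg
  have hQ := h.Q_nonneg
  have hsum := hh.le_abs_carterK_add (ω := ω) hm1
  have hsP : ∀ x ∈ Ioo p q, ‖Ψ x‖ ^ 2 ≤ K * (P + ∫ r in p..q, ‖F r‖ ^ 2) := fun x hx => by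
    have := (hs x hx).2.1
    have := sq_nonneg ‖w x‖
    linarith
  have hsQ : ∀ x ∈ Ioo p q, ‖Ψ x‖ ^ 2 ≤ K * (Q + ∫ r in p..q, ‖F r‖ ^ 2) := fun x hx => by
    have := (hs x hx).2.2
    have := sq_nonneg ‖w x‖
    linarith
  have hPQ := h.left_le hpq hsQ
  have hQP := h.right_le hpq hsP
  have key : ∀ V, (∀ x ∈ Ioo p q, ‖Ψ x‖ ^ 2 + ‖w x‖ ^ 2 ≤ K * (V + ∫ r in p..q, ‖F r‖ ^ 2)) →
      c * V ≤ |carterK a l ω m q * Q + carterK a l ω m p * P| + c * (∫ r in p..q, ‖F r‖ ^ 2) →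
      ‖Ψ x‖ ^ 2 + ‖w x‖ ^ 2
        ≤ K * ((3 * c ^ 2 + (q - p) * K) / c ^ 2 + 1) * ∫ r in p..q, ‖F r‖ ^ 2 := by
    intro V hV hfl
    have h1 := h.sq_mul_le_of_flux hpq hK hc0.le (fun x hx => by
      have := hV x hx
      have := sq_nonneg ‖w x‖
      linarith) hfl
    have h2 : V ≤ (3 * c ^ 2 + (q - p) * K) / c ^ 2 * ∫ r in p..q, ‖F r‖ ^ 2 := by
      rw [div_mul_eq_mul_div, le_div_iff₀ (by positivity)]
      linarith
    refine (hV x hx).trans ?_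
    rw [mul_assoc]
    exact mul_le_mul_of_nonneg_left (by linarith) hK.le
  have keyP := key P (fun x hx => (hs x hx).2.1)
  have keyQ := key Q (fun x hx => (hs x hx).2.2)
  clear key hs hsup hsP hsQ
  have tri1 := abs_sub_abs_le_abs_sub (carterK a l ω m q * Q) (-(carterK a l ω m p * P))
  have tri2 := abs_sub_abs_le_abs_sub (carterK a l ω m p * P) (-(carterK a l ω m q * Q))
  rw [sub_neg_eq_add, abs_neg, abs_mul, abs_mul, abs_of_nonneg hP, abs_of_nonneg hQ] at tri1 tri2
  rw [add_comm (carterK a l ω m p * P)] at tri2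
  generalize hI : |carterK a l ω m q * Q + carterK a l ω m p * P| = I at *
  generalize ∫ r in p..q, ‖F r‖ ^ 2 = A at *
  have hcA : 0 ≤ c * A := by positivity
  rcases hcase with h0 | h0 | h0
  · have hIe : I = |carterK a l ω m q| * Q + |carterK a l ω m p| * P := by
      rw [← hI, abs_add_of_mul_nonneg, abs_mul, abs_mul, abs_of_nonneg hP, abs_of_nonneg hQ]
      have e : carterK a l ω m q * Q * (carterK a l ω m p * P)
          = carterK a l ω m p * carterK a l ω m q * (P * Q) := by ring
      rw [e]; positivity
    rcases le_total (|carterK a l ω m p|) (|carterK a l ω m q|) with h1 | h1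
    · refine keyQ ?_
      have : c * Q ≤ |carterK a l ω m q| * Q := mul_le_mul_of_nonneg_right (by linarith) hQ
      linarith
    · refine keyP ?_
      have : c * P ≤ |carterK a l ω m p| * P := mul_le_mul_of_nonneg_right (by linarith) hP
      linarith
  · refine keyQ ?_
    have h1 : 2 * c * Q ≤ |carterK a l ω m q| * Q := mul_le_mul_of_nonneg_right (by linarith) hQ
    have h2 : |carterK a l ω m p| * P ≤ η * (K * (Q + A)) :=
      mul_le_mul h0 hPQ hP hη0.le
    have h3 : η * K * (Q + A) ≤ c * (Q + A) :=
      mul_le_mul_of_nonneg_right hηK (by linarith)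
    linarith
  · refine keyP ?_
    have h1 : 2 * c * P ≤ |carterK a l ω m p| * P := mul_le_mul_of_nonneg_right (by linarith) hP
    have h2 : |carterK a l ω m q| * Q ≤ η * (K * (P + A)) :=
      mul_le_mul h0 hQP hQ hη0.le
    have h3 : η * K * (P + A) ≤ c * (P + A) :=
      mul_le_mul_of_nonneg_right hηK (by linarith)
    linarith

end

section

variable {a M l p q s musq : ℝ}

theorem RadialEq.hasDerivAt_ingoing {ω m L r : ℝ} {Ψ w F : ℝ → ℂ}
    (h : RadialEq a M l musq ω m L p q Ψ w F) (hr : r ∈ Ioo p q) (hΔ : Delta a M l r ≠ 0) :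
    HasDerivAt (fun r => w r + I * carterK a l ω m r * Ψ r)
      (I * ((carterK a l ω m r / Delta a M l r : ℝ) : ℂ)
          * (w r + I * carterK a l ω m r * Ψ r)
        + (F r + (((L + musq * (r ^ 2 + a ^ 2) : ℝ) : ℂ) + I * ((2 * ω * r : ℝ) : ℂ))
          * Ψ r)) r := by
  have h1 := (h.deriv_snd r hr).add
    ((((hasDerivAt_carterK a l ω m r).ofReal_comp).const_mul I).mul (h.deriv_fst r hr))
  refine h1.congr_deriv ?_
  have hΔ' : ((Delta a M l r : ℝ) : ℂ) ≠ 0 := by exact_mod_cast hΔ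
  unfold radialG
  push_cast
  field_simp
  ring_nf
  rw [I_sq]
  ring

/-- The massless axisymmetric field near zero frequency: `ωΨ` is controlled by the flux, and the
ingoing combination `w + iKΨ` by integration from the event horizon. -/
theorem Horizons.exists_massless_bound (hh : Horizons a M l p q s) (N : ℝ) :
    ∃ B > 0, ∀ ω L : ℝ, |ω| ≤ N → |L| ≤ N → 0 ≤ L → L ≤ (a * ω) ^ 2 →
      ∀ (Ψ w F : ℝ → ℂ) (P Q : ℝ), RadialSolution a M l 0 ω 0 L p q Ψ w F P Q →
        ∀ x ∈ Ioo p q, ‖w x‖ ^ 2 + ω ^ 2 * ‖Ψ x‖ ^ 2 ≤ B * ∫ r in p..q, ‖F r‖ ^ 2 := by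
  obtain ⟨K, hK, y₀, -, -, hsup⟩ := hh.exists_sup_bound le_rfl N
  have hp := hh.p_pos
  have hq := hh.q_pos
  have hpq := hh.p_lt
  obtain ⟨C, hC⟩ : ∃ C, C = K * ((3 * N ^ 2 * (p ^ 2 + a ^ 2) ^ 2 + (q - p) * K)
    / (p ^ 2 + a ^ 2) ^ 2 + N ^ 2) := ⟨_, rfl⟩
  have hC0 : 0 < C := by rw [hC]; positivity
  obtain ⟨D, hD⟩ : ∃ D, D = √(q - p) + (q - p) * ((a ^ 2 * |N| + 2 * q) * √C)
    + (q ^ 2 + a ^ 2) * √C := ⟨_, rfl⟩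
  refine ⟨D ^ 2 + C, by positivity, fun ω L hω hL hL0 hLa Ψ w F P Q h x hx => ?_⟩
  have hN0 : 0 ≤ N := (abs_nonneg _).trans hω
  have hs := (hsup ω 0 L hω (by simpa using hN0) hL Ψ w F P Q h).1
  have hA := h.integral_source_nonneg hpq.le
  have hP := h.P_nonneg
  have hQ := h.Q_nonneg
  have hω2 : ω ^ 2 ≤ N ^ 2 := by
    rw [← sq_abs ω]; exact pow_le_pow_left₀ (abs_nonneg _) hω 2
  obtain ⟨A, hAe⟩ : ∃ A, A = ∫ r in p..q, ‖F r‖ ^ 2 := ⟨_, rfl⟩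
  have hfl := h.sq_mul_le_of_flux (V := P) (c := |ω| * (p ^ 2 + a ^ 2)) hpq hK (by positivity)
    (fun x hx => by
      have := (hs x hx).2.1
      have := sq_nonneg ‖w x‖
      linarith) (by
      have e : carterK a l ω 0 q * Q + carterK a l ω 0 p * P
          = ω * ((q ^ 2 + a ^ 2) * Q + (p ^ 2 + a ^ 2) * P) := by unfold carterK; ring
      rw [e, abs_mul, abs_of_nonneg (a := (q ^ 2 + a ^ 2) * Q + (p ^ 2 + a ^ 2) * P)
        (by positivity), mul_assoc]
      have h1 : |ω| * ((p ^ 2 + a ^ 2) * P) ≤ |ω| * ((q ^ 2 + a ^ 2) * Q + (p ^ 2 + a ^ 2) * P) :=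
        mul_le_mul_of_nonneg_left (by have := mul_nonneg (add_nonneg (sq_nonneg q) (sq_nonneg a)) hQ; linarith)
          (abs_nonneg _)
      have h2 : 0 ≤ |ω| * (p ^ 2 + a ^ 2) * ∫ r in p..q, ‖F r‖ ^ 2 := by positivity
      linarith)
  rw [← hAe] at hfl hs hA ⊢
  have hPω : ω ^ 2 * P ≤ (3 * N ^ 2 * (p ^ 2 + a ^ 2) ^ 2 + (q - p) * K)
      / (p ^ 2 + a ^ 2) ^ 2 * A := by
    rw [div_mul_eq_mul_div, le_div_iff₀ (by positivity)]
    rw [mul_pow, sq_abs] at hfl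
    have : ω ^ 2 * (p ^ 2 + a ^ 2) ^ 2 * A ≤ N ^ 2 * (p ^ 2 + a ^ 2) ^ 2 * A := by gcongr
    linarith
  have hΨ : ∀ y ∈ Ioo p q, ω ^ 2 * ‖Ψ y‖ ^ 2 ≤ C * A := by
    intro y hy
    have h1 : ‖Ψ y‖ ^ 2 ≤ K * (P + A) := by
      have := (hs y hy).2.1
      have := sq_nonneg ‖w y‖
      linarith
    have h2 := mul_le_mul_of_nonneg_left h1 (sq_nonneg ω)
    have h3 := mul_le_mul_of_nonneg_left hPω hK.le
    have h4 : K * (ω ^ 2 * A) ≤ K * (N ^ 2 * A) := by gcongr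
    rw [hC]
    linarith
  have hΨ' : ∀ y ∈ Ioo p q, |ω| * ‖Ψ y‖ ≤ √C * √A := by
    intro y hy
    rw [← sqrt_mul hC0.le]
    refine le_sqrt_of_sq_le ?_
    rw [mul_pow, sq_abs]
    exact hΨ y hy
  -- the ingoing combination
  have hz : ‖w x + I * carterK a l ω 0 x * Ψ x‖
      ≤ √(q - p) * √A + (q - p) * ((a ^ 2 * |N| + 2 * q) * (√C * √A)) := by
    have hl := h.in_left.norm.add_const
      (√(q - p) * √A + (q - p) * ((a ^ 2 * |N| + 2 * q) * (√C * √A)))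
    rw [norm_zero, zero_add] at hl
    refine ge_of_tendsto hl ?_
    filter_upwards [Ioo_mem_nhdsGT hx.1] with y hy
    have hsub : Icc y x ⊆ Ioo p q := fun r hr => ⟨hy.1.trans_le hr.1, hr.2.trans_lt hx.2⟩
    have hΨc := (RadialSolution.continuousOn_fst h.toRadialEq).mono hsub
    have hFc := h.cont_F.mono hsub
    have cg : ContinuousOn (fun r : ℝ => (((L + 0 * (r ^ 2 + a ^ 2) : ℝ) : ℂ)
        + I * ((2 * ω * r : ℝ) : ℂ)) * Ψ r) (Icc y x) :=
      (Continuous.continuousOn (by fun_prop)).mul hΨc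
    have h1 := abs_norm_sub_le_of_rotation hy.2.le
      (f := fun r => w r + I * carterK a l ω 0 r * Ψ r)
      (k := fun r => carterK a l ω 0 r / Delta a M l r)
      (fun r hr => h.toRadialEq.hasDerivAt_ingoing (hsub hr) (hh.Delta_pos (hsub hr)).ne')
      (ContinuousOn.div (by fun_prop) (by fun_prop) fun r hr => (hh.Delta_pos (hsub hr)).ne')
      (hFc.add cg)
    have hFi := h.sourceIntervalIntegrable hpq.le
    have hFA : ∫ r in y..x, ‖F r‖ ^ 2 ≤ A := by
      rw [hAe]
      exact intervalIntegral.integral_mono_interval hy.1.le hy.2.le hx.2.le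
        (.of_forall fun r => sq_nonneg _) hFi
    have h2 := integral_norm_le_sqrt hy.2.le hFc hFA
    have h3 : √(x - y) * √A ≤ √(q - p) * √A := by
      have : √(x - y) ≤ √(q - p) := sqrt_le_sqrt (by linarith [hy.1, hx.2])
      gcongr
    have hgb : ∀ r ∈ Icc y x, ‖(((L + 0 * (r ^ 2 + a ^ 2) : ℝ) : ℂ)
        + I * ((2 * ω * r : ℝ) : ℂ)) * Ψ r‖ ≤ (a ^ 2 * |N| + 2 * q) * (√C * √A) := by
      intro r hr
      have hr0 : 0 ≤ r := (hp.trans (hsub hr).1).le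
      have e1 : ‖((L + 0 * (r ^ 2 + a ^ 2) : ℝ) : ℂ) + I * ((2 * ω * r : ℝ) : ℂ)‖
          ≤ (a ^ 2 * |N| + 2 * q) * |ω| := by
        refine (norm_add_le _ _).trans ?_
        rw [norm_mul, norm_I, one_mul, norm_real, norm_real,
          norm_eq_abs, norm_eq_abs, zero_mul, add_zero, abs_of_nonneg hL0, abs_mul,
          abs_mul, abs_of_nonneg hr0, abs_two]
        have i1 : L ≤ a ^ 2 * |N| * |ω| := by
          refine hLa.trans ?_
          rw [mul_pow, ← sq_abs ω, sq |ω|, ← mul_assoc]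
          have : |ω| ≤ |N| := by rwa [abs_of_nonneg hN0]
          gcongr
        have i2 : 2 * |ω| * r ≤ 2 * |ω| * q :=
          mul_le_mul_of_nonneg_left (hsub hr).2.le (by positivity)
        linarith
      rw [norm_mul]
      refine (mul_le_mul_of_nonneg_right e1 (norm_nonneg _)).trans ?_
      rw [mul_assoc]
      exact mul_le_mul_of_nonneg_left (hΨ' r (hsub hr)) (by positivity)
    have h4 : ∫ r in y..x, ‖F r + (((L + 0 * (r ^ 2 + a ^ 2) : ℝ) : ℂ)
        + I * ((2 * ω * r : ℝ) : ℂ)) * Ψ r‖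
        ≤ ∫ r in y..x, (‖F r‖ + (a ^ 2 * |N| + 2 * q) * (√C * √A)) := by
      refine intervalIntegral.integral_mono_on hy.2.le ?_ ?_ fun r hr => ?_
      · exact ContinuousOn.intervalIntegrable (by rw [uIcc_of_le hy.2.le]; exact (hFc.add cg).norm)
      · exact ContinuousOn.intervalIntegrable
          (by rw [uIcc_of_le hy.2.le]; exact hFc.norm.add continuousOn_const)
      · exact (norm_add_le _ _).trans (add_le_add_right (hgb r hr) _)
    rw [intervalIntegral.integral_add
      (ContinuousOn.intervalIntegrable (by rw [uIcc_of_le hy.2.le]; exact hFc.norm))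
      intervalIntegrable_const, intervalIntegral.integral_const, smul_eq_mul] at h4
    have h5 : (x - y) * ((a ^ 2 * |N| + 2 * q) * (√C * √A))
        ≤ (q - p) * ((a ^ 2 * |N| + 2 * q) * (√C * √A)) :=
      mul_le_mul_of_nonneg_right (by linarith [hy.1, hx.2]) (by positivity)
    have h6 := (abs_le.1 h1).2
    linarith
  have hwx : ‖w x‖ ≤ D * √A := by
    have e : w x = (w x + I * carterK a l ω 0 x * Ψ x)
        - I * carterK a l ω 0 x * Ψ x := by ring
    have h1 : ‖I * carterK a l ω 0 x * Ψ x‖ ≤ (q ^ 2 + a ^ 2) * (√C * √A) := by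
      rw [norm_mul, norm_mul, norm_I, one_mul, norm_real, norm_eq_abs]
      have e2 : |carterK a l ω 0 x| = (x ^ 2 + a ^ 2) * |ω| := by
        unfold carterK
        rw [mul_zero, sub_zero, abs_mul, abs_of_nonneg (by positivity : 0 ≤ x ^ 2 + a ^ 2)]
        ring
      rw [e2, mul_assoc]
      have h3 : x ^ 2 ≤ q ^ 2 := pow_le_pow_left₀ (hp.trans hx.1).le hx.2.le 2
      exact mul_le_mul (by linarith) (hΨ' x hx) (by positivity) (by positivity)
    rw [e]
    refine (norm_sub_le _ _).trans ?_
    rw [hD]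
    linarith
  have h1 := pow_le_pow_left₀ (norm_nonneg _) hwx 2
  rw [mul_pow, sq_sqrt hA] at h1
  have := hΨ x hx
  linarith

/-- If the potential is bounded below and `K` is small throughout, the radial equation is coercive
in the interior, and the source controls the solution. -/
theorem Horizons.exists_coercive_bound (hh : Horizons a M l p q s) (hmu : 0 ≤ musq) (N : ℝ) {c : ℝ}
    (hc : 0 < c) : ∃ κ > 0, ∃ B > 0, ∀ ω m L : ℝ, |ω| ≤ N → |m| ≤ N → |L| ≤ N →
      (∀ r ∈ Icc p q, |carterK a l ω m r| ≤ κ) →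
      (∀ r ∈ Icc p q, c ≤ L + musq * (r ^ 2 + a ^ 2)) →
      ∀ (Ψ w F : ℝ → ℂ) (P Q : ℝ), RadialSolution a M l musq ω m L p q Ψ w F P Q →
        ∀ x ∈ Ioo p q, ‖Ψ x‖ ^ 2 + ‖w x‖ ^ 2 ≤ B * ∫ r in p..q, ‖F r‖ ^ 2 := by
  obtain ⟨K, hK, y₀, hy₀, hy₁, hsup⟩ := hh.exists_sup_bound hmu N
  have hpq := hh.p_lt
  have hw : 0 < q - p := sub_pos.2 hpq
  obtain ⟨D', hD'⟩ := isCompact_Icc.exists_bound_of_continuousOn (s := Icc p q)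
    (continuous_Delta a M l).continuousOn
  obtain ⟨D, hD0, hD⟩ : ∃ D > 0, ∀ r ∈ Icc p q, Delta a M l r ≤ D :=
    ⟨|D'| + 1, by positivity, fun r hr =>
      (le_abs_self _).trans (((hD' r hr).trans (le_abs_self _)).trans (by linarith))⟩
  obtain ⟨b, hb⟩ : ∃ b, b = min c (1 / D) := ⟨_, rfl⟩
  have hb0 : 0 < b := by rw [hb]; exact lt_min hc (by positivity)
  obtain ⟨g, hg⟩ : ∃ g, g = b * (q - p) / (2 * K) := ⟨_, rfl⟩
  have hg0 : 0 < g := by rw [hg]; positivity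
  obtain ⟨t, ht0, hty, htg⟩ : ∃ t > 0, t ≤ y₀ ∧ 2 * K ^ 2 * t ≤ g / 4 := by
    refine ⟨min y₀ (g / (8 * K ^ 2)), lt_min hy₀ (by positivity), min_le_left _ _, ?_⟩
    have h1 := mul_le_mul_of_nonneg_left (min_le_right y₀ (g / (8 * K ^ 2)))
      (by positivity : 0 ≤ 2 * K ^ 2)
    have e : 2 * K ^ 2 * (g / (8 * K ^ 2)) = g / 4 := by field_simp; ring
    linarith
  have hIcc : ∀ r ∈ Icc (p + t) (q - t), r ∈ Ioo p q := fun r hr =>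
    ⟨by linarith [hr.1], by linarith [hr.2]⟩
  have htle : p + t ≤ q - t := by linarith
  obtain ⟨T, hT0, hT⟩ := hh.exists_inv_Delta_bound (x := p + t) (y := q - t) (by linarith)
    (by linarith)
  obtain ⟨ε, hε⟩ : ∃ ε, ε = g / (4 * (K * (q - p))) := ⟨_, rfl⟩
  have hε0 : 0 < ε := by rw [hε]; positivity
  have hεg : ε * (K * (q - p)) = g / 4 := by rw [hε]; field_simp
  obtain ⟨κ, hκ⟩ : ∃ κ, κ = √(g / (4 * (T * (K * (q - p))))) := ⟨_, rfl⟩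
  have hκ0 : 0 < κ := by rw [hκ]; positivity
  have hκg : κ ^ 2 * T * (K * (q - p)) = g / 4 := by
    rw [hκ, sq_sqrt (by positivity)]; field_simp
  obtain ⟨R, hR⟩ : ∃ R, R = 4 / g * (g * K + 3 * g / 4 + 1 / (4 * ε) + 2 * K) := ⟨_, rfl⟩
  have hR0 : 0 < R := by rw [hR]; positivity
  refine ⟨κ, hκ0, K * (R + K + 1), by positivity, ?_⟩
  intro ω m L hω hm hL hsmall hpos Ψ w F P Q h x hx
  obtain ⟨hs, hbd⟩ := hsup ω m L hω hm hL Ψ w F P Q h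
  have hA := h.integral_source_nonneg hpq.le
  have hFi := h.sourceIntervalIntegrable hpq.le
  obtain ⟨A, hAe⟩ : ∃ A, A = ∫ r in p..q, ‖F r‖ ^ 2 := ⟨_, rfl⟩
  rw [← hAe] at hs hbd hA ⊢
  obtain ⟨o, ho⟩ : ∃ o, o = (p + q) / 2 := ⟨_, rfl⟩
  have ho1 : o ∈ Icc (p + y₀) (q - y₀) := ⟨by linarith, by linarith⟩
  have ho2 : o ∈ Ioo p q := ⟨by linarith, by linarith⟩
  obtain ⟨σ, hσ⟩ : ∃ σ, σ = ‖Ψ o‖ ^ 2 + ‖w o‖ ^ 2 := ⟨_, rfl⟩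
  have hσ0 : 0 ≤ σ := by rw [hσ]; positivity
  have up : ∀ y ∈ Ioo p q, ‖Ψ y‖ ^ 2 + ‖w y‖ ^ 2 ≤ K * (σ + A) := fun y hy => by
    rw [hσ]; exact (hs y hy).1 o ho1
  have low : ∀ r ∈ Icc (p + y₀) (q - y₀), σ / K - A ≤ ‖Ψ r‖ ^ 2 + ‖w r‖ ^ 2 := fun r hr => by
    have h1 := (hs o ho2).1 r hr
    rw [← hσ] at h1
    have h2 : σ / K ≤ ‖Ψ r‖ ^ 2 + ‖w r‖ ^ 2 + A := by
      rw [div_le_iff₀ hK]; linarith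
    linarith
  have upΨ : ∀ y ∈ Ioo p q, ‖Ψ y‖ ^ 2 ≤ K * (σ + A) := fun y hy => by
    have := up y hy
    have := sq_nonneg ‖w y‖
    linarith
  obtain ⟨be1, be2⟩ := hbd _ upΨ t ⟨ht0, hty⟩
  suffices hfin : σ ≤ (R + K) * A by
    refine (up x hx).trans ?_
    rw [mul_assoc]
    exact mul_le_mul_of_nonneg_left (by linarith) hK.le
  rcases le_or_gt (σ / K - A) 0 with hneg | hneg
  · have h1 : σ / K ≤ A := by linarith
    rw [div_le_iff₀ hK] at h1
    have : 0 ≤ R * A := by positivity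
    linarith
  have hΨc := (RadialSolution.continuousOn_fst h.toRadialEq).mono hIcc
  have hwc := (RadialSolution.continuousOn_snd h.toRadialEq).mono hIcc
  have hFc := h.cont_F.mono hIcc
  have hderiv : ∀ r ∈ Icc (p + t) (q - t), HasDerivAt (fun r => inner ℝ (Ψ r) (w r))
      (inner ℝ (Ψ r) (F r) - radialG a M l musq ω m L r / Delta a M l r * ‖Ψ r‖ ^ 2
        + 1 / Delta a M l r * ‖w r‖ ^ 2) r := by
    intro r hr
    refine ((h.deriv_fst r (hIcc r hr)).inner ℝ (h.deriv_snd r (hIcc r hr))).congr_deriv ?_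
    rw [inner_sub_right, inner_ofReal_mul_right, inner_ofReal_mul_left,
      real_inner_self_eq_norm_sq, real_inner_self_eq_norm_sq]
  have cinv : ContinuousOn (fun r => 1 / Delta a M l r) (Icc (p + t) (q - t)) :=
    ContinuousOn.div (by fun_prop) (by fun_prop) fun r hr => (hh.Delta_pos (hIcc r hr)).ne'
  have cG : ContinuousOn (fun r => radialG a M l musq ω m L r / Delta a M l r)
      (Icc (p + t) (q - t)) :=
    ContinuousOn.div (by fun_prop) (by fun_prop) fun r hr => (hh.Delta_pos (hIcc r hr)).ne'
  have hint : IntervalIntegrable (fun r => inner ℝ (Ψ r) (F r)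
      - radialG a M l musq ω m L r / Delta a M l r * ‖Ψ r‖ ^ 2
        + 1 / Delta a M l r * ‖w r‖ ^ 2) volume (p + t) (q - t) :=
    ContinuousOn.intervalIntegrable (by
      rw [uIcc_of_le htle]
      exact ((hΨc.inner hFc).sub (cG.mul (hΨc.norm.pow 2))).add (cinv.mul (hwc.norm.pow 2)))
  have hFTC := intervalIntegral.integral_eq_sub_of_hasDerivAt
    (fun r hr => hderiv r (by rwa [uIcc_of_le htle] at hr)) hint
  have hSi : IntervalIntegrable (fun r => ‖Ψ r‖ ^ 2 + ‖w r‖ ^ 2) volume (p + t) (q - t) :=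
    ContinuousOn.intervalIntegrable (by
      rw [uIcc_of_le htle]; exact (hΨc.norm.pow 2).add (hwc.norm.pow 2))
  have hFi' : IntervalIntegrable (fun r => ‖F r‖ ^ 2) volume (p + t) (q - t) :=
    hFi.mono_set (by
      rw [uIcc_of_le htle, uIcc_of_le hpq.le]
      exact Icc_subset_Icc (by linarith) (by linarith))
  have hpt : ∀ r ∈ Icc (p + t) (q - t),
      b * (‖Ψ r‖ ^ 2 + ‖w r‖ ^ 2) - (κ ^ 2 * T + ε) * (K * (σ + A)) - 1 / (4 * ε) * ‖F r‖ ^ 2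
      ≤ inner ℝ (Ψ r) (F r) - radialG a M l musq ω m L r / Delta a M l r * ‖Ψ r‖ ^ 2
        + 1 / Delta a M l r * ‖w r‖ ^ 2 := by
    intro r hr
    have hr' : r ∈ Icc p q := ⟨(hIcc r hr).1.le, (hIcc r hr).2.le⟩
    have hΔ := hh.Delta_pos (hIcc r hr)
    have e : radialG a M l musq ω m L r / Delta a M l r
        = carterK a l ω m r ^ 2 * (1 / Delta a M l r) - (L + musq * (r ^ 2 + a ^ 2)) := by
      unfold radialG; field_simp
    have i1 : carterK a l ω m r ^ 2 * (1 / Delta a M l r) ≤ κ ^ 2 * T :=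
      mul_le_mul (by rw [← sq_abs]; exact pow_le_pow_left₀ (abs_nonneg _) (hsmall r hr') 2)
        (hT r hr) (by positivity) (by positivity)
    have i2 : b ≤ L + musq * (r ^ 2 + a ^ 2) := by
      rw [hb]; exact (min_le_left _ _).trans (hpos r hr')
    have i3 : b ≤ 1 / Delta a M l r := by
      rw [hb]; exact (min_le_right _ _).trans (one_div_le_one_div_of_le hΔ (hD r hr'))
    have i4 := (abs_le.1 (abs_inner_le_young (Ψ r) (F r) hε0)).1
    have k1 := mul_le_mul_of_nonneg_right i1 (sq_nonneg ‖Ψ r‖)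
    have k2 := mul_le_mul_of_nonneg_right i2 (sq_nonneg ‖Ψ r‖)
    have k3 := mul_le_mul_of_nonneg_right i3 (sq_nonneg ‖w r‖)
    have k4 := mul_le_mul_of_nonneg_left (upΨ r (hIcc r hr))
      (by positivity : 0 ≤ κ ^ 2 * T + ε)
    rw [e]
    linarith
  have hge := intervalIntegral.integral_mono_on htle
    (((hSi.const_mul b).sub intervalIntegrable_const).sub (hFi'.const_mul (1 / (4 * ε)))) hint hpt
  rw [hFTC, intervalIntegral.integral_sub ((hSi.const_mul b).sub intervalIntegrable_const)
    (hFi'.const_mul _), intervalIntegral.integral_sub (hSi.const_mul b) intervalIntegrable_const,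
    intervalIntegral.integral_const, smul_eq_mul,
    intervalIntegral.integral_const_mul, intervalIntegral.integral_const_mul] at hge
  have hFle : ∫ r in (p + t)..(q - t), ‖F r‖ ^ 2 ≤ A := by
    rw [hAe]
    exact intervalIntegral.integral_mono_interval (by linarith) htle (by linarith)
      (.of_forall fun r => sq_nonneg _) hFi
  have hSge : (q - p) / 2 * (σ / K - A) ≤ ∫ r in (p + t)..(q - t), (‖Ψ r‖ ^ 2 + ‖w r‖ ^ 2) := by
    have hmid : p + y₀ ≤ q - y₀ := by linarith
    have h1 : ∫ r in (p + y₀)..(q - y₀), (‖Ψ r‖ ^ 2 + ‖w r‖ ^ 2)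
        ≤ ∫ r in (p + t)..(q - t), (‖Ψ r‖ ^ 2 + ‖w r‖ ^ 2) :=
      intervalIntegral.integral_mono_interval (by linarith) hmid (by linarith)
        (.of_forall fun r => by positivity) hSi
    have h2 := intervalIntegral.integral_mono_on hmid intervalIntegrable_const
      (hSi.mono_set (by
        rw [uIcc_of_le htle, uIcc_of_le hmid]
        exact Icc_subset_Icc (by linarith) (by linarith))) low
    rw [intervalIntegral.integral_const, smul_eq_mul] at h2
    have h3 : (q - p) / 2 * (σ / K - A) ≤ (q - y₀ - (p + y₀)) * (σ / K - A) :=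
      mul_le_mul_of_nonneg_right (by linarith) hneg.le
    linarith
  have f1 := mul_le_mul_of_nonneg_left hSge hb0.le
  have e1 : b * ((q - p) / 2 * (σ / K - A)) = g * σ - g * K * A := by
    rw [hg]; field_simp
  rw [e1] at f1
  have f2 := mul_le_mul_of_nonneg_left hFle (by positivity : 0 ≤ 1 / (4 * ε))
  have f3 : (q - t - (p + t)) * ((κ ^ 2 * T + ε) * (K * (σ + A))) ≤ g / 2 * (σ + A) := by
    have j1 : (q - t - (p + t)) * ((κ ^ 2 * T + ε) * (K * (σ + A)))
        ≤ (q - p) * ((κ ^ 2 * T + ε) * (K * (σ + A))) :=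
      mul_le_mul_of_nonneg_right (by linarith) (by positivity)
    have j2 : (q - p) * ((κ ^ 2 * T + ε) * (K * (σ + A)))
        = (κ ^ 2 * T * (K * (q - p)) + ε * (K * (q - p))) * (σ + A) := by ring
    rw [j2, hκg, hεg] at j1
    linarith
  have f4 : 2 * (K * (t * (K * (σ + A)) + A)) ≤ g / 4 * (σ + A) + 2 * K * A := by
    have j := mul_le_mul_of_nonneg_right htg (by positivity : 0 ≤ σ + A)
    have e : 2 * (K * (t * (K * (σ + A)) + A)) = 2 * K ^ 2 * t * (σ + A) + 2 * K * A := by ring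
    rw [e]; linarith
  have f5 := (abs_le.1 be1).1
  have f6 := (abs_le.1 be2).2
  have f7 : g / 4 * σ ≤ (g * K + 3 * g / 4 + 1 / (4 * ε) + 2 * K) * A := by
    linarith only [f3, f1, f2, f4, f5, f6, hge]
  have f8 : σ ≤ R * A := by
    have := mul_le_mul_of_nonneg_left f7 (by positivity : 0 ≤ 4 / g)
    have e : 4 / g * (g / 4 * σ) = σ := by field_simp
    rw [e] at this
    rw [hR]; linarith
  have : 0 ≤ K * A := by positivity
  linarith

end

section

variable {a M l p q s musq : ℝ}

/-- If `am = 0` and the frequency is not small, then `K = ω(r² + a²)` has the same sign and a definite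
size at both horizons, and the flux identity controls the solution. -/
theorem Horizons.exists_nonrotating_bound (hh : Horizons a M l p q s) (hmu : 0 ≤ musq) (N : ℝ)
    {ω₀ : ℝ} (hω₀ : 0 < ω₀) : ∃ B > 0, ∀ ω m L : ℝ, |ω| ≤ N → |m| ≤ N → |L| ≤ N → a * m = 0 →
      ω₀ ≤ |ω| → ∀ (Ψ w F : ℝ → ℂ) (P Q : ℝ), RadialSolution a M l musq ω m L p q Ψ w F P Q →
        ∀ x ∈ Ioo p q, ‖Ψ x‖ ^ 2 + ‖w x‖ ^ 2 ≤ B * ∫ r in p..q, ‖F r‖ ^ 2 := by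
  obtain ⟨K, hK, y₀, -, -, hsup⟩ := hh.exists_sup_bound hmu N
  have hp := hh.p_pos
  have hq := hh.q_pos
  have hpq := hh.p_lt
  obtain ⟨c, hc⟩ : ∃ c, c = ω₀ * (p ^ 2 + a ^ 2) := ⟨_, rfl⟩
  have hc0 : 0 < c := by rw [hc]; positivity
  refine ⟨K * ((3 * c ^ 2 + (q - p) * K) / c ^ 2 + 1), by positivity, ?_⟩
  intro ω m L hω hm hL ham hω1 Ψ w F P Q h x hx
  have hs := (hsup ω m L hω hm hL Ψ w F P Q h).1
  have hA := h.integral_source_nonneg hpq.le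
  have hP := h.P_nonneg
  have hQ := h.Q_nonneg
  have hQ' := mul_nonneg (add_nonneg (sq_nonneg q) (sq_nonneg a)) hQ
  have h1 := h.sq_mul_le_of_flux (V := P) hpq hK hc0.le (fun x hx => by
      have := (hs x hx).2.1
      have := sq_nonneg ‖w x‖
      linarith) (by
      have e : carterK a l ω m q * Q + carterK a l ω m p * P
          = ω * ((q ^ 2 + a ^ 2) * Q + (p ^ 2 + a ^ 2) * P) := by
        have e1 : ∀ r, carterK a l ω m r = ω * (r ^ 2 + a ^ 2) := fun r => by
          unfold carterK
          rw [show a * Xi a l * m = Xi a l * (a * m) by ring, ham]; ring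
        rw [e1, e1]; ring
      rw [e, abs_mul, abs_of_nonneg (a := (q ^ 2 + a ^ 2) * Q + (p ^ 2 + a ^ 2) * P)
        (by positivity), hc, mul_assoc]
      have h1 : ω₀ * ((p ^ 2 + a ^ 2) * P) ≤ |ω| * ((q ^ 2 + a ^ 2) * Q + (p ^ 2 + a ^ 2) * P) :=
        mul_le_mul hω1 (by linarith) (by positivity) (abs_nonneg _)
      have h2 : 0 ≤ ω₀ * (p ^ 2 + a ^ 2) * ∫ r in p..q, ‖F r‖ ^ 2 := by positivity
      linarith)
  have h2 : P ≤ (3 * c ^ 2 + (q - p) * K) / c ^ 2 * ∫ r in p..q, ‖F r‖ ^ 2 := by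
    rw [div_mul_eq_mul_div, le_div_iff₀ (by positivity)]
    linarith
  refine (hs x hx).2.1.trans ?_
  rw [mul_assoc]
  exact mul_le_mul_of_nonneg_left (by linarith) hK.le

theorem IsAdmissible.one_le {ω L : ℝ} {m : ℤ} (h : IsAdmissible 0 l ω m L) (hm : m ≠ 0) :
    1 ≤ L := by
  obtain ⟨hL, σ, hσ, hle⟩ := h
  have hX : Xi 0 l = 1 := by simp [Xi]
  have hm1 : (1 : ℝ) ≤ (m : ℝ) ^ 2 := by
    have h1 : (1 : ℝ) ≤ |(m : ℝ)| := by exact_mod_cast Int.one_le_abs hm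
    rw [← sq_abs]
    exact one_le_pow₀ h1
  rw [hX] at hle
  have h1 : σ ^ 2 ≤ 1 := pow_le_one₀ hσ.1 hσ.2
  have h2 := mul_le_mul_of_nonneg_right h1 hL
  have e : (1 * (m : ℝ) - 0 * ω * σ ^ 2) ^ 2 = (m : ℝ) ^ 2 := by ring
  rw [e] at hle
  linarith

/-- Outside superradiance the source controls the solution in any bounded frequency range. -/
theorem Horizons.exists_low_frequency_estimate (hh : Horizons a M l p q s) (hmu : 0 ≤ musq)
    (N : ℝ) : ∃ B > 0, ∀ (ω Λ : ℝ) (m : ℤ), IsAngularEigenvalue a l musq (a * ω) m Λ →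
      |ω| ≤ N → |(m : ℝ)| ≤ N → shiftedEigenvalue a l (a * ω) m Λ ≤ N →
      0 ≤ carterK a l ω m p * carterK a l ω m q → ∀ (Ψ w F : ℝ → ℂ) (P Q : ℝ),
      RadialSolution a M l musq ω m (shiftedEigenvalue a l (a * ω) m Λ) p q Ψ w F P Q →
      ∀ x ∈ Ioo p q, ‖w x‖ ^ 2
          + (ω ^ 2 + (m : ℝ) ^ 2 + shiftedEigenvalue a l (a * ω) m Λ + musq) * ‖Ψ x‖ ^ 2
        ≤ B * ∫ r in p..q, ‖F r‖ ^ 2 := by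
  have hp := hh.p_pos
  have hq := hh.q_pos
  have hpq := hh.p_lt
  obtain ⟨c, hc, hc4, hcmu⟩ : ∃ c > 0, c ≤ 1 / 4 ∧ (0 < musq → c ≤ musq * p ^ 2) := by
    rcases hmu.eq_or_lt with h0 | h0
    · exact ⟨1 / 4, by norm_num, le_rfl, fun h => absurd h (by rw [← h0]; exact lt_irrefl _)⟩
    · exact ⟨min (1 / 4) (musq * p ^ 2), lt_min (by norm_num) (by positivity), min_le_left _ _,
        fun _ => min_le_right _ _⟩
  obtain ⟨κ, hκ, B₁, hB₁, H₁⟩ := hh.exists_coercive_bound hmu N hc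
  have hω₀ : 0 < κ / (q ^ 2 + a ^ 2) := by positivity
  obtain ⟨B₂, hB₂, H₂⟩ := hh.exists_nonrotating_bound hmu N hω₀
  obtain ⟨B₃, hB₃, H₃⟩ := hh.exists_massless_bound N
  obtain ⟨B₄, hB₄, H₄⟩ : ∃ B > 0, ∀ ω m L : ℝ, |ω| ≤ N → |m| ≤ N → |L| ≤ N → a ≠ 0 → 1 ≤ |m| →
      0 ≤ carterK a l ω m p * carterK a l ω m q →
      ∀ (Ψ w F : ℝ → ℂ) (P Q : ℝ), RadialSolution a M l musq ω m L p q Ψ w F P Q →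
        ∀ x ∈ Ioo p q, ‖Ψ x‖ ^ 2 + ‖w x‖ ^ 2 ≤ B * ∫ r in p..q, ‖F r‖ ^ 2 := by
    by_cases ha : a = 0
    · exact ⟨1, one_pos, fun _ _ _ _ _ _ h => absurd ha h⟩
    · obtain ⟨_, _, B, hB, H⟩ := hh.exists_rotating_bound hmu ha N
      exact ⟨B, hB, fun ω m L h1 h2 h3 _ h4 h5 => H ω m L h1 h2 h3 h4 (.inl h5)⟩
  obtain ⟨W, hW⟩ : ∃ W, W = N ^ 2 + N ^ 2 + |N| + musq + 1 := ⟨_, rfl⟩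
  have hW1 : 1 ≤ W := by
    have : 0 ≤ N ^ 2 + N ^ 2 + |N| + musq := by positivity
    linarith
  refine ⟨W * (B₁ + B₂ + B₄) + (1 + a ^ 2) * B₃, by positivity, ?_⟩
  intro ω Λ m hΛ hω hm hL hKK Ψ w F P Q h x hx
  have hadm := hΛ.isAdmissible hmu
  have hA := h.integral_source_nonneg hpq.le
  have hL0 := hadm.1
  have hLabs : |shiftedEigenvalue a l (a * ω) m Λ| ≤ N := by rwa [abs_of_nonneg hL0]
  have fin : ∀ B, 0 ≤ B → B ≤ B₁ + B₂ + B₄ →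
      ‖Ψ x‖ ^ 2 + ‖w x‖ ^ 2 ≤ B * ∫ r in p..q, ‖F r‖ ^ 2 →
      ‖w x‖ ^ 2 + (ω ^ 2 + (m : ℝ) ^ 2 + shiftedEigenvalue a l (a * ω) m Λ + musq) * ‖Ψ x‖ ^ 2
        ≤ (W * (B₁ + B₂ + B₄) + (1 + a ^ 2) * B₃) * ∫ r in p..q, ‖F r‖ ^ 2 := by
    intro B hB hBle hS
    have h1 : ω ^ 2 + (m : ℝ) ^ 2 + shiftedEigenvalue a l (a * ω) m Λ + musq ≤ W := by
      have i1 : ω ^ 2 ≤ N ^ 2 := by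
        rw [← sq_abs ω]; exact pow_le_pow_left₀ (abs_nonneg _) hω 2
      have i2 : (m : ℝ) ^ 2 ≤ N ^ 2 := by
        rw [← sq_abs (m : ℝ)]; exact pow_le_pow_left₀ (abs_nonneg _) hm 2
      have i3 := le_abs_self N
      rw [hW]; linarith
    have h2 := mul_le_mul_of_nonneg_right h1 (sq_nonneg ‖Ψ x‖)
    have h3 := mul_le_mul_of_nonneg_right hW1 (sq_nonneg ‖w x‖)
    have h4 := mul_le_mul_of_nonneg_left hS (zero_le_one.trans hW1)
    have h5 := mul_le_mul_of_nonneg_right hBle hA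
    have h6 := mul_le_mul_of_nonneg_left h5 (zero_le_one.trans hW1)
    have h7 : 0 ≤ (1 + a ^ 2) * B₃ * ∫ r in p..q, ‖F r‖ ^ 2 := by positivity
    linarith
  by_cases ham : a * (m : ℝ) = 0
  · -- the potential has a positive lower bound except for the massless axisymmetric ground state
    have hdich : c ≤ shiftedEigenvalue a l (a * ω) m Λ + musq * p ^ 2 ∨
        (musq = 0 ∧ m = 0 ∧ shiftedEigenvalue a l (a * ω) m Λ ≤ (a * ω) ^ 2) := by
      rcases hmu.eq_or_lt with h0 | h0
      · by_cases hm0 : m = 0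
        · subst hm0
          subst h0
          rcases hΛ.gap with h1 | h1
          · left; linarith
          · right; exact ⟨rfl, rfl, by simpa using h1⟩
        · left
          have ha : a = 0 := by
            rcases mul_eq_zero.1 ham with h1 | h1
            · exact h1
            · exact absurd (by exact_mod_cast h1) hm0
          subst ha
          have := hadm.one_le hm0
          have : 0 ≤ musq * p ^ 2 := by positivity
          linarith
      · left
        have := hcmu h0
        linarith
    rcases hdich with hd | ⟨h1, h2, h3⟩
    · by_cases hsm : |ω| ≤ κ / (q ^ 2 + a ^ 2)
      · refine fin B₁ hB₁.le (by linarith) (H₁ ω m _ hω hm hLabs (fun r hr => ?_) (fun r hr => ?_)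
          Ψ w F P Q h x hx)
        · have e1 : carterK a l ω m r = ω * (r ^ 2 + a ^ 2) := by
            unfold carterK
            rw [show a * Xi a l * m = Xi a l * (a * m) by ring, ham]; ring
          rw [e1, abs_mul, abs_of_nonneg (by positivity : 0 ≤ r ^ 2 + a ^ 2)]
          have h3 : r ^ 2 ≤ q ^ 2 := pow_le_pow_left₀ (hp.le.trans hr.1) hr.2 2
          rw [le_div_iff₀ (by positivity)] at hsm
          refine le_trans ?_ hsm
          gcongr
        · have h3 : p ^ 2 ≤ r ^ 2 + a ^ 2 := by
            have := pow_le_pow_left₀ hp.le hr.1 2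
            have := sq_nonneg a
            linarith
          have := mul_le_mul_of_nonneg_left h3 hmu
          linarith
      · exact fin B₂ hB₂.le (by linarith)
          (H₂ ω m _ hω hm hLabs ham (not_le.1 hsm).le Ψ w F P Q h x hx)
    · subst h2
      subst h1
      have h4 := H₃ ω _ hω hLabs hL0 h3 Ψ w F P Q (by simpa using h) x hx
      have h5 : ω ^ 2 + ((0 : ℤ) : ℝ) ^ 2 + shiftedEigenvalue a l (a * ω) (0 : ℤ) Λ + 0
          ≤ (1 + a ^ 2) * ω ^ 2 := by
        have : (a * ω) ^ 2 = a ^ 2 * ω ^ 2 := by ring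
        push_cast at h3 ⊢
        linarith
      have h6 := mul_le_mul_of_nonneg_right h5 (sq_nonneg ‖Ψ x‖)
      have h7 := mul_le_mul_of_nonneg_left h4 (by positivity : 0 ≤ 1 + a ^ 2)
      have h8 : 0 ≤ a ^ 2 * ‖w x‖ ^ 2 := by positivity
      have h9 : 0 ≤ W * (B₁ + B₂ + B₄) * ∫ r in p..q, ‖F r‖ ^ 2 := by positivity
      linarith
  · have ha : a ≠ 0 := left_ne_zero_of_mul ham
    have hm0 : m ≠ 0 := by
      have := right_ne_zero_of_mul ham
      exact_mod_cast this
    have hm1 : 1 ≤ |(m : ℝ)| := by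
      have := Int.one_le_abs hm0
      exact_mod_cast this
    exact fin B₄ hB₄.le (by linarith) (H₄ ω m _ hω hm hLabs ha hm1 hKK Ψ w F P Q h x hx)

end

section

/-! ### The densities of the estimate in terms of the radial system -/

variable {a M l musq ω Λ p q s : ℝ} {m : ℤ} {u H : ℝ → ℂ}

theorem ind_nonneg (P : Prop) : 0 ≤ ind P := by unfold ind; split_ifs <;> norm_num

theorem ind_le_one (P : Prop) : ind P ≤ 1 := by unfold ind; split_ifs <;> norm_num

theorem ind_abs_pos_le_sq (m : ℤ) : ind (0 < |m|) ≤ (m : ℝ) ^ 2 := by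
  unfold ind
  split_ifs with h
  · have h1 : (1 : ℝ) ≤ |(m : ℝ)| := by exact_mod_cast h
    rw [← sq_abs]
    exact one_le_pow₀ h1
  · positivity

theorem starDeriv_psi (hh : Horizons a M l p q s) {r : ℝ} (hr : r ∈ Ioo p q)
    (hu : HasDerivAt u (deriv u r) r) :
    starDeriv a M l (psi a u) r = ((1 / (r ^ 2 + a ^ 2) : ℝ) : ℂ) * radialMomentum a M l u r := by
  have hΔ : ((Delta a M l r : ℝ) : ℂ) ≠ 0 := by exact_mod_cast (hh.Delta_pos hr).ne'
  unfold starDeriv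
  rw [(hasDerivAt_psi hh hr hu).deriv]
  push_cast
  field_simp

theorem rho_mul_starDeriv {r : ℝ} (hr : 0 < r) :
    (rho a r : ℂ) * starDeriv a M l u r
      = radialMomentum a M l u r + ((Delta a M l r * r / (r ^ 2 + a ^ 2) : ℝ) : ℂ) * psi a u r := by
  have hρ : (rho a r : ℂ) ≠ 0 := by exact_mod_cast (rho_pos (a := a) hr).ne'
  unfold radialMomentum
  rw [psi_eq, ← rho_sq]
  push_cast
  field_simp
  ring

theorem norm_eq_rho_mul {r : ℝ} (hr : 0 < r) : ‖u r‖ = rho a r * ‖psi a u r‖ := by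
  rw [← rho_mul_psi (a := a) hr u, norm_mul, norm_real, norm_eq_abs,
    abs_of_pos (rho_pos hr)]

theorem source_eq (hh : Horizons a M l p q s) {r : ℝ} (hr : r ∈ Ioo p q) :
    H r = ((Delta a M l r / rho a r ^ 3 : ℝ) : ℂ) * radialSource a M l H r := by
  have hΔ : ((Delta a M l r : ℝ) : ℂ) ≠ 0 := by exact_mod_cast (hh.Delta_pos hr).ne'
  have hρ : (rho a r : ℂ) ≠ 0 := by exact_mod_cast (rho_pos (a := a) (hh.p_pos.trans hr.1)).ne'
  unfold radialSource
  push_cast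
  field_simp

theorem norm_source_eq (hh : Horizons a M l p q s) {r : ℝ} (hr : r ∈ Ioo p q) :
    ‖H r‖ = Delta a M l r / rho a r ^ 3 * ‖radialSource a M l H r‖ := by
  have hρ := rho_pos (a := a) (hh.p_pos.trans hr.1)
  have hΔ := hh.Delta_pos hr
  conv_lhs => rw [source_eq (H := H) hh hr]
  rw [norm_mul, norm_real, norm_eq_abs, abs_of_pos (by positivity)]

theorem sourceDensity_eq (hh : Horizons a M l p q s) {r : ℝ} (hr : r ∈ Ioo p q) :
    (r ^ 2 + a ^ 2) / Delta a M l r * sourceDensity a M l ω m u H r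
      = (1 / (r ^ 2 + a ^ 2) * ‖radialMomentum a M l u r
          + ((Delta a M l r * r / (r ^ 2 + a ^ 2) : ℝ) : ℂ) * psi a u r‖
        + (|ω| + |(m : ℝ)|) * ‖psi a u r‖) * ‖radialSource a M l H r‖ := by
  have hr0 := hh.p_pos.trans hr.1
  have hρ := rho_pos (a := a) hr0
  have hΔ := hh.Delta_pos hr
  unfold sourceDensity
  rw [← rho_mul_starDeriv hr0]
  simp only [norm_mul, norm_real, Complex.norm_intCast, norm_eq_abs]
  rw [norm_source_eq (H := H) hh hr, norm_eq_rho_mul (a := a) (u := u) hr0, abs_of_pos hρ, ← rho_sq a r]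
  field_simp
  ring

theorem fluxDensity_eq (hh : Horizons a M l p q s) (hp : rPlus a M l = p)
    (hq : rCosmo a M l = q) {r : ℝ} (hr : r ∈ Ioo p q) :
    (r ^ 2 + a ^ 2) / Delta a M l r * fluxDensity a M l ω m u H r
      = (carterK a l ω m p / (p ^ 2 + a ^ 2) + carterK a l ω m q / (q ^ 2 + a ^ 2))
        * inner ℝ (I * psi a u r) (radialSource a M l H r) := by
  have hr0 := hh.p_pos.trans hr.1
  have hρ := rho_pos (a := a) hr0
  have hΔ := hh.Delta_pos hr
  have hp0 : 0 < p ^ 2 + a ^ 2 := by have := hh.p_pos; positivity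
  have hq0 : 0 < q ^ 2 + a ^ 2 := by have := hh.q_pos; positivity
  have e : ((starRingEnd ℂ) (u r) * H r).im
      = Delta a M l r / (r ^ 2 + a ^ 2)
        * inner ℝ (I * psi a u r) (radialSource a M l H r) := by
    rw [inner_I_mul]
    conv_lhs => rw [source_eq (H := H) hh hr, ← rho_mul_psi (a := a) hr0 u]
    rw [map_mul, Complex.conj_ofReal]
    have e1 : (rho a r : ℂ) * (starRingEnd ℂ) (psi a u r)
        * (((Delta a M l r / rho a r ^ 3 : ℝ) : ℂ) * radialSource a M l H r)
        = ((Delta a M l r / (r ^ 2 + a ^ 2) : ℝ) : ℂ)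
          * ((starRingEnd ℂ) (psi a u r) * radialSource a M l H r) := by
      have hρ' : (rho a r : ℂ) ≠ 0 := by exact_mod_cast hρ.ne'
      rw [← rho_sq a r]
      push_cast
      field_simp
    rw [e1, Complex.im_ofReal_mul]
  unfold fluxDensity omegaPlus omegaCosmo
  rw [e, hp, hq]
  unfold carterK
  have : 0 < r ^ 2 + a ^ 2 := by positivity
  field_simp

theorem bulkDensity_eq (hh : Horizons a M l p q s) {rt r : ℝ} (hr : r ∈ Ioo p q)
    (hu : HasDerivAt u (deriv u r) r) :
    (r ^ 2 + a ^ 2) / Delta a M l r * bulkDensity a M l musq ω m Λ rt u r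
      = ‖radialMomentum a M l u r‖ ^ 2 / (r ^ 2 + a ^ 2)
        + ind (0 < |m|) * (r ^ 2 + a ^ 2) * ‖psi a u r‖ ^ 2
        + ind (0 < |m|) * ‖radialMomentum a M l u r
            + ((Delta a M l r * r / (r ^ 2 + a ^ 2) : ℝ) : ℂ) * psi a u r‖ ^ 2
        + (ω ^ 2 + lamTilde a ω Λ) * ((1 - rt / r) ^ 2 * (r ^ 2 + a ^ 2) ^ 2 * ‖psi a u r‖ ^ 2)
        + (r ^ 2 + a ^ 2) ^ 2 * ((musq + ind (0 < |m|)) / Delta a M l r * ‖psi a u r‖ ^ 2) := by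
  have hr0 := hh.p_pos.trans hr.1
  have hρ := rho_pos (a := a) hr0
  have hΔ := hh.Delta_pos hr
  have hsu : (r ^ 2 + a ^ 2) * ‖starDeriv a M l u r‖ ^ 2
      = ‖radialMomentum a M l u r
          + ((Delta a M l r * r / (r ^ 2 + a ^ 2) : ℝ) : ℂ) * psi a u r‖ ^ 2 := by
    rw [← rho_mul_starDeriv hr0, norm_mul, norm_real, norm_eq_abs,
      abs_of_pos hρ, mul_pow, rho_sq]
  have hu2 : ‖u r‖ ^ 2 = (r ^ 2 + a ^ 2) * ‖psi a u r‖ ^ 2 := by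
    rw [norm_eq_rho_mul (a := a) (u := u) hr0, mul_pow, rho_sq]
  have hsp : ‖starDeriv a M l (psi a u) r‖ ^ 2
      = ‖radialMomentum a M l u r‖ ^ 2 / (r ^ 2 + a ^ 2) ^ 2 := by
    rw [starDeriv_psi hh hr hu, norm_mul, norm_real, norm_eq_abs,
      abs_of_pos (by positivity), mul_pow, div_pow, one_pow, one_div_mul_eq_div]
  unfold bulkDensity
  rw [← hsu, hsp, hu2]
  generalize ‖starDeriv a M l u r‖ ^ 2 = v
  generalize ‖radialMomentum a M l u r‖ ^ 2 = x
  generalize ‖psi a u r‖ ^ 2 = y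
  generalize (1 - rt / r) ^ 2 = z
  generalize ind (0 < |m|) = i
  field_simp

theorem sq_add_lamTilde_le (a l ω Λ : ℝ) (m : ℤ)
    (hL : 0 ≤ shiftedEigenvalue a l (a * ω) m Λ) :
    ω ^ 2 + lamTilde a ω Λ
      ≤ (1 + |a| * Xi a l) * (ω ^ 2 + (m : ℝ) ^ 2 + shiftedEigenvalue a l (a * ω) m Λ) := by
  have hX := one_le_Xi a l
  have hlam : lamTilde a ω Λ
      = shiftedEigenvalue a l (a * ω) m Λ + 2 * (a * ω) * m * Xi a l := by
    unfold lamTilde shiftedEigenvalue; ring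
  rw [hlam]
  generalize shiftedEigenvalue a l (a * ω) m Λ = L at *
  have k1 : a * (2 * (ω * m)) ≤ |a| * (ω ^ 2 + (m : ℝ) ^ 2) := by
    refine (le_abs_self _).trans ?_
    rw [abs_mul]
    refine mul_le_mul_of_nonneg_left (abs_le.2 ⟨?_, ?_⟩) (abs_nonneg _)
    · linarith [sq_nonneg (ω + m)]
    · linarith [sq_nonneg (ω - m)]
  have k2 := mul_le_mul_of_nonneg_right k1 (by linarith : 0 ≤ Xi a l)
  have k3 : 0 ≤ |a| * Xi a l * L := by positivity
  have k4 := sq_nonneg (m : ℝ)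
  linarith

theorem norm_add_ofReal_mul_sq_le {W Ψ : ℂ} {c C i : ℝ} (hc : |c| ≤ C) (hi : i ∈ Icc (0 : ℝ) 1) :
    i * ‖W + (c : ℂ) * Ψ‖ ^ 2 ≤ 2 * ‖W‖ ^ 2 + 2 * C ^ 2 * (i * ‖Ψ‖ ^ 2) := by
  have j1 : ‖W + (c : ℂ) * Ψ‖ ≤ ‖W‖ + C * ‖Ψ‖ := by
    refine (norm_add_le _ _).trans (add_le_add_right ?_ _)
    rw [norm_mul, norm_real, norm_eq_abs]
    exact mul_le_mul_of_nonneg_right hc (norm_nonneg _)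
  have j2 := pow_le_pow_left₀ (norm_nonneg _) j1 2
  have j3 := sq_nonneg (‖W‖ - C * ‖Ψ‖)
  have j5 := mul_le_mul_of_nonneg_left j2 hi.1
  have j6 := mul_nonneg hi.1 j3
  have j7 : i * ‖W‖ ^ 2 ≤ 1 * ‖W‖ ^ 2 := mul_le_mul_of_nonneg_right hi.2 (sq_nonneg _)
  linarith

/-- The weighted integrand of the left-hand side is controlled by `w` and `Ψ`, with the degeneracy
at `rt` and the only singular coefficient at the horizons displayed. -/
theorem Horizons.exists_bulkDensity_le (hh : Horizons a M l p q s) (hmu : 0 ≤ musq) :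
    ∃ C > 0, ∀ (ω Λ rt : ℝ) (m : ℤ) (u : ℝ → ℂ),
      0 ≤ shiftedEigenvalue a l (a * ω) m Λ → ∀ r ∈ Ioo p q, HasDerivAt u (deriv u r) r →
      (r ^ 2 + a ^ 2) / Delta a M l r * bulkDensity a M l musq ω m Λ rt u r
        ≤ C * (‖radialMomentum a M l u r‖ ^ 2 + (ind (0 < |m|)
          + (ω ^ 2 + (m : ℝ) ^ 2 + shiftedEigenvalue a l (a * ω) m Λ) * (1 - rt / r) ^ 2
          + (musq + ind (0 < |m|)) / Delta a M l r) * ‖psi a u r‖ ^ 2) := by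
  have hp := hh.p_pos
  have hq := hh.q_pos
  have hX := one_le_Xi a l
  obtain ⟨D, hD⟩ := isCompact_Icc.exists_bound_of_continuousOn (s := Icc p q)
    (continuous_Delta a M l).continuousOn
  have hD0 : 0 ≤ D := (norm_nonneg _).trans (hD p (left_mem_Icc.2 hh.p_lt.le))
  obtain ⟨Y, hY⟩ : ∃ Y, Y = q ^ 2 + a ^ 2 := ⟨_, rfl⟩
  have hY0 : 0 < Y := by rw [hY]; positivity
  refine ⟨1 / p ^ 2 + 2 + Y + 2 * (D / p) ^ 2 + (1 + |a| * Xi a l) * Y ^ 2 + Y ^ 2,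
    by positivity, ?_⟩
  intro ω Λ rt m u hL r hr hu
  have hr0 := hp.trans hr.1
  have hΔ := hh.Delta_pos hr
  have hpr : p ^ 2 ≤ r ^ 2 := pow_le_pow_left₀ hp.le hr.1.le 2
  have hrq : r ^ 2 + a ^ 2 ≤ Y := by
    have := pow_le_pow_left₀ hr0.le hr.2.le 2
    rw [hY]; linarith
  have hs0 : 0 < r ^ 2 + a ^ 2 := by positivity
  have hcoef : |Delta a M l r * r / (r ^ 2 + a ^ 2)| ≤ D / p := by
    rw [abs_of_pos (by positivity), div_le_div_iff₀ hs0 hp]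
    have k1 : Delta a M l r ≤ D := (le_abs_self _).trans (hD r ⟨hr.1.le, hr.2.le⟩)
    have k2 : r * p ≤ r ^ 2 + a ^ 2 := by nlinarith [hr.1, sq_nonneg a]
    rw [mul_assoc]
    exact mul_le_mul k1 k2 (by positivity) hD0
  rw [bulkDensity_eq hh hr hu]
  have t3 := norm_add_ofReal_mul_sq_le (W := radialMomentum a M l u r) (Ψ := psi a u r) hcoef
    ⟨ind_nonneg (0 < |m|), ind_le_one (0 < |m|)⟩
  have j1 := sq_add_lamTilde_le a l ω Λ m hL
  have hi0 := ind_nonneg (0 < |m|)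
  generalize ind (0 < |m|) = i at *
  generalize i * ‖radialMomentum a M l u r
    + ((Delta a M l r * r / (r ^ 2 + a ^ 2) : ℝ) : ℂ) * psi a u r‖ ^ 2 = T at *
  have y0 := sq_nonneg ‖psi a u r‖
  generalize ‖psi a u r‖ ^ 2 = y at *
  have n0 := sq_nonneg ‖radialMomentum a M l u r‖
  generalize ‖radialMomentum a M l u r‖ ^ 2 = x0 at *
  have hn : 0 ≤ ω ^ 2 + (m : ℝ) ^ 2 + shiftedEigenvalue a l (a * ω) m Λ := by positivity
  generalize ω ^ 2 + (m : ℝ) ^ 2 + shiftedEigenvalue a l (a * ω) m Λ = n at *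
  generalize ω ^ 2 + lamTilde a ω Λ = g at *
  have hz := sq_nonneg (1 - rt / r)
  generalize (1 - rt / r) ^ 2 = z at *
  have t1 : x0 / (r ^ 2 + a ^ 2) ≤ 1 / p ^ 2 * x0 := by
    rw [one_div_mul_eq_div]
    exact div_le_div_of_nonneg_left n0 (by positivity)
      (by have := sq_nonneg a; linarith)
  have t2 : i * (r ^ 2 + a ^ 2) * y ≤ Y * (i * y) := by
    rw [mul_comm i, mul_assoc]
    exact mul_le_mul_of_nonneg_right hrq (by positivity)
  have j2 : (r ^ 2 + a ^ 2) ^ 2 ≤ Y ^ 2 := pow_le_pow_left₀ hs0.le hrq 2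
  have t4 : g * (z * (r ^ 2 + a ^ 2) ^ 2 * y)
      ≤ (1 + |a| * Xi a l) * Y ^ 2 * (n * z * y) := by
    have j3 := mul_le_mul_of_nonneg_right j1
      (by positivity : 0 ≤ z * (r ^ 2 + a ^ 2) ^ 2 * y)
    have j4 := mul_le_mul_of_nonneg_right j2 (by positivity :
      0 ≤ (1 + |a| * Xi a l) * n * (z * y))
    linarith
  have t5 : (r ^ 2 + a ^ 2) ^ 2 * ((musq + i) / Delta a M l r * y)
      ≤ Y ^ 2 * ((musq + i) / Delta a M l r * y) :=
    mul_le_mul_of_nonneg_right j2 (by positivity)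
  have n1 : 0 ≤ i * y := by positivity
  have n2 : 0 ≤ n * z * y := by positivity
  have n3 : 0 ≤ (musq + i) / Delta a M l r * y := by positivity
  rw [show (i + n * z + (musq + i) / Delta a M l r) * y
    = i * y + n * z * y + (musq + i) / Delta a M l r * y by ring]
  generalize i * y = x1 at *
  generalize n * z * y = x2 at *
  generalize (musq + i) / Delta a M l r * y = x3 at *
  have c1 : 0 ≤ 1 / p ^ 2 := by positivity
  have c3 : 0 ≤ 2 * (D / p) ^ 2 := by positivity
  have c4 : 0 ≤ (1 + |a| * Xi a l) * Y ^ 2 := by positivity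
  have c5 : 0 ≤ Y ^ 2 := by positivity
  clear hL hD hcoef
  generalize 1 / p ^ 2 = b1 at *
  generalize 2 * (D / p) ^ 2 = b3 at *
  generalize (1 + |a| * Xi a l) * Y ^ 2 = b4 at *
  generalize Y ^ 2 = b5 at *
  have f0 : 0 ≤ (Y + b3 + b4 + b5) * x0 := by positivity
  have f1 : 0 ≤ (b1 + 2 + b4 + b5) * x1 := by positivity
  have f2 : 0 ≤ (b1 + 2 + Y + b3 + b5) * x2 := by positivity
  have f3 : 0 ≤ (b1 + 2 + Y + b3 + b4) * x3 := by positivity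
  linarith only [f0, f1, f2, f3, t1, t2, t3, t4, t5]

end

section

variable {a M l musq p q s : ℝ}

/-- On a compact part of `(p, q)` the left-hand side is bounded by the nondegenerate energy. -/
theorem Horizons.exists_bulkDensity_le_energy (hh : Horizons a M l p q s) (hmu : 0 ≤ musq)
    {rin rout : ℝ} (hin : p < rin) (hout : rout < q) : ∃ C > 0,
    ∀ (ω Λ rt : ℝ) (m : ℤ) (u : ℝ → ℂ), 0 ≤ shiftedEigenvalue a l (a * ω) m Λ →
      (∀ r ∈ Ioo p q, HasDerivAt u (deriv u r) r) → rt ∈ Icc 0 q → ∀ r ∈ Ioo rin rout,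
      (r ^ 2 + a ^ 2) / Delta a M l r * bulkDensity a M l musq ω m Λ rt u r
        ≤ C * (‖radialMomentum a M l u r‖ ^ 2
          + (ω ^ 2 + (m : ℝ) ^ 2 + shiftedEigenvalue a l (a * ω) m Λ + musq)
            * ‖psi a u r‖ ^ 2) := by
  obtain ⟨C, hC, H⟩ := hh.exists_bulkDensity_le hmu
  obtain ⟨E, hE, hEb⟩ := hh.exists_inv_Delta_bound hin hout
  have hp := hh.p_pos
  have hq := hh.q_pos
  refine ⟨C * (1 + (1 + (q / p) ^ 2) + E), by positivity, ?_⟩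
  intro ω Λ rt m u hL hu hrt r hr
  have hr' : r ∈ Ioo p q := ⟨hin.trans hr.1, hr.2.trans hout⟩
  have hr0 := hp.trans hr'.1
  refine (H ω Λ rt m u hL r hr' (hu r hr')).trans ?_
  rw [mul_assoc]
  refine mul_le_mul_of_nonneg_left ?_ hC.le
  have hi := ind_abs_pos_le_sq m
  have hΔ := hh.Delta_pos hr'
  have hE1 := hEb r ⟨hr.1.le, hr.2.le⟩
  generalize ind (0 < |m|) = i at *
  have hz : (1 - rt / r) ^ 2 ≤ 1 + (q / p) ^ 2 := by
    have h1 : rt / r ≤ q / p := div_le_div₀ hq.le hrt.2 hp hr'.1.le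
    have h2 : 0 ≤ rt / r := div_nonneg hrt.1 hr0.le
    have h3 := pow_le_pow_left₀ h2 h1 2
    linarith
  have n0 := sq_nonneg ‖radialMomentum a M l u r‖
  have n1 := sq_nonneg ‖psi a u r‖
  generalize ‖radialMomentum a M l u r‖ ^ 2 = x at *
  generalize ‖psi a u r‖ ^ 2 = y at *
  generalize shiftedEigenvalue a l (a * ω) m Λ = L at *
  obtain ⟨Z, hZ⟩ : ∃ Z, Z = 1 + (q / p) ^ 2 := ⟨_, rfl⟩
  have hZ0 : 0 ≤ Z := by rw [hZ]; positivity
  rw [← hZ] at hz ⊢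
  obtain ⟨W, hW⟩ : ∃ W, W = ω ^ 2 + (m : ℝ) ^ 2 + L + musq := ⟨_, rfl⟩
  have hW0 : 0 ≤ W := by rw [hW]; positivity
  have k1 : i ≤ W := by rw [hW]; linarith [sq_nonneg ω]
  have k2 : (ω ^ 2 + (m : ℝ) ^ 2 + L) * (1 - rt / r) ^ 2 ≤ W * Z :=
    mul_le_mul (by rw [hW]; linarith) hz (sq_nonneg _) hW0
  have k3 : (musq + i) / Delta a M l r ≤ W * E := by
    rw [div_eq_mul_one_div]
    exact mul_le_mul (by rw [hW]; linarith [sq_nonneg ω]) hE1 (by positivity) hW0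
  rw [← hW]
  have k4 := mul_le_mul_of_nonneg_right (add_le_add (add_le_add k1 k2) k3) n1
  have k5 : 0 ≤ (Z + E) * x := by positivity
  linarith

/-- For a trapped frequency the weight degenerates at the trapping radius. The constant depends only
on the range of that radius, and not on the compact part of `(p, q)`, once the frequency is large:
away from the trapping radius the singular coefficient `1/Δ` is absorbed by the frequency. -/
theorem Horizons.exists_bulkDensity_le_trapped (hh : Horizons a M l p q s) (hmu : 0 ≤ musq)
    {Rm Rp : ℝ} (hRm : p < Rm) (hRp : Rp < q) : ∃ C > 0, ∀ rin rout, p < rin → rout < q →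
    ∃ N₁ > 0, ∀ (ω Λ rt N : ℝ) (m : ℤ) (u : ℝ → ℂ), 0 ≤ shiftedEigenvalue a l (a * ω) m Λ →
      (∀ r ∈ Ioo p q, HasDerivAt u (deriv u r) r) → rt ∈ Ioo Rm Rp → N₁ ≤ N →
      N ^ 2 = ω ^ 2 + (m : ℝ) ^ 2 + shiftedEigenvalue a l (a * ω) m Λ → ∀ r ∈ Ioo rin rout,
      (r ^ 2 + a ^ 2) / Delta a M l r * bulkDensity a M l musq ω m Λ rt u r
        ≤ C * (‖radialMomentum a M l u r‖ ^ 2 + (1 + N ^ 2 * (r - rt) ^ 2)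
            * ‖psi a u r‖ ^ 2) := by
  obtain ⟨C, hC, H⟩ := hh.exists_bulkDensity_le hmu
  have hp := hh.p_pos
  obtain ⟨d, hd0, hd1, hd2⟩ : ∃ d > 0, p < Rm - d ∧ Rp + d < q := by
    refine ⟨min (Rm - p) (q - Rp) / 2, ?_, ?_, ?_⟩
    · have : 0 < min (Rm - p) (q - Rp) := lt_min (by linarith) (by linarith)
      positivity
    · have := min_le_left (Rm - p) (q - Rp); linarith
    · have := min_le_right (Rm - p) (q - Rp); linarith
  obtain ⟨E, hE, hEb⟩ := hh.exists_inv_Delta_bound hd1 hd2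
  refine ⟨C * (1 + (musq + 1) * E + (1 / p ^ 2 + 1)), by positivity, fun rin rout hin hout => ?_⟩
  obtain ⟨D, hD, hDb⟩ := hh.exists_inv_Delta_bound hin hout
  refine ⟨√((musq + 1) * D / d ^ 2) + 1, by positivity, ?_⟩
  intro ω Λ rt N m u hL hu hrt hN hNsq r hr
  have hr' : r ∈ Ioo p q := ⟨hin.trans hr.1, hr.2.trans hout⟩
  have hr0 := hp.trans hr'.1
  refine (H ω Λ rt m u hL r hr' (hu r hr')).trans ?_
  rw [mul_assoc]
  refine mul_le_mul_of_nonneg_left ?_ hC.le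
  have hi1 := ind_le_one (0 < |m|)
  have hΔ := hh.Delta_pos hr'
  rw [← hNsq]
  generalize ind (0 < |m|) = i at *
  have n0 := sq_nonneg ‖radialMomentum a M l u r‖
  have n1 := sq_nonneg ‖psi a u r‖
  generalize ‖radialMomentum a M l u r‖ ^ 2 = x at *
  generalize ‖psi a u r‖ ^ 2 = y at *
  have hN2 : (musq + 1) * D / d ^ 2 ≤ N ^ 2 := by
    have h1 : √((musq + 1) * D / d ^ 2) ≤ N := by linarith
    have h2 := pow_le_pow_left₀ (sqrt_nonneg _) h1 2
    rwa [sq_sqrt (by positivity)] at h2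
  have k2 : (1 - rt / r) ^ 2 ≤ 1 / p ^ 2 * (r - rt) ^ 2 := by
    have e : 1 - rt / r = (r - rt) / r := by field_simp
    rw [e, div_pow, one_div_mul_eq_div]
    exact div_le_div_of_nonneg_left (sq_nonneg _) (by positivity)
      (pow_le_pow_left₀ hp.le hr'.1.le 2)
  have k3 : (musq + i) / Delta a M l r ≤ (musq + 1) * E + N ^ 2 * (r - rt) ^ 2 := by
    have j1 : (musq + i) / Delta a M l r ≤ (musq + 1) * (1 / Delta a M l r) := by
      rw [mul_one_div]
      exact div_le_div_of_nonneg_right (by linarith) hΔ.le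
    refine j1.trans ?_
    by_cases hnear : r ∈ Icc (Rm - d) (Rp + d)
    · have := mul_le_mul_of_nonneg_left (hEb r hnear) (by linarith : 0 ≤ musq + 1)
      have : 0 ≤ N ^ 2 * (r - rt) ^ 2 := by positivity
      linarith
    · have hdist : d ^ 2 ≤ (r - rt) ^ 2 := by
        rw [← sq_abs (r - rt)]
        refine pow_le_pow_left₀ hd0.le ?_ 2
        rw [le_abs]
        by_contra hcon
        push Not at hcon
        exact hnear ⟨by linarith [hrt.1], by linarith [hrt.2]⟩
      have j2 := mul_le_mul_of_nonneg_left (hDb r ⟨hr.1.le, hr.2.le⟩)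
        (by linarith : 0 ≤ musq + 1)
      have j3 : (musq + 1) * D ≤ N ^ 2 * d ^ 2 := by
        rwa [div_le_iff₀ (by positivity)] at hN2
      have j4 := mul_le_mul_of_nonneg_left hdist (sq_nonneg N)
      have : 0 ≤ (musq + 1) * E := by positivity
      linarith
  have k4 := mul_le_mul_of_nonneg_left k2 (sq_nonneg N)
  have k5 := mul_le_mul_of_nonneg_right (add_le_add (add_le_add hi1 k4) k3) n1
  have k6 : 0 ≤ ((musq + 1) * E + (1 / p ^ 2 + 1)) * x := by positivity
  have k7 : 0 ≤ (1 / p ^ 2 + 1) * y := by positivity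
  have k8 : 0 ≤ ((musq + 1) * E) * (N ^ 2 * (r - rt) ^ 2) * y := by positivity
  have k9 : 0 ≤ N ^ 2 * (r - rt) ^ 2 * y := by positivity
  linarith

theorem setIntegral_starMeasure_le (hh : Horizons a M l p q s) (hp : rPlus a M l = p)
    (hq : rCosmo a M l = q) {rin rout : ℝ} (hin : p ≤ rin) (hout : rout ≤ q) {f g : ℝ → ℝ}
    (hfg : ∀ r ∈ Ioo rin rout, (r ^ 2 + a ^ 2) / Delta a M l r * f r ≤ g r)
    (hg : IntervalIntegrable g volume p q) (hg0 : ∀ r, 0 ≤ g r) :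
    ∫ r in Ioo rin rout, f r ∂(starMeasure a M l) ≤ ∫ r in p..q, g r := by
  have hsub : Ioo rin rout ⊆ Ioo p q := Ioo_subset_Ioo hin hout
  have hpq := hh.p_lt
  have hg' := (intervalIntegrable_iff_integrableOn_Ioo_of_le hpq.le).1 hg
  rw [setIntegral_starMeasure hh hp hq f measurableSet_Ioo hsub,
    intervalIntegral.integral_of_le hpq.le, integral_Ioc_eq_integral_Ioo]
  by_cases hi : IntegrableOn (fun r => (r ^ 2 + a ^ 2) / Delta a M l r * f r) (Ioo rin rout)
  · refine (setIntegral_mono_on hi (hg'.mono_set hsub) measurableSet_Ioo hfg).trans ?_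
    exact setIntegral_mono_set hg' (.of_forall hg0) hsub.eventuallyLE
  · rw [integral_undef hi]
    exact setIntegral_nonneg measurableSet_Ioo fun r _ => hg0 r

theorem setIntegral_starMeasure_nonneg (hh : Horizons a M l p q s) (hp : rPlus a M l = p)
    (hq : rCosmo a M l = q) {x y : ℝ} (hx : p ≤ x) (hy : y ≤ q) {f : ℝ → ℝ}
    (hf : ∀ r ∈ Ioo p q, 0 ≤ f r) :
    0 ≤ ∫ r in Ioo x y, f r ∂(starMeasure a M l) := by
  have hsub : Ioo x y ⊆ Ioo p q := Ioo_subset_Ioo hx hy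
  rw [setIntegral_starMeasure hh hp hq f measurableSet_Ioo hsub]
  refine setIntegral_nonneg measurableSet_Ioo fun r hr => ?_
  have := hh.Delta_pos (hsub hr)
  have := hf r (hsub hr)
  positivity

section

variable {ω Λ L P Q : ℝ} {m : ℤ} {u H : ℝ → ℂ}

theorem RadialSolution.integrable_sourceDensity (hh : Horizons a M l p q s)
    (hp : rPlus a M l = p) (hq : rCosmo a M l = q)
    (h : RadialSolution a M l musq ω m L p q (psi a u) (radialMomentum a M l u)
      (radialSource a M l H) P Q) :
    Integrable (sourceDensity a M l ω m u H) (starMeasure a M l) := by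
  rw [integrable_starMeasure_iff hh hp hq]
  rw [integrableOn_congr_fun (fun r hr => sourceDensity_eq hh hr) measurableSet_Ioo,
    ← intervalIntegrable_iff_integrableOn_Ioo_of_le hh.p_lt.le]
  obtain ⟨X, hX⟩ := h.bounded
  have hΨ := RadialSolution.continuousOn_fst h.toRadialEq
  have hw := RadialSolution.continuousOn_snd h.toRadialEq
  obtain ⟨D, hD⟩ := isCompact_Icc.exists_bound_of_continuousOn (s := Icc p q)
    (f := fun r => Delta a M l r * r / (r ^ 2 + a ^ 2))
    (ContinuousOn.div (by fun_prop) (by fun_prop) fun r hr => by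
      have := hh.pos_of_mem hr; positivity)
  have hp0 := hh.p_pos
  have hpos : ∀ r ∈ Ioo p q, 0 < r ^ 2 + a ^ 2 := fun r hr => by
    have := hp0.trans hr.1; positivity
  have c1 : ContinuousOn (fun r => 1 / (r ^ 2 + a ^ 2)) (Ioo p q) :=
    ContinuousOn.div (by fun_prop) (by fun_prop) fun r hr => (hpos r hr).ne'
  have c2 : ContinuousOn (fun r => ((Delta a M l r * r / (r ^ 2 + a ^ 2) : ℝ) : ℂ)) (Ioo p q) :=
    Complex.continuous_ofReal.comp_continuousOn
      (ContinuousOn.div (by fun_prop) (by fun_prop) fun r hr => (hpos r hr).ne')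
  refine RadialSolution.integrable_of_le h.toRadialEq hh.p_lt.le
    (((c1.mul (hw.add (c2.mul hΨ)).norm).add (continuousOn_const.mul hΨ.norm)).mul h.cont_F.norm)
    (C := 1 / p ^ 2 * (X + D * X) + (|ω| + |(m : ℝ)|) * X) fun r hr => ?_
  obtain ⟨h1, h2⟩ := hX r hr
  have hX0 : 0 ≤ X := (norm_nonneg _).trans h1
  have h3 := hD r ⟨hr.1.le, hr.2.le⟩
  have hD0 : 0 ≤ D := (norm_nonneg _).trans h3
  have h4 : ‖radialMomentum a M l u r
      + ((Delta a M l r * r / (r ^ 2 + a ^ 2) : ℝ) : ℂ) * psi a u r‖ ≤ X + D * X := by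
    refine (norm_add_le _ _).trans (add_le_add h2 ?_)
    rw [norm_mul, norm_real]
    exact mul_le_mul h3 h1 (norm_nonneg _) hD0
  have h5 : 1 / (r ^ 2 + a ^ 2) ≤ 1 / p ^ 2 :=
    one_div_le_one_div_of_le (by positivity) (by
      have := pow_le_pow_left₀ hp0.le hr.1.le 2
      have := sq_nonneg a
      linarith)
  have h6 := hpos r hr
  rw [abs_of_nonneg (by positivity)]
  have h7 : ‖radialSource a M l H r‖ ≤ 1 + ‖radialSource a M l H r‖ ^ 2 := by
    nlinarith [sq_nonneg (‖radialSource a M l H r‖ - 1), norm_nonneg (radialSource a M l H r)]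
  refine mul_le_mul (add_le_add (mul_le_mul h5 h4 (norm_nonneg _) (by positivity))
    (mul_le_mul_of_nonneg_left h1 (by positivity))) h7 (norm_nonneg _) (by positivity)

theorem RadialSolution.integrable_fluxDensity (hh : Horizons a M l p q s)
    (hp : rPlus a M l = p) (hq : rCosmo a M l = q)
    (h : RadialSolution a M l musq ω m L p q (psi a u) (radialMomentum a M l u)
      (radialSource a M l H) P Q) :
    Integrable (fluxDensity a M l ω m u H) (starMeasure a M l) := by
  rw [integrable_starMeasure_iff hh hp hq,
    integrableOn_congr_fun (fun r hr => fluxDensity_eq hh hp hq hr) measurableSet_Ioo,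
    ← intervalIntegrable_iff_integrableOn_Ioo_of_le hh.p_lt.le]
  exact h.integrable_source_flux hh.p_lt.le continuousOn_const

theorem RadialSolution.integral_fluxDensity (hh : Horizons a M l p q s)
    (hp : rPlus a M l = p) (hq : rCosmo a M l = q)
    (h : RadialSolution a M l musq ω m L p q (psi a u) (radialMomentum a M l u)
      (radialSource a M l H) P Q) :
    ∫ r, fluxDensity a M l ω m u H r ∂(starMeasure a M l)
      = (carterK a l ω m p / (p ^ 2 + a ^ 2) + carterK a l ω m q / (q ^ 2 + a ^ 2))
        * (carterK a l ω m q * Q + carterK a l ω m p * P) := by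
  rw [integral_starMeasure hh hp hq,
    setIntegral_congr_fun measurableSet_Ioo (fun r hr => fluxDensity_eq hh hp hq hr),
    ← integral_Ioc_eq_integral_Ioo, ← intervalIntegral.integral_of_le hh.p_lt.le,
    intervalIntegral.integral_const_mul, h.flux_identity hh.p_lt]

theorem RadialSolution.tendsto_norm_sq (hh : Horizons a M l p q s)
    (h : RadialSolution a M l musq ω m L p q (psi a u) (radialMomentum a M l u)
      (radialSource a M l H) P Q) :
    Tendsto (fun r => ‖u r‖ ^ 2) (𝓝[>] p) (𝓝 ((p ^ 2 + a ^ 2) * P)) := by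
  have h1 : Tendsto (fun r : ℝ => r ^ 2 + a ^ 2) (𝓝[>] p) (𝓝 (p ^ 2 + a ^ 2)) :=
    ((by fun_prop : Continuous fun r : ℝ => r ^ 2 + a ^ 2).tendsto p).mono_left nhdsWithin_le_nhds
  refine (h1.mul h.lim_left).congr' ?_
  filter_upwards [self_mem_nhdsWithin] with r hr
  rw [norm_eq_rho_mul (a := a) (u := u) (hh.p_pos.trans hr), mul_pow, rho_sq]

/-- The first-order source is square integrable in `r` with the norm of the right-hand side of the
estimate. -/
theorem integral_source_le (hh : Horizons a M l p q s) (hp : rPlus a M l = p)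
    (hq : rCosmo a M l = q)
    (hH : Integrable (fun r => ‖H r‖ ^ 2 / Delta a M l r) (starMeasure a M l)) :
    ∫ r in p..q, ‖radialSource a M l H r‖ ^ 2
      ≤ (q ^ 2 + a ^ 2) ^ 2 * ∫ r, ‖H r‖ ^ 2 / Delta a M l r ∂(starMeasure a M l) := by
  have hpq := hh.p_lt
  rw [integrable_starMeasure_iff hh hp hq] at hH
  rw [integral_starMeasure hh hp hq, intervalIntegral.integral_of_le hpq.le,
    integral_Ioc_eq_integral_Ioo, ← integral_const_mul]
  refine integral_mono_of_nonneg (.of_forall fun r => sq_nonneg _)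
    (hH.const_mul _) ?_
  refine (ae_restrict_iff' measurableSet_Ioo).2 (.of_forall fun r hr => ?_)
  have hr0 := hh.p_pos.trans hr.1
  have hρ := rho_pos (a := a) hr0
  have hΔ := hh.Delta_pos hr
  have hs : 0 < r ^ 2 + a ^ 2 := by positivity
  have hrq : r ^ 2 + a ^ 2 ≤ q ^ 2 + a ^ 2 := by
    have := pow_le_pow_left₀ hr0.le hr.2.le 2
    linarith
  have e : ‖radialSource a M l H r‖ ^ 2
      = (r ^ 2 + a ^ 2) ^ 2 * ((r ^ 2 + a ^ 2) / Delta a M l r * (‖H r‖ ^ 2 / Delta a M l r)) := by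
    unfold radialSource
    rw [norm_mul, norm_real, norm_eq_abs, abs_of_pos (by positivity), ← rho_sq a r]
    field_simp
  simp only
  rw [e]
  exact mul_le_mul_of_nonneg_right (pow_le_pow_left₀ hs.le hrq 2) (by positivity)

/-- The total flux is controlled by the energy and the source. -/
theorem RadialSolution.abs_flux_mul_le {m : ℝ} {Ψ w F : ℝ → ℂ} (hpq : p < q)
    (h : RadialSolution a M l musq ω m L p q Ψ w F P Q) (α : ℝ) :
    |α * (carterK a l ω m q * Q + carterK a l ω m p * P)|
      ≤ ∫ r in p..q, (0 * ‖w r‖ ^ 2 + α ^ 2 * ‖Ψ r‖ ^ 2 + ‖F r‖ ^ 2) := by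
  rw [← h.flux_identity hpq, ← intervalIntegral.integral_const_mul]
  have hi := h.integrable_source_flux hpq.le (χ := fun _ => α) continuousOn_const
  have hg := (h.integrable_sq hpq.le (φ := fun _ => 0) (ψ := fun _ => α ^ 2)
    continuousOn_const continuousOn_const).add (h.sourceIntervalIntegrable hpq.le)
  have hpt : ∀ r, |α * inner ℝ (I * Ψ r) (F r)|
      ≤ 0 * ‖w r‖ ^ 2 + α ^ 2 * ‖Ψ r‖ ^ 2 + ‖F r‖ ^ 2 := by
    intro r
    rw [abs_mul]
    have h1 := abs_real_inner_le_norm (I * Ψ r) (F r)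
    rw [norm_mul, norm_I, one_mul] at h1
    have h2 := mul_le_mul_of_nonneg_left h1 (abs_nonneg α)
    have h3 := sq_nonneg (|α| * ‖Ψ r‖ - ‖F r‖)
    have h4 : 0 ≤ |α| * (‖Ψ r‖ * ‖F r‖) := by positivity
    rw [← sq_abs α]
    linarith
  rw [abs_le]
  constructor
  · rw [← intervalIntegral.integral_neg]
    exact intervalIntegral.integral_mono_on hpq.le hg.neg hi fun r _ => (abs_le.1 (hpt r)).1
  · exact intervalIntegral.integral_mono_on hpq.le hi hg fun r _ => (abs_le.1 (hpt r)).2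

end

end

section

/-! ### The radial estimate in all frequency ranges -/

variable {a M l musq p q s : ℝ}

theorem exists_carterK_eq_zero {ω m : ℝ} (hpq : p ≤ q)
    (h : carterK a l ω m p * carterK a l ω m q < 0) : ∃ t ∈ Icc p q, carterK a l ω m t = 0 := by
  have h1 := intermediate_value_uIcc (a := p) (b := q)
    (continuous_carterK a l ω m).continuousOn
  have h0 : (0 : ℝ) ∈ uIcc (carterK a l ω m p) (carterK a l ω m q) := by
    rw [mem_uIcc]
    rcases mul_neg_iff.1 h with h2 | h2
    · exact .inr ⟨h2.2.le, h2.1.le⟩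
    · exact .inl ⟨h2.1.le, h2.2.le⟩
  obtain ⟨t, ht, h2⟩ := h1 h0
  exact ⟨t, by rwa [uIcc_of_le hpq] at ht, h2⟩

theorem mul_ne_zero_of_carterK_mul_neg {ω m : ℝ}
    (h : carterK a l ω m p * carterK a l ω m q < 0) : a * m ≠ 0 := by
  intro ham
  have e1 : ∀ r, carterK a l ω m r = ω * (r ^ 2 + a ^ 2) := fun r => by
    unfold carterK
    rw [show a * Xi a l * m = Xi a l * (a * m) by ring, ham]; ring
  rw [e1, e1] at h
  have : 0 ≤ ω ^ 2 * ((p ^ 2 + a ^ 2) * (q ^ 2 + a ^ 2)) := by positivity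
  linarith

theorem Horizons.isSuperradiant_of_neg (hh : Horizons a M l p q s) (hp : rPlus a M l = p)
    (hq : rCosmo a M l = q) {ω : ℝ} {m : ℤ}
    (h : carterK a l ω m p * carterK a l ω m q < 0) : IsSuperradiant a M l ω m := by
  have ham := mul_ne_zero_of_carterK_mul_neg h
  have hp0 := hh.p_pos
  have hpq := hh.p_lt
  have hX := one_le_Xi a l
  unfold IsSuperradiant
  rw [hp, hq]
  obtain ⟨b, hb⟩ : ∃ b, b = a ^ 2 * (m : ℝ) ^ 2 * Xi a l := ⟨_, rfl⟩
  have hb0 : 0 ≤ b := by rw [hb]; positivity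
  obtain ⟨x, hx⟩ : ∃ x, x = a * m * ω := ⟨_, rfl⟩
  have hρ : p ^ 2 + a ^ 2 < q ^ 2 + a ^ 2 := by
    have := pow_lt_pow_left₀ hpq hp0.le two_ne_zero
    linarith
  have hneg : (x * (p ^ 2 + a ^ 2) - b) * (x * (q ^ 2 + a ^ 2) - b) < 0 := by
    have e : (x * (p ^ 2 + a ^ 2) - b) * (x * (q ^ 2 + a ^ 2) - b)
        = (a * m) ^ 2 * (carterK a l ω m p * carterK a l ω m q) := by
      rw [hx, hb]; unfold carterK; ring
    rw [e]
    exact mul_neg_of_pos_of_neg (by positivity) h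
  rw [← hb, ← hx]
  have hp1 : 0 < p ^ 2 + a ^ 2 := by positivity
  generalize p ^ 2 + a ^ 2 = P at *
  generalize q ^ 2 + a ^ 2 = Q at *
  rcases mul_neg_iff.1 hneg with ⟨h1, h2⟩ | ⟨h1, h2⟩
  · exfalso
    have h3 : 0 < x := pos_of_mul_pos_left (by linarith : 0 < x * P) hp1.le
    have := mul_lt_mul_of_pos_left hρ h3
    linarith
  · exact ⟨by rw [div_lt_iff₀ (hp1.trans hρ)]; linarith, by rw [lt_div_iff₀ hp1]; linarith⟩

/-- Bounded superradiant frequencies that stay away from both thresholds lie in the frequency set on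
which the horizon term is admitted. -/
theorem Horizons.exists_inBoundedSuperradiant (hh : Horizons a M l p q s) (hp : rPlus a M l = p)
    (hq : rCosmo a M l = q) (ha : a ≠ 0) (N : ℝ) {η : ℝ} (hη : 0 < η) :
    ∃ C₀ > 0, ∀ (C ω Λ : ℝ) (m : ℤ), C₀ ≤ C → 0 ≤ shiftedEigenvalue a l (a * ω) m Λ →
      ω ^ 2 + (m : ℝ) ^ 2 + shiftedEigenvalue a l (a * ω) m Λ ≤ N ^ 2 →
      carterK a l ω m p * carterK a l ω m q < 0 → η < |carterK a l ω m p| →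
      η < |carterK a l ω m q| → InBoundedSuperradiant a M l C ω m Λ := by
  have hp0 := hh.p_pos
  have hq0 := hh.q_pos
  have hpq := hh.p_lt
  have hX := one_le_Xi a l
  have ha' : 0 < |a| := abs_pos.2 ha
  refine ⟨|N| + (q ^ 2 + a ^ 2) / |a| + (1 + |a| * Xi a l) * N ^ 2 + (q ^ 2 + a ^ 2) / η,
    by positivity, ?_⟩
  intro C ω Λ m hC hL hN hneg hηp hηq
  have n1 : 0 ≤ |N| := abs_nonneg N
  have n2 : 0 < (q ^ 2 + a ^ 2) / |a| := by positivity
  have n3 : 0 ≤ (1 + |a| * Xi a l) * N ^ 2 := by positivity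
  have n4 : 0 < (q ^ 2 + a ^ 2) / η := by positivity
  have hC0 : 0 < C := by linarith
  have hthr : ∀ x k : ℝ, x ∈ Icc p q → η < |k| → 1 / C < |k / (x ^ 2 + a ^ 2)| := by
    intro x k hx hk
    have hx0 : 0 < x := hp0.trans_le hx.1
    have hxq : x ^ 2 ≤ q ^ 2 := pow_le_pow_left₀ hx0.le hx.2 2
    have h1 : (q ^ 2 + a ^ 2) / η ≤ C := by linarith
    rw [div_le_iff₀ hη] at h1
    rw [abs_div, abs_of_pos (by positivity : 0 < x ^ 2 + a ^ 2), div_lt_div_iff₀ hC0 (by positivity)]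
    have h2 := mul_lt_mul_of_pos_left hk hC0
    linarith
  refine ⟨⟨?_, ?_⟩, ?_, hh.isSuperradiant_of_neg hp hq hneg, ?_, ?_⟩
  · -- `K` vanishes at an intermediate radius, which bounds `ω` below
    obtain ⟨t, ht, hKt⟩ := exists_carterK_eq_zero hpq.le hneg
    have hm0 : m ≠ 0 := by
      have := right_ne_zero_of_mul (mul_ne_zero_of_carterK_mul_neg hneg)
      exact_mod_cast this
    have hm1 : 1 ≤ |(m : ℝ)| := by
      have := Int.one_le_abs hm0
      exact_mod_cast this
    have h1 : ω * (t ^ 2 + a ^ 2) = a * Xi a l * m := by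
      unfold carterK at hKt; linarith
    have h2 : |ω| * (t ^ 2 + a ^ 2) = |a| * (Xi a l * |(m : ℝ)|) := by
      rw [← abs_of_nonneg (by positivity : 0 ≤ t ^ 2 + a ^ 2), ← abs_mul, h1, abs_mul, abs_mul,
        abs_of_nonneg (by linarith : 0 ≤ Xi a l), mul_assoc]
    have h3 : |a| * 1 ≤ |a| * (Xi a l * |(m : ℝ)|) :=
      mul_le_mul_of_nonneg_left (one_le_mul_of_one_le_of_one_le hX hm1) ha'.le
    have h4 : |ω| * (t ^ 2 + a ^ 2) ≤ |ω| * (q ^ 2 + a ^ 2) := by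
      have := pow_le_pow_left₀ (hp0.le.trans ht.1) ht.2 2
      gcongr
    have h5 : (q ^ 2 + a ^ 2) / |a| ≤ C := by linarith
    rw [div_le_iff₀ ha'] at h5
    rw [inv_le_iff_one_le_mul₀ hC0]
    have h6 : 1 * |a| ≤ C * |ω| * |a| := by
      have := mul_le_mul_of_nonneg_left h5 (abs_nonneg ω)
      linarith
    have := le_of_mul_le_mul_right h6 ha'
    linarith
  · have h1 : |ω| ≤ |N| := sq_le_sq.1 (by linarith [sq_nonneg (m : ℝ)])
    linarith
  · have h1 := sq_add_lamTilde_le a l ω Λ m hL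
    have h2 : (1 + |a| * Xi a l) * (ω ^ 2 + (m : ℝ) ^ 2 + shiftedEigenvalue a l (a * ω) m Λ)
        ≤ (1 + |a| * Xi a l) * N ^ 2 := mul_le_mul_of_nonneg_left hN (by positivity)
    linarith [sq_nonneg ω]
  · have e : ω - omegaPlus a M l * m = carterK a l ω m p / (p ^ 2 + a ^ 2) := by
      unfold omegaPlus carterK; rw [hp]; field_simp
    rw [e]
    exact hthr p _ ⟨le_rfl, hpq.le⟩ hηp
  · have e : ω - omegaCosmo a M l * m = carterK a l ω m q / (q ^ 2 + a ^ 2) := by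
      unfold omegaCosmo carterK; rw [hq]; field_simp
    rw [e]
    exact hthr q _ ⟨hpq.le, le_rfl⟩ hηq

theorem RadialSolution.integral_energy_le {ω m L P Q W Z : ℝ} {Ψ w F : ℝ → ℂ} (hpq : p ≤ q)
    (h : RadialSolution a M l musq ω m L p q Ψ w F P Q)
    (hZ : ∀ x ∈ Ioo p q, ‖w x‖ ^ 2 + W * ‖Ψ x‖ ^ 2 ≤ Z) :
    ∫ r in p..q, (‖w r‖ ^ 2 + W * ‖Ψ r‖ ^ 2) ≤ (q - p) * Z := by
  have hi : IntervalIntegrable (fun r => ‖w r‖ ^ 2 + W * ‖Ψ r‖ ^ 2) volume p q := by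
    simpa using h.integrable_sq hpq (φ := fun _ => 1) (ψ := fun _ => W) continuousOn_const
      continuousOn_const
  have := intervalIntegral.integral_mono_on_of_le_Ioo hpq hi
    (intervalIntegrable_const (c := Z)) hZ
  rwa [intervalIntegral.integral_const, smul_eq_mul] at this

/-- Superradiant frequencies in a bounded range: the solution is controlled by the source and the
horizon term. -/
theorem Horizons.exists_superradiant_bound (hh : Horizons a M l p q s) (hp : rPlus a M l = p)
    (hq : rCosmo a M l = q) (hmu : 0 ≤ musq) (N : ℝ) :
    ∃ C₀ > 0, ∃ B > 0, ∀ (C ω Λ : ℝ) (m : ℤ), C₀ ≤ C → 0 ≤ shiftedEigenvalue a l (a * ω) m Λ →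
      ω ^ 2 + (m : ℝ) ^ 2 + shiftedEigenvalue a l (a * ω) m Λ ≤ N ^ 2 →
      carterK a l ω m p * carterK a l ω m q < 0 → ∀ (Ψ w F : ℝ → ℂ) (P Q : ℝ),
      RadialSolution a M l musq ω m (shiftedEigenvalue a l (a * ω) m Λ) p q Ψ w F P Q →
      ∀ x ∈ Ioo p q, ‖Ψ x‖ ^ 2 + ‖w x‖ ^ 2 ≤ B * ((∫ r in p..q, ‖F r‖ ^ 2)
        + ind (InBoundedSuperradiant a M l C ω m Λ)
          * (|carterK a l ω m p| * |carterK a l ω m q| * P)) := by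
  by_cases ha : a = 0
  · refine ⟨1, one_pos, 1, one_pos, fun C ω Λ m _ _ _ hneg => ?_⟩
    exact absurd (by rw [ha, zero_mul]) (mul_ne_zero_of_carterK_mul_neg hneg)
  have hpq := hh.p_lt
  obtain ⟨N', hN'⟩ : ∃ N', N' = |N| + N ^ 2 := ⟨_, rfl⟩
  obtain ⟨η, hη, B₁, hB₁, H₁⟩ := hh.exists_rotating_bound hmu ha N'
  obtain ⟨K, hK, _, _, _, H₂⟩ := hh.exists_sup_bound hmu N'
  obtain ⟨C₀, hC₀, H₃⟩ := hh.exists_inBoundedSuperradiant hp hq ha N hη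
  refine ⟨C₀, hC₀, B₁ + K * (1 + 1 / η ^ 2), by positivity, ?_⟩
  intro C ω Λ m hC hL hN hneg Ψ w F P Q h x hx
  have hA := h.integral_source_nonneg hpq.le
  have hP := h.P_nonneg
  have hω : |ω| ≤ N' := by
    have h1 : |ω| ≤ |N| := sq_le_sq.1 (by linarith [sq_nonneg (m : ℝ)])
    rw [hN']; linarith [sq_nonneg N]
  have hm : |(m : ℝ)| ≤ N' := by
    have h1 : |(m : ℝ)| ≤ |N| := sq_le_sq.1 (by linarith [sq_nonneg ω])
    rw [hN']; linarith [sq_nonneg N]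
  have hLN : |shiftedEigenvalue a l (a * ω) m Λ| ≤ N' := by
    rw [abs_of_nonneg hL, hN']
    linarith [sq_nonneg ω, sq_nonneg (m : ℝ), abs_nonneg N]
  have hm1 : 1 ≤ |(m : ℝ)| := by
    have hm0 : m ≠ 0 := by
      have := right_ne_zero_of_mul (mul_ne_zero_of_carterK_mul_neg hneg)
      exact_mod_cast this
    have := Int.one_le_abs hm0
    exact_mod_cast this
  have hi := ind_nonneg (InBoundedSuperradiant a M l C ω m Λ)
  by_cases hcase : |carterK a l ω m p| ≤ η ∨ |carterK a l ω m q| ≤ η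
  · refine (H₁ ω m _ hω hm hLN hm1 (.inr hcase) Ψ w F P Q h x hx).trans ?_
    have n1 : 0 ≤ K * (1 + 1 / η ^ 2) * ∫ r in p..q, ‖F r‖ ^ 2 := by positivity
    have n2 : 0 ≤ (B₁ + K * (1 + 1 / η ^ 2)) * (ind (InBoundedSuperradiant a M l C ω m Λ)
          * (|carterK a l ω m p| * |carterK a l ω m q| * P)) := by positivity
    linarith
  · push Not at hcase
    have hin := H₃ C ω Λ m hC hL hN hneg hcase.1 hcase.2
    have e : ind (InBoundedSuperradiant a M l C ω m Λ) = 1 := if_pos hin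
    rw [e, one_mul]
    refine ((H₂ ω m _ hω hm hLN Ψ w F P Q h).1 x hx).2.1.trans ?_
    have h1 : η * η ≤ |carterK a l ω m p| * |carterK a l ω m q| :=
      mul_le_mul hcase.1.le hcase.2.le hη.le (abs_nonneg _)
    have h2 : P ≤ 1 / η ^ 2 * (|carterK a l ω m p| * |carterK a l ω m q| * P) := by
      have h3 := mul_le_mul_of_nonneg_right h1 hP
      rw [one_div_mul_eq_div, le_div_iff₀ (by positivity)]
      linarith
    have n0 : 0 ≤ |carterK a l ω m p| * |carterK a l ω m q| * P := by positivity
    generalize |carterK a l ω m p| * |carterK a l ω m q| * P = X at *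
    generalize ∫ r in p..q, ‖F r‖ ^ 2 = A at *
    have h4 := mul_le_mul_of_nonneg_left h2 hK.le
    have n1 : 0 ≤ B₁ * (A + X) := by positivity
    have n2 : 0 ≤ K * (1 / η ^ 2) * A := by positivity
    have n3 : 0 ≤ K * X := by positivity
    linarith

theorem mul_add_mul_nonneg_flux {k₁ k₂ P Q x y : ℝ} (hk : 0 ≤ k₁ * k₂) (hP : 0 ≤ P) (hQ : 0 ≤ Q)
    (hx : 0 < x) (hxy : x ≤ y) :
    k₂ ^ 2 * Q + k₁ ^ 2 * P ≤ y * ((k₁ / x + k₂ / y) * (k₂ * Q + k₁ * P)) := by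
  have hy : 0 < y := hx.trans_le hxy
  have e : y * ((k₁ / x + k₂ / y) * (k₂ * Q + k₁ * P))
      = y / x * (k₁ * k₂ * Q + k₁ ^ 2 * P) + (k₂ ^ 2 * Q + k₁ * k₂ * P) := by
    field_simp
  rw [e]
  have h1 : 1 ≤ y / x := (one_le_div hx).2 hxy
  have h2 : 0 ≤ k₁ * k₂ * Q := by positivity
  have h3 : 0 ≤ k₁ * k₂ * P := by positivity
  have h4 : 0 ≤ k₁ ^ 2 * P := by positivity
  have h5 := mul_le_mul_of_nonneg_right h1 (add_nonneg h2 h4)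
  linarith

/-- Every frequency is either trapped and large, with an estimate that degenerates at the trapping
radius and whose boundary terms are controlled by the flux, or admits a nondegenerate estimate. The
threshold `N₁` between the two regimes is at our disposal. -/
theorem Horizons.exists_radial_estimate (hh : Horizons a M l p q s) (hp : rPlus a M l = p)
    (hq : rCosmo a M l = q) (hmu : 0 ≤ musq) :
    ∃ Rm Rp c C C₀ : ℝ, p < Rm ∧ Rm < Rp ∧ Rp < q ∧ 0 < C ∧ 0 < C₀ ∧ ∀ N₁, 0 < N₁ → ∃ B > 0,
      ∀ (ω Λ : ℝ) (m : ℤ), IsAngularEigenvalue a l musq (a * ω) m Λ →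
      ∀ (Ψ w F : ℝ → ℂ) (P Q : ℝ),
      RadialSolution a M l musq ω m (shiftedEigenvalue a l (a * ω) m Λ) p q Ψ w F P Q →
      (∃ N, N₁ ≤ N ∧ N ^ 2 = ω ^ 2 + (m : ℝ) ^ 2 + shiftedEigenvalue a l (a * ω) m Λ ∧
        (∃ rc ∈ Ioo Rm Rp, IsTrappingRadius a M l p q c ω m rc) ∧
        ∀ rc ∈ Ioo Rm Rp, IsTrappingRadius a M l p q c ω m rc →
          ∫ r in p..q, (‖w r‖ ^ 2 + (1 + N ^ 2 * (r - rc) ^ 2) * ‖Ψ r‖ ^ 2)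
            ≤ C * ((carterK a l ω m p / (p ^ 2 + a ^ 2) + carterK a l ω m q / (q ^ 2 + a ^ 2))
                * (carterK a l ω m q * Q + carterK a l ω m p * P)
              + ∫ r in p..q, ‖F r‖ ^ 2)) ∨
      ∀ C', C₀ ≤ C' → ∫ r in p..q, (‖w r‖ ^ 2
          + (ω ^ 2 + (m : ℝ) ^ 2 + shiftedEigenvalue a l (a * ω) m Λ + musq) * ‖Ψ r‖ ^ 2)
        ≤ B * ((∫ r in p..q, ‖F r‖ ^ 2) + ind (InBoundedSuperradiant a M l C' ω m Λ)
          * (|carterK a l ω m p| * |carterK a l ω m q| * P)) := by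
  obtain ⟨Rm, Rp, c, η, N₀, C, hRm, hR, hRp, hc, hη, hN₀, hC, H⟩ :=
    hh.exists_high_frequency_estimate musq
  obtain ⟨C₀, hC₀, B₀, hB₀, H₀⟩ := hh.exists_superradiant_bound hp hq hmu N₀
  have hpq := hh.p_lt
  have hp0 := hh.p_pos
  have hq0 := hh.q_pos
  have hY0 : 0 < q ^ 2 + a ^ 2 := by positivity
  refine ⟨Rm, Rp, c, C * (q ^ 2 + a ^ 2) + C, C₀, hRm, hR, hRp, by positivity, hC₀,
    fun N₁ hN₁ => ?_⟩
  obtain ⟨B₁, hB₁, H₁⟩ := hh.exists_low_frequency_estimate hmu (N₁ + N₀ + (N₁ + N₀) ^ 2)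
  refine ⟨C * (1 + musq / N₀ ^ 2) + (q - p) * B₁ + (q - p) * ((1 + N₀ ^ 2 + musq) * B₀),
    by positivity, ?_⟩
  intro ω Λ m hΛ Ψ w F P Q h
  have hadm := hΛ.isAdmissible hmu
  have hL := hadm.1
  have hA := h.integral_source_nonneg hpq.le
  have hP := h.P_nonneg
  have hQ := h.Q_nonneg
  obtain ⟨L, hLe⟩ : ∃ L, L = shiftedEigenvalue a l (a * ω) m Λ := ⟨_, rfl⟩
  rw [← hLe] at h hadm hL ⊢
  have hsum : 0 ≤ ω ^ 2 + (m : ℝ) ^ 2 + L := by positivity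
  obtain ⟨N, hN⟩ : ∃ N, N = √(ω ^ 2 + (m : ℝ) ^ 2 + L) := ⟨_, rfl⟩
  have hNn : 0 ≤ N := by rw [hN]; positivity
  have hN2 : N ^ 2 = ω ^ 2 + (m : ℝ) ^ 2 + L := by rw [hN, sq_sqrt hsum]
  have hfin : ∀ B, B ≤ C * (1 + musq / N₀ ^ 2) + (q - p) * B₁
      + (q - p) * ((1 + N₀ ^ 2 + musq) * B₀) → ∀ X T : ℝ, 0 ≤ X →
      T ≤ B * X → T ≤ (C * (1 + musq / N₀ ^ 2) + (q - p) * B₁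
      + (q - p) * ((1 + N₀ ^ 2 + musq) * B₀)) * X := fun B hB X T hX hT =>
    hT.trans (mul_le_mul_of_nonneg_right hB hX)
  have nB1 : 0 ≤ C * (1 + musq / N₀ ^ 2) := by positivity
  have nB2 : 0 ≤ (q - p) * B₁ := by positivity
  have nB3 : 0 ≤ (q - p) * ((1 + N₀ ^ 2 + musq) * B₀) := by positivity
  have hX : ∀ C', 0 ≤ ind (InBoundedSuperradiant a M l C' ω m Λ)
      * (|carterK a l ω m p| * |carterK a l ω m q| * P) := fun C' => by
    have := ind_nonneg (InBoundedSuperradiant a M l C' ω m Λ)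
    positivity
  have hno : ∀ t ∈ Icc p q, carterK a l ω m t = 0 → 0 < N → |carterK a l ω m t| < η * N :=
    fun t _ h0 hNp => by rw [h0, abs_zero]; positivity
  -- a barrier
  by_cases hbar : N₀ ≤ N ∧ ∃ t ∈ Icc p q, |carterK a l ω m t| < η * N
  · right
    intro C' _
    refine hfin (C * (1 + musq / N₀ ^ 2)) (by linarith) _ _ (add_nonneg hA (hX C')) ?_
    have h1 := (H ω m L N hadm hbar.1 hN2).1 hbar.2 Ψ w F P Q h
    have hW : ω ^ 2 + (m : ℝ) ^ 2 + L + musq ≤ (1 + musq / N₀ ^ 2) * N ^ 2 := by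
      have i1 : N₀ ^ 2 ≤ N ^ 2 := pow_le_pow_left₀ hN₀.le hbar.1 2
      have i2 := mul_le_mul_of_nonneg_left i1 (by positivity : 0 ≤ musq / N₀ ^ 2)
      rw [div_mul_cancel₀ _ (by positivity)] at i2
      linarith
    have h2 : ∫ r in p..q, (‖w r‖ ^ 2 + (ω ^ 2 + (m : ℝ) ^ 2 + L + musq) * ‖Ψ r‖ ^ 2)
        ≤ ∫ r in p..q, (1 + musq / N₀ ^ 2) * (‖w r‖ ^ 2 + N ^ 2 * ‖Ψ r‖ ^ 2) := by
      have j1 : ∀ W : ℝ, IntervalIntegrable (fun r => ‖w r‖ ^ 2 + W * ‖Ψ r‖ ^ 2) volume p q :=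
        fun W => by
          simpa using h.integrable_sq hpq.le (φ := fun _ => 1) (ψ := fun _ => W)
            continuousOn_const continuousOn_const
      refine intervalIntegral.integral_mono_on hpq.le (j1 _) ((j1 _).const_mul _) fun r _ => ?_
      have k1 := mul_le_mul_of_nonneg_right hW (sq_nonneg ‖Ψ r‖)
      have k2 : 0 ≤ musq / N₀ ^ 2 * ‖w r‖ ^ 2 := by positivity
      linarith
    rw [intervalIntegral.integral_const_mul] at h2
    have h3 := mul_le_mul_of_nonneg_left h1 (by positivity : 0 ≤ 1 + musq / N₀ ^ 2)
    have h4 := mul_nonneg nB1 (hX C')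
    linarith
  -- superradiant frequencies are bounded, since `K` vanishes between the horizons
  by_cases hneg : carterK a l ω m p * carterK a l ω m q < 0
  · right
    intro C' hC'
    refine hfin ((q - p) * ((1 + N₀ ^ 2 + musq) * B₀)) (by linarith) _ _
      (add_nonneg hA (hX C')) ?_
    obtain ⟨t, ht, hKt⟩ := exists_carterK_eq_zero hpq.le hneg
    have hlt : N < N₀ := by
      by_contra hcon
      push Not at hcon
      exact hbar ⟨hcon, t, ht, hno t ht hKt (hN₀.trans_le hcon)⟩
    have hle : ω ^ 2 + (m : ℝ) ^ 2 + L ≤ N₀ ^ 2 := by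
      rw [← hN2]; exact pow_le_pow_left₀ hNn hlt.le 2
    have h1 := H₀ C' ω Λ m hC' (by rw [← hLe]; exact hL) (by rw [← hLe]; exact hle) hneg Ψ w F P Q
      (by rw [← hLe]; exact h)
    rw [mul_assoc]
    refine h.integral_energy_le hpq.le fun x hx => ?_
    have h2 := h1 x hx
    have k1 : ω ^ 2 + (m : ℝ) ^ 2 + L + musq ≤ 1 + N₀ ^ 2 + musq := by linarith
    have k2 := mul_le_mul_of_nonneg_right k1 (sq_nonneg ‖Ψ x‖)
    have k3 : 0 ≤ (N₀ ^ 2 + musq) * ‖w x‖ ^ 2 := by positivity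
    have k4 := mul_le_mul_of_nonneg_left h2 (by positivity : 0 ≤ 1 + N₀ ^ 2 + musq)
    linarith
  push Not at hneg
  by_cases hbig : N₁ ≤ N ∧ N₀ ≤ N
  · left
    have hall : ∀ t ∈ Icc p q, η * N ≤ |carterK a l ω m t| := by
      intro t ht
      by_contra hcon
      exact hbar ⟨hbig.2, t, ht, not_le.1 hcon⟩
    obtain ⟨h1, h2⟩ := (H ω m L N hadm hbig.2 hN2).2 hall
    refine ⟨N, hbig.1, hN2, h1, fun rc hrc htr => (h2 rc hrc htr Ψ w F P Q h).trans ?_⟩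
    have h3 := mul_add_mul_nonneg_flux hneg hP hQ (x := p ^ 2 + a ^ 2) (y := q ^ 2 + a ^ 2)
      (by positivity) (by
        have := pow_le_pow_left₀ hp0.le hpq.le 2
        linarith)
    have h0 : 0 ≤ carterK a l ω m q ^ 2 * Q + carterK a l ω m p ^ 2 * P := by positivity
    generalize (carterK a l ω m p / (p ^ 2 + a ^ 2) + carterK a l ω m q / (q ^ 2 + a ^ 2))
      * (carterK a l ω m q * Q + carterK a l ω m p * P) = I at *
    generalize carterK a l ω m q ^ 2 * Q + carterK a l ω m p ^ 2 * P = X at *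
    have hI : 0 ≤ I := nonneg_of_mul_nonneg_right (h0.trans h3) hY0
    have k1 := mul_le_mul_of_nonneg_left h3 hC.le
    have k2 : 0 ≤ C * I := by positivity
    have k3 : 0 ≤ C * (q ^ 2 + a ^ 2) * ∫ r in p..q, ‖F r‖ ^ 2 := by positivity
    linarith
  · right
    intro C' _
    refine hfin ((q - p) * B₁) (by linarith) _ _ (add_nonneg hA (hX C')) ?_
    have hlt : N ≤ N₁ + N₀ := by
      by_contra hcon
      push Not at hcon
      exact hbig ⟨by linarith, by linarith⟩
    have hle : ω ^ 2 + (m : ℝ) ^ 2 + L ≤ (N₁ + N₀) ^ 2 := by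
      rw [← hN2]; exact pow_le_pow_left₀ hNn hlt 2
    have hpos : 0 < N₁ + N₀ := by positivity
    have hω : |ω| ≤ N₁ + N₀ := abs_le_of_sq_le_sq (by linarith [sq_nonneg (m : ℝ)]) hpos.le
    have hm : |(m : ℝ)| ≤ N₁ + N₀ := abs_le_of_sq_le_sq (by linarith [sq_nonneg ω]) hpos.le
    have h1 := H₁ ω Λ m hΛ (by linarith) (by linarith)
      (by rw [← hLe]; linarith [sq_nonneg ω, sq_nonneg (m : ℝ)]) hneg Ψ w F P Q
      (by rw [← hLe]; exact h)
    rw [← hLe] at h1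
    have h2 := h.integral_energy_le hpq.le h1
    have h3 := mul_nonneg nB2 (hX C')
    linarith

end

/-! ### The constants of the estimate -/

open Classical in
/-- A trapping radius in `(Rm, Rp)` if there is one, and `0` otherwise. -/
noncomputable def trappingRadius (a M l p q c Rm Rp ω : ℝ) (m : ℤ) : ℝ :=
  if h : ∃ rc ∈ Ioo Rm Rp, IsTrappingRadius a M l p q c ω m rc then h.choose else 0

theorem trappingRadius_mem (a M l p q c Rm Rp ω : ℝ) (m : ℤ) :
    trappingRadius a M l p q c Rm Rp ω m ∈ Ioo Rm Rp ∪ {0} := by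
  unfold trappingRadius
  split_ifs with h
  · exact .inl h.choose_spec.1
  · exact .inr rfl

theorem trappingRadius_spec {a M l p q c Rm Rp ω : ℝ} {m : ℤ}
    (h : ∃ rc ∈ Ioo Rm Rp, IsTrappingRadius a M l p q c ω m rc) :
    trappingRadius a M l p q c Rm Rp ω m ∈ Ioo Rm Rp ∧
      IsTrappingRadius a M l p q c ω m (trappingRadius a M l p q c Rm Rp ω m) := by
  have e : trappingRadius a M l p q c Rm Rp ω m = h.choose := dif_pos h
  rw [e]
  exact h.choose_spec

/-- The coefficient of the flux term, `(ω - ω₊m) + (ω - ω̄₊m)`, is at most of the order of the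
frequency. -/
theorem exists_sq_threshold_le (a l p q : ℝ) : ∃ κ, 0 ≤ κ ∧ ∀ ω m : ℝ,
    (carterK a l ω m p / (p ^ 2 + a ^ 2) + carterK a l ω m q / (q ^ 2 + a ^ 2)) ^ 2
      ≤ κ * (ω ^ 2 + m ^ 2) := by
  obtain ⟨x, hx⟩ : ∃ x, x = (p ^ 2 + a ^ 2) / (p ^ 2 + a ^ 2)
    + (q ^ 2 + a ^ 2) / (q ^ 2 + a ^ 2) := ⟨_, rfl⟩
  obtain ⟨y, hy⟩ : ∃ y, y = a * Xi a l / (p ^ 2 + a ^ 2) + a * Xi a l / (q ^ 2 + a ^ 2) :=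
    ⟨_, rfl⟩
  refine ⟨x ^ 2 + y ^ 2, by positivity, fun ω m => ?_⟩
  have e : carterK a l ω m p / (p ^ 2 + a ^ 2) + carterK a l ω m q / (q ^ 2 + a ^ 2)
      = x * ω - y * m := by rw [hx, hy]; unfold carterK; ring
  rw [e]
  linarith [sq_nonneg (x * m + y * ω)]

end KerrDeSitter

open KerrDeSitter in
theorem theorem8p3 (a M l musq : ℝ) (hl : 0 < l) (hsub : IsSubextremal a M l)
    (hmu : 0 ≤ musq) :
    ∃ (E Rminus Rplus : ℝ) (rtrap : ℝ → ℤ → ℕ → ℝ),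
      0 < E ∧ rPlus a M l < Rminus ∧ Rminus < Rplus ∧ Rplus < rCosmo a M l ∧
      (∀ (ω : ℝ) (m : ℤ) (ℓ : ℕ), rtrap ω m ℓ ∈ Ioo Rminus Rplus ∪ {0}) ∧
      ∃ δ > 0, ∃ C₀ > 0,
        ∀ rin ∈ Ioo (rPlus a M l) (rPlus a M l + δ),
        ∀ rout ∈ Ioo (rCosmo a M l - δ) (rCosmo a M l),
        ∀ C ≥ C₀, ∃ B > 0,
          ∀ (ω : ℝ) (m : ℤ) (ℓ : ℕ) (Λ : ℝ),
            IsSpheroidalEigenvalue a l musq (a * ω) m ℓ Λ →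
          ∀ u H : ℝ → ℂ, IsOutgoingSolution a M l musq ω m Λ u H →
            Integrable (fun r => ‖H r‖ ^ 2 / Delta a M l r) (starMeasure a M l) →
            Integrable (sourceDensity a M l ω m u H) (starMeasure a M l) ∧
            Integrable (fluxDensity a M l ω m u H) (starMeasure a M l) ∧
            ∃ U : ℝ,
              Tendsto (fun r => ‖u r‖ ^ 2) (𝓝[>] (rPlus a M l)) (𝓝 U) ∧
              ∫ r in Ioo rin rout, bulkDensity a M l musq ω m Λ (rtrap ω m ℓ) u r
                  ∂(starMeasure a M l)
                ≤ B * ind (0 < |m|) * ∫ r in Ioo (rPlus a M l) rin,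
                      sourceDensity a M l ω m u H r ∂(starMeasure a M l)
                  + B * ind (0 < |m|) * ∫ r in Ioo rout (rCosmo a M l),
                      sourceDensity a M l ω m u H r ∂(starMeasure a M l)
                  + B * ∫ r, ‖H r‖ ^ 2 / Delta a M l r ∂(starMeasure a M l)
                  + E * ∫ r, fluxDensity a M l ω m u H r ∂(starMeasure a M l)
                  + B * ind (InBoundedSuperradiant a M l C ω m Λ)
                      * |ω - omegaPlus a M l * m| * |ω - omegaCosmo a M l * m| * U := by
  obtain ⟨s, hh⟩ := exists_horizons hl hsub
  obtain ⟨p, hp⟩ : ∃ p, rPlus a M l = p := ⟨_, rfl⟩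
  obtain ⟨q, hq⟩ : ∃ q, rCosmo a M l = q := ⟨_, rfl⟩
  rw [hp, hq] at hh ⊢
  have hp0 := hh.p_pos
  have hq0 := hh.q_pos
  have hpq := hh.p_lt
  have hY0 : 0 < q ^ 2 + a ^ 2 := by positivity
  obtain ⟨Rm, Rp, c, C₁, C₀, hRm, hR, hRp, hC₁, hC₀, H₁⟩ := hh.exists_radial_estimate hp hq hmu
  obtain ⟨C₂, hC₂, H₂⟩ := hh.exists_bulkDensity_le_trapped hmu hRm hRp
  obtain ⟨κ, hκ0, hκ⟩ := exists_sq_threshold_le a l p q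
  refine ⟨C₂ * C₁, Rm, Rp, fun ω m _ => trappingRadius a M l p q c Rm Rp ω m, by positivity,
    hRm, hR, hRp, fun ω m _ => trappingRadius_mem _ _ _ _ _ _ _ _ _ _, (q - p) / 2, by linarith,
    C₀, hC₀, ?_⟩
  intro rin hrin rout hrout C hC
  obtain ⟨N₁, hN₁, H₃⟩ := H₂ rin rout hrin.1 hrout.2
  obtain ⟨B₁, hB₁, H₄⟩ := H₁ N₁ hN₁
  obtain ⟨C₃, hC₃, H₅⟩ := hh.exists_bulkDensity_le_energy hmu hrin.1 hrout.2
  obtain ⟨B₂, hB₂⟩ : ∃ B₂, B₂ = (C₃ + C₂ * C₁ * κ) * B₁ + C₂ * C₁ := ⟨_, rfl⟩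
  have hB₂0 : 0 < B₂ := by rw [hB₂]; positivity
  refine ⟨B₂ * ((q ^ 2 + a ^ 2) ^ 2 + (q ^ 2 + a ^ 2)), by positivity, ?_⟩
  intro ω m ℓ Λ hΛ u H hu hH
  have hL := (hΛ.2.1.isAdmissible hmu).1
  obtain ⟨P, Q, h⟩ := hu.exists_radialSolution hh hp hq hmu hH
  have hderiv : ∀ r ∈ Ioo p q, HasDerivAt u (deriv u r) r := by
    have hsm := hu.smooth
    rw [hp, hq] at hsm
    intro r hr
    exact ((hsm.differentiableOn (by simp)).differentiableAt (Ioo_mem_nhds hr.1 hr.2)).hasDerivAt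
  refine ⟨h.integrable_sourceDensity hh hp hq, h.integrable_fluxDensity hh hp hq,
    (p ^ 2 + a ^ 2) * P, h.tendsto_norm_sq hh, ?_⟩
  have hP := h.P_nonneg
  have hsrc : ∀ r ∈ Ioo p q, 0 ≤ sourceDensity a M l ω m u H r := fun r _ => by
    unfold sourceDensity; positivity
  have s1 := setIntegral_starMeasure_nonneg hh hp hq (x := p) (y := rin) le_rfl
    (by linarith [hrin.2]) hsrc
  have s2 := setIntegral_starMeasure_nonneg hh hp hq (x := rout) (y := q)
    (by linarith [hrout.1]) le_rfl hsrc
  have hHF := integral_source_le hh hp hq hH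
  have hA := h.integral_source_nonneg hpq.le
  have hi1 := ind_nonneg (0 < |m|)
  have hi2 := ind_nonneg (InBoundedSuperradiant a M l C ω m Λ)
  rw [h.integral_fluxDensity hh hp hq]
  have e1 : |ω - omegaPlus a M l * m| = |carterK a l ω m p| / (p ^ 2 + a ^ 2) := by
    have e : ω - omegaPlus a M l * m = carterK a l ω m p / (p ^ 2 + a ^ 2) := by
      unfold omegaPlus carterK; rw [hp]; field_simp
    rw [e, abs_div, abs_of_pos (by positivity : 0 < p ^ 2 + a ^ 2)]
  have e2 : |ω - omegaCosmo a M l * m| = |carterK a l ω m q| / (q ^ 2 + a ^ 2) := by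
    have e : ω - omegaCosmo a M l * m = carterK a l ω m q / (q ^ 2 + a ^ 2) := by
      unfold omegaCosmo carterK; rw [hq]; field_simp
    rw [e, abs_div, abs_of_pos hY0]
  rw [e1, e2]
  obtain ⟨A, hAe⟩ : ∃ A, A = ∫ r in p..q, ‖radialSource a M l H r‖ ^ 2 := ⟨_, rfl⟩
  obtain ⟨J, hJ⟩ : ∃ J, J = ∫ r, ‖H r‖ ^ 2 / Delta a M l r ∂(starMeasure a M l) := ⟨_, rfl⟩
  obtain ⟨I, hI⟩ : ∃ I, I
      = (carterK a l ω m p / (p ^ 2 + a ^ 2) + carterK a l ω m q / (q ^ 2 + a ^ 2))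
        * (carterK a l ω m q * Q + carterK a l ω m p * P) := ⟨_, rfl⟩
  obtain ⟨X, hX⟩ : ∃ X, X = ind (InBoundedSuperradiant a M l C ω m Λ)
      * (|carterK a l ω m p| * |carterK a l ω m q| * P) := ⟨_, rfl⟩
  have hX0 : 0 ≤ X := by rw [hX]; positivity
  rw [← hJ, ← hI]
  rw [← hAe, ← hJ] at hHF
  rw [← hAe] at hA
  -- it suffices to bound the left-hand side in terms of the radial system
  suffices hmain : ∫ r in Ioo rin rout, bulkDensity a M l musq ω m Λ
      (trappingRadius a M l p q c Rm Rp ω m) u r ∂(starMeasure a M l)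
      ≤ C₂ * C₁ * I + B₂ * (A + X) by
    have hJ0 : 0 ≤ J := nonneg_of_mul_nonneg_right (hA.trans hHF) (by positivity)
    have eX : B₂ * ((q ^ 2 + a ^ 2) ^ 2 + (q ^ 2 + a ^ 2))
        * ind (InBoundedSuperradiant a M l C ω m Λ)
        * (|carterK a l ω m p| / (p ^ 2 + a ^ 2)) * (|carterK a l ω m q| / (q ^ 2 + a ^ 2))
        * ((p ^ 2 + a ^ 2) * P) = B₂ * (q ^ 2 + a ^ 2 + 1) * X := by
      have : 0 < p ^ 2 + a ^ 2 := by positivity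
      rw [hX]
      field_simp
    rw [eX]
    have hB0 : 0 ≤ B₂ * ((q ^ 2 + a ^ 2) ^ 2 + (q ^ 2 + a ^ 2)) * ind (0 < |m|) := by positivity
    have t1 := mul_nonneg hB0 s1
    have t2 := mul_nonneg hB0 s2
    have t3 := mul_le_mul_of_nonneg_left hHF hB₂0.le
    have t4 : 0 ≤ B₂ * (q ^ 2 + a ^ 2) * J := by positivity
    have t5 : 0 ≤ B₂ * (q ^ 2 + a ^ 2) * X := by positivity
    linarith
  have hint : ∀ W : ℝ → ℝ, Continuous W → IntervalIntegrable
      (fun r => ‖radialMomentum a M l u r‖ ^ 2 + W r * ‖psi a u r‖ ^ 2) volume p q :=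
    fun W hW => by
      simpa using h.integrable_sq hpq.le (φ := fun _ => 1) (ψ := W)
        continuousOn_const hW.continuousOn
  -- trapped high frequencies keep the flux term with the constant `E = C₂ C₁`; for all others the
  -- flux term is itself bounded by the nondegenerate energy, with a constant in `B`
  rcases H₄ ω Λ m hΛ.2.1 _ _ _ P Q h with ⟨N, hN, hNsq, hex, hest⟩ | hest
  · obtain ⟨hmem, htr⟩ := trappingRadius_spec hex
    have h1 := hest _ hmem htr
    rw [← hAe, ← hI] at h1
    refine (setIntegral_starMeasure_le hh hp hq hrin.1.le hrout.2.le
      (H₃ ω Λ _ N m u hL hderiv hmem hN hNsq) ((hint _ (by fun_prop)).const_mul C₂)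
      fun r => by positivity).trans ?_
    rw [intervalIntegral.integral_const_mul]
    have h2 := mul_le_mul_of_nonneg_left h1 hC₂.le
    have h3 : 0 ≤ (C₃ + C₂ * C₁ * κ) * B₁ * (A + X) := by positivity
    have h4 : 0 ≤ C₂ * C₁ * X := by positivity
    rw [hB₂]
    linarith
  · have hrt : trappingRadius a M l p q c Rm Rp ω m ∈ Icc 0 q := by
      rcases trappingRadius_mem a M l p q c Rm Rp ω m with h0 | h0
      · exact ⟨by linarith [h0.1], by linarith [h0.2]⟩
      · rw [mem_singleton_iff] at h0
        rw [h0]; exact ⟨le_rfl, hq0.le⟩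
    have h1 := hest C hC
    rw [← hAe, ← hX] at h1
    refine (setIntegral_starMeasure_le hh hp hq hrin.1.le hrout.2.le
      (H₅ ω Λ _ m u hL hderiv hrt) ((hint _ continuous_const).const_mul C₃)
      fun r => by positivity).trans ?_
    rw [intervalIntegral.integral_const_mul]
    have h2 := h.abs_flux_mul_le hpq
      (carterK a l ω m p / (p ^ 2 + a ^ 2) + carterK a l ω m q / (q ^ 2 + a ^ 2))
    rw [← hI] at h2
    have hFi := h.toRadialEq.sourceIntervalIntegrable hpq.le
    have h3 : ∫ r in p..q, (0 * ‖radialMomentum a M l u r‖ ^ 2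
        + (carterK a l ω m p / (p ^ 2 + a ^ 2) + carterK a l ω m q / (q ^ 2 + a ^ 2)) ^ 2
          * ‖psi a u r‖ ^ 2 + ‖radialSource a M l H r‖ ^ 2)
        ≤ ∫ r in p..q, (κ * (‖radialMomentum a M l u r‖ ^ 2
          + (ω ^ 2 + (m : ℝ) ^ 2 + shiftedEigenvalue a l (a * ω) m Λ + musq)
            * ‖psi a u r‖ ^ 2) + ‖radialSource a M l H r‖ ^ 2) := by
      refine intervalIntegral.integral_mono_on hpq.le
        ((h.integrable_sq hpq.le continuousOn_const continuousOn_const).add hFi)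
        (((hint _ continuous_const).const_mul κ).add hFi) fun r _ => ?_
      have k1 := mul_le_mul_of_nonneg_right (hκ ω m) (sq_nonneg ‖psi a u r‖)
      have k2 : 0 ≤ κ * ‖radialMomentum a M l u r‖ ^ 2 := by positivity
      have k3 : 0 ≤ κ * (shiftedEigenvalue a l (a * ω) m Λ + musq) * ‖psi a u r‖ ^ 2 := by
        positivity
      linarith
    rw [intervalIntegral.integral_add ((hint _ continuous_const).const_mul κ) hFi,
      intervalIntegral.integral_const_mul, ← hAe] at h3
    generalize ∫ r in p..q, (‖radialMomentum a M l u r‖ ^ 2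
          + (ω ^ 2 + (m : ℝ) ^ 2 + shiftedEigenvalue a l (a * ω) m Λ + musq)
            * ‖psi a u r‖ ^ 2) = T at *
    have h4 : -I ≤ κ * T + A := by linarith [neg_abs_le I]
    have h5 := mul_le_mul_of_nonneg_left h4 (by positivity : 0 ≤ C₂ * C₁)
    have h6 := mul_le_mul_of_nonneg_left h1 (by positivity : 0 ≤ C₃ + C₂ * C₁ * κ)
    have h7 : 0 ≤ C₂ * C₁ * X := by positivity
    rw [hB₂]
    linarith
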